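/- Let $(\mathcal M,\Box,U,\Sigma)$ be a symmetric monoidal category with coequalizers such that $X\Box-$ and $-\Box X$ preserve coequalizers for every object $X$ (coherence isomorphisms of $\mathcal M$ are suppressed below). For monoids $A,B,C$ in $\mathcal M$, an $A$-$B$-bimodule $M$ and a $B$-$C$-bimodule $N$, let $\sqcap(M,N):M\Box N\to M\otimes_B N$ be the coequalizer of the two morphisms $M\Box B\Box N\rightrightarrows M\Box N$ given by the right action of $B$ on $M$ and the left action of $B$ on $N$. Monoids, bimodules and bimodule morphisms form a monoidal bicategory $\mathrm{BIM}(\mathcal M)$ with horizontal composition $\otimes_B$ and monoidal product $\Box$. A monoid morphism $f:A\to B$ induces the $A$-$B$-bimodule $f^*=(B,\ \mu_B(f\Box B),\ \mu_B)$, and there are canonical isomorphisms $f^*\otimes_B g^*\cong (gf)^*$. Let $R$ be a fixed monoid in $\mathcal M$, $R^{op}=(R,\mu_R\Sigma_{R,R},\eta_R)$ and $R^e=R\Box R^{op}$. **The category $\mathrm{Bgd}_R(\mathcal M)$.** A left bialgebroid over $R$ consists of a monoid $A$, monoid morphisms $s:R\to A$ and $t:R^{op}\to A$ with $\mu_A(s\Box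 t)=\mu_A\Sigma_{A,A}(s\Box t)$, and a comonoid structure $\gamma:L\to L\otimes_R L$, $\pi:L\to R$ in the category of $R$-$R$-bimodules on $L=(A,\ \mu_A(s\Box A),\ \mu_A\Sigma_{A,A}(A\Box t))$, such that 1. $\rho(\gamma\Box t\Box\eta_A)=\rho(\gamma\Box\eta_A\Box s)$, 2. $\gamma\eta_A=\sqcap(L,L)(\eta_A\Box\eta_A)$, 3. $\gamma\mu_A=\lambda(A\Box\gamma)$, 4. $\pi\eta_A=\eta_R$, 5. $\pi\mu_A(A\Box s\pi)=\pi\mu_A=\pi\mu_A(A\Box t\pi)$, where $\rho:(L\otimes_RL)\Box A\Box A\to L\otimes_RL$ and $\lambda:A\Box(L\otimes_RL)\to L\otimes_RL$ are the unique morphisms with $\rho(\sqcap(L,L)\Box A\Box A)=\sqcap(L,L)\mu_{A\Box A}$ and $\lambda(A\Box\sqcap(L,L))=\rho(\gamma\Box A\Box A)$ (the latter exists by 1). A morphism of bialgebroids over $R$ is a monoid morphism $\Phi:A\to A'$ that is also a comonoid morphism $L\to L'$ in the category of $R$-$R$-bimodules. **Pseudo-monoids.** A pseudo-monoid in $\mathrm{BIM}(\mathcal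 M)$ consists of a monoid $A$, an $A$-$(A\Box A)$-bimodule $M$, a left $A$-module $J$, and bimodule isomorphisms $$l:M\otimes_{A\Box A}(J\Box A)\to A,\qquad r:M\otimes_{A\Box A}(A\Box J)\to A,\qquad a:M\otimes_{A\Box A}(M\Box A)\to M\otimes_{A\Box A}(A\Box M)$$ satisfying the pentagon and triangle identities. A monoidal morphism from $(A,M,J)$ to $(B,N,K)$ is a $B$-$A$-bimodule $F$ with bimodule morphisms $\sigma:N\otimes_{B\Box B}(F\Box F)\to F\otimes_AM$ and $\iota:K\to F\otimes_AJ$ satisfying, up to the coherence isomorphisms of $\mathrm{BIM}(\mathcal M)$, $$(F\otimes l_A)(\sigma\otimes(J\Box A))(N\otimes(\iota\Box F))=l_B\otimes F,$$ $$(F\otimes r_A)(\sigma\otimes(A\Box J))(N\otimes(F\Box\iota))=r_B\otimes F,$$ $$(F\otimes a_A)(\sigma\otimes(M\Box A))(N\otimes(\sigma\Box F))=(\sigma\otimes(A\Box M))(N\otimes(F\Box\sigma))(a_B\otimes(F\Box F\Box F)).$$ It is strong if $\sigma$ and $\iota$ are isomorphisms. Monoidal morphisms compose in the usual way by pasting their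 structure 2-cells. **The canonical pseudo-monoid** $(R^e,m,j)$. In element notation, $m=R\Box R\Box R$ with $$(p\otimes q)(x\otimes y\otimes z)(a\otimes a'\otimes b\otimes b')=pxa\otimes a'yb\otimes b'zq,$$ $j=R$ with $(p\otimes q)c=pcq$, all products being taken in $R$, and $$l\big((x\otimes y\otimes z)\otimes(c\otimes(b\otimes b'))\big)=xcyb\otimes b'z,\qquad r\big((x\otimes y\otimes z)\otimes((a\otimes a')\otimes c)\big)=xa\otimes a'ycz,$$ $$a\big((x\otimes y\otimes z)\otimes((u\otimes v\otimes w)\otimes(b\otimes b'))\big)=(xu\otimes v\otimes 1)\otimes\big((1\otimes1)\otimes(1\otimes wyb\otimes b'z)\big).$$ **The category $\mathrm{DS}_R(\mathcal M)$.** An object is a pseudo-monoid $(A,M,J)$ in $\mathrm{BIM}(\mathcal M)$ together with a monoid morphism $\chi:R^e\to A$ and a strong monoidal morphism $(\chi^*,\sigma,\iota)$ from $(A,M,J)$ to $(R^e,m,j)$. A morphism from $(A,M,J,\chi,\sigma,\iota)$ to $(A',M',J',\chi',\sigma',\iota')$ is a monoid morphism $\Phi:A\to A'$ with $\Phi\chi=\chi'$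 such that $\Phi^*$ carries the structure of a monoidal morphism $(A',M',J')\to(A,M,J)$ whose composite with $(\chi^*,\sigma,\iota)$ is $(\chi'^*,\sigma',\iota')$, under the canonical isomorphism $\chi^*\otimes_A\Phi^*\cong\chi'^*$. **Theorem.** The morphisms of $\mathrm{DS}_R(\mathcal M)$ contain the identities and are closed under composition, so that $\mathrm{DS}_R(\mathcal M)$ is a category, and the categories $\mathrm{Bgd}_R(\mathcal M)$ and $\mathrm{DS}_R(\mathcal M)$ are equivalent. -/

import Mathlib

open CategoryTheory MonoidalCategory Limits MonObj

universe v u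

namespace IntBgd

section StableEpi

variable {C : Type u} [Category.{v} C] [MonoidalCategory C]

/-- A morphism all of whose whiskerings are epimorphisms. -/
class StableEpi {X Y : C} (f : X ⟶ Y) : Prop where
  epi (Z Z' : C) : Epi ((Z ◁ f) ▷ Z')

instance StableEpi.whiskerBoth {X Y : C} (f : X ⟶ Y) [h : StableEpi f] (Z Z' : C) :
    Epi ((Z ◁ f) ▷ Z') := h.epi Z Z'

instance StableEpi.whiskerL {X Y : C} (f : X ⟶ Y) [StableEpi f] (Z : C) : Epi (Z ◁ f) := by
  have h : Z ◁ f = (ρ_ _).inv ≫ ((Z ◁ f) ▷ 𝟙_ C) ≫ (ρ_ _).hom := by simp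
  rw [h]; infer_instance

instance StableEpi.whiskerR {X Y : C} (f : X ⟶ Y) [StableEpi f] (Z : C) : Epi (f ▷ Z) := by
  have h : f ▷ Z = ((λ_ _).inv ▷ Z) ≫ ((𝟙_ C ◁ f) ▷ Z) ≫ ((λ_ _).hom ▷ Z) := by simp
  rw [h]; infer_instance

instance (priority := 900) StableEpi.toEpi {X Y : C} (f : X ⟶ Y) [StableEpi f] : Epi f := by
  have h : f = (λ_ _).inv ≫ (𝟙_ C ◁ f) ≫ (λ_ _).hom := by simp
  rw [h]; infer_instance

instance StableEpi.left {X Y : C} (f : X ⟶ Y) [StableEpi f] (W : C) : StableEpi (W ◁ f) where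
  epi Z Z' := by
    have h : (Z ◁ W ◁ f) ▷ Z' = ((α_ _ _ _).inv ▷ Z') ≫ (((Z ⊗ W) ◁ f) ▷ Z') ≫
      ((α_ _ _ _).hom ▷ Z') := by
      rw [← comp_whiskerRight, ← comp_whiskerRight]; simp
    rw [h]; infer_instance

instance StableEpi.right {X Y : C} (f : X ⟶ Y) [StableEpi f] (W : C) : StableEpi (f ▷ W) where
  epi Z Z' := by
    have h : (Z ◁ f ▷ W) ▷ Z' = ((α_ Z X W).inv ▷ Z') ≫ (α_ _ _ _).hom ≫
      ((Z ◁ f) ▷ (W ⊗ Z')) ≫ (α_ _ _ _).inv ≫ ((α_ _ _ _).hom ▷ Z') := by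
      monoidal
    rw [h]; infer_instance

instance StableEpi.comp {X Y W : C} (f : X ⟶ Y) (g : Y ⟶ W) [StableEpi f] [StableEpi g] :
    StableEpi (f ≫ g) where
  epi Z Z' := by
    rw [MonoidalCategory.whiskerLeft_comp, comp_whiskerRight]; infer_instance

instance StableEpi.tensor {X Y X' Y' : C} (f : X ⟶ Y) (g : X' ⟶ Y') [StableEpi f]
    [StableEpi g] : StableEpi (f ⊗ₘ g) := by
  rw [MonoidalCategory.tensorHom_def]; infer_instance

instance (priority := 900) StableEpi.ofIso {X Y : C} (f : X ⟶ Y) [IsIso f] : StableEpi f where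
  epi _ _ := inferInstance

end StableEpi

variable {C : Type u} [Category.{v} C] [MonoidalCategory C]

section Coeq
variable [HasCoequalizers C]

section
variable [∀ X : C, PreservesColimitsOfShape WalkingParallelPair (tensorLeft X)]

/-- Morphisms out of `Z ⊗ coequalizer f g`. -/
noncomputable def coeqDescL (Z : C) {X Y W : C} (f g : X ⟶ Y) (h : Z ⊗ Y ⟶ W)
    (w : Z ◁ f ≫ h = Z ◁ g ≫ h) : Z ⊗ coequalizer f g ⟶ W :=
  (PreservesCoequalizer.iso (tensorLeft Z) f g).inv ≫ coequalizer.desc h w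

theorem whiskerLeft_coeqDescL (Z : C) {X Y W : C} (f g : X ⟶ Y) (h : Z ⊗ Y ⟶ W)
    (w : Z ◁ f ≫ h = Z ◁ g ≫ h) :
    Z ◁ coequalizer.π f g ≫ coeqDescL Z f g h w = h :=
  map_π_preserves_coequalizer_inv_desc (tensorLeft Z) f g h w

end

section
variable [∀ X : C, PreservesColimitsOfShape WalkingParallelPair (tensorRight X)]

/-- Morphisms out of `coequalizer f g ⊗ Z`. -/
noncomputable def coeqDescR (Z : C) {X Y W : C} (f g : X ⟶ Y) (h : Y ⊗ Z ⟶ W)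
    (w : f ▷ Z ≫ h = g ▷ Z ≫ h) : coequalizer f g ⊗ Z ⟶ W :=
  (PreservesCoequalizer.iso (tensorRight Z) f g).inv ≫ coequalizer.desc h w

theorem whiskerRight_coeqDescR (Z : C) {X Y W : C} (f g : X ⟶ Y) (h : Y ⊗ Z ⟶ W)
    (w : f ▷ Z ≫ h = g ▷ Z ≫ h) :
    coequalizer.π f g ▷ Z ≫ coeqDescR Z f g h w = h :=
  map_π_preserves_coequalizer_inv_desc (tensorRight Z) f g h w

end

variable [∀ X : C, PreservesColimitsOfShape WalkingParallelPair (tensorLeft X)]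
variable [∀ X : C, PreservesColimitsOfShape WalkingParallelPair (tensorRight X)]

instance stableEpi_coequalizer {X Y : C} (f g : X ⟶ Y) : StableEpi (coequalizer.π f g) where
  epi Z Z' := by
    have : Epi ((tensorLeft Z ⋙ tensorRight Z').map (coequalizer.π f g)) := inferInstance
    exact this

end Coeq


section Tens
set_option linter.unusedSectionVars false
variable [HasCoequalizers C]
variable {A B D E : Mon C}

/-- The underlying object of the tensor product `P ⊗_B N`. -/
noncomputable def tensX (P : Bimod A B) (N : Bimod B D) : C :=
  coequalizer (P.actRight ▷ N.X) ((α_ _ _ _).hom ≫ P.X ◁ N.actLeft)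

/-- The canonical projection `P ⊗ N ⟶ P ⊗_B N`. -/
noncomputable def projX (P : Bimod A B) (N : Bimod B D) : P.X ⊗ N.X ⟶ tensX P N :=
  coequalizer.π _ _

theorem projX_condition (P : Bimod A B) (N : Bimod B D) :
    P.actRight ▷ N.X ≫ projX P N = (α_ _ _ _).hom ≫ P.X ◁ N.actLeft ≫ projX P N := by
  have := coequalizer.condition (P.actRight ▷ N.X) ((α_ _ _ _).hom ≫ P.X ◁ N.actLeft)
  simp only [Category.assoc] at this
  exact this

/-- The universal property of `P ⊗_B N`. -/
noncomputable def tensXDesc (P : Bimod A B) (N : Bimod B D) {W : C} (h : P.X ⊗ N.X ⟶ W)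
    (w : P.actRight ▷ N.X ≫ h = (α_ _ _ _).hom ≫ P.X ◁ N.actLeft ≫ h) : tensX P N ⟶ W :=
  coequalizer.desc h (by simpa using w)

@[simp] theorem projX_tensXDesc (P : Bimod A B) (N : Bimod B D) {W : C} (h : P.X ⊗ N.X ⟶ W)
    (w : P.actRight ▷ N.X ≫ h = (α_ _ _ _).hom ≫ P.X ◁ N.actLeft ≫ h) :
    projX P N ≫ tensXDesc P N h w = h :=
  coequalizer.π_desc h _

@[simp] theorem projX_tensXDesc_assoc (P : Bimod A B) (N : Bimod B D) {W W' : C}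
    (h : P.X ⊗ N.X ⟶ W)
    (w : P.actRight ▷ N.X ≫ h = (α_ _ _ _).hom ≫ P.X ◁ N.actLeft ≫ h) (k : W ⟶ W') :
    projX P N ≫ tensXDesc P N h w ≫ k = h ≫ k := by
  rw [← Category.assoc, projX_tensXDesc]

variable [∀ X : C, PreservesColimitsOfShape WalkingParallelPair (tensorLeft X)]
variable [∀ X : C, PreservesColimitsOfShape WalkingParallelPair (tensorRight X)]

instance (P : Bimod A B) (N : Bimod B D) : StableEpi (projX P N) := stableEpi_coequalizer _ _

/-- The universal property of `Z ⊗ (P ⊗_B N)`. -/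
noncomputable def tensXDescL (Z : C) (P : Bimod A B) (N : Bimod B D) {W : C}
    (h : Z ⊗ P.X ⊗ N.X ⟶ W)
    (w : Z ◁ P.actRight ▷ N.X ≫ h = Z ◁ (α_ _ _ _).hom ≫ Z ◁ P.X ◁ N.actLeft ≫ h) :
    Z ⊗ tensX P N ⟶ W :=
  coeqDescL Z _ _ h (by simpa using w)

@[simp] theorem projX_tensXDescL (Z : C) (P : Bimod A B) (N : Bimod B D) {W : C}
    (h : Z ⊗ P.X ⊗ N.X ⟶ W)
    (w : Z ◁ P.actRight ▷ N.X ≫ h = Z ◁ (α_ _ _ _).hom ≫ Z ◁ P.X ◁ N.actLeft ≫ h) :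
    Z ◁ projX P N ≫ tensXDescL Z P N h w = h :=
  whiskerLeft_coeqDescL _ _ _ _ _

/-- The universal property of `(P ⊗_B N) ⊗ Z`. -/
noncomputable def tensXDescR (Z : C) (P : Bimod A B) (N : Bimod B D) {W : C}
    (h : (P.X ⊗ N.X) ⊗ Z ⟶ W)
    (w : P.actRight ▷ N.X ▷ Z ≫ h = (α_ _ _ _).hom ▷ Z ≫ (P.X ◁ N.actLeft) ▷ Z ≫ h) :
    tensX P N ⊗ Z ⟶ W :=
  coeqDescR Z _ _ h (by simpa using w)

@[simp] theorem projX_tensXDescR (Z : C) (P : Bimod A B) (N : Bimod B D) {W : C}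
    (h : (P.X ⊗ N.X) ⊗ Z ⟶ W)
    (w : P.actRight ▷ N.X ▷ Z ≫ h = (α_ _ _ _).hom ▷ Z ≫ (P.X ◁ N.actLeft) ▷ Z ≫ h) :
    projX P N ▷ Z ≫ tensXDescR Z P N h w = h :=
  whiskerRight_coeqDescR _ _ _ _ _

/-- The left action on `P ⊗_B N`. -/
noncomputable def tensXActL (P : Bimod A B) (N : Bimod B D) : A.X ⊗ tensX P N ⟶ tensX P N :=
  tensXDescL A.X P N ((α_ _ _ _).inv ≫ P.actLeft ▷ N.X ≫ projX P N) (by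
    have h1 : A.X ◁ P.actRight ▷ N.X ≫ (α_ _ _ _).inv ≫ P.actLeft ▷ N.X =
        (α_ _ _ _).inv ≫ (α_ _ _ _).inv ▷ N.X ≫ P.actLeft ▷ B.X ▷ N.X ≫ P.actRight ▷ N.X := by
      rw [← comp_whiskerRight, P.middle_assoc]; simp
    rw [← Category.assoc, ← Category.assoc, Category.assoc _ (α_ _ _ _).inv, h1]
    simp only [Category.assoc]
    rw [projX_condition]
    have h2 : P.actLeft ▷ B.X ▷ N.X ≫ (α_ P.X B.X N.X).hom ≫ P.X ◁ N.actLeft =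
        (α_ _ _ _).hom ≫ (A.X ⊗ P.X) ◁ N.actLeft ≫ P.actLeft ▷ N.X := by
      rw [whisker_exchange]; simp
    have h3 := congrArg (· ≫ projX P N) h2
    simp only [Category.assoc] at h3
    rw [h3]; simp)

theorem projX_tensXActL (P : Bimod A B) (N : Bimod B D) :
    A.X ◁ projX P N ≫ tensXActL P N = (α_ _ _ _).inv ≫ P.actLeft ▷ N.X ≫ projX P N := by
  simp [tensXActL]

/-- The right action on `P ⊗_B N`. -/
noncomputable def tensXActR (P : Bimod A B) (N : Bimod B D) : tensX P N ⊗ D.X ⟶ tensX P N :=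
  tensXDescR D.X P N ((α_ _ _ _).hom ≫ P.X ◁ N.actRight ≫ projX P N) (by
    have h1 : P.actRight ▷ N.X ▷ D.X ≫ (α_ _ _ _).hom ≫ P.X ◁ N.actRight =
        (α_ _ _ _).hom ≫ (P.X ⊗ B.X) ◁ N.actRight ≫ P.actRight ▷ N.X := by
      rw [whisker_exchange]; simp
    have h1' := congrArg (· ≫ projX P N) h1
    simp only [Category.assoc] at h1'
    rw [h1', projX_condition]
    have h2 : (P.X ◁ N.actLeft) ▷ D.X ≫ (α_ P.X N.X D.X).hom ≫ P.X ◁ N.actRight =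
        (α_ _ _ _).hom ≫ P.X ◁ (N.actLeft ▷ D.X ≫ N.actRight) := by
      rw [MonoidalCategory.whiskerLeft_comp]; simp only [associator_naturality_middle_assoc]
    have h2' := congrArg (· ≫ projX P N) h2
    simp only [Category.assoc] at h2'
    rw [h2', N.middle_assoc]; simp)

theorem projX_tensXActR (P : Bimod A B) (N : Bimod B D) :
    projX P N ▷ D.X ≫ tensXActR P N = (α_ _ _ _).hom ≫ P.X ◁ N.actRight ≫ projX P N := by
  simp [tensXActR]

theorem projX_tensXActL_assoc (P : Bimod A B) (N : Bimod B D) {W : C} (k : tensX P N ⟶ W) :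
    A.X ◁ projX P N ≫ tensXActL P N ≫ k = (α_ _ _ _).inv ≫ P.actLeft ▷ N.X ≫ projX P N ≫ k := by
  rw [← Category.assoc, projX_tensXActL]; simp

theorem projX_tensXActR_assoc (P : Bimod A B) (N : Bimod B D) {W : C} (k : tensX P N ⟶ W) :
    projX P N ▷ D.X ≫ tensXActR P N ≫ k = (α_ _ _ _).hom ≫ P.X ◁ N.actRight ≫ projX P N ≫ k := by
  rw [← Category.assoc, projX_tensXActR]; simp

/-- The tensor product of bimodules, i.e. horizontal composition in `BIM`. -/
noncomputable def tens (P : Bimod A B) (N : Bimod B D) : Bimod A D where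
  X := tensX P N
  actLeft := tensXActL P N
  actRight := tensXActR P N
  one_actLeft := by
    rw [← cancel_epi (𝟙_ C ◁ projX P N), whisker_exchange_assoc, projX_tensXActL,
      associator_inv_naturality_left_assoc, ← comp_whiskerRight_assoc, P.one_actLeft]
    simp
  left_assoc := by
    rw [← cancel_epi ((A.X ⊗ A.X) ◁ projX P N), whisker_exchange_assoc, projX_tensXActL,
      associator_inv_naturality_left_assoc, ← comp_whiskerRight_assoc, P.left_assoc]
    rw [associator_naturality_right_assoc, ← MonoidalCategory.whiskerLeft_comp_assoc,
      projX_tensXActL]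
    simp only [MonoidalCategory.whiskerLeft_comp, Category.assoc, projX_tensXActL]
    simp
  actRight_one := by
    rw [← cancel_epi (projX P N ▷ 𝟙_ C), ← whisker_exchange_assoc, projX_tensXActR,
      associator_naturality_right_assoc, ← MonoidalCategory.whiskerLeft_comp_assoc,
      N.actRight_one]
    simp
  right_assoc := by
    rw [← cancel_epi (projX P N ▷ (D.X ⊗ D.X)), ← whisker_exchange_assoc, projX_tensXActR,
      associator_naturality_right_assoc, ← MonoidalCategory.whiskerLeft_comp_assoc,
      N.right_assoc]
    rw [associator_inv_naturality_left_assoc, ← comp_whiskerRight_assoc,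
      projX_tensXActR]
    simp only [comp_whiskerRight, Category.assoc, projX_tensXActR]
    simp
  middle_assoc := by
    rw [← cancel_epi ((A.X ◁ projX P N) ▷ D.X), ← comp_whiskerRight_assoc, projX_tensXActL]
    simp only [comp_whiskerRight, Category.assoc, projX_tensXActR]
    rw [associator_naturality_middle_assoc, ← MonoidalCategory.whiskerLeft_comp_assoc,
      projX_tensXActR]
    simp only [MonoidalCategory.whiskerLeft_comp, Category.assoc, projX_tensXActL]
    rw [associator_inv_naturality_right_assoc, whisker_exchange_assoc]
    simp

/-- The canonical projection `⊓(P, N) : P ⊗ N ⟶ P ⊗_B N`. -/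
noncomputable def proj (P : Bimod A B) (N : Bimod B D) : P.X ⊗ N.X ⟶ (tens P N).X := projX P N

instance (P : Bimod A B) (N : Bimod B D) : StableEpi (proj P N) := stableEpi_coequalizer _ _

theorem proj_condition (P : Bimod A B) (N : Bimod B D) :
    P.actRight ▷ N.X ≫ proj P N = (α_ _ _ _).hom ≫ P.X ◁ N.actLeft ≫ proj P N :=
  projX_condition P N

theorem proj_actLeft (P : Bimod A B) (N : Bimod B D) :
    A.X ◁ proj P N ≫ (tens P N).actLeft = (α_ _ _ _).inv ≫ P.actLeft ▷ N.X ≫ proj P N :=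
  projX_tensXActL P N

theorem proj_actRight (P : Bimod A B) (N : Bimod B D) :
    proj P N ▷ D.X ≫ (tens P N).actRight = (α_ _ _ _).hom ≫ P.X ◁ N.actRight ≫ proj P N :=
  projX_tensXActR P N

theorem proj_actLeft_assoc (P : Bimod A B) (N : Bimod B D) {W : C} (k : (tens P N).X ⟶ W) :
    A.X ◁ proj P N ≫ (tens P N).actLeft ≫ k =
      (α_ _ _ _).inv ≫ P.actLeft ▷ N.X ≫ proj P N ≫ k :=
  projX_tensXActL_assoc P N k

theorem proj_actRight_assoc (P : Bimod A B) (N : Bimod B D) {W : C} (k : (tens P N).X ⟶ W) :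
    proj P N ▷ D.X ≫ (tens P N).actRight ≫ k =
      (α_ _ _ _).hom ≫ P.X ◁ N.actRight ≫ proj P N ≫ k :=
  projX_tensXActR_assoc P N k

/-- The universal property of `P ⊗_B N`. -/
noncomputable def tensDesc (P : Bimod A B) (N : Bimod B D) {W : C} (h : P.X ⊗ N.X ⟶ W)
    (w : P.actRight ▷ N.X ≫ h = (α_ _ _ _).hom ≫ P.X ◁ N.actLeft ≫ h) : (tens P N).X ⟶ W :=
  tensXDesc P N h w

@[simp] theorem proj_tensDesc (P : Bimod A B) (N : Bimod B D) {W : C} (h : P.X ⊗ N.X ⟶ W)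
    (w : P.actRight ▷ N.X ≫ h = (α_ _ _ _).hom ≫ P.X ◁ N.actLeft ≫ h) :
    proj P N ≫ tensDesc P N h w = h :=
  projX_tensXDesc P N h w

@[simp] theorem proj_tensDesc_assoc (P : Bimod A B) (N : Bimod B D) {W W' : C}
    (h : P.X ⊗ N.X ⟶ W)
    (w : P.actRight ▷ N.X ≫ h = (α_ _ _ _).hom ≫ P.X ◁ N.actLeft ≫ h) (k : W ⟶ W') :
    proj P N ≫ tensDesc P N h w ≫ k = h ≫ k :=
  projX_tensXDesc_assoc P N h w k

/-- The universal property of `Z ⊗ (P ⊗_B N)`. -/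
noncomputable def tensDescL (Z : C) (P : Bimod A B) (N : Bimod B D) {W : C}
    (h : Z ⊗ P.X ⊗ N.X ⟶ W)
    (w : Z ◁ P.actRight ▷ N.X ≫ h = Z ◁ (α_ _ _ _).hom ≫ Z ◁ P.X ◁ N.actLeft ≫ h) :
    Z ⊗ (tens P N).X ⟶ W :=
  tensXDescL Z P N h w

@[simp] theorem proj_tensDescL (Z : C) (P : Bimod A B) (N : Bimod B D) {W : C}
    (h : Z ⊗ P.X ⊗ N.X ⟶ W)
    (w : Z ◁ P.actRight ▷ N.X ≫ h = Z ◁ (α_ _ _ _).hom ≫ Z ◁ P.X ◁ N.actLeft ≫ h) :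
    Z ◁ proj P N ≫ tensDescL Z P N h w = h :=
  projX_tensXDescL Z P N h w

/-- The universal property of `(P ⊗_B N) ⊗ Z`. -/
noncomputable def tensDescR (Z : C) (P : Bimod A B) (N : Bimod B D) {W : C}
    (h : (P.X ⊗ N.X) ⊗ Z ⟶ W)
    (w : P.actRight ▷ N.X ▷ Z ≫ h = (α_ _ _ _).hom ▷ Z ≫ (P.X ◁ N.actLeft) ▷ Z ≫ h) :
    (tens P N).X ⊗ Z ⟶ W :=
  tensXDescR Z P N h w

@[simp] theorem proj_tensDescR (Z : C) (P : Bimod A B) (N : Bimod B D) {W : C}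
    (h : (P.X ⊗ N.X) ⊗ Z ⟶ W)
    (w : P.actRight ▷ N.X ▷ Z ≫ h = (α_ _ _ _).hom ▷ Z ≫ (P.X ◁ N.actLeft) ▷ Z ≫ h) :
    proj P N ▷ Z ≫ tensDescR Z P N h w = h :=
  projX_tensXDescR Z P N h w

end Tens

section Cells
set_option linter.unusedSectionVars false
variable {A A' A'' B B' B'' D D' D'' E E' : Mon C}

/-- A morphism of bimodules along monoid morphisms `φ` and `ψ`. -/
@[ext]
structure Cell (φ : A ⟶ A') (ψ : B ⟶ B') (P : Bimod A B) (Q : Bimod A' B') where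
  hom : P.X ⟶ Q.X
  left : P.actLeft ≫ hom = (φ.hom ⊗ₘ hom) ≫ Q.actLeft
  right : P.actRight ≫ hom = (hom ⊗ₘ ψ.hom) ≫ Q.actRight

/-- A 2-cell of `BIM`: a morphism of `A`-`B`-bimodules. -/
abbrev BimHom (P Q : Bimod A B) := Cell (𝟙 A) (𝟙 B) P Q

namespace Cell

theorem left_assoc {φ : A ⟶ A'} {ψ : B ⟶ B'} {P : Bimod A B} {Q : Bimod A' B'}
    (f : Cell φ ψ P Q) {W : C} (k : Q.X ⟶ W) :
    P.actLeft ≫ f.hom ≫ k = (φ.hom ⊗ₘ f.hom) ≫ Q.actLeft ≫ k := by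
  rw [← Category.assoc, f.left, Category.assoc]

theorem right_assoc {φ : A ⟶ A'} {ψ : B ⟶ B'} {P : Bimod A B} {Q : Bimod A' B'}
    (f : Cell φ ψ P Q) {W : C} (k : Q.X ⟶ W) :
    P.actRight ≫ f.hom ≫ k = (f.hom ⊗ₘ ψ.hom) ≫ Q.actRight ≫ k := by
  rw [← Category.assoc, f.right, Category.assoc]

/-- The identity of a bimodule. -/
@[simps] def id (P : Bimod A B) : BimHom P P where
  hom := 𝟙 P.X
  left := by simp
  right := by simp

/-- Vertical composition. -/
@[simps] def comp {φ : A ⟶ A'} {ψ : B ⟶ B'} {φ' : A' ⟶ A''} {ψ' : B' ⟶ B''}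
    {P : Bimod A B} {Q : Bimod A' B'} {S : Bimod A'' B''}
    (f : Cell φ ψ P Q) (g : Cell φ' ψ' Q S) : Cell (φ ≫ φ') (ψ ≫ ψ') P S where
  hom := f.hom ≫ g.hom
  left := by rw [f.left_assoc, g.left]; simp
  right := by rw [f.right_assoc, g.right]; simp

/-- Replace the base morphisms by equal ones. -/
@[simps] def cast {φ φ' : A ⟶ A'} {ψ ψ' : B ⟶ B'} {P : Bimod A B} {Q : Bimod A' B'}
    (f : Cell φ ψ P Q) (h : φ = φ' := by simp) (h' : ψ = ψ' := by simp) : Cell φ' ψ' P Q where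
  hom := f.hom
  left := by rw [← h]; exact f.left
  right := by rw [← h']; exact f.right

/-- The inverse of an invertible cell. -/
@[simps] def inverse {φ : A ⟶ A'} {ψ : B ⟶ B'} {P : Bimod A B} {Q : Bimod A' B'}
    (f : Cell φ ψ P Q) (φ' : A' ⟶ A) (ψ' : B' ⟶ B) (g : Q.X ⟶ P.X)
    (hfg : f.hom ≫ g = 𝟙 _) (hgf : g ≫ f.hom = 𝟙 _)
    (hφ : φ' ≫ φ = 𝟙 _ := by simp) (hψ : ψ' ≫ ψ = 𝟙 _ := by simp) : Cell φ' ψ' Q P where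
  hom := g
  left := by
    have h1 : φ'.hom ≫ φ.hom = 𝟙 _ := by rw [← Mon.comp_hom', hφ]; rfl
    have h2 : Q.actLeft = (φ'.hom ⊗ₘ g) ≫ P.actLeft ≫ f.hom := by
      rw [f.left, tensorHom_comp_tensorHom_assoc, h1, hgf]; simp
    rw [h2]; simp [hfg]
  right := by
    have h1 : ψ'.hom ≫ ψ.hom = 𝟙 _ := by rw [← Mon.comp_hom', hψ]; rfl
    have h2 : Q.actRight = (g ⊗ₘ ψ'.hom) ≫ P.actRight ≫ f.hom := by
      rw [f.right, tensorHom_comp_tensorHom_assoc, h1, hgf]; simp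
    rw [h2]; simp [hfg]

variable [HasCoequalizers C]
variable [∀ X : C, PreservesColimitsOfShape WalkingParallelPair (tensorLeft X)]
variable [∀ X : C, PreservesColimitsOfShape WalkingParallelPair (tensorRight X)]

theorem hcomp_aux {φ : A ⟶ A'} {ψ ψ' : B ⟶ B'} {χ : D ⟶ D'}
    {P : Bimod A B} {Q : Bimod A' B'} {N : Bimod B D} {S : Bimod B' D'}
    (f : Cell φ ψ P Q) (g : Cell ψ' χ N S) (h : ψ = ψ') :
    P.actRight ▷ N.X ≫ (f.hom ⊗ₘ g.hom) ≫ proj Q S =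
      (α_ _ _ _).hom ≫ P.X ◁ N.actLeft ≫ (f.hom ⊗ₘ g.hom) ≫ proj Q S := by
  subst h
  have h1 : P.actRight ▷ N.X ≫ (f.hom ⊗ₘ g.hom) =
      ((f.hom ⊗ₘ ψ.hom) ⊗ₘ g.hom) ≫ Q.actRight ▷ S.X := by
    simp only [← tensorHom_id, tensorHom_comp_tensorHom, f.right, Category.id_comp,
      Category.comp_id]
  have h2 : P.X ◁ N.actLeft ≫ (f.hom ⊗ₘ g.hom) =
      (f.hom ⊗ₘ (ψ.hom ⊗ₘ g.hom)) ≫ Q.X ◁ S.actLeft := by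
    simp only [← id_tensorHom, tensorHom_comp_tensorHom, g.left, Category.id_comp,
      Category.comp_id]
  rw [← Category.assoc, h1, Category.assoc, proj_condition,
    ← Category.assoc (P.X ◁ N.actLeft), h2]
  simp

/-- Horizontal composition: the module tensor product of bimodule morphisms. -/
noncomputable def hcomp {φ : A ⟶ A'} {ψ ψ' : B ⟶ B'} {χ : D ⟶ D'}
    {P : Bimod A B} {Q : Bimod A' B'} {N : Bimod B D} {S : Bimod B' D'}
    (f : Cell φ ψ P Q) (g : Cell ψ' χ N S) (h : ψ = ψ' := by simp) :
    Cell φ χ (tens P N) (tens Q S) where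
  hom := tensDesc P N ((f.hom ⊗ₘ g.hom) ≫ proj Q S) (hcomp_aux f g h)
  left := by
    rw [← cancel_epi (A.X ◁ proj P N), proj_actLeft_assoc, proj_tensDesc]
    have h3 : A.X ◁ proj P N ≫ (φ.hom ⊗ₘ tensDesc P N ((f.hom ⊗ₘ g.hom) ≫ proj Q S)
        (hcomp_aux f g h)) = (φ.hom ⊗ₘ (f.hom ⊗ₘ g.hom)) ≫ A'.X ◁ proj Q S := by
      simp only [← id_tensorHom, tensorHom_comp_tensorHom, proj_tensDesc, Category.id_comp,
        Category.comp_id]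
    rw [← Category.assoc (A.X ◁ proj P N), h3, Category.assoc, proj_actLeft]
    have h4 : P.actLeft ▷ N.X ≫ (f.hom ⊗ₘ g.hom) =
        ((φ.hom ⊗ₘ f.hom) ⊗ₘ g.hom) ≫ Q.actLeft ▷ S.X := by
      simp only [← tensorHom_id, tensorHom_comp_tensorHom, f.left, Category.id_comp,
        Category.comp_id]
    rw [← Category.assoc (P.actLeft ▷ N.X), h4]
    simp
  right := by
    rw [← cancel_epi (proj P N ▷ D.X), proj_actRight_assoc, proj_tensDesc]
    have h3 : proj P N ▷ D.X ≫ (tensDesc P N ((f.hom ⊗ₘ g.hom) ≫ proj Q S)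
        (hcomp_aux f g h) ⊗ₘ χ.hom) = ((f.hom ⊗ₘ g.hom) ⊗ₘ χ.hom) ≫ proj Q S ▷ D'.X := by
      simp only [← tensorHom_id, tensorHom_comp_tensorHom, proj_tensDesc, Category.id_comp,
        Category.comp_id]
    rw [← Category.assoc (proj P N ▷ D.X), h3, Category.assoc, proj_actRight]
    have h4 : P.X ◁ N.actRight ≫ (f.hom ⊗ₘ g.hom) =
        (f.hom ⊗ₘ (g.hom ⊗ₘ χ.hom)) ≫ Q.X ◁ S.actRight := by
      simp only [← id_tensorHom, tensorHom_comp_tensorHom, g.right, Category.id_comp,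
        Category.comp_id]
    rw [← Category.assoc (P.X ◁ N.actRight), h4]
    simp

theorem proj_hcomp {φ : A ⟶ A'} {ψ ψ' : B ⟶ B'} {χ : D ⟶ D'}
    {P : Bimod A B} {Q : Bimod A' B'} {N : Bimod B D} {S : Bimod B' D'}
    (f : Cell φ ψ P Q) (g : Cell ψ' χ N S) (h : ψ = ψ') :
    proj P N ≫ (hcomp f g h).hom = (f.hom ⊗ₘ g.hom) ≫ proj Q S :=
  proj_tensDesc _ _ _ (hcomp_aux f g h)

theorem proj_hcomp_assoc {φ : A ⟶ A'} {ψ ψ' : B ⟶ B'} {χ : D ⟶ D'}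
    {P : Bimod A B} {Q : Bimod A' B'} {N : Bimod B D} {S : Bimod B' D'}
    (f : Cell φ ψ P Q) (g : Cell ψ' χ N S) (h : ψ = ψ') {W : C}
    (k : (tens Q S).X ⟶ W) :
    proj P N ≫ (hcomp f g h).hom ≫ k = (f.hom ⊗ₘ g.hom) ≫ proj Q S ≫ k := by
  rw [← Category.assoc, proj_hcomp f g h, Category.assoc]

end Cell
end Cells

section Assoc
set_option linter.unusedSectionVars false
variable {A B D E : Mon C}
variable [HasCoequalizers C]
variable [∀ X : C, PreservesColimitsOfShape WalkingParallelPair (tensorLeft X)]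
variable [∀ X : C, PreservesColimitsOfShape WalkingParallelPair (tensorRight X)]

section
variable (P : Bimod A B) (N : Bimod B D) (S : Bimod D E)

theorem assocHomAux_w :
    P.actRight ▷ N.X ▷ S.X ≫ (α_ _ _ _).hom ≫ P.X ◁ proj N S ≫ proj P (tens N S) =
      (α_ _ _ _).hom ▷ S.X ≫ (P.X ◁ N.actLeft) ▷ S.X ≫
        (α_ _ _ _).hom ≫ P.X ◁ proj N S ≫ proj P (tens N S) := by
  rw [associator_naturality_left_assoc, ← whisker_exchange_assoc, proj_condition,
    associator_naturality_right_assoc, ← MonoidalCategory.whiskerLeft_comp_assoc, proj_actLeft]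
  simp

/-- Auxiliary map for the associator. -/
noncomputable def assocHomAux : (tens P N).X ⊗ S.X ⟶ (tens P (tens N S)).X :=
  tensDescR S.X P N ((α_ _ _ _).hom ≫ P.X ◁ proj N S ≫ proj P (tens N S))
    (assocHomAux_w P N S)

theorem proj_assocHomAux : proj P N ▷ S.X ≫ assocHomAux P N S =
    (α_ _ _ _).hom ≫ P.X ◁ proj N S ≫ proj P (tens N S) :=
  proj_tensDescR _ _ _ _ _

theorem assocHom_w : (tens P N).actRight ▷ S.X ≫ assocHomAux P N S =
    (α_ _ _ _).hom ≫ (tens P N).X ◁ S.actLeft ≫ assocHomAux P N S := by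
  rw [← cancel_epi (proj P N ▷ D.X ▷ S.X), ← comp_whiskerRight_assoc, proj_actRight]
  simp only [comp_whiskerRight, Category.assoc, proj_assocHomAux]
  rw [associator_naturality_left_assoc, ← whisker_exchange_assoc, proj_assocHomAux,
    associator_naturality_middle_assoc, ← MonoidalCategory.whiskerLeft_comp_assoc,
    proj_condition]
  simp

/-- The associativity morphism `(P ⊗ N) ⊗ S ⟶ P ⊗ (N ⊗ S)`. -/
noncomputable def assocHomX : (tens (tens P N) S).X ⟶ (tens P (tens N S)).X :=
  tensDesc (tens P N) S (assocHomAux P N S) (assocHom_w P N S)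

theorem proj_assocHomX : proj P N ▷ S.X ≫ proj (tens P N) S ≫ assocHomX P N S =
    (α_ _ _ _).hom ≫ P.X ◁ proj N S ≫ proj P (tens N S) := by
  rw [assocHomX, proj_tensDesc, proj_assocHomAux]

theorem assocInvAux_w :
    P.X ◁ N.actRight ▷ S.X ≫ (α_ _ _ _).inv ≫ proj P N ▷ S.X ≫ proj (tens P N) S =
      P.X ◁ (α_ _ _ _).hom ≫ P.X ◁ N.X ◁ S.actLeft ≫
        (α_ _ _ _).inv ≫ proj P N ▷ S.X ≫ proj (tens P N) S := by
  have h : P.X ◁ N.actRight ▷ S.X ≫ (α_ _ _ _).inv ≫ proj P N ▷ S.X =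
      (α_ _ _ _).inv ≫ (α_ _ _ _).inv ▷ S.X ≫ proj P N ▷ D.X ▷ S.X ≫
        (tens P N).actRight ▷ S.X := by
    rw [← comp_whiskerRight, proj_actRight]; simp
  have h' := congrArg (· ≫ proj (tens P N) S) h
  simp only [Category.assoc] at h'
  rw [h', proj_condition, associator_naturality_left_assoc, ← whisker_exchange_assoc]
  simp

/-- Auxiliary map for the inverse associator. -/
noncomputable def assocInvAux : P.X ⊗ (tens N S).X ⟶ (tens (tens P N) S).X :=
  tensDescL P.X N S ((α_ _ _ _).inv ≫ proj P N ▷ S.X ≫ proj (tens P N) S)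
    (assocInvAux_w P N S)

theorem proj_assocInvAux : P.X ◁ proj N S ≫ assocInvAux P N S =
    (α_ _ _ _).inv ≫ proj P N ▷ S.X ≫ proj (tens P N) S :=
  proj_tensDescL _ _ _ _ _

theorem assocInv_w : P.actRight ▷ (tens N S).X ≫ assocInvAux P N S =
    (α_ _ _ _).hom ≫ P.X ◁ (tens N S).actLeft ≫ assocInvAux P N S := by
  rw [← cancel_epi ((P.X ⊗ B.X) ◁ proj N S), whisker_exchange_assoc, proj_assocInvAux,
    associator_inv_naturality_left_assoc, ← comp_whiskerRight_assoc, proj_condition,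
    associator_naturality_right_assoc, ← MonoidalCategory.whiskerLeft_comp_assoc,
    proj_actLeft]
  simp only [MonoidalCategory.whiskerLeft_comp, Category.assoc, proj_assocInvAux]
  simp

/-- The inverse associativity morphism. -/
noncomputable def assocInvX : (tens P (tens N S)).X ⟶ (tens (tens P N) S).X :=
  tensDesc P (tens N S) (assocInvAux P N S) (assocInv_w P N S)

theorem proj_assocInvX : P.X ◁ proj N S ≫ proj P (tens N S) ≫ assocInvX P N S =
    (α_ _ _ _).inv ≫ proj P N ▷ S.X ≫ proj (tens P N) S := by
  rw [assocInvX, proj_tensDesc, proj_assocInvAux]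

theorem assoc_hom_inv : assocHomX P N S ≫ assocInvX P N S = 𝟙 _ := by
  rw [← cancel_epi (proj (tens P N) S), ← cancel_epi (proj P N ▷ S.X)]
  have h := congrArg (· ≫ assocInvX P N S) (proj_assocHomX P N S)
  simp only [Category.assoc] at h
  rw [h, proj_assocInvX]; simp

theorem assoc_inv_hom : assocInvX P N S ≫ assocHomX P N S = 𝟙 _ := by
  rw [← cancel_epi (proj P (tens N S)), ← cancel_epi (P.X ◁ proj N S)]
  have h := congrArg (· ≫ assocHomX P N S) (proj_assocInvX P N S)
  simp only [Category.assoc] at h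
  rw [h, proj_assocHomX]; simp

/-- The associativity 2-cell `(P ⊗ N) ⊗ S ⟶ P ⊗ (N ⊗ S)`. -/
noncomputable def assocHom : BimHom (tens (tens P N) S) (tens P (tens N S)) where
  hom := assocHomX P N S
  left := by
    rw [← cancel_epi (A.X ◁ proj (tens P N) S), ← cancel_epi (A.X ◁ proj P N ▷ S.X)]
    rw [proj_actLeft_assoc, associator_inv_naturality_middle_assoc, ← comp_whiskerRight_assoc,
      proj_actLeft]
    simp only [comp_whiskerRight, Category.assoc, proj_assocHomX, Mon.id_hom', id_tensorHom]
    have h := congrArg (fun k => A.X ◁ k) (proj_assocHomX P N S)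
    simp only [MonoidalCategory.whiskerLeft_comp] at h
    have h' := congrArg (· ≫ (tens P (tens N S)).actLeft) h
    simp only [Category.assoc] at h'
    rw [h', proj_actLeft, associator_inv_naturality_right_assoc, whisker_exchange_assoc]
    simp
  right := by
    rw [← cancel_epi (proj (tens P N) S ▷ E.X), ← cancel_epi (proj P N ▷ S.X ▷ E.X)]
    rw [proj_actRight_assoc, associator_naturality_left_assoc, ← whisker_exchange_assoc]
    rw [proj_assocHomX]
    have h := congrArg (fun k => k ▷ E.X) (proj_assocHomX P N S)
    simp only [comp_whiskerRight] at h
    have h' := congrArg (· ≫ (tens P (tens N S)).actRight) h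
    simp only [Category.assoc] at h'
    simp only [Mon.id_hom', tensorHom_id]
    rw [h', proj_actRight, associator_naturality_middle_assoc,
      ← MonoidalCategory.whiskerLeft_comp_assoc, proj_actRight]
    simp

/-- The inverse associativity 2-cell. -/
noncomputable def assocInv : BimHom (tens P (tens N S)) (tens (tens P N) S) :=
  (assocHom P N S).inverse (𝟙 _) (𝟙 _) (assocInvX P N S) (assoc_hom_inv P N S)
    (assoc_inv_hom P N S)

end

section
variable (P : Bimod A B)

/-- The identity 1-cell: a monoid as a bimodule over itself. -/
abbrev reg (A : Mon C) : Bimod A A where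
  X := A.X
  actLeft := μ[A.X]
  actRight := μ[A.X]

theorem leftUnit_w : (reg A).actRight ▷ P.X ≫ P.actLeft =
    (α_ _ _ _).hom ≫ (reg A).X ◁ P.actLeft ≫ P.actLeft := P.left_assoc

theorem rightUnit_w : P.actRight ▷ (reg B).X ≫ P.actRight =
    (α_ _ _ _).hom ≫ P.X ◁ (reg B).actLeft ≫ P.actRight := by
  have := P.right_assoc
  change _ = (α_ _ _ _).hom ≫ P.X ◁ μ ≫ P.actRight
  rw [this]; simp only [Iso.hom_inv_id_assoc]

/-- The unit 2-cell `A ⊗_A P ⟶ P`. -/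
noncomputable def leftUnit : BimHom (tens (reg A) P) P where
  hom := tensDesc (reg A) P P.actLeft (leftUnit_w P)
  left := by
    rw [← cancel_epi (A.X ◁ proj (reg A) P), proj_actLeft_assoc, proj_tensDesc]
    simp only [Mon.id_hom', id_tensorHom]
    rw [← MonoidalCategory.whiskerLeft_comp_assoc, proj_tensDesc]
    rw [P.left_assoc]; simp
  right := by
    rw [← cancel_epi (proj (reg A) P ▷ B.X), proj_actRight_assoc, proj_tensDesc]
    simp only [Mon.id_hom', tensorHom_id]
    rw [← comp_whiskerRight_assoc, proj_tensDesc, P.middle_assoc]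

theorem proj_leftUnit : proj (reg A) P ≫ (leftUnit P).hom = P.actLeft :=
  proj_tensDesc _ _ _ (leftUnit_w P)

/-- The unit 2-cell `P ⊗_B B ⟶ P`. -/
noncomputable def rightUnit : BimHom (tens P (reg B)) P where
  hom := tensDesc P (reg B) P.actRight (rightUnit_w P)
  left := by
    rw [← cancel_epi (A.X ◁ proj P (reg B)), proj_actLeft_assoc, proj_tensDesc]
    simp only [Mon.id_hom', id_tensorHom]
    rw [← MonoidalCategory.whiskerLeft_comp_assoc, proj_tensDesc]
    have := P.middle_assoc
    change _ ≫ P.actLeft ▷ B.X ≫ _ = _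
    rw [this]; simp
  right := by
    rw [← cancel_epi (proj P (reg B) ▷ B.X), proj_actRight_assoc, proj_tensDesc]
    simp only [Mon.id_hom', tensorHom_id]
    rw [← comp_whiskerRight_assoc, proj_tensDesc]
    exact (rightUnit_w P).symm

theorem proj_rightUnit : proj P (reg B) ≫ (rightUnit P).hom = P.actRight :=
  proj_tensDesc _ _ _ (rightUnit_w P)

/-- The inverse of the left unit 2-cell. -/
noncomputable def leftUnitInv : BimHom P (tens (reg A) P) :=
  (leftUnit P).inverse (𝟙 _) (𝟙 _) ((λ_ P.X).inv ≫ η[A.X] ▷ P.X ≫ proj (reg A) P)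
    (by
      rw [← cancel_epi (proj (reg A) P)]
      have h := congrArg (· ≫ (λ_ P.X).inv ≫ η[A.X] ▷ P.X ≫ proj (reg A) P) (proj_leftUnit P)
      simp only [Category.assoc] at h
      rw [h, leftUnitor_inv_naturality_assoc, whisker_exchange_assoc]
      have h2 := proj_condition (reg A) P
      have h3 : A.X ◁ P.actLeft ≫ proj (reg A) P =
          (α_ _ _ _).inv ≫ μ[A.X] ▷ P.X ≫ proj (reg A) P := by
        rw [Iso.eq_inv_comp]; exact h2.symm
      change _ ≫ _ ≫ A.X ◁ P.actLeft ≫ _ = _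
      rw [h3, associator_inv_naturality_left_assoc, ← comp_whiskerRight_assoc,
        MonObj.one_mul]
      simp)
    (by
      rw [Category.assoc, Category.assoc, proj_leftUnit, P.one_actLeft, Iso.inv_hom_id])

/-- The inverse of the right unit 2-cell. -/
noncomputable def rightUnitInv : BimHom P (tens P (reg B)) :=
  (rightUnit P).inverse (𝟙 _) (𝟙 _) ((ρ_ P.X).inv ≫ P.X ◁ η[B.X] ≫ proj P (reg B))
    (by
      rw [← cancel_epi (proj P (reg B))]
      have h := congrArg (· ≫ (ρ_ P.X).inv ≫ P.X ◁ η[B.X] ≫ proj P (reg B)) (proj_rightUnit P)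
      simp only [Category.assoc] at h
      rw [h, rightUnitor_inv_naturality_assoc, ← whisker_exchange_assoc]
      have h2 := proj_condition P (reg B)
      change _ ≫ _ ≫ P.actRight ▷ B.X ≫ _ = _
      have h3 : P.actRight ▷ B.X ≫ proj P (reg B) =
        (α_ _ _ _).hom ≫ P.X ◁ μ[B.X] ≫ proj P (reg B) := h2
      rw [h3, associator_naturality_right_assoc, ← MonoidalCategory.whiskerLeft_comp_assoc,
        MonObj.mul_one]
      simp)
    (by
      rw [Category.assoc, Category.assoc, proj_rightUnit, P.actRight_one, Iso.inv_hom_id])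

end
end Assoc

section Box
set_option linter.unusedSectionVars false
variable [BraidedCategory C]

theorem tensorμ_comp_assoc {X₁ X₂ Y₁ Y₂ Z₁ Z₂ V₁ V₂ U₁ U₂ W₁ W₂ : C}
    (f₁ : X₁ ⊗ Y₁ ⟶ V₁) (f₂ : X₂ ⊗ Y₂ ⟶ V₂) (g₁ : V₁ ⊗ Z₁ ⟶ W₁) (g₂ : V₂ ⊗ Z₂ ⟶ W₂)
    (h₁ : Y₁ ⊗ Z₁ ⟶ U₁) (h₂ : Y₂ ⊗ Z₂ ⟶ U₂) (k₁ : X₁ ⊗ U₁ ⟶ W₁) (k₂ : X₂ ⊗ U₂ ⟶ W₂)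
    (e₁ : f₁ ▷ Z₁ ≫ g₁ = (α_ _ _ _).hom ≫ X₁ ◁ h₁ ≫ k₁)
    (e₂ : f₂ ▷ Z₂ ≫ g₂ = (α_ _ _ _).hom ≫ X₂ ◁ h₂ ≫ k₂) :
    (tensorμ X₁ X₂ Y₁ Y₂ ≫ (f₁ ⊗ₘ f₂)) ▷ (Z₁ ⊗ Z₂) ≫ tensorμ V₁ V₂ Z₁ Z₂ ≫ (g₁ ⊗ₘ g₂) =
      (α_ _ _ _).hom ≫ (X₁ ⊗ X₂) ◁ (tensorμ Y₁ Y₂ Z₁ Z₂ ≫ (h₁ ⊗ₘ h₂)) ≫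
        tensorμ X₁ X₂ U₁ U₂ ≫ (k₁ ⊗ₘ k₂) := by
  rw [comp_whiskerRight, Category.assoc, tensorμ_natural_left_assoc, tensorHom_comp_tensorHom,
    e₁, e₂, ← tensorHom_comp_tensorHom, ← tensorHom_comp_tensorHom, tensor_associativity_assoc,
    MonoidalCategory.whiskerLeft_comp, Category.assoc, tensorμ_natural_right_assoc]

variable {A B D E A' B' D' E' : Mon C}

/-- The monoidal product of bimodules, an `A ⊗ A'`-`B ⊗ B'`-bimodule. -/
abbrev box (P : Bimod A B) (P' : Bimod A' B') : Bimod (A ⊗ A') (B ⊗ B') where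
  X := P.X ⊗ P'.X
  actLeft := tensorμ A.X A'.X P.X P'.X ≫ (P.actLeft ⊗ₘ P'.actLeft)
  actRight := tensorμ P.X P'.X B.X B'.X ≫ (P.actRight ⊗ₘ P'.actRight)
  one_actLeft := by
    change ((λ_ (𝟙_ C)).inv ≫ (η[A.X] ⊗ₘ η[A'.X])) ▷ (P.X ⊗ P'.X) ≫ _ = _
    rw [comp_whiskerRight, Category.assoc, tensorμ_natural_left_assoc, tensorHom_comp_tensorHom,
      P.one_actLeft, P'.one_actLeft, ← tensor_left_unitality]
  left_assoc := tensorμ_comp_assoc _ _ _ _ _ _ _ _ P.left_assoc P'.left_assoc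
  actRight_one := by
    change (P.X ⊗ P'.X) ◁ ((λ_ (𝟙_ C)).inv ≫ (η[B.X] ⊗ₘ η[B'.X])) ≫ _ = _
    rw [MonoidalCategory.whiskerLeft_comp, Category.assoc, tensorμ_natural_right_assoc,
      tensorHom_comp_tensorHom, P.actRight_one, P'.actRight_one, ← tensor_right_unitality]
  right_assoc := by
    rw [Iso.eq_inv_comp]
    refine (tensorμ_comp_assoc _ _ _ _ _ _ _ _ ?_ ?_).symm
    · rw [P.right_assoc, Iso.hom_inv_id_assoc]
    · rw [P'.right_assoc, Iso.hom_inv_id_assoc]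
  middle_assoc := tensorμ_comp_assoc _ _ _ _ _ _ _ _ P.middle_assoc P'.middle_assoc

/-- The monoidal product of bimodule morphisms. -/
def Cell.box {φ : A ⟶ B} {ψ : D ⟶ E} {φ' : A' ⟶ B'} {ψ' : D' ⟶ E'}
    {P : Bimod A D} {Q : Bimod B E} {P' : Bimod A' D'} {Q' : Bimod B' E'}
    (f : Cell φ ψ P Q) (f' : Cell φ' ψ' P' Q') :
    Cell (φ ⊗ₘ φ') (ψ ⊗ₘ ψ') (IntBgd.box P P') (IntBgd.box Q Q') where
  hom := f.hom ⊗ₘ f'.hom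
  left := by
    change (tensorμ _ _ _ _ ≫ (P.actLeft ⊗ₘ P'.actLeft)) ≫ (f.hom ⊗ₘ f'.hom) =
      ((φ.hom ⊗ₘ φ'.hom) ⊗ₘ (f.hom ⊗ₘ f'.hom)) ≫
        tensorμ _ _ _ _ ≫ (Q.actLeft ⊗ₘ Q'.actLeft)
    rw [Category.assoc, tensorHom_comp_tensorHom, f.left, f'.left, tensorμ_natural_assoc,
      tensorHom_comp_tensorHom]
  right := by
    change (tensorμ _ _ _ _ ≫ (P.actRight ⊗ₘ P'.actRight)) ≫ (f.hom ⊗ₘ f'.hom) =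
      ((f.hom ⊗ₘ f'.hom) ⊗ₘ (ψ.hom ⊗ₘ ψ'.hom)) ≫
        tensorμ _ _ _ _ ≫ (Q.actRight ⊗ₘ Q'.actRight)
    rw [Category.assoc, tensorHom_comp_tensorHom, f.right, f'.right, tensorμ_natural_assoc,
      tensorHom_comp_tensorHom]

/-- The associativity constraint of the monoidal product of bimodules. -/
def boxAssoc (P : Bimod A B) (P' : Bimod A' B') (P'' : Bimod D E) :
    Cell (α_ A A' D).hom (α_ B B' E).hom (box (box P P') P'') (box P (box P' P'')) where
  hom := (α_ P.X P'.X P''.X).hom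
  left := by
    change (tensorμ _ _ _ _ ≫ ((tensorμ _ _ _ _ ≫ (P.actLeft ⊗ₘ P'.actLeft)) ⊗ₘ
      P''.actLeft)) ≫ _ = ((α_ _ _ _).hom ⊗ₘ (α_ _ _ _).hom) ≫ tensorμ _ _ _ _ ≫
        (P.actLeft ⊗ₘ (tensorμ _ _ _ _ ≫ (P'.actLeft ⊗ₘ P''.actLeft)))
    have h := associator_monoidal_assoc A.X A'.X D.X P.X P'.X P''.X
      (P.actLeft ⊗ₘ (P'.actLeft ⊗ₘ P''.actLeft))
    rw [← associator_naturality, ← tensorHom_id, tensorHom_comp_tensorHom_assoc,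
      Category.id_comp, ← id_tensorHom, tensorHom_comp_tensorHom, Category.id_comp] at h
    rw [Category.assoc]; exact h
  right := by
    change (tensorμ _ _ _ _ ≫ ((tensorμ _ _ _ _ ≫ (P.actRight ⊗ₘ P'.actRight)) ⊗ₘ
      P''.actRight)) ≫ _ = ((α_ _ _ _).hom ⊗ₘ (α_ _ _ _).hom) ≫ tensorμ _ _ _ _ ≫
        (P.actRight ⊗ₘ (tensorμ _ _ _ _ ≫ (P'.actRight ⊗ₘ P''.actRight)))
    have h := associator_monoidal_assoc P.X P'.X P''.X B.X B'.X E.X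
      (P.actRight ⊗ₘ (P'.actRight ⊗ₘ P''.actRight))
    rw [← associator_naturality, ← tensorHom_id, tensorHom_comp_tensorHom_assoc,
      Category.id_comp, ← id_tensorHom, tensorHom_comp_tensorHom, Category.id_comp] at h
    rw [Category.assoc]; exact h

/-- The inverse associativity constraint. -/
def boxAssocInv (P : Bimod A B) (P' : Bimod A' B') (P'' : Bimod D E) :
    Cell (α_ A A' D).inv (α_ B B' E).inv (box P (box P' P'')) (box (box P P') P'') :=
  (boxAssoc P P' P'').inverse _ _ (α_ P.X P'.X P''.X).inv (Iso.hom_inv_id _) (Iso.inv_hom_id _)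
    (Iso.inv_hom_id _) (Iso.inv_hom_id _)

/-- The left unit constraint of the monoidal product of bimodules. -/
def boxLeftUnit (P : Bimod A B) :
    Cell (λ_ A).hom (λ_ B).hom (box (reg (𝟙_ (Mon C))) P) P where
  hom := (λ_ P.X).hom
  left := by
    change (tensorμ (𝟙_ C) A.X (𝟙_ C) P.X ≫ ((λ_ (𝟙_ C)).hom ⊗ₘ P.actLeft)) ≫ (λ_ P.X).hom =
      ((λ_ A.X).hom ⊗ₘ (λ_ P.X).hom) ≫ P.actLeft
    rw [leftUnitor_monoidal, MonoidalCategory.tensorHom_def]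
    simp
  right := by
    change (tensorμ (𝟙_ C) P.X (𝟙_ C) B.X ≫ ((λ_ (𝟙_ C)).hom ⊗ₘ P.actRight)) ≫ (λ_ P.X).hom =
      ((λ_ P.X).hom ⊗ₘ (λ_ B.X).hom) ≫ P.actRight
    rw [leftUnitor_monoidal, MonoidalCategory.tensorHom_def]
    simp

/-- The inverse left unit constraint. -/
def boxLeftUnitInv (P : Bimod A B) :
    Cell (λ_ A).inv (λ_ B).inv P (box (reg (𝟙_ (Mon C))) P) :=
  (boxLeftUnit P).inverse _ _ (λ_ P.X).inv (Iso.hom_inv_id _) (Iso.inv_hom_id _)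
    (Iso.inv_hom_id _) (Iso.inv_hom_id _)

/-- The right unit constraint of the monoidal product of bimodules. -/
def boxRightUnit (P : Bimod A B) :
    Cell (ρ_ A).hom (ρ_ B).hom (box P (reg (𝟙_ (Mon C)))) P where
  hom := (ρ_ P.X).hom
  left := by
    change (tensorμ A.X (𝟙_ C) P.X (𝟙_ C) ≫ (P.actLeft ⊗ₘ (λ_ (𝟙_ C)).hom)) ≫ (ρ_ P.X).hom =
      ((ρ_ A.X).hom ⊗ₘ (ρ_ P.X).hom) ≫ P.actLeft
    rw [rightUnitor_monoidal, MonoidalCategory.tensorHom_def']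
    simp
  right := by
    change (tensorμ P.X (𝟙_ C) B.X (𝟙_ C) ≫ (P.actRight ⊗ₘ (λ_ (𝟙_ C)).hom)) ≫ (ρ_ P.X).hom =
      ((ρ_ P.X).hom ⊗ₘ (ρ_ B.X).hom) ≫ P.actRight
    rw [rightUnitor_monoidal, MonoidalCategory.tensorHom_def']
    simp

/-- The identity `A ⊠ A' = A ⊗ A'` on identity 1-cells. -/
def boxReg (A A' : Mon C) : BimHom (box (reg A) (reg A')) (reg (A ⊗ A')) where
  hom := 𝟙 (A.X ⊗ A'.X)
  left := by
    change (tensorμ _ _ _ _ ≫ (μ[A.X] ⊗ₘ μ[A'.X])) ≫ 𝟙 _ = (𝟙 (A.X ⊗ A'.X) ⊗ₘ 𝟙 (A.X ⊗ A'.X)) ≫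
      tensorμ _ _ _ _ ≫ (μ[A.X] ⊗ₘ μ[A'.X])
    simp
  right := by
    change (tensorμ _ _ _ _ ≫ (μ[A.X] ⊗ₘ μ[A'.X])) ≫ 𝟙 _ = (𝟙 (A.X ⊗ A'.X) ⊗ₘ 𝟙 (A.X ⊗ A'.X)) ≫
      tensorμ _ _ _ _ ≫ (μ[A.X] ⊗ₘ μ[A'.X])
    simp

/-- The inverse of `boxReg`. -/
def boxRegInv (A A' : Mon C) : BimHom (reg (A ⊗ A')) (box (reg A) (reg A')) :=
  (boxReg A A').inverse (𝟙 _) (𝟙 _) (𝟙 (A.X ⊗ A'.X)) (Category.id_comp _) (Category.id_comp _)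

variable [HasCoequalizers C]
variable [∀ X : C, PreservesColimitsOfShape WalkingParallelPair (tensorLeft X)]
variable [∀ X : C, PreservesColimitsOfShape WalkingParallelPair (tensorRight X)]

section
variable (P : Bimod A B) (P' : Bimod A' B') (N : Bimod B D) (N' : Bimod B' D')

theorem interchange_w : (box P P').actRight ▷ (box N N').X ≫
      tensorμ P.X P'.X N.X N'.X ≫ (proj P N ⊗ₘ proj P' N') =
    (α_ _ _ _).hom ≫ (box P P').X ◁ (box N N').actLeft ≫
      tensorμ P.X P'.X N.X N'.X ≫ (proj P N ⊗ₘ proj P' N') :=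
  tensorμ_comp_assoc _ _ _ _ _ _ _ _ (proj_condition P N) (proj_condition P' N')

/-- The interchange morphism `(P ⊠ P') ⊗ (N ⊠ N') ⟶ (P ⊗ N) ⊠ (P' ⊗ N')`. -/
noncomputable def interchangeX :
    (tens (box P P') (box N N')).X ⟶ (tens P N).X ⊗ (tens P' N').X :=
  tensDesc (box P P') (box N N') (tensorμ P.X P'.X N.X N'.X ≫ (proj P N ⊗ₘ proj P' N'))
    (interchange_w P P' N N')

theorem proj_interchangeX : proj (box P P') (box N N') ≫ interchangeX P P' N N' =
    tensorμ P.X P'.X N.X N'.X ≫ (proj P N ⊗ₘ proj P' N') :=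
  proj_tensDesc _ _ _ (interchange_w P P' N N')

/-- The interchange 2-cell `(P ⊠ P') ⊗ (N ⊠ N') ⟶ (P ⊗ N) ⊠ (P' ⊗ N')`. -/
noncomputable def interchange :
    BimHom (tens (box P P') (box N N')) (box (tens P N) (tens P' N')) where
  hom := interchangeX P P' N N'
  left := by
    rw [← cancel_epi ((A ⊗ A').X ◁ proj (box P P') (box N N')), proj_actLeft_assoc,
      proj_interchangeX]
    simp only [Mon.id_hom', id_tensorHom]
    rw [← MonoidalCategory.whiskerLeft_comp_assoc, proj_interchangeX, Iso.inv_comp_eq]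
    refine tensorμ_comp_assoc _ _ _ _ _ _ _ _ ?_ ?_
    · rw [proj_actLeft, Iso.hom_inv_id_assoc]
    · rw [proj_actLeft, Iso.hom_inv_id_assoc]
  right := by
    rw [← cancel_epi (proj (box P P') (box N N') ▷ (D ⊗ D').X), proj_actRight_assoc,
      proj_interchangeX]
    simp only [Mon.id_hom', tensorHom_id]
    rw [← comp_whiskerRight_assoc, proj_interchangeX]
    exact (tensorμ_comp_assoc _ _ _ _ _ _ _ _ (proj_actRight P N) (proj_actRight P' N')).symm

/-- Auxiliary map for the inverse of the interchange. -/
noncomputable def interchangePre :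
    (P.X ⊗ N.X) ⊗ (P'.X ⊗ N'.X) ⟶ (tens (box P P') (box N N')).X :=
  tensorδ P.X P'.X N.X N'.X ≫ proj (box P P') (box N N')

theorem tensorμ_interchangePre : tensorμ P.X P'.X N.X N'.X ≫ interchangePre P P' N N' =
    proj (box P P') (box N N') := by
  rw [interchangePre, tensorμ_tensorδ_assoc]

instance (X₁ X₂ Y₁ Y₂ : C) : IsIso (tensorμ X₁ X₂ Y₁ Y₂) :=
  ⟨tensorδ X₁ X₂ Y₁ Y₂, tensorμ_tensorδ _ _ _ _, tensorδ_tensorμ _ _ _ _⟩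

theorem interchangePre_balanced :
    (P.actRight ▷ N.X ⊗ₘ P'.actRight ▷ N'.X) ≫ interchangePre P P' N N' =
      (((α_ _ _ _).hom ≫ P.X ◁ N.actLeft) ⊗ₘ ((α_ _ _ _).hom ≫ P'.X ◁ N'.actLeft)) ≫
        interchangePre P P' N N' := by
  rw [← cancel_epi (tensorμ (P.X ⊗ B.X) (P'.X ⊗ B'.X) N.X N'.X),
    ← cancel_epi (tensorμ P.X P'.X B.X B'.X ▷ (N.X ⊗ N'.X))]
  rw [← tensorμ_natural_left_assoc, tensorμ_interchangePre, ← comp_whiskerRight_assoc]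
  rw [← tensorHom_comp_tensorHom_assoc, tensor_associativity_assoc,
    ← tensorμ_natural_right_assoc, tensorμ_interchangePre,
    ← MonoidalCategory.whiskerLeft_comp_assoc]
  exact proj_condition (box P P') (box N N')

theorem actRight_insert : ((ρ_ P.X).inv ≫ P.X ◁ η[B.X]) ▷ N.X ≫ P.actRight ▷ N.X = 𝟙 _ := by
  rw [← comp_whiskerRight, Category.assoc, P.actRight_one, Iso.inv_hom_id, id_whiskerRight]

theorem actLeft_insert : ((ρ_ P.X).inv ≫ P.X ◁ η[B.X]) ▷ N.X ≫ (α_ _ _ _).hom ≫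
    P.X ◁ N.actLeft = 𝟙 _ := by
  have e : η[B.X] ▷ N.X ≫ N.actLeft = (λ_ N.X).hom := N.one_actLeft
  have h : ((ρ_ P.X).inv ≫ P.X ◁ η[B.X]) ▷ N.X ≫ (α_ _ _ _).hom =
      P.X ◁ ((λ_ N.X).inv ≫ η[B.X] ▷ N.X) := by
    simp
  rw [← Category.assoc, h, ← MonoidalCategory.whiskerLeft_comp, Category.assoc, e,
    Iso.inv_hom_id, MonoidalCategory.whiskerLeft_id]

theorem interchangePre_balanced_left :
    (P.actRight ▷ N.X) ▷ (P'.X ⊗ N'.X) ≫ interchangePre P P' N N' =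
      ((α_ _ _ _).hom ≫ P.X ◁ N.actLeft) ▷ (P'.X ⊗ N'.X) ≫ interchangePre P P' N N' := by
  have h := congrArg (fun k => (((P.X ⊗ B.X) ⊗ N.X) ◁ (((ρ_ P'.X).inv ≫ P'.X ◁ η[B'.X]) ▷ N'.X))
    ≫ k) (interchangePre_balanced P P' N N')
  simp only [← id_tensorHom, tensorHom_comp_tensorHom_assoc, Category.id_comp] at h
  simp only [id_tensorHom, actRight_insert, actLeft_insert, tensorHom_id] at h
  exact h

theorem interchangePre_balanced_right :
    (P.X ⊗ N.X) ◁ (P'.actRight ▷ N'.X) ≫ interchangePre P P' N N' =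
      (P.X ⊗ N.X) ◁ ((α_ _ _ _).hom ≫ P'.X ◁ N'.actLeft) ≫ interchangePre P P' N N' := by
  have h := congrArg (fun k => ((((ρ_ P.X).inv ≫ P.X ◁ η[B.X]) ▷ N.X) ▷ ((P'.X ⊗ B'.X) ⊗ N'.X))
    ≫ k) (interchangePre_balanced P P' N N')
  simp only [← tensorHom_id, tensorHom_comp_tensorHom_assoc, Category.id_comp] at h
  simp only [tensorHom_id, actRight_insert, actLeft_insert, id_tensorHom] at h
  exact h

/-- Auxiliary map for the inverse of the interchange. -/
noncomputable def interchangeInvAux :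
    (P.X ⊗ N.X) ⊗ (tens P' N').X ⟶ (tens (box P P') (box N N')).X :=
  tensDescL (P.X ⊗ N.X) P' N' (interchangePre P P' N N') (by
    rw [interchangePre_balanced_right, MonoidalCategory.whiskerLeft_comp, Category.assoc])

theorem proj_interchangeInvAux :
    (P.X ⊗ N.X) ◁ proj P' N' ≫ interchangeInvAux P P' N N' = interchangePre P P' N N' :=
  proj_tensDescL _ _ _ _ _

/-- The inverse of the interchange. -/
noncomputable def interchangeInvX :
    (tens P N).X ⊗ (tens P' N').X ⟶ (tens (box P P') (box N N')).X :=
  tensDescR _ P N (interchangeInvAux P P' N N') (by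
    rw [← comp_whiskerRight_assoc, ← cancel_epi (((P.X ⊗ B.X) ⊗ N.X) ◁ proj P' N'),
      whisker_exchange_assoc, proj_interchangeInvAux, whisker_exchange_assoc,
      proj_interchangeInvAux, interchangePre_balanced_left])

theorem proj_interchangeInvX :
    (proj P N ⊗ₘ proj P' N') ≫ interchangeInvX P P' N N' = interchangePre P P' N N' := by
  rw [MonoidalCategory.tensorHom_def', Category.assoc, interchangeInvX, proj_tensDescR,
    proj_interchangeInvAux]

/-- The inverse interchange 2-cell. -/
noncomputable def interchangeInv :
    BimHom (box (tens P N) (tens P' N')) (tens (box P P') (box N N')) :=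
  (interchange P P' N N').inverse (𝟙 _) (𝟙 _) (interchangeInvX P P' N N')
    (by
      rw [← cancel_epi (proj (box P P') (box N N'))]
      change _ ≫ interchangeX P P' N N' ≫ _ = _
      have h := congrArg (· ≫ interchangeInvX P P' N N') (proj_interchangeX P P' N N')
      simp only [Category.assoc] at h
      rw [h, proj_interchangeInvX, tensorμ_interchangePre, Category.comp_id])
    (by
      change interchangeInvX P P' N N' ≫ interchangeX P P' N N' = 𝟙 ((tens P N).X ⊗ (tens P' N').X)
      rw [← cancel_epi (proj P N ⊗ₘ proj P' N')]
      have h := congrArg (· ≫ interchangeX P P' N N') (proj_interchangeInvX P P' N N')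
      simp only [Category.assoc] at h
      rw [h, interchangePre, Category.assoc, proj_interchangeX, tensorδ_tensorμ_assoc]
      simp)

end
end Box

section Basic
set_option linter.unusedSectionVars false
variable {A A' B B' D E : Mon C}

/-- Restriction of a bimodule along monoid morphisms. -/
abbrev res (φ : A ⟶ A') (ψ : B ⟶ B') (P : Bimod A' B') : Bimod A B where
  X := P.X
  actLeft := φ.hom ▷ P.X ≫ P.actLeft
  actRight := P.X ◁ ψ.hom ≫ P.actRight
  one_actLeft := by
    rw [← comp_whiskerRight_assoc, IsMonHom.one_hom, P.one_actLeft]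
  left_assoc := by
    rw [← comp_whiskerRight_assoc, IsMonHom.mul_hom, comp_whiskerRight, Category.assoc,
      P.left_assoc, MonoidalCategory.whiskerLeft_comp, Category.assoc,
      whisker_exchange_assoc, MonoidalCategory.tensorHom_def', comp_whiskerRight, Category.assoc]
    simp
  actRight_one := by
    rw [← MonoidalCategory.whiskerLeft_comp_assoc, IsMonHom.one_hom, P.actRight_one]
  right_assoc := by
    rw [← MonoidalCategory.whiskerLeft_comp_assoc, IsMonHom.mul_hom,
      MonoidalCategory.whiskerLeft_comp, Category.assoc,
      P.right_assoc, comp_whiskerRight, Category.assoc, ← whisker_exchange_assoc,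
      MonoidalCategory.tensorHom_def, MonoidalCategory.whiskerLeft_comp, Category.assoc]
    simp
  middle_assoc := by
    rw [comp_whiskerRight, Category.assoc, ← whisker_exchange_assoc, P.middle_assoc,
      MonoidalCategory.whiskerLeft_comp, Category.assoc, whisker_exchange_assoc,
      whisker_exchange_assoc]
    simp

/-- The identity of the underlying object, as a cell from a restricted bimodule. -/
def resCell (φ : A ⟶ A') (ψ : B ⟶ B') (P : Bimod A' B') : Cell φ ψ (res φ ψ P) P where
  hom := 𝟙 P.X
  left := by simp
  right := by simp

/-- The identity of the underlying object, as a cell to a restricted bimodule. -/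
def resCellInv (φ : A ⟶ A') (ψ : B ⟶ B') (φ' : A' ⟶ A) (ψ' : B' ⟶ B) (P : Bimod A' B')
    (hφ : φ' ≫ φ = 𝟙 _ := by simp) (hψ : ψ' ≫ ψ = 𝟙 _ := by simp) :
    Cell φ' ψ' P (res φ ψ P) :=
  (resCell φ ψ P).inverse φ' ψ' (𝟙 P.X) (Category.id_comp _) (Category.id_comp _) hφ hψ

/-- The `A`-`B`-bimodule `f_*` on `B` induced by a monoid morphism `f : A ⟶ B`. -/
abbrev companion (f : A ⟶ B) : Bimod A B := res f (𝟙 B) (reg B)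

variable [BraidedCategory C]

/-- The opposite monoid, with multiplication `β ≫ μ`. -/
abbrev opMonObj (M : C) [MonObj M] : MonObj M where
  one := η[M]
  mul := (β_ M M).hom ≫ μ[M]
  one_mul := by
    rw [BraidedCategory.braiding_naturality_left_assoc, MonObj.mul_one, braiding_rightUnitor]
  mul_one := by
    rw [BraidedCategory.braiding_naturality_right_assoc, MonObj.one_mul, braiding_leftUnitor]
  mul_assoc := by
    rw [comp_whiskerRight, MonoidalCategory.whiskerLeft_comp, Category.assoc, Category.assoc,
      BraidedCategory.braiding_naturality_left_assoc,
      BraidedCategory.braiding_naturality_right_assoc]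
    have e := BraidedCategory.braiding_naturality_left (β_ M M).hom M
    rw [reassoc_of% e, MonObj.mul_assoc, BraidedCategory.braiding_tensor_left_hom,
      BraidedCategory.braiding_tensor_right_hom]
    simp

/-- The opposite of a monoid. -/
abbrev op (A : Mon C) : Mon C where
  X := A.X
  mon := opMonObj A.X

theorem op_mul (A : Mon C) : μ[(op A).X] = (β_ A.X A.X).hom ≫ μ[A.X] := rfl

theorem comm_right_assoc {A B P : C} (mA : A ⊗ A ⟶ A) (mB : B ⊗ B ⟶ B)
    (f : P ⊗ A ⟶ P) (g : P ⊗ B ⟶ P)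
    (hf : P ◁ mA ≫ f = (α_ _ _ _).inv ≫ f ▷ A ≫ f)
    (hg : P ◁ mB ≫ g = (α_ _ _ _).inv ≫ g ▷ B ≫ g)
    (hfg : g ▷ A ≫ f = (α_ _ _ _).hom ≫ P ◁ (β_ B A).hom ≫ (α_ _ _ _).inv ≫ f ▷ B ≫ g) :
    P ◁ (tensorμ A B A B ≫ (mA ⊗ₘ mB)) ≫ (α_ _ _ _).inv ≫ f ▷ B ≫ g =
      (α_ _ _ _).inv ≫ ((α_ _ _ _).inv ≫ f ▷ B ≫ g) ▷ (A ⊗ B) ≫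
        (α_ _ _ _).inv ≫ f ▷ B ≫ g := by
  calc
    _ = P ◁ tensorμ A B A B ⊗≫ (P ◁ mA ≫ f) ▷ (B ⊗ B) ≫ P ◁ mB ≫ g := by
      rw [MonoidalCategory.tensorHom_def, comp_whiskerRight, Category.assoc,
        ← whisker_exchange_assoc]
      monoidal
    _ = 𝟙 _ ⊗≫ P ◁ A ◁ (β_ B A).hom ▷ B ⊗≫ f ▷ (A ⊗ B ⊗ B) ⊗≫ f ▷ (B ⊗ B) ⊗≫ g ▷ B ≫ g := by
      rw [hf, hg, tensorμ]
      monoidal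
    _ = 𝟙 _ ⊗≫ ((P ⊗ A) ◁ (β_ B A).hom ≫ f ▷ (A ⊗ B)) ▷ B ⊗≫ f ▷ (B ⊗ B) ⊗≫ g ▷ B ≫ g := by
      monoidal
    _ = 𝟙 _ ⊗≫ f ▷ ((B ⊗ A) ⊗ B) ⊗≫ ((α_ _ _ _).hom ≫ P ◁ (β_ B A).hom ≫ (α_ _ _ _).inv ≫
        f ▷ B ≫ g) ▷ B ≫ g := by
      rw [whisker_exchange]; monoidal
    _ = _ := by
      rw [← hfg]; monoidal

theorem comm_left_assoc {A B P : C} (mA : A ⊗ A ⟶ A) (mB : B ⊗ B ⟶ B)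
    (f : A ⊗ P ⟶ P) (g : B ⊗ P ⟶ P)
    (hf : mA ▷ P ≫ f = (α_ _ _ _).hom ≫ A ◁ f ≫ f)
    (hg : mB ▷ P ≫ g = (α_ _ _ _).hom ≫ B ◁ g ≫ g)
    (hfg : B ◁ f ≫ g = (α_ _ _ _).inv ≫ (β_ B A).hom ▷ P ≫ (α_ _ _ _).hom ≫ A ◁ g ≫ f) :
    (tensorμ A B A B ≫ (mA ⊗ₘ mB)) ▷ P ≫ (α_ _ _ _).hom ≫ A ◁ g ≫ f =
      (α_ _ _ _).hom ≫ (A ⊗ B) ◁ ((α_ _ _ _).hom ≫ A ◁ g ≫ f) ≫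
        (α_ _ _ _).hom ≫ A ◁ g ≫ f := by
  calc
    _ = tensorμ A B A B ▷ P ⊗≫ (A ⊗ A) ◁ (mB ▷ P ≫ g) ≫ mA ▷ P ≫ f := by
      rw [MonoidalCategory.tensorHom_def', MonoidalCategory.whiskerLeft_comp, Category.assoc,
        whisker_exchange_assoc]
      monoidal
    _ = 𝟙 _ ⊗≫ A ◁ (β_ B A).hom ▷ (B ⊗ P) ⊗≫ (A ⊗ A ⊗ B) ◁ g ⊗≫ (A ⊗ A) ◁ g ⊗≫ A ◁ f ≫ f := by
      rw [hf, hg, tensorμ]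
      monoidal
    _ = 𝟙 _ ⊗≫ A ◁ ((β_ B A).hom ▷ (B ⊗ P) ≫ (A ⊗ B) ◁ g) ⊗≫ (A ⊗ A) ◁ g ⊗≫ A ◁ f ≫ f := by
      monoidal
    _ = 𝟙 _ ⊗≫ (A ⊗ B ⊗ A) ◁ g ⊗≫ A ◁ ((α_ _ _ _).inv ≫ (β_ B A).hom ▷ P ≫
        (α_ _ _ _).hom ≫ A ◁ g ≫ f) ≫ f := by
      rw [← whisker_exchange]; monoidal
    _ = _ := by
      rw [← hfg]; monoidal

theorem comm_right_one {A B P : C} (eA : 𝟙_ C ⟶ A) (eB : 𝟙_ C ⟶ B)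
    (f : P ⊗ A ⟶ P) (g : P ⊗ B ⟶ P) (hf : P ◁ eA ≫ f = (ρ_ P).hom)
    (hg : P ◁ eB ≫ g = (ρ_ P).hom) :
    P ◁ ((λ_ (𝟙_ C)).inv ≫ (eA ⊗ₘ eB)) ≫ (α_ _ _ _).inv ≫ f ▷ B ≫ g = (ρ_ P).hom := by
  have h : P ◁ (eA ⊗ₘ eB) ≫ (α_ _ _ _).inv ≫ f ▷ B ≫ g =
      (α_ _ _ _).inv ≫ (P ◁ eA ≫ f) ▷ (𝟙_ C) ≫ P ◁ eB ≫ g := by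
    rw [MonoidalCategory.tensorHom_def, comp_whiskerRight, Category.assoc,
      ← whisker_exchange_assoc]
    simp
  rw [MonoidalCategory.whiskerLeft_comp, Category.assoc, h, hf, hg]
  monoidal

theorem comm_left_one {A B P : C} (eA : 𝟙_ C ⟶ A) (eB : 𝟙_ C ⟶ B)
    (f : A ⊗ P ⟶ P) (g : B ⊗ P ⟶ P) (hf : eA ▷ P ≫ f = (λ_ P).hom)
    (hg : eB ▷ P ≫ g = (λ_ P).hom) :
    ((λ_ (𝟙_ C)).inv ≫ (eA ⊗ₘ eB)) ▷ P ≫ (α_ _ _ _).hom ≫ A ◁ g ≫ f = (λ_ P).hom := by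
  have h : (eA ⊗ₘ eB) ▷ P ≫ (α_ _ _ _).hom ≫ A ◁ g ≫ f =
      (α_ _ _ _).hom ≫ 𝟙_ C ◁ (eB ▷ P ≫ g) ≫ eA ▷ P ≫ f := by
    rw [MonoidalCategory.tensorHom_def', MonoidalCategory.whiskerLeft_comp, Category.assoc,
      whisker_exchange_assoc]
    simp
  rw [comp_whiskerRight, Category.assoc, h, hf, hg]
  monoidal

theorem op_right_assoc {A P : C} (m : A ⊗ A ⟶ A) (f : A ⊗ P ⟶ P)
    (hf : m ▷ P ≫ f = (α_ _ _ _).hom ≫ A ◁ f ≫ f) :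
    P ◁ ((β_ A A).hom ≫ m) ≫ (β_ P A).hom ≫ f =
      (α_ _ _ _).inv ≫ ((β_ P A).hom ≫ f) ▷ A ≫ (β_ P A).hom ≫ f := by
  rw [BraidedCategory.braiding_naturality_right_assoc, comp_whiskerRight, comp_whiskerRight,
    Category.assoc, Category.assoc, BraidedCategory.braiding_naturality_left_assoc, hf,
    BraidedCategory.braiding_tensor_left_hom]
  rw [BraidedCategory.braiding_tensor_right_hom]
  simp

theorem op_left_assoc {A P : C} (m : A ⊗ A ⟶ A) (f : P ⊗ A ⟶ P)
    (hf : P ◁ m ≫ f = (α_ _ _ _).inv ≫ f ▷ A ≫ f) :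
    ((β_ A A).hom ≫ m) ▷ P ≫ (β_ A P).hom ≫ f =
      (α_ _ _ _).hom ≫ A ◁ ((β_ A P).hom ≫ f) ≫ (β_ A P).hom ≫ f := by
  rw [comp_whiskerRight, Category.assoc, BraidedCategory.braiding_naturality_left_assoc, hf,
    MonoidalCategory.whiskerLeft_comp, Category.assoc,
    BraidedCategory.braiding_naturality_right_assoc]
  have e := BraidedCategory.braiding_naturality_left (β_ A A).hom P
  rw [reassoc_of% e, BraidedCategory.braiding_tensor_left_hom,
    BraidedCategory.braiding_tensor_right_hom]
  simp

/-- A left `A`-action on an `A`-`B`-bimodule, turned into a right action of the opposite monoid: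
the right action of `a ⊗ b` on `p` is `a p b`. -/
abbrev turnRight (P : Bimod A B) : Bimod (𝟙_ (Mon C)) (op A ⊗ B) where
  X := P.X
  actLeft := (λ_ P.X).hom
  actRight := (α_ _ _ _).inv ≫ ((β_ P.X A.X).hom ≫ P.actLeft) ▷ B.X ≫ P.actRight
  one_actLeft := by
    change 𝟙 _ ▷ _ ≫ _ = _; simp
  left_assoc := by
    change (λ_ (𝟙_ C)).hom ▷ _ ≫ _ = _
    monoidal
  actRight_one := by
    refine comm_right_one _ _ _ _ ?_ P.actRight_one
    change P.X ◁ η[A.X] ≫ _ = _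
    rw [BraidedCategory.braiding_naturality_right_assoc, P.one_actLeft, braiding_leftUnitor]
  right_assoc := by
    refine comm_right_assoc _ _ _ _ (op_right_assoc _ _ P.left_assoc) P.right_assoc ?_
    rw [BraidedCategory.braiding_naturality_left_assoc, comp_whiskerRight, Category.assoc,
      P.middle_assoc, BraidedCategory.braiding_tensor_left_hom]
    simp
  middle_assoc := by
    simp

/-- A right `B`-action on an `A`-`B`-bimodule, turned into a left action of the opposite monoid:
the left action of `a ⊗ b` on `p` is `a p b`. -/
abbrev turnLeft (P : Bimod A B) : Bimod (A ⊗ op B) (𝟙_ (Mon C)) where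
  X := P.X
  actLeft := (α_ _ _ _).hom ≫ A.X ◁ ((β_ B.X P.X).hom ≫ P.actRight) ≫ P.actLeft
  actRight := (ρ_ P.X).hom
  one_actLeft := by
    refine comm_left_one _ _ _ _ P.one_actLeft ?_
    change η[B.X] ▷ P.X ≫ _ = _
    rw [BraidedCategory.braiding_naturality_left_assoc, P.actRight_one, braiding_rightUnitor]
  left_assoc := by
    refine comm_left_assoc _ _ _ _ P.left_assoc
      (op_left_assoc _ _ P.right_assoc) ?_
    rw [BraidedCategory.braiding_naturality_right_assoc, MonoidalCategory.whiskerLeft_comp,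
      Category.assoc, BraidedCategory.braiding_tensor_right_hom]
    have h : A.X ◁ P.actRight ≫ P.actLeft =
        (α_ _ _ _).inv ≫ P.actLeft ▷ B.X ≫ P.actRight := by
      rw [P.middle_assoc, Iso.inv_hom_id_assoc]
    rw [h]
    simp
  actRight_one := by
    change _ ◁ 𝟙 _ ≫ _ = _; simp
  right_assoc := by
    change _ ◁ (λ_ (𝟙_ C)).hom ≫ _ = _
    monoidal
  middle_assoc := by
    simp

end Basic

section Canonical
set_option linter.unusedSectionVars false
variable [BraidedCategory C]

theorem mul_push {R Y : C} [MonObj R] (g : Y ⟶ R) :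
    μ[R] ▷ Y ≫ R ◁ g ≫ μ[R] = (α_ _ _ _).hom ≫ R ◁ (R ◁ g ≫ μ[R]) ≫ μ[R] := by
  rw [← whisker_exchange_assoc, MonObj.mul_assoc]
  simp

theorem mul_push_three {R Y : C} [MonObj R] (g : Y ⟶ R) :
    ((μ[R] ▷ R ≫ μ[R]) ⊗ₘ g) ≫ μ[R] =
      𝟙 _ ⊗≫ R ◁ (R ◁ (R ◁ g ≫ μ[R]) ≫ μ[R]) ≫ μ[R] := by
  rw [MonoidalCategory.tensorHom_def, comp_whiskerRight, Category.assoc, Category.assoc,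
    mul_push, associator_naturality_left_assoc, mul_push]
  monoidal

theorem mul_push_four {R Y : C} [MonObj R] (g : Y ⟶ R) :
    ((R ◁ (R ◁ μ[R] ≫ μ[R]) ≫ μ[R]) ⊗ₘ g) ≫ μ[R] =
      𝟙 _ ⊗≫ R ◁ (R ◁ (R ◁ (R ◁ g ≫ μ[R]) ≫ μ[R]) ≫ μ[R]) ≫ μ[R] := by
  rw [MonoidalCategory.tensorHom_def, comp_whiskerRight, Category.assoc, Category.assoc,
    mul_push, associator_naturality_middle_assoc, ← MonoidalCategory.whiskerLeft_comp_assoc,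
    comp_whiskerRight, Category.assoc, mul_push, associator_naturality_middle_assoc,
    ← MonoidalCategory.whiskerLeft_comp_assoc, mul_push]
  monoidal

/-- Multiplication of four factors. -/
def mulFour (R : C) [MonObj R] : R ⊗ R ⊗ R ⊗ R ⟶ R := R ◁ (R ◁ μ[R] ≫ μ[R]) ≫ μ[R]

/-- Multiplication of seven factors. -/
def mulSeven (R : C) [MonObj R] : R ⊗ R ⊗ R ⊗ R ⊗ R ⊗ R ⊗ R ⟶ R :=
  R ◁ (R ◁ (R ◁ mulFour R ≫ μ[R]) ≫ μ[R]) ≫ μ[R]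

theorem snakeOne_left {R : C} [MonObj R] :
    (μ[R] ▷ R ⊗ₘ ((α_ R R R).inv ≫ ((β_ R R).hom ≫ μ[R]) ▷ R ≫ μ[R]) ▷ R) ≫
        (μ[R] ⊗ₘ μ[R]) ≫ μ[R] =
      𝟙 _ ⊗≫ R ◁ R ◁ R ◁ ((β_ R R).hom ▷ (R ⊗ R)) ⊗≫ mulSeven R := by
  have h : ((α_ R R R).inv ≫ ((β_ R R).hom ≫ μ[R]) ▷ R ≫ μ[R]) ▷ R ≫ μ[R] =
      𝟙 _ ⊗≫ (β_ R R).hom ▷ (R ⊗ R) ⊗≫ mulFour R := by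
    have e : μ[R] ▷ R ▷ R ≫ μ[R] ▷ R ≫ μ[R] =
        𝟙 _ ⊗≫ mulFour R := by
      rw [MonObj.mul_assoc, associator_naturality_left_assoc, mul_push, mulFour]
      monoidal
    calc
      _ = 𝟙 _ ⊗≫ (β_ R R).hom ▷ R ▷ R ≫ μ[R] ▷ R ▷ R ≫ μ[R] ▷ R ≫ μ[R] := by monoidal
      _ = _ := by rw [e]; monoidal
  rw [tensorHom_comp_tensorHom_assoc, h, mul_push_three, mulSeven]
  monoidal

theorem snakeOne_right {R : C} [MonObj R] :
    (R ◁ ((α_ R R R).hom ≫ R ◁ ((β_ R R).hom ≫ μ[R]) ≫ μ[R]) ⊗ₘ R ◁ μ[R]) ≫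
        (μ[R] ⊗ₘ μ[R]) ≫ μ[R] =
      𝟙 _ ⊗≫ R ◁ R ◁ ((β_ R R).hom ▷ (R ⊗ R ⊗ R)) ⊗≫ mulSeven R := by
  have h : (R ◁ ((α_ R R R).hom ≫ R ◁ ((β_ R R).hom ≫ μ[R]) ≫ μ[R]) ≫ μ[R]) =
      (R ◁ ((α_ R R R).hom ≫ R ◁ ((β_ R R).hom))) ≫ R ◁ (R ◁ μ[R] ≫ μ[R]) ≫ μ[R] := by
    monoidal
  rw [tensorHom_comp_tensorHom_assoc, h]
  have h2 := mul_push_four (R ◁ μ[R] ≫ μ[R])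
  have h3 : ((R ◁ ((α_ R R R).hom ≫ R ◁ ((β_ R R).hom))) ≫ R ◁ (R ◁ μ[R] ≫ μ[R]) ≫ μ[R] ⊗ₘ
      R ◁ μ[R] ≫ μ[R]) = (R ◁ ((α_ R R R).hom ≫ R ◁ ((β_ R R).hom))) ▷ _ ≫
      ((R ◁ (R ◁ μ[R] ≫ μ[R]) ≫ μ[R]) ⊗ₘ (R ◁ μ[R] ≫ μ[R])) := by
    rw [← tensorHom_id, tensorHom_comp_tensorHom, Category.id_comp]
  rw [h3, Category.assoc, h2, mulSeven, mulFour]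
  monoidal

theorem snakeOne_aux {R : C} [MonObj R] :
    (tensorμ R R R (R ⊗ R) ≫ (μ[R] ⊗ₘ ((α_ R R R).inv ≫ ((β_ R R).hom ≫ μ[R]) ▷ R ≫ μ[R]))) ▷
        (R ⊗ R) ≫ tensorμ R R R R ≫ (μ[R] ⊗ₘ μ[R]) ≫ μ[R] =
      (α_ _ _ _).hom ≫ (R ⊗ R) ◁ ((α_ R R R).inv ▷ (R ⊗ R) ≫ tensorμ (R ⊗ R) R R R ≫
        (((α_ R R R).hom ≫ R ◁ ((β_ R R).hom ≫ μ[R]) ≫ μ[R]) ⊗ₘ μ[R])) ≫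
        tensorμ R R R R ≫ (μ[R] ⊗ₘ μ[R]) ≫ μ[R] := by
  rw [comp_whiskerRight, Category.assoc, tensorμ_natural_left_assoc,
    MonoidalCategory.whiskerLeft_comp, Category.assoc, MonoidalCategory.whiskerLeft_comp,
    Category.assoc, tensorμ_natural_right_assoc, snakeOne_left, snakeOne_right]
  have e := BraidedCategory.braiding_naturality_right R ((α_ R R R).hom ≫ R ◁ (β_ R R).hom)
  symm
  calc
    _ = 𝟙 _ ⊗≫ R ◁ R ◁ R ◁ R ◁ (β_ R R).hom ▷ R ⊗≫ R ◁ ((β_ R ((R ⊗ R) ⊗ R)).hom ≫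
        ((α_ R R R).hom ≫ R ◁ (β_ R R).hom) ▷ R) ▷ (R ⊗ R) ⊗≫ mulSeven R := by
      simp only [tensorμ]
      monoidal
    _ = 𝟙 _ ⊗≫ R ◁ R ◁ R ◁ R ◁ (β_ R R).hom ▷ R ⊗≫ R ◁ R ◁ R ◁ (β_ R R).hom ▷ R ▷ R ⊗≫
        R ◁ (β_ R R).hom ▷ (R ⊗ R) ▷ (R ⊗ R) ⊗≫ R ◁ R ◁ (β_ R R).hom ▷ R ▷ (R ⊗ R) ⊗≫
        R ◁ R ◁ R ◁ (β_ R R).hom ▷ (R ⊗ R) ⊗≫ mulSeven R := by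
      rw [← e]
      simp only [BraidedCategory.braiding_tensor_right_hom]
      monoidal
    _ = 𝟙 _ ⊗≫ R ◁ (((R ⊗ R) ◁ (R ◁ (β_ R R).hom ⊗≫ (β_ R R).hom ▷ R)) ≫
        (β_ R R).hom ▷ ((R ⊗ R) ⊗ R)) ▷ R ⊗≫ R ◁ R ◁ (β_ R R).hom ▷ R ▷ (R ⊗ R) ⊗≫
        R ◁ R ◁ R ◁ (β_ R R).hom ▷ (R ⊗ R) ⊗≫ mulSeven R := by
      monoidal
    _ = _ := by
      rw [whisker_exchange]
      simp only [tensorμ, BraidedCategory.braiding_tensor_left_hom]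
      monoidal

theorem snakeTwo_left {R : C} [MonObj R] :
    ((R ◁ ((α_ R R R).inv ≫ ((β_ R R).hom ≫ μ[R]) ▷ R ≫ μ[R]) ≫ μ[R]) ⊗ₘ
        (R ◁ ((β_ R R).hom ≫ μ[R]) ≫ μ[R])) ≫ μ[R] =
      𝟙 _ ⊗≫ R ◁ (β_ R R).hom ▷ (R ⊗ R ⊗ R ⊗ R) ⊗≫ R ◁ R ◁ R ◁ R ◁ R ◁ (β_ R R).hom ⊗≫
        mulSeven R := by
  have h : R ◁ ((α_ R R R).inv ≫ ((β_ R R).hom ≫ μ[R]) ▷ R ≫ μ[R]) ≫ μ[R] =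
      (R ◁ ((α_ R R R).inv ≫ (β_ R R).hom ▷ R ≫ (α_ R R R).hom)) ≫ R ◁ (R ◁ μ[R] ≫ μ[R]) ≫
        μ[R] := by
    have := MonObj.mul_assoc R
    rw [comp_whiskerRight, Category.assoc, this]
    monoidal
  have h' : R ◁ ((β_ R R).hom ≫ μ[R]) ≫ μ[R] = R ◁ (β_ R R).hom ≫ R ◁ μ[R] ≫ μ[R] := by
    simp
  rw [h, h', ← tensorHom_comp_tensorHom, Category.assoc, mul_push_four, mulSeven, mulFour,
    MonoidalCategory.tensorHom_def]
  monoidal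

theorem snakeTwo_right {R : C} [MonObj R] :
    (((β_ R R).hom ≫ μ[R]) ▷ R ⊗ₘ ((α_ R R R).hom ≫ R ◁ ((β_ R R).hom ≫ μ[R]) ≫ μ[R]) ▷ R) ≫
        (μ[R] ⊗ₘ μ[R]) ≫ μ[R] =
      𝟙 _ ⊗≫ (β_ R R).hom ▷ (R ⊗ R ⊗ R ⊗ R ⊗ R) ⊗≫ R ◁ R ◁ R ◁ R ◁ (β_ R R).hom ▷ R ⊗≫
        mulSeven R := by
  have h : ((α_ R R R).hom ≫ R ◁ ((β_ R R).hom ≫ μ[R]) ≫ μ[R]) ▷ R ≫ μ[R] =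
      𝟙 _ ⊗≫ R ◁ (β_ R R).hom ▷ R ⊗≫ mulFour R := by
    have e : (R ◁ μ[R]) ▷ R ≫ μ[R] ▷ R ≫ μ[R] = 𝟙 _ ⊗≫ mulFour R := by
      rw [MonObj.mul_assoc, associator_naturality_middle_assoc,
        ← MonoidalCategory.whiskerLeft_comp_assoc, MonObj.mul_assoc, mulFour]
      monoidal
    calc
      _ = 𝟙 _ ⊗≫ R ◁ (β_ R R).hom ▷ R ⊗≫ (R ◁ μ[R]) ▷ R ≫ μ[R] ▷ R ≫ μ[R] := by monoidal
      _ = _ := by rw [e]; monoidal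
  have h' : ((β_ R R).hom ≫ μ[R]) ▷ R ≫ μ[R] = (β_ R R).hom ▷ R ≫ μ[R] ▷ R ≫ μ[R] := by
    simp
  have h'' : ∀ {Y : C} (g : Y ⟶ R), ((β_ R R).hom ▷ R ≫ μ[R] ▷ R ≫ μ[R] ⊗ₘ g) =
      (β_ R R).hom ▷ R ▷ Y ≫ ((μ[R] ▷ R ≫ μ[R]) ⊗ₘ g) := by
    intro Y g
    rw [← tensorHom_id _ Y, tensorHom_comp_tensorHom, Category.id_comp]
  rw [tensorHom_comp_tensorHom_assoc, h, h', h'', Category.assoc, mul_push_three, mulSeven]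
  monoidal

theorem snakeTwo_aux {R : C} [MonObj R] :
    (tensorμ R R (R ⊗ R) R ≫ (((α_ R R R).inv ≫ ((β_ R R).hom ≫ μ[R]) ▷ R ≫ μ[R]) ⊗ₘ
        ((β_ R R).hom ≫ μ[R]))) ▷ (R ⊗ R) ≫ tensorμ R R R R ≫
          (((β_ R R).hom ≫ μ[R]) ⊗ₘ ((β_ R R).hom ≫ μ[R])) ≫ μ[R] =
      (α_ _ _ _).hom ≫ (R ⊗ R) ◁ ((α_ R R R).hom ▷ (R ⊗ R) ≫ tensorμ R (R ⊗ R) R R ≫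
        (((β_ R R).hom ≫ μ[R]) ⊗ₘ ((α_ R R R).hom ≫ R ◁ ((β_ R R).hom ≫ μ[R]) ≫ μ[R]))) ≫
        tensorμ R R R R ≫ (((β_ R R).hom ≫ μ[R]) ⊗ₘ ((β_ R R).hom ≫ μ[R])) ≫ μ[R] := by
  rw [comp_whiskerRight, Category.assoc, tensorμ_natural_left_assoc,
    MonoidalCategory.whiskerLeft_comp, Category.assoc, MonoidalCategory.whiskerLeft_comp,
    Category.assoc, tensorμ_natural_right_assoc, tensorHom_comp_tensorHom_assoc,
    tensorHom_comp_tensorHom_assoc, BraidedCategory.braiding_naturality_left_assoc,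
    BraidedCategory.braiding_naturality_left_assoc,
    BraidedCategory.braiding_naturality_right_assoc,
    BraidedCategory.braiding_naturality_right_assoc, ← tensorHom_comp_tensorHom_assoc,
    snakeTwo_left, ← tensorHom_comp_tensorHom_assoc,
    ← tensorHom_comp_tensorHom_assoc, snakeTwo_right]
  trans 𝟙 _ ⊗≫ (β_ ((R ⊗ R) ⊗ ((R ⊗ R) ⊗ R)) R).hom ▷ R ⊗≫
    R ◁ R ◁ (β_ R R).hom ▷ (R ⊗ R ⊗ R) ⊗≫ R ◁ (β_ R R).hom ▷ (R ⊗ R ⊗ R ⊗ R) ⊗≫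
      R ◁ R ◁ R ◁ (R ◁ R ◁ (β_ R R).hom ≫ (β_ R (R ⊗ (R ⊗ R))).hom) ⊗≫ mulSeven R
  · have e := BraidedCategory.braiding_naturality_left (tensorμ R R (R ⊗ R) R) R
    calc
      _ = 𝟙 _ ⊗≫ (tensorμ R R (R ⊗ R) R ▷ R ≫ (β_ ((R ⊗ R ⊗ R) ⊗ R ⊗ R) R).hom) ▷ R ⊗≫
          R ◁ (R ⊗ R ⊗ R) ◁ (β_ (R ⊗ R) R).hom ⊗≫ R ◁ (β_ R R).hom ▷ (R ⊗ R ⊗ R ⊗ R) ⊗≫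
            R ◁ R ◁ R ◁ R ◁ R ◁ (β_ R R).hom ⊗≫ mulSeven R := by
        rw [MonoidalCategory.tensorHom_def,
          BraidedCategory.braiding_tensor_left_hom (R ⊗ R ⊗ R) (R ⊗ R) R]
        simp only [tensorμ]
        monoidal
      _ = 𝟙 _ ⊗≫ (β_ ((R ⊗ R) ⊗ ((R ⊗ R) ⊗ R)) R).hom ▷ R ⊗≫ R ◁ R ◁ (β_ R R).hom ▷ (R ⊗ R ⊗ R) ⊗≫
          R ◁ (R ⊗ R) ◁ (((β_ R R).hom ▷ (R ⊗ R)) ≫ (R ⊗ R) ◁ (β_ R R).hom) ⊗≫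
           R ◁ R ◁ R ◁ R ◁ (β_ R R).hom ▷ R ⊗≫ R ◁ (β_ R R).hom ▷ (R ⊗ R ⊗ R ⊗ R) ⊗≫
            R ◁ R ◁ R ◁ R ◁ R ◁ (β_ R R).hom ⊗≫ mulSeven R := by
        rw [e]
        simp only [tensorμ, BraidedCategory.braiding_tensor_left_hom R R R,
          BraidedCategory.braiding_tensor_right_hom]
        monoidal
      _ = 𝟙 _ ⊗≫ (β_ ((R ⊗ R) ⊗ ((R ⊗ R) ⊗ R)) R).hom ▷ R ⊗≫ R ◁ R ◁ (β_ R R).hom ▷ (R ⊗ R ⊗ R) ⊗≫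
          R ◁ ((R ⊗ R) ◁ ((R ⊗ R) ◁ (β_ R R).hom ⊗≫ (β_ R R).hom ▷ (R ⊗ R) ⊗≫
            R ◁ (β_ R R).hom ▷ R) ≫ (β_ R R).hom ▷ (R ⊗ (R ⊗ R) ⊗ R)) ⊗≫
            R ◁ R ◁ R ◁ R ◁ R ◁ (β_ R R).hom ⊗≫ mulSeven R := by
        rw [← whisker_exchange]
        monoidal
      _ = _ := by
        rw [whisker_exchange]
        simp only [BraidedCategory.braiding_tensor_right_hom]
        monoidal
  · symm
    have e := BraidedCategory.braiding_naturality_right (R ⊗ R) (β_ R R).hom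
    have e' := BraidedCategory.braiding_naturality_right R ((α_ R R R).hom ≫ R ◁ (β_ R R).hom)
    calc
      _ = 𝟙 _ ⊗≫ R ◁ R ◁ R ◁ (β_ (R ⊗ R) R).hom ▷ R ⊗≫
          ((β_ (R ⊗ R) (R ⊗ R)).hom ≫ (β_ R R).hom ▷ (R ⊗ R)) ▷ (R ⊗ R ⊗ R) ⊗≫
          R ◁ R ◁ R ◁ ((β_ R ((R ⊗ R) ⊗ R)).hom ≫ ((α_ R R R).hom ≫ R ◁ (β_ R R).hom) ▷ R) ⊗≫
            mulSeven R := by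
        trans 𝟙 _ ⊗≫ R ◁ R ◁ R ◁ (β_ (R ⊗ R) R).hom ▷ R ⊗≫
          (β_ (R ⊗ R) (R ⊗ R)).hom ▷ (R ⊗ R ⊗ R) ⊗≫
            ((R ⊗ R) ◁ (R ◁ (β_ R ((R ⊗ R) ⊗ R)).hom) ≫ (β_ R R).hom ▷ (R ⊗ ((R ⊗ R) ⊗ R) ⊗ R)) ⊗≫
              R ◁ R ◁ R ◁ R ◁ (β_ R R).hom ▷ R ⊗≫ mulSeven R
        · rw [MonoidalCategory.tensorHom_def, BraidedCategory.braiding_tensor_left_hom R R (R ⊗ R)]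
          simp only [tensorμ]
          monoidal
        · rw [whisker_exchange]
          monoidal
      _ = 𝟙 _ ⊗≫ R ◁ R ◁ R ◁ (β_ (R ⊗ R) R).hom ▷ R ⊗≫
          ((R ⊗ R) ◁ (β_ R R).hom ≫ (β_ (R ⊗ R) (R ⊗ R)).hom) ▷ (R ⊗ R ⊗ R) ⊗≫
          R ◁ R ◁ R ◁ (R ◁ ((α_ R R R).hom ≫ R ◁ (β_ R R).hom) ≫ (β_ R (R ⊗ (R ⊗ R))).hom) ⊗≫
            mulSeven R := by
        rw [e, e']
      _ = _ := by
        simp only [BraidedCategory.braiding_tensor_left_hom,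
          BraidedCategory.braiding_tensor_right_hom]
        monoidal

end Canonical

section Env
set_option linter.unusedSectionVars false
variable [BraidedCategory C]

theorem unit_act_left {A P P' Q : C} (a : A ⊗ P ⟶ P') :
    (ρ_ A).inv ▷ (P ⊗ Q) ≫ tensorμ A (𝟙_ C) P Q ≫ (a ⊗ₘ (λ_ Q).hom) =
      (α_ _ _ _).inv ≫ a ▷ Q := by
  simp only [tensorμ, braiding_tensorUnit_left, MonoidalCategory.tensorHom_def']
  monoidal

theorem unit_act_right {A P Q Q' : C} (a : A ⊗ Q ⟶ Q') :
    (λ_ A).inv ▷ (P ⊗ Q) ≫ tensorμ (𝟙_ C) A P Q ≫ ((λ_ P).hom ⊗ₘ a) =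
      (α_ _ _ _).inv ≫ (β_ A P).hom ▷ Q ≫ (α_ _ _ _).hom ≫ P ◁ a := by
  simp only [tensorμ, MonoidalCategory.tensorHom_def]
  monoidal

theorem right_unit_act {B P Q : C} (b : Q ⊗ B ⟶ Q) :
    tensorμ P Q (𝟙_ C) B ≫ ((ρ_ P).hom ⊗ₘ b) =
      (P ⊗ Q) ◁ (λ_ B).hom ≫ (α_ _ _ _).hom ≫ P ◁ b := by
  simp only [tensorμ, braiding_tensorUnit_right, MonoidalCategory.tensorHom_def]
  monoidal

theorem left_unit_act {B P Q : C} (b : P ⊗ B ⟶ P) :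
    tensorμ P Q B (𝟙_ C) ≫ (b ⊗ₘ (ρ_ Q).hom) =
      (P ⊗ Q) ◁ (ρ_ B).hom ≫ (α_ _ _ _).hom ≫ P ◁ (β_ Q B).hom ≫ (α_ _ _ _).inv ≫ b ▷ Q := by
  simp only [tensorμ, MonoidalCategory.tensorHom_def']
  monoidal

theorem snakeOne_equivLeft {R : C} [MonObj R] :
    (α_ R (R ⊗ R) (R ⊗ R)).inv ≫ ((α_ R R R).inv ≫ μ[R] ▷ R) ▷ (R ⊗ R) ≫
      tensorμ R R R R ≫ (μ[R] ⊗ₘ μ[R]) ≫ μ[R] =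
    R ◁ (tensorμ R R R R ≫ (μ[R] ⊗ₘ μ[R]) ≫ μ[R]) ≫ μ[R] := by
  have e : μ[R] ▷ R ▷ (R ⊗ R) ≫ tensorμ R R R R =
      tensorμ (R ⊗ R) R R R ≫ (μ[R] ▷ R ⊗ₘ 𝟙 (R ⊗ R)) := by
    have := tensorμ_natural_left μ[R] (𝟙 R) R R
    simpa using this
  rw [comp_whiskerRight, Category.assoc, reassoc_of% e,
    tensorHom_comp_tensorHom_assoc, Category.id_comp, mul_push_three]
  have h : R ◁ ((μ[R] ⊗ₘ μ[R]) ≫ μ[R]) = 𝟙 _ ⊗≫ R ◁ R ◁ (R ◁ μ[R] ≫ μ[R]) ⊗≫ R ◁ μ[R] := by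
    rw [MonoidalCategory.tensorHom_def, Category.assoc, mul_push]; monoidal
  rw [MonoidalCategory.whiskerLeft_comp R (tensorμ R R R R), Category.assoc, h]
  simp only [tensorμ]
  monoidal

theorem mul_push_two {R : C} [MonObj R] : (μ[R] ⊗ₘ (R ◁ μ[R] ≫ μ[R])) ≫ μ[R] =
    𝟙 _ ⊗≫ (μ[R] ⊗ₘ μ[R]) ▷ R ⊗≫ μ[R] ▷ R ≫ μ[R] := by
  have h : R ◁ μ[R] ≫ μ[R] = (α_ _ _ _).inv ≫ μ[R] ▷ R ≫ μ[R] := by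
    rw [MonObj.mul_assoc]; simp
  calc
    _ = 𝟙 _ ⊗≫ μ[R] ▷ (R ⊗ R ⊗ R) ⊗≫ R ◁ (R ◁ μ[R] ≫ μ[R]) ≫ μ[R] := by
      rw [MonoidalCategory.tensorHom_def]; monoidal
    _ = 𝟙 _ ⊗≫ μ[R] ▷ (R ⊗ R ⊗ R) ⊗≫ R ◁ (μ[R] ▷ R) ⊗≫ (R ◁ μ[R] ≫ μ[R]) := by
      conv_lhs => rw [h]
      monoidal
    _ = _ := by
      rw [h, MonoidalCategory.tensorHom_def]; monoidal

theorem snakeOne_equivRight {R : C} [MonObj R] :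
    (α_ (R ⊗ R) (R ⊗ R) (𝟙_ C ⊗ R)).hom ≫ (R ⊗ R) ◁ ((R ⊗ R) ◁ (λ_ R).hom ≫ (α_ R R R).hom ≫
        R ◁ μ[R]) ≫ tensorμ R R R R ≫ (μ[R] ⊗ₘ μ[R]) ≫ μ[R] =
    ((tensorμ R R R R ≫ (μ[R] ⊗ₘ μ[R]) ≫ μ[R]) ⊗ₘ (λ_ R).hom) ≫ μ[R] := by
  have e : (R ⊗ R) ◁ R ◁ μ[R] ≫ tensorμ R R R R =
      tensorμ R R R (R ⊗ R) ≫ (𝟙 (R ⊗ R) ⊗ₘ R ◁ μ[R]) := by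
    have := tensorμ_natural_right R R (𝟙 R) μ[R]
    simpa using this
  rw [MonoidalCategory.whiskerLeft_comp, MonoidalCategory.whiskerLeft_comp, Category.assoc,
    Category.assoc, reassoc_of% e, tensorHom_comp_tensorHom_assoc, Category.id_comp, mul_push_two,
    MonoidalCategory.tensorHom_def']
  simp only [tensorμ]
  monoidal

theorem snakeTwo_equivLeft {R : C} [MonObj R] :
    (α_ R (R ⊗ R) (R ⊗ R)).inv ≫ ((α_ R R R).inv ≫ (β_ R R).hom ▷ R ≫ (α_ R R R).hom ≫
        R ◁ ((β_ R R).hom ≫ μ[R])) ▷ (R ⊗ R) ≫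
      tensorμ R R R R ≫ (((β_ R R).hom ≫ μ[R]) ⊗ₘ ((β_ R R).hom ≫ μ[R])) ≫ μ[R] =
    R ◁ (tensorμ R R R R ≫ (((β_ R R).hom ≫ μ[R]) ⊗ₘ ((β_ R R).hom ≫ μ[R])) ≫ μ[R]) ≫
      (β_ R R).hom ≫ μ[R] := by
  have e : (R ◁ μ[R]) ▷ (R ⊗ R) ≫ tensorμ R R R R =
      tensorμ R (R ⊗ R) R R ≫ (𝟙 (R ⊗ R) ⊗ₘ μ[R] ▷ R) := by
    have := tensorμ_natural_left (𝟙 R) μ[R] R R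
    simpa using this
  have l : (α_ R (R ⊗ R) (R ⊗ R)).inv ≫ ((α_ R R R).inv ≫ (β_ R R).hom ▷ R ≫ (α_ R R R).hom ≫
        R ◁ ((β_ R R).hom ≫ μ[R])) ▷ (R ⊗ R) ≫
      tensorμ R R R R ≫ (((β_ R R).hom ≫ μ[R]) ⊗ₘ ((β_ R R).hom ≫ μ[R])) ≫ μ[R] =
      (α_ R (R ⊗ R) (R ⊗ R)).inv ≫ ((α_ R R R).inv ≫ (β_ R R).hom ▷ R ≫ (α_ R R R).hom ≫
        R ◁ (β_ R R).hom) ▷ (R ⊗ R) ≫ tensorμ R (R ⊗ R) R R ≫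
          ((β_ R R).hom ⊗ₘ (β_ (R ⊗ R) R).hom) ≫ (μ[R] ⊗ₘ (R ◁ μ[R] ≫ μ[R])) ≫ μ[R] := by
    simp only [MonoidalCategory.whiskerLeft_comp, comp_whiskerRight, Category.assoc]
    rw [reassoc_of% e, tensorHom_comp_tensorHom_assoc, Category.id_comp,
      BraidedCategory.braiding_naturality_left_assoc, tensorHom_comp_tensorHom_assoc]
  have r : R ◁ (tensorμ R R R R ≫ (((β_ R R).hom ≫ μ[R]) ⊗ₘ ((β_ R R).hom ≫ μ[R])) ≫ μ[R]) ≫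
      (β_ R R).hom ≫ μ[R] = (β_ R ((R ⊗ R) ⊗ (R ⊗ R))).hom ≫ (tensorμ R R R R ≫
        ((β_ R R).hom ⊗ₘ (β_ R R).hom)) ▷ R ⊗≫ (μ[R] ⊗ₘ (R ◁ μ[R] ≫ μ[R])) ≫ μ[R] := by
    rw [BraidedCategory.braiding_naturality_right_assoc, mul_push_two,
      ← tensorHom_comp_tensorHom_assoc]
    monoidal
  rw [l, r]
  generalize (μ[R] ⊗ₘ (R ◁ μ[R] ≫ μ[R])) ≫ μ[R] = m
  symm
  calc
    _ = 𝟙 _ ⊗≫ (β_ R R).hom ▷ (R ⊗ R ⊗ R) ⊗≫ R ◁ (β_ R R).hom ▷ (R ⊗ R) ⊗≫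
          R ◁ R ◁ (β_ R R).hom ▷ R ⊗≫
          (((R ⊗ R ⊗ R) ◁ (β_ R R).hom ≫ (R ◁ (β_ R R).hom) ▷ (R ⊗ R)) ⊗≫
            (β_ R R).hom ▷ (R ⊗ R ⊗ R)) ⊗≫ R ◁ R ◁ (β_ R R).hom ▷ R ⊗≫ m := by
      rw [MonoidalCategory.tensorHom_def]
      simp only [tensorμ, BraidedCategory.braiding_tensor_right_hom]
      monoidal
    _ = 𝟙 _ ⊗≫ (β_ R R).hom ▷ (R ⊗ R ⊗ R) ⊗≫ R ◁ (β_ R R).hom ▷ (R ⊗ R) ⊗≫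
          R ◁ R ◁ (β_ R R).hom ▷ R ⊗≫ R ◁ (β_ R R).hom ▷ (R ⊗ R) ⊗≫
          ((R ⊗ R) ◁ (R ◁ (β_ R R).hom) ≫ (β_ R R).hom ▷ (R ⊗ R ⊗ R)) ⊗≫
            R ◁ R ◁ (β_ R R).hom ▷ R ⊗≫ m := by
      rw [whisker_exchange]
      monoidal
    _ = _ := by
      rw [whisker_exchange, MonoidalCategory.tensorHom_def]
      simp only [tensorμ, BraidedCategory.braiding_tensor_left_hom]
      monoidal

theorem snakeTwo_equivRight {R : C} [MonObj R] :
    (α_ (R ⊗ R) (R ⊗ R) (R ⊗ 𝟙_ C)).hom ≫ (R ⊗ R) ◁ ((R ⊗ R) ◁ (ρ_ R).hom ≫ (α_ R R R).hom ≫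
        R ◁ (β_ R R).hom ≫ (α_ R R R).inv ≫ ((β_ R R).hom ≫ μ[R]) ▷ R) ≫
      tensorμ R R R R ≫ (((β_ R R).hom ≫ μ[R]) ⊗ₘ ((β_ R R).hom ≫ μ[R])) ≫ μ[R] =
    ((tensorμ R R R R ≫ (((β_ R R).hom ≫ μ[R]) ⊗ₘ ((β_ R R).hom ≫ μ[R])) ≫ μ[R]) ⊗ₘ
      (ρ_ R).hom) ≫ (β_ R R).hom ≫ μ[R] := by
  have e : (R ⊗ R) ◁ μ[R] ▷ R ≫ tensorμ R R R R =
      tensorμ R R (R ⊗ R) R ≫ (R ◁ μ[R] ⊗ₘ 𝟙 (R ⊗ R)) := by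
    have := tensorμ_natural_right R R μ[R] (𝟙 R)
    simpa using this
  have l : (α_ (R ⊗ R) (R ⊗ R) (R ⊗ 𝟙_ C)).hom ≫ (R ⊗ R) ◁ ((R ⊗ R) ◁ (ρ_ R).hom ≫ (α_ R R R).hom ≫
        R ◁ (β_ R R).hom ≫ (α_ R R R).inv ≫ ((β_ R R).hom ≫ μ[R]) ▷ R) ≫
      tensorμ R R R R ≫ (((β_ R R).hom ≫ μ[R]) ⊗ₘ ((β_ R R).hom ≫ μ[R])) ≫ μ[R] =
      (α_ (R ⊗ R) (R ⊗ R) (R ⊗ 𝟙_ C)).hom ≫ (R ⊗ R) ◁ ((R ⊗ R) ◁ (ρ_ R).hom ≫ (α_ R R R).hom ≫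
        R ◁ (β_ R R).hom ≫ (α_ R R R).inv ≫ (β_ R R).hom ▷ R) ≫ tensorμ R R (R ⊗ R) R ≫
          ((β_ R (R ⊗ R)).hom ⊗ₘ (β_ R R).hom) ≫ ((μ[R] ▷ R ≫ μ[R]) ⊗ₘ μ[R]) ≫ μ[R] := by
    simp only [MonoidalCategory.whiskerLeft_comp, comp_whiskerRight, Category.assoc]
    rw [reassoc_of% e, tensorHom_comp_tensorHom_assoc, Category.id_comp,
      BraidedCategory.braiding_naturality_right_assoc, tensorHom_comp_tensorHom_assoc]
  have h : ((μ[R] ▷ R ≫ μ[R]) ⊗ₘ μ[R]) ≫ μ[R] =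
      𝟙 _ ⊗≫ R ◁ ((μ[R] ⊗ₘ μ[R]) ≫ μ[R]) ≫ μ[R] := by
    rw [mul_push_three, MonoidalCategory.tensorHom_def, Category.assoc, mul_push]
    monoidal
  have r : ((tensorμ R R R R ≫ (((β_ R R).hom ≫ μ[R]) ⊗ₘ ((β_ R R).hom ≫ μ[R])) ≫ μ[R]) ⊗ₘ
      (ρ_ R).hom) ≫ (β_ R R).hom ≫ μ[R] = _ ◁ (ρ_ R).hom ≫ (β_ ((R ⊗ R) ⊗ (R ⊗ R)) R).hom ≫
        R ◁ (tensorμ R R R R ≫ ((β_ R R).hom ⊗ₘ (β_ R R).hom)) ⊗≫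
          ((μ[R] ▷ R ≫ μ[R]) ⊗ₘ μ[R]) ≫ μ[R] := by
    rw [MonoidalCategory.tensorHom_def', Category.assoc,
      BraidedCategory.braiding_naturality_left_assoc, h, ← tensorHom_comp_tensorHom_assoc]
    monoidal
  rw [l, r]
  generalize ((μ[R] ▷ R ≫ μ[R]) ⊗ₘ μ[R]) ≫ μ[R] = m
  symm
  calc
    _ = _ ◁ (ρ_ R).hom ⊗≫ R ◁ R ◁ R ◁ (β_ R R).hom ⊗≫ R ◁ R ◁ (β_ R R).hom ▷ R ⊗≫
          R ◁ (β_ R R).hom ▷ (R ⊗ R) ⊗≫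
          ((β_ R R).hom ▷ (R ⊗ R) ≫ (R ⊗ R) ◁ (β_ R R).hom) ▷ R ⊗≫
          R ◁ (β_ R R).hom ▷ (R ⊗ R) ⊗≫ R ◁ R ◁ R ◁ (β_ R R).hom ⊗≫ m := by
      rw [MonoidalCategory.tensorHom_def]
      simp only [tensorμ, BraidedCategory.braiding_tensor_left_hom]
      monoidal
    _ = _ := by
      rw [← whisker_exchange, MonoidalCategory.tensorHom_def]
      simp only [tensorμ, BraidedCategory.braiding_tensor_right_hom]
      monoidal

/-- The enveloping monoid `R ⊗ Rᵒᵖ`. -/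
abbrev env (R : Mon C) : Mon C := R ⊗ op R

/-- `R` with right action of `Rᵒᵖ ⊗ R`: `y (a' ⊗ b) = a' y b`. -/
abbrev coev (R : Mon C) : Bimod (𝟙_ (Mon C)) (op R ⊗ R) := turnRight (reg R)

/-- `R` with left action of `R ⊗ Rᵒᵖ`: `(r ⊗ r') x = r x r'`. -/
abbrev envJ (R : Mon C) : Bimod (env R) (𝟙_ (Mon C)) := turnLeft (reg R)

/-- `R ⊠ coev R`, with left action of `R` alone. -/
abbrev envL (R : Mon C) : Bimod R (R ⊗ (op R ⊗ R)) :=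
  res (ρ_ R).inv (𝟙 _) (box (reg R) (coev R))

/-- `coev R ⊠ Rᵒᵖ`, with left action of `Rᵒᵖ` alone. -/
abbrev envR (R : Mon C) : Bimod (op R) ((op R ⊗ R) ⊗ op R) :=
  res (λ_ (op R)).inv (𝟙 _) (box (coev R) (reg (op R)))

/-- Regrouping of the four factors of `(R ⊗ Rᵒᵖ) ⊗ (R ⊗ Rᵒᵖ)`. -/
def envPsi (R : Mon C) : env R ⊗ env R ⟶ (R ⊗ (op R ⊗ R)) ⊗ op R :=
  (α_ (R ⊗ op R) R (op R)).inv ≫ (α_ R (op R) R).hom ▷ op R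

/-- The multiplication 1-cell of the canonical pseudo-monoid: `R ⊗ R ⊗ R` with
`(r ⊗ r') (x ⊗ y ⊗ z) (a ⊗ a' ⊗ b ⊗ b') = r x a ⊗ a' y b ⊗ b' z r'`. -/
abbrev envM (R : Mon C) : Bimod (env R) (env R ⊗ env R) :=
  res (𝟙 _) (envPsi R) (box (envL R) (reg (op R)))

variable [HasCoequalizers C]
variable [∀ X : C, PreservesColimitsOfShape WalkingParallelPair (tensorLeft X)]
variable [∀ X : C, PreservesColimitsOfShape WalkingParallelPair (tensorRight X)]

/-- Descent of a bimodule morphism to a module tensor product. -/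
noncomputable def Cell.desc {A B D A' D' : Mon C} {φ : A ⟶ A'} {ψ : D ⟶ D'}
    (P : Bimod A B) (N : Bimod B D) {Q : Bimod A' D'} (h : P.X ⊗ N.X ⟶ Q.X)
    (w : P.actRight ▷ N.X ≫ h = (α_ _ _ _).hom ≫ P.X ◁ N.actLeft ≫ h)
    (hl : (α_ _ _ _).inv ≫ P.actLeft ▷ N.X ≫ h = (φ.hom ⊗ₘ h) ≫ Q.actLeft)
    (hr : (α_ _ _ _).hom ≫ P.X ◁ N.actRight ≫ h = (h ⊗ₘ ψ.hom) ≫ Q.actRight) :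
    Cell φ ψ (tens P N) Q where
  hom := tensDesc P N h w
  left := by
    rw [← cancel_epi (A.X ◁ proj P N), proj_actLeft_assoc, proj_tensDesc, hl,
      ← id_tensorHom, tensorHom_comp_tensorHom_assoc, proj_tensDesc, Category.id_comp]
  right := by
    rw [← cancel_epi (proj P N ▷ D.X), proj_actRight_assoc, proj_tensDesc, hr,
      ← tensorHom_id, tensorHom_comp_tensorHom_assoc, proj_tensDesc, Category.id_comp]

variable (R : Mon C)

theorem snakeOne_w : (envL R).actRight ▷ (res (α_ R (op R) R).inv (𝟙 _) (box (envJ R) (reg R))).X ≫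
      tensorμ R.X R.X R.X R.X ≫ (μ[R.X] ⊗ₘ μ[R.X]) ≫ μ[R.X] =
    (α_ _ _ _).hom ≫ (envL R).X ◁
      (res (α_ R (op R) R).inv (𝟙 _) (box (envJ R) (reg R))).actLeft ≫
        tensorμ R.X R.X R.X R.X ≫ (μ[R.X] ⊗ₘ μ[R.X]) ≫ μ[R.X] := by
  have h := snakeOne_aux (R := R.X)
  have e : (envL R).actRight = tensorμ R.X R.X R.X (R.X ⊗ R.X) ≫
      (μ[R.X] ⊗ₘ ((α_ R.X R.X R.X).inv ≫ ((β_ R.X R.X).hom ≫ μ[R.X]) ▷ R.X ≫ μ[R.X])) := by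
    change _ ◁ 𝟙 _ ≫ _ = _
    rw [MonoidalCategory.whiskerLeft_id, Category.id_comp]
    rfl
  rw [e]
  exact h

/-- The 2-cell `(x ⊗ y) ⊗ (q ⊗ b) ↦ x q y b`. -/
noncomputable def snakeOne : Cell (𝟙 R) (λ_ R).hom
    (tens (envL R) (res (α_ R (op R) R).inv (𝟙 _) (box (envJ R) (reg R)))) (reg R) :=
  Cell.desc _ _ (tensorμ R.X R.X R.X R.X ≫ (μ[R.X] ⊗ₘ μ[R.X]) ≫ μ[R.X]) (snakeOne_w R)
    (by
      have e : (envL R).actLeft = (α_ _ _ _).inv ≫ μ[R.X] ▷ R.X := unit_act_left _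
      rw [e, Mon.id_hom', id_tensorHom]
      exact snakeOne_equivLeft)
    (by
      have e : (res (α_ R (op R) R).inv (𝟙 _) (box (envJ R) (reg R))).actRight =
          (R.X ⊗ R.X) ◁ (λ_ R.X).hom ≫ (α_ _ _ _).hom ≫ R.X ◁ μ[R.X] := by
        change _ ◁ 𝟙 _ ≫ _ = _
        rw [MonoidalCategory.whiskerLeft_id, Category.id_comp]
        exact right_unit_act _
      rw [e]
      exact snakeOne_equivRight)

theorem snakeTwo_w :
    (envR R).actRight ▷ (res (α_ (op R) R (op R)).hom (𝟙 _) (box (reg (op R)) (envJ R))).X ≫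
      tensorμ R.X R.X R.X R.X ≫
        (((β_ R.X R.X).hom ≫ μ[R.X]) ⊗ₘ ((β_ R.X R.X).hom ≫ μ[R.X])) ≫ μ[R.X] =
    (α_ _ _ _).hom ≫ (envR R).X ◁
      (res (α_ (op R) R (op R)).hom (𝟙 _) (box (reg (op R)) (envJ R))).actLeft ≫
        tensorμ R.X R.X R.X R.X ≫
          (((β_ R.X R.X).hom ≫ μ[R.X]) ⊗ₘ ((β_ R.X R.X).hom ≫ μ[R.X])) ≫ μ[R.X] := by
  have h := snakeTwo_aux (R := R.X)
  have e : (envR R).actRight = tensorμ R.X R.X (R.X ⊗ R.X) R.X ≫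
      (((α_ R.X R.X R.X).inv ≫ ((β_ R.X R.X).hom ≫ μ[R.X]) ▷ R.X ≫ μ[R.X]) ⊗ₘ
        ((β_ R.X R.X).hom ≫ μ[R.X])) := by
    change _ ◁ 𝟙 _ ≫ _ = _
    rw [MonoidalCategory.whiskerLeft_id, Category.id_comp]
    rfl
  rw [e]
  exact h

/-- The 2-cell `(y ⊗ z) ⊗ (a' ⊗ q) ↦ a' y q z`. -/
noncomputable def snakeTwo : Cell (𝟙 (op R)) (ρ_ (op R)).hom
    (tens (envR R) (res (α_ (op R) R (op R)).hom (𝟙 _) (box (reg (op R)) (envJ R))))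
      (reg (op R)) :=
  Cell.desc _ _ (tensorμ R.X R.X R.X R.X ≫
      (((β_ R.X R.X).hom ≫ μ[R.X]) ⊗ₘ ((β_ R.X R.X).hom ≫ μ[R.X])) ≫ μ[R.X]) (snakeTwo_w R)
    (by
      have e : (envR R).actLeft = (α_ _ _ _).inv ≫ (β_ R.X R.X).hom ▷ R.X ≫ (α_ _ _ _).hom ≫
          R.X ◁ ((β_ R.X R.X).hom ≫ μ[R.X]) := unit_act_right _
      rw [e, Mon.id_hom', id_tensorHom]
      exact snakeTwo_equivLeft)
    (by
      have e : (res (α_ (op R) R (op R)).hom (𝟙 _) (box (reg (op R)) (envJ R))).actRight =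
          (R.X ⊗ R.X) ◁ (ρ_ R.X).hom ≫ (α_ _ _ _).hom ≫ R.X ◁ (β_ R.X R.X).hom ≫
            (α_ _ _ _).inv ≫ ((β_ R.X R.X).hom ≫ μ[R.X]) ▷ R.X := by
        change _ ◁ 𝟙 _ ≫ _ = _
        rw [MonoidalCategory.whiskerLeft_id, Category.id_comp]
        exact left_unit_act _
      rw [e]
      exact snakeTwo_equivRight)

/-- The 1-cell `envM R` as `envL R ⊠ Rᵒᵖ`. -/
def envMLeft : Cell (𝟙 (env R)) (envPsi R) (envM R) (box (envL R) (reg (op R))) :=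
  resCell _ _ _

/-- The inverse of `envMLeft`. -/
def envMLeftInv : Cell (𝟙 (env R)) ((α_ R (op R) R).inv ▷ op R ≫ (α_ (R ⊗ op R) R (op R)).hom)
    (box (envL R) (reg (op R))) (envM R) :=
  resCellInv _ _ _ _ _ (by simp) (by simp [envPsi])

/-- The 1-cell `envM R` as `R ⊠ envR R`. -/
def envMRight : Cell (𝟙 (env R)) (envPsi R ≫ (α_ R (op R ⊗ R) (op R)).hom)
    (envM R) (box (reg R) (envR R)) :=
  ((((envMLeft R).comp ((resCell _ _ _).box (Cell.id _))).comp
    (boxAssoc (reg R) (coev R) (reg (op R)))).comp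
      ((Cell.id _).box (resCellInv _ _ (λ_ (op R)).hom (𝟙 _) _))).cast
        (by simp) (by simp)

/-- The inverse of `envMRight`. -/
def envMRightInv : Cell (𝟙 (env R)) ((α_ R (op R ⊗ R) (op R)).inv ≫
      (α_ R (op R) R).inv ▷ op R ≫ (α_ (R ⊗ op R) R (op R)).hom)
    (box (reg R) (envR R)) (envM R) :=
  (((((Cell.id _).box (resCell _ _ _)).comp
    (boxAssocInv (reg R) (coev R) (reg (op R)))).comp
      ((resCellInv _ _ (ρ_ R).hom (𝟙 _) _).box (Cell.id _))).comp (envMLeftInv R)).cast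
        (by simp) (by simp)

/-- The left unit constraint of the canonical pseudo-monoid:
`(x ⊗ y ⊗ z) ⊗ (q ⊗ (b ⊗ b')) ↦ x q y b ⊗ b' z`. -/
noncomputable def envUnitLeft : Cell (𝟙 (env R)) (λ_ (env R)).hom
    (tens (envM R) (box (envJ R) (reg (env R)))) (reg (env R)) :=
  ((((Cell.hcomp (envMLeft R)
    ((((Cell.id (envJ R)).box (boxRegInv R (op R))).comp (boxAssocInv _ _ _)).comp
      ((resCellInv (α_ R (op R) R).inv (𝟙 _) (α_ R (op R) R).hom (𝟙 _) _).box (Cell.id _)))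
        (by simp [envPsi])).comp (interchange _ _ _ _)).comp
          ((snakeOne R).box (leftUnit _))).comp (boxReg _ _)).cast (by simp) (by simp)

/-- The right unit constraint of the canonical pseudo-monoid:
`(x ⊗ y ⊗ z) ⊗ ((a ⊗ a') ⊗ q) ↦ x a ⊗ a' y q z`. -/
noncomputable def envUnitRight : Cell (𝟙 (env R)) (ρ_ (env R)).hom
    (tens (envM R) (box (reg (env R)) (envJ R))) (reg (env R)) :=
  ((((Cell.hcomp (envMRight R)
    ((((boxRegInv R (op R)).box (Cell.id (envJ R))).comp (boxAssoc _ _ _)).comp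
      ((Cell.id _).box (resCellInv (α_ (op R) R (op R)).hom (𝟙 _) (α_ (op R) R (op R)).inv (𝟙 _) _)))
        (by simp [envPsi])).comp (interchange _ _ _ _)).comp
          ((leftUnit _).box (snakeTwo R))).comp (boxReg _ _)).cast (by simp) (by simp)

end Env

section EnvAssoc
set_option linter.unusedSectionVars false

theorem coherence_one {D : Type u} [Category.{v} D] [MonoidalCategory D] (X Y : D) :
    (α_ (X ⊗ Y ⊗ X) (Y ⊗ X) Y).inv ≫ (α_ (X ⊗ Y ⊗ X) Y X).inv ▷ Y ≫
        (α_ X Y X).inv ▷ Y ▷ X ▷ Y ≫ (α_ ((X ⊗ Y) ⊗ X) Y X).hom ▷ Y ≫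
          (α_ ((X ⊗ Y) ⊗ X) (Y ⊗ X) Y).hom ≫ (α_ (X ⊗ Y) X ((Y ⊗ X) ⊗ Y)).hom ≫
            (α_ X Y (X ⊗ (Y ⊗ X) ⊗ Y)).hom ≫ X ◁ Y ◁ X ◁ (α_ Y X Y).hom ≫
              X ◁ Y ◁ (α_ X Y (X ⊗ Y)).inv ≫ (α_ X Y ((X ⊗ Y) ⊗ X ⊗ Y)).inv =
    (α_ X (Y ⊗ X) ((Y ⊗ X) ⊗ Y)).hom ≫ X ◁ (α_ Y X ((Y ⊗ X) ⊗ Y)).hom ≫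
        X ◁ Y ◁ X ◁ (α_ Y X Y).hom ≫ X ◁ Y ◁ (α_ X Y (X ⊗ Y)).inv ≫
          (α_ X Y ((X ⊗ Y) ⊗ X ⊗ Y)).inv := by
  monoidal

theorem coherence_two {D : Type u} [Category.{v} D] [MonoidalCategory D] (X Y : D) :
    (α_ ((X ⊗ Y) ⊗ (X ⊗ Y)) X Y).inv ≫ (α_ (X ⊗ Y) X Y).inv ▷ X ▷ Y ≫
        (α_ X Y X).hom ▷ Y ▷ X ▷ Y ≫ (α_ ((X ⊗ Y ⊗ X) ⊗ Y) X Y).hom ≫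
          (α_ (X ⊗ Y ⊗ X) Y (X ⊗ Y)).hom ≫ (α_ X (Y ⊗ X) (Y ⊗ (X ⊗ Y))).hom ≫
            X ◁ (α_ Y X (Y ⊗ (X ⊗ Y))).hom ≫ X ◁ Y ◁ (α_ X Y (X ⊗ Y)).inv ≫
              (α_ X Y ((X ⊗ Y) ⊗ X ⊗ Y)).inv =
    (α_ (X ⊗ Y) (X ⊗ Y) (X ⊗ Y)).hom := by
  monoidal

variable [BraidedCategory C]
variable [HasCoequalizers C]
variable [∀ X : C, PreservesColimitsOfShape WalkingParallelPair (tensorLeft X)]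
variable [∀ X : C, PreservesColimitsOfShape WalkingParallelPair (tensorRight X)]
variable (R : Mon C)

/-- The 2-cell `(x ⊗ y ⊗ z) ⊗ ((u ⊗ v ⊗ w) ⊗ (b ⊗ b')) ↦ (x u ⊗ v) ⊗ (w y b ⊗ b' z)`. -/
noncomputable def envFlattenLeft : Cell (𝟙 (env R))
    (envPsi R ▷ env R ≫ (α_ (R ⊗ (op R ⊗ R)) (op R) (env R)).hom ≫
      (R ⊗ (op R ⊗ R)) ◁ (α_ (op R) R (op R)).inv)
    (tens (envM R) (box (envM R) (reg (env R)))) (box (envL R) (envR R)) :=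
  (((Cell.hcomp (envMRight R)
    ((((envMLeft R).box (boxRegInv R (op R))).comp (boxAssoc _ _ _)).comp
      ((Cell.id (envL R)).box ((boxAssocInv _ _ _).comp ((boxReg _ _).box (Cell.id _)))))
        (by simp [envPsi])).comp (interchange _ _ _ _)).comp
          ((leftUnit _).box
            (((Cell.id (envR R)).hcomp (boxReg _ _)).comp (rightUnit _)))).cast
              (by simp) (by simp)

/-- The inverse of `(x ⊗ y ⊗ z) ⊗ ((a ⊗ a') ⊗ (u ⊗ v ⊗ w)) ↦ (x a ⊗ a' y u) ⊗ (v ⊗ w z)`,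
where `w z` is the product of `R`. -/
noncomputable def envFlattenRightInv : Cell (𝟙 (env R))
    ((α_ R (op R ⊗ R) ((op R ⊗ R) ⊗ op R)).hom ≫
      R ◁ (α_ (op R) R ((op R ⊗ R) ⊗ op R)).hom ≫
        (α_ R (op R) (R ⊗ ((op R ⊗ R) ⊗ op R))).inv ≫
          env R ◁ ((α_ R (op R ⊗ R) (op R)).inv ≫ (α_ R (op R) R).inv ▷ op R ≫
            (α_ (R ⊗ op R) R (op R)).hom))
    (box (envL R) (envR R)) (tens (envM R) (box (reg (env R)) (envM R))) :=
  (((((rightUnitInv (envL R)).comp ((Cell.id (envL R)).hcomp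
      ((boxRegInv R (op R ⊗ R)).comp ((Cell.id (reg R)).box (boxRegInv (op R) R))))).box
        (leftUnitInv (envR R))).comp (interchangeInv _ _ _ _)).comp
    (Cell.hcomp (envMLeftInv R)
      ((((boxAssoc _ _ _).comp ((Cell.id (reg R)).box (boxAssoc _ _ _))).comp
        (boxAssocInv _ _ _)).comp ((boxReg R (op R)).box (envMRightInv R)))
          (by simp))).cast (by simp) (by simp; exact coherence_one R (op R))

/-- The associativity constraint of the canonical pseudo-monoid:
`(x ⊗ y ⊗ z) ⊗ ((u ⊗ v ⊗ w) ⊗ (b ⊗ b')) ↦ (x u ⊗ v ⊗ 1) ⊗ ((1 ⊗ 1) ⊗ (1 ⊗ w y b ⊗ b' z))`. -/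
noncomputable def envAssoc : Cell (𝟙 (env R)) (α_ (env R) (env R) (env R)).hom
    (tens (envM R) (box (envM R) (reg (env R))))
    (tens (envM R) (box (reg (env R)) (envM R))) :=
  ((envFlattenLeft R).comp (envFlattenRightInv R)).cast (by simp)
    (by simp [envPsi]; exact coherence_two R (op R))

end EnvAssoc

section Monoidal
set_option linter.unusedSectionVars false
variable [BraidedCategory C]
variable [HasCoequalizers C]
variable [∀ X : C, PreservesColimitsOfShape WalkingParallelPair (tensorLeft X)]
variable [∀ X : C, PreservesColimitsOfShape WalkingParallelPair (tensorRight X)]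

section
variable {A B B' D D' E E' : Mon C}

/-- The 2-cell `(m ⊗ (N ⊠ N')) ⊗ (S ⊠ S') ⟶ m ⊗ ((N ⊗ S) ⊠ (N' ⊗ S'))`. -/
noncomputable def collect (m : Bimod A (B ⊗ B')) (N : Bimod B D) (N' : Bimod B' D')
    (S : Bimod D E) (S' : Bimod D' E') :
    BimHom (tens (tens m (box N N')) (box S S')) (tens m (box (tens N S) (tens N' S'))) :=
  ((assocHom m (box N N') (box S S')).comp
    ((Cell.id m).hcomp (interchange N N' S S'))).cast

/-- The inverse of `collect`. -/
noncomputable def distribute (m : Bimod A (B ⊗ B')) (N : Bimod B D) (N' : Bimod B' D')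
    (S : Bimod D E) (S' : Bimod D' E') :
    BimHom (tens m (box (tens N S) (tens N' S'))) (tens (tens m (box N N')) (box S S')) :=
  (((Cell.id m).hcomp (interchangeInv N N' S S')).comp
    (assocInv m (box N N') (box S S'))).cast

/-- The 2-cell `A ⊗ P ⟶ P ⊗ B` comparing the two unit constraints. -/
noncomputable def unitSwap (P : Bimod A B) : BimHom (tens (reg A) P) (tens P (reg B)) :=
  ((leftUnit P).comp (rightUnitInv P)).cast

/-- The inverse of `unitSwap`. -/
noncomputable def unitSwapInv (P : Bimod A B) : BimHom (tens P (reg B)) (tens (reg A) P) :=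
  ((rightUnit P).comp (leftUnitInv P)).cast

/-- The 2-cell `P ⊗ (B ⊠ B') ⟶ P ⊗ (B ⊗ B')`. -/
noncomputable def tensBoxReg (P : Bimod A (B ⊗ B')) :
    BimHom (tens P (box (reg B) (reg B'))) (tens P (reg (B ⊗ B'))) :=
  (Cell.id P).hcomp (boxReg B B')

/-- The inverse of `tensBoxReg`. -/
noncomputable def tensBoxRegInv (P : Bimod A (B ⊗ B')) :
    BimHom (tens P (reg (B ⊗ B'))) (tens P (box (reg B) (reg B'))) :=
  (Cell.id P).hcomp (boxRegInv B B')

/-- The 2-cell `B ⊗ P ⟶ P ⊗ (B ⊠ B')`. -/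
noncomputable def unitSwapBox (P : Bimod A (B ⊗ B')) :
    BimHom (tens (reg A) P) (tens P (box (reg B) (reg B'))) :=
  ((unitSwap P).comp (tensBoxRegInv P)).cast

/-- The inverse of `unitSwapBox`. -/
noncomputable def unitSwapBoxInv (P : Bimod A (B ⊗ B')) :
    BimHom (tens P (box (reg B) (reg B'))) (tens (reg A) P) :=
  ((tensBoxReg P).comp (unitSwapInv P)).cast

end

variable (C) in
/-- The data of a pseudo-monoid in `BIM`. The coherence isomorphisms of the monoidal bicategory
on 1-cells are accounted for by letting the constraints `l`, `r`, `a` be equivariant along the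
coherence isomorphisms of the tensor product of monoids. -/
structure PseudomonoidData where
  A : Mon C
  M : Bimod A (A ⊗ A)
  J : Bimod A (𝟙_ (Mon C))
  l : Cell (𝟙 A) (λ_ A).hom (tens M (box J (reg A))) (reg A)
  r : Cell (𝟙 A) (ρ_ A).hom (tens M (box (reg A) J)) (reg A)
  a : Cell (𝟙 A) (α_ A A A).hom (tens M (box M (reg A))) (tens M (box (reg A) M))

namespace PseudomonoidData
variable (P : PseudomonoidData C)

/-- The pentagon identity. -/
def Pentagon : Prop :=
  (collect P.M P.M (reg P.A) (box P.M (reg P.A)) (reg P.A)).hom ≫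
    ((Cell.id P.M).hcomp (P.a.box (Cell.id (tens (reg P.A) (reg P.A))))).hom ≫
    (distribute P.M P.M (reg P.A) (box (reg P.A) P.M) (reg P.A)).hom ≫
    (P.a.hcomp (boxAssoc (reg P.A) P.M (reg P.A))).hom ≫
    (collect P.M (reg P.A) P.M (reg P.A) (box P.M (reg P.A))).hom ≫
    ((Cell.id P.M).hcomp ((Cell.id (tens (reg P.A) (reg P.A))).box P.a)).hom =
  (P.a.hcomp (boxAssoc P.M (reg P.A) (reg P.A))).hom ≫
    (collect P.M (reg P.A) P.M P.M (box (reg P.A) (reg P.A))).hom ≫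
    ((Cell.id P.M).hcomp ((unitSwapBox P.M).box (unitSwapBoxInv P.M))).hom ≫
    (distribute P.M P.M (reg P.A) (box (reg P.A) (reg P.A)) P.M).hom ≫
    (P.a.hcomp (boxAssoc (reg P.A) (reg P.A) P.M)).hom ≫
    (collect P.M (reg P.A) P.M (reg P.A) (box (reg P.A) P.M)).hom

/-- The triangle identity. -/
def Triangle : Prop :=
  (P.a.hcomp (boxAssoc (reg P.A) P.J (reg P.A))).hom ≫
    (collect P.M (reg P.A) P.M (reg P.A) (box P.J (reg P.A))).hom ≫
    ((Cell.id P.M).hcomp ((leftUnit (reg P.A)).box P.l)).hom =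
  (collect P.M P.M (reg P.A) (box (reg P.A) P.J) (reg P.A)).hom ≫
    ((Cell.id P.M).hcomp (P.r.box (leftUnit (reg P.A)))).hom

end PseudomonoidData

variable (C) in
/-- A pseudo-monoid in `BIM`. -/
structure Pseudomonoid extends PseudomonoidData C where
  isIso_l : IsIso l.hom
  isIso_r : IsIso r.hom
  isIso_a : IsIso a.hom
  pentagon : toPseudomonoidData.Pentagon
  triangle : toPseudomonoidData.Triangle

/-- The canonical pseudo-monoid on `R ⊗ Rᵒᵖ`. -/
noncomputable abbrev envPseudomonoid (R : Mon C) : PseudomonoidData C where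
  A := env R
  M := envM R
  J := envJ R
  l := envUnitLeft R
  r := envUnitRight R
  a := envAssoc R

/-- For `σ : m ⊗ (F ⊠ F) ⟶ F ⊗ M`, the induced 2-cell
`m ⊗ ((F ⊗ N) ⊠ (F ⊗ N')) ⟶ F ⊗ (M ⊗ (N ⊠ N'))`. -/
noncomputable def extend {A B D D' : Mon C} {M : Bimod A (A ⊗ A)} {m : Bimod B (B ⊗ B)}
    {F : Bimod B A} (σ : BimHom (tens m (box F F)) (tens F M)) (N : Bimod A D)
    (N' : Bimod A D') :
    BimHom (tens m (box (tens F N) (tens F N'))) (tens F (tens M (box N N'))) :=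
  (((distribute m F F N N').comp (σ.hcomp (Cell.id (box N N')))).comp
    (assocHom F M (box N N'))).cast

/-- The structure of a monoidal morphism from `P` to `Q` on a 1-cell `F`. -/
structure MonoidalStr (P Q : PseudomonoidData C) (F : Bimod Q.A P.A) where
  tensorCell : BimHom (tens Q.M (box F F)) (tens F P.M)
  unitCell : BimHom Q.J (tens F P.J)
  left_unit :
    (collect Q.M Q.J (reg Q.A) (reg (𝟙_ (Mon C))) F).hom ≫
      ((Cell.id Q.M).hcomp (((rightUnit Q.J).comp unitCell).box (unitSwap F))).hom ≫
      (extend tensorCell P.J (reg P.A)).hom ≫ ((Cell.id F).hcomp P.l).hom ≫ (rightUnit F).hom =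
    (Q.l.hcomp (boxLeftUnit F)).hom ≫ (leftUnit F).hom
  right_unit :
    (collect Q.M (reg Q.A) Q.J F (reg (𝟙_ (Mon C)))).hom ≫
      ((Cell.id Q.M).hcomp ((unitSwap F).box ((rightUnit Q.J).comp unitCell))).hom ≫
      (extend tensorCell (reg P.A) P.J).hom ≫ ((Cell.id F).hcomp P.r).hom ≫ (rightUnit F).hom =
    (Q.r.hcomp (boxRightUnit F)).hom ≫ (leftUnit F).hom
  assoc :
    (collect Q.M Q.M (reg Q.A) (box F F) F).hom ≫
      ((Cell.id Q.M).hcomp (tensorCell.box (unitSwap F))).hom ≫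
      (extend tensorCell P.M (reg P.A)).hom ≫ ((Cell.id F).hcomp P.a).hom =
    (Q.a.hcomp (boxAssoc F F F)).hom ≫
      (collect Q.M (reg Q.A) Q.M F (box F F)).hom ≫
      ((Cell.id Q.M).hcomp ((unitSwap F).box tensorCell)).hom ≫
      (extend tensorCell (reg P.A) P.M).hom

/-- A monoidal morphism is strong if its structure 2-cells are invertible. -/
structure MonoidalStr.IsStrong {P Q : PseudomonoidData C} {F : Bimod Q.A P.A}
    (S : MonoidalStr P Q F) : Prop where
  isIso_tensorCell : IsIso S.tensorCell.hom
  isIso_unitCell : IsIso S.unitCell.hom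

/-- For composable `f`, `g` with composite `h`, the 2-cell `f_* ⊗ g_* ⟶ h_*`. -/
noncomputable def companionComp {A B D : Mon C} (f : A ⟶ B) (g : B ⟶ D) (h : A ⟶ D)
    (w : f ≫ g = h) : BimHom (tens (companion f) (companion g)) (companion h) :=
  Cell.desc _ _ (g.hom ▷ D.X ≫ μ[D.X])
    (by
      subst w
      have e : (companion f).actRight = μ[B.X] := by
        change _ ◁ 𝟙 _ ≫ _ = _; simp
      rw [e]
      change μ[B.X] ▷ D.X ≫ g.hom ▷ D.X ≫ μ[D.X] =
        (α_ _ _ _).hom ≫ B.X ◁ (g.hom ▷ D.X ≫ μ[D.X]) ≫ g.hom ▷ D.X ≫ μ[D.X]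
      rw [← comp_whiskerRight_assoc, IsMonHom.mul_hom, comp_whiskerRight, Category.assoc,
        MonObj.mul_assoc, whisker_exchange_assoc, MonoidalCategory.tensorHom_def]
      monoidal)
    (by
      subst w
      change (α_ _ _ _).inv ≫ (f.hom ▷ B.X ≫ μ[B.X]) ▷ D.X ≫ g.hom ▷ D.X ≫ μ[D.X] =
        (𝟙 _ ⊗ₘ (g.hom ▷ D.X ≫ μ[D.X])) ≫ (f.hom ≫ g.hom) ▷ D.X ≫ μ[D.X]
      have h : (f.hom ▷ B.X ≫ μ[B.X]) ▷ D.X ≫ g.hom ▷ D.X =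
          (f.hom ≫ g.hom) ▷ B.X ▷ D.X ≫ (D.X ◁ g.hom) ▷ D.X ≫ μ[D.X] ▷ D.X := by
        rw [← comp_whiskerRight, ← comp_whiskerRight, ← comp_whiskerRight, Category.assoc,
          IsMonHom.mul_hom, MonoidalCategory.tensorHom_def]
        simp
      rw [reassoc_of% h, MonObj.mul_assoc, id_tensorHom, whisker_exchange_assoc]
      monoidal)
    (by
      change (α_ _ _ _).hom ≫ B.X ◁ (D.X ◁ 𝟙 D.X ≫ μ[D.X]) ≫ g.hom ▷ D.X ≫ μ[D.X] =
        ((g.hom ▷ D.X ≫ μ[D.X]) ⊗ₘ 𝟙 D.X) ≫ D.X ◁ 𝟙 D.X ≫ μ[D.X]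
      have h : (α_ B.X D.X D.X).hom ≫ B.X ◁ μ[D.X] ≫ g.hom ▷ D.X ≫ μ[D.X] =
          (g.hom ▷ D.X) ▷ D.X ≫ μ[D.X] ▷ D.X ≫ μ[D.X] := by
        rw [MonObj.mul_assoc, whisker_exchange_assoc]
        monoidal
      simpa using h)

end Monoidal

section DS
set_option linter.unusedSectionVars false
variable [BraidedCategory C]
variable [HasCoequalizers C]
variable [∀ X : C, PreservesColimitsOfShape WalkingParallelPair (tensorLeft X)]
variable [∀ X : C, PreservesColimitsOfShape WalkingParallelPair (tensorRight X)]

/-- The composite structure 2-cell of two monoidal morphisms with underlying 1-cells `F`, `G`. -/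
noncomputable def MonoidalStr.compTensor {P Q S : PseudomonoidData C} {F : Bimod S.A Q.A}
    {G : Bimod Q.A P.A} (T : MonoidalStr Q S F) (U : MonoidalStr P Q G) :
    BimHom (tens S.M (box (tens F G) (tens F G))) (tens (tens F G) P.M) :=
  (((extend T.tensorCell G G).comp ((Cell.id F).hcomp U.tensorCell)).comp
    (assocInv F G P.M)).cast

/-- The composite unit 2-cell of two monoidal morphisms with underlying 1-cells `F`, `G`. -/
noncomputable def MonoidalStr.compUnit {P Q S : PseudomonoidData C} {F : Bimod S.A Q.A}
    {G : Bimod Q.A P.A} (T : MonoidalStr Q S F) (U : MonoidalStr P Q G) :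
    BimHom S.J (tens (tens F G) P.J) :=
  ((T.unitCell.comp ((Cell.id F).hcomp U.unitCell)).comp (assocInv F G P.J)).cast

/-- An object of `DS_R`: a pseudo-monoid together with a strong monoidal morphism to the canonical
pseudo-monoid of `R ⊗ Rᵒᵖ` that is induced by a monoid morphism `χ`. -/
structure DS (R : Mon C) where
  P : Pseudomonoid C
  χ : env R ⟶ P.A
  str : MonoidalStr P.toPseudomonoidData (envPseudomonoid R) (companion χ)
  isStrong : str.IsStrong

/-- A monoid morphism `Φ` is a morphism of `DS_R` if `Φ_*` is a monoidal morphism whose composite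
with the monoidal morphism `χ_*` of `X` is the monoidal morphism `χ_*` of `Y`. -/
def IsDSHom {R : Mon C} (X Y : DS R) (Φ : X.P.A ⟶ Y.P.A) : Prop :=
  ∃ (w : X.χ ≫ Φ = Y.χ)
    (T : MonoidalStr Y.P.toPseudomonoidData X.P.toPseudomonoidData (companion Φ)),
    (X.str.compTensor T).hom ≫
        ((companionComp X.χ Φ Y.χ w).hcomp (Cell.id Y.P.M)).hom =
      ((Cell.id (envPseudomonoid R).M).hcomp
          ((companionComp X.χ Φ Y.χ w).box (companionComp X.χ Φ Y.χ w))).hom ≫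
        Y.str.tensorCell.hom ∧
    (X.str.compUnit T).hom ≫ ((companionComp X.χ Φ Y.χ w).hcomp (Cell.id Y.P.J)).hom =
      Y.str.unitCell.hom

/-- A morphism of `DS_R`. -/
@[ext]
structure DSHom {R : Mon C} (X Y : DS R) where
  map : X.P.A ⟶ Y.P.A
  isHom : IsDSHom X Y map

/-- The category `DS_R`, given that its morphisms contain the identities and are closed under
composition. -/
abbrev DS.category (R : Mon C) (hid : ∀ X : DS R, IsDSHom X X (𝟙 X.P.A))
    (hcomp : ∀ (X Y Z : DS R) (f : X.P.A ⟶ Y.P.A) (g : Y.P.A ⟶ Z.P.A),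
      IsDSHom X Y f → IsDSHom Y Z g → IsDSHom X Z (f ≫ g)) : Category.{v} (DS R) where
  Hom X Y := DSHom X Y
  id X := ⟨𝟙 _, hid X⟩
  comp f g := ⟨f.map ≫ g.map, hcomp _ _ _ _ _ f.isHom g.isHom⟩
  id_comp f := by ext1; exact Category.id_comp _
  comp_id f := by ext1; exact Category.comp_id _
  assoc f g h := by ext1; exact Category.assoc _ _ _

end DS

section Bialgebroids
set_option linter.unusedSectionVars false
variable [SymmetricCategory C]

/-- The monoids and the source and target maps of a left bialgebroid over `R`. -/
structure BialgebroidBase (R : Mon C) where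
  A : Mon C
  s : R ⟶ A
  t : op R ⟶ A
  comm : (s.hom ⊗ₘ t.hom) ≫ μ[A.X] = (s.hom ⊗ₘ t.hom) ≫ (β_ A.X A.X).hom ≫ μ[A.X]

/-- The `R`-`R`-bimodule `L` on `A`, with `r a r' = s(r) t(r') a`. -/
abbrev BialgebroidBase.L {R : Mon C} (H : BialgebroidBase R) : Bimod R R where
  X := H.A.X
  actLeft := H.s.hom ▷ H.A.X ≫ μ[H.A.X]
  actRight := H.A.X ◁ H.t.hom ≫ (β_ H.A.X H.A.X).hom ≫ μ[H.A.X]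
  one_actLeft := (companion H.s).one_actLeft
  left_assoc := (companion H.s).left_assoc
  actRight_one := by
    have h : H.A.X ◁ η[R.X] ≫ H.A.X ◁ H.t.hom = H.A.X ◁ η[H.A.X] := by
      rw [← MonoidalCategory.whiskerLeft_comp]
      exact congrArg _ (IsMonHom.one_hom H.t.hom)
    rw [reassoc_of% h, BraidedCategory.braiding_naturality_right_assoc, MonObj.one_mul,
      braiding_leftUnitor]
  right_assoc := by
    have h : μ[R.X] ≫ H.t.hom = (H.t.hom ⊗ₘ H.t.hom) ≫ (β_ H.A.X H.A.X).hom ≫ μ[H.A.X] := by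
      have e : ((β_ R.X R.X).hom ≫ μ[R.X]) ≫ H.t.hom = (H.t.hom ⊗ₘ H.t.hom) ≫ μ[H.A.X] :=
        IsMonHom.mul_hom H.t.hom
      rw [← cancel_epi (β_ R.X R.X).hom, ← Category.assoc, e,
        ← BraidedCategory.braiding_naturality_assoc, SymmetricCategory.symmetry_assoc]
    have h' := op_right_assoc μ[H.A.X] μ[H.A.X] (MonObj.mul_assoc H.A.X)
    rw [← MonoidalCategory.whiskerLeft_comp_assoc, h, MonoidalCategory.whiskerLeft_comp,
      Category.assoc, h', MonoidalCategory.tensorHom_def',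
      comp_whiskerRight, Category.assoc, ← whisker_exchange_assoc]
    monoidal
  middle_assoc := by
    have h : ((μ[H.A.X] ▷ H.A.X) ≫ (β_ H.A.X H.A.X).hom ≫ μ[H.A.X]) =
        (α_ _ _ _).hom ≫ H.A.X ◁ (β_ H.A.X H.A.X).hom ≫ (α_ _ _ _).inv ≫
          ((β_ H.A.X H.A.X).hom ≫ μ[H.A.X]) ▷ H.A.X ≫ μ[H.A.X] := by
      rw [BraidedCategory.braiding_naturality_left_assoc, comp_whiskerRight, Category.assoc,
        MonObj.mul_assoc, BraidedCategory.braiding_tensor_left_hom]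
      simp
    calc
      _ = 𝟙 _ ⊗≫ (H.s.hom ▷ H.A.X) ▷ R.X ≫ (H.A.X ⊗ H.A.X) ◁ H.t.hom ⊗≫
          (μ[H.A.X] ▷ H.A.X) ≫ (β_ H.A.X H.A.X).hom ≫ μ[H.A.X] := by
        rw [comp_whiskerRight, Category.assoc, ← whisker_exchange_assoc]
        monoidal
      _ = 𝟙 _ ⊗≫ (H.s.hom ▷ (H.A.X ⊗ R.X) ≫
          H.A.X ◁ (H.A.X ◁ H.t.hom ≫ (β_ H.A.X H.A.X).hom)) ⊗≫
          ((β_ H.A.X H.A.X).hom ≫ μ[H.A.X]) ▷ H.A.X ≫ μ[H.A.X] := by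
        rw [h]; monoidal
      _ = 𝟙 _ ⊗≫ R.X ◁ (β_ H.A.X R.X).hom ⊗≫
          ((R.X ◁ H.t.hom ≫ H.s.hom ▷ H.A.X) ≫ (β_ H.A.X H.A.X).hom ≫ μ[H.A.X]) ▷ H.A.X ≫
            μ[H.A.X] := by
        rw [← whisker_exchange, BraidedCategory.braiding_naturality_right]
        monoidal
      _ = 𝟙 _ ⊗≫ R.X ◁ (β_ H.A.X R.X).hom ⊗≫
          ((R.X ◁ H.t.hom ≫ H.s.hom ▷ H.A.X) ≫ μ[H.A.X]) ▷ H.A.X ≫ μ[H.A.X] := by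
        have e := H.comm
        rw [MonoidalCategory.tensorHom_def'] at e
        erw [e]
      _ = _ := by
        calc
          _ = 𝟙 _ ⊗≫ R.X ◁ ((β_ H.A.X R.X).hom ≫ H.t.hom ▷ H.A.X) ⊗≫
              (H.s.hom ▷ (H.A.X ⊗ H.A.X) ≫ H.A.X ◁ μ[H.A.X]) ≫ μ[H.A.X] := by
            rw [comp_whiskerRight, Category.assoc, MonObj.mul_assoc]
            monoidal
          _ = _ := by
            rw [← whisker_exchange, ← BraidedCategory.braiding_naturality_right]
            monoidal

variable [HasCoequalizers C]
variable [∀ X : C, PreservesColimitsOfShape WalkingParallelPair (tensorLeft X)]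
variable [∀ X : C, PreservesColimitsOfShape WalkingParallelPair (tensorRight X)]

theorem mul_whisker_move {A R : C} :
    tensorμ (A ⊗ R) A A A ≫ ((α_ A R A).hom ≫ A ◁ (β_ R A).hom ≫ (α_ A A R).inv) ▷ (A ⊗ A) ≫
        (α_ (A ⊗ A) R (A ⊗ A)).hom =
      (α_ A R A).hom ▷ (A ⊗ A) ≫ tensorμ A (R ⊗ A) A A ≫ (A ⊗ A) ◁ (α_ R A A).hom := by
  simp only [tensorμ, BraidedCategory.braiding_tensor_left_hom]
  monoidal

theorem factorwise_mul {A R W : C} [MonObj A] (f : A ⊗ R ⟶ A) (g : R ⊗ A ⟶ A) (p : A ⊗ A ⟶ W)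
    (hf : f ▷ A ≫ μ[A] =
      (α_ A R A).hom ≫ A ◁ (β_ R A).hom ≫ (α_ A A R).inv ≫ μ[A] ▷ R ≫ f)
    (hg : g ▷ A ≫ μ[A] = (α_ R A A).hom ≫ R ◁ μ[A] ≫ g)
    (hp : f ▷ A ≫ p = (α_ A R A).hom ≫ A ◁ g ≫ p) :
    f ▷ A ▷ (A ⊗ A) ≫ tensorμ A A A A ≫ (μ[A] ⊗ₘ μ[A]) ≫ p =
      (α_ A R A).hom ▷ (A ⊗ A) ≫ (A ◁ g) ▷ (A ⊗ A) ≫ tensorμ A A A A ≫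
        (μ[A] ⊗ₘ μ[A]) ≫ p := by
  have e1 : f ▷ A ▷ (A ⊗ A) ≫ tensorμ A A A A = tensorμ (A ⊗ R) A A A ≫ (f ▷ A ▷ (A ⊗ A)) := by
    have := tensorμ_natural_left f (𝟙 A) A A
    simpa using this
  have e2 : (A ◁ g) ▷ (A ⊗ A) ≫ tensorμ A A A A =
      tensorμ A (R ⊗ A) A A ≫ ((A ⊗ A) ◁ g ▷ A) := by
    have := tensorμ_natural_left (𝟙 A) g A A
    simpa using this
  have e3 : f ▷ A ▷ (A ⊗ A) ≫ (μ[A] ⊗ₘ μ[A]) =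
      ((α_ A R A).hom ≫ A ◁ (β_ R A).hom ≫ (α_ A A R).inv) ▷ (A ⊗ A) ≫
        (μ[A] ▷ R ⊗ₘ μ[A]) ≫ f ▷ A := by
    rw [MonoidalCategory.tensorHom_def, ← comp_whiskerRight_assoc, hf,
      MonoidalCategory.tensorHom_def, Category.assoc, whisker_exchange]
    simp
  have e4 : (A ⊗ A) ◁ g ▷ A ≫ (μ[A] ⊗ₘ μ[A]) =
      (A ⊗ A) ◁ (α_ R A A).hom ≫ (μ[A] ⊗ₘ R ◁ μ[A]) ≫ A ◁ g := by
    rw [MonoidalCategory.tensorHom_def', ← MonoidalCategory.whiskerLeft_comp_assoc, hg,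
      MonoidalCategory.tensorHom_def', Category.assoc, ← whisker_exchange]
    simp
  have e5 : (μ[A] ▷ R ⊗ₘ μ[A]) ≫ (α_ A R A).hom = (α_ _ _ _).hom ≫ (μ[A] ⊗ₘ R ◁ μ[A]) := by
    rw [← tensorHom_id, associator_naturality, id_tensorHom]
  rw [reassoc_of% e1, reassoc_of% e3, hp, reassoc_of% e2, reassoc_of% e4, reassoc_of% e5,
    ← reassoc_of% (mul_whisker_move (A := A) (R := R))]

theorem mul_twisted_act {A R : C} [MonObj A] (t : R ⟶ A)
    (hs : ∀ X Y : C, (β_ X Y).hom ≫ (β_ Y X).hom = 𝟙 _) :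
    ((β_ A R).hom ≫ t ▷ A ≫ μ[A]) ▷ A ≫ μ[A] =
      (α_ A R A).hom ≫ A ◁ (β_ R A).hom ≫ (α_ A A R).inv ≫ μ[A] ▷ R ≫
        (β_ A R).hom ≫ t ▷ A ≫ μ[A] := by
  have h : A ◁ (β_ R A).hom ≫ A ◁ (β_ A R).hom = 𝟙 _ := by
    rw [← MonoidalCategory.whiskerLeft_comp, hs, MonoidalCategory.whiskerLeft_id]
  rw [BraidedCategory.braiding_naturality_left_assoc, BraidedCategory.braiding_tensor_left_hom]
  simp only [Category.assoc, Iso.inv_hom_id_assoc, reassoc_of% h, Iso.hom_inv_id_assoc]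
  rw [comp_whiskerRight, comp_whiskerRight, Category.assoc, Category.assoc, MonObj.mul_assoc,
    associator_naturality_left_assoc, whisker_exchange_assoc]

theorem unit_mul_left {A R : C} [MonObj A] (t : R ⟶ A) :
    (A ◁ t ≫ (β_ A A).hom ≫ μ[A]) ▷ A =
      (β_ A R).hom ▷ A ≫ (α_ R A A).hom ≫ (t ≫ (ρ_ A).inv ≫ A ◁ η[A]) ▷ (A ⊗ A) ≫
        tensorμ A A A A ≫ (μ[A] ⊗ₘ μ[A]) := by
  have e : (A ◁ η[A]) ▷ (A ⊗ A) ≫ tensorμ A A A A ≫ (μ[A] ⊗ₘ μ[A]) =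
      tensorμ A (𝟙_ C) A A ≫ (μ[A] ⊗ₘ (λ_ A).hom) := by
    have := tensorμ_natural_left (𝟙 A) η[A] A A
    simp only [id_tensorHom, id_whiskerRight] at this
    rw [reassoc_of% this, ← id_tensorHom, tensorHom_comp_tensorHom, Category.id_comp,
      MonObj.one_mul]
  rw [BraidedCategory.braiding_naturality_right_assoc, comp_whiskerRight t,
    comp_whiskerRight (ρ_ A).inv, Category.assoc, Category.assoc, e, unit_act_left]
  monoidal

theorem unit_mul_right {A R : C} [MonObj A] (s : R ⟶ A)
    (hs : ∀ X Y : C, (β_ X Y).hom ≫ (β_ Y X).hom = 𝟙 _) :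
    (α_ A R A).hom ≫ A ◁ (s ▷ A ≫ μ[A]) =
      (β_ A R).hom ▷ A ≫ (α_ R A A).hom ≫ (s ≫ (λ_ A).inv ≫ η[A] ▷ A) ▷ (A ⊗ A) ≫
        tensorμ A A A A ≫ (μ[A] ⊗ₘ μ[A]) := by
  have e : (η[A] ▷ A) ▷ (A ⊗ A) ≫ tensorμ A A A A ≫ (μ[A] ⊗ₘ μ[A]) =
      tensorμ (𝟙_ C) A A A ≫ ((λ_ A).hom ⊗ₘ μ[A]) := by
    have := tensorμ_natural_left η[A] (𝟙 A) A A
    simp only [tensorHom_id, id_whiskerRight] at this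
    rw [reassoc_of% this, ← tensorHom_id, tensorHom_comp_tensorHom, Category.id_comp,
      MonObj.one_mul]
  have e' : (β_ A R).hom ≫ s ▷ A ≫ (β_ A A).hom = A ◁ s := by
    rw [BraidedCategory.braiding_naturality_left, reassoc_of% (hs A R)]
  rw [comp_whiskerRight s, comp_whiskerRight (λ_ A).inv, Category.assoc, Category.assoc, e,
    unit_act_right]
  calc
    _ = 𝟙 _ ⊗≫ A ◁ s ▷ A ⊗≫ A ◁ μ[A] := by monoidal
    _ = 𝟙 _ ⊗≫ ((β_ A R).hom ≫ s ▷ A ≫ (β_ A A).hom) ▷ A ⊗≫ A ◁ μ[A] := by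
      rw [e']; monoidal
    _ = _ := by monoidal

theorem act_descends {P T Q : C} (m : Q ⊗ Q ⟶ Q) (n : P ⊗ Q ⟶ P) (r : T ⊗ Q ⟶ T) (p : P ⟶ T)
    [Epi (p ▷ (Q ⊗ Q))] (hp : p ▷ Q ≫ r = n ≫ p)
    (hn : P ◁ m ≫ n = (α_ P Q Q).inv ≫ n ▷ Q ≫ n) :
    T ◁ m ≫ r = (α_ T Q Q).inv ≫ r ▷ Q ≫ r := by
  rw [← cancel_epi (p ▷ (Q ⊗ Q)), ← whisker_exchange_assoc, hp, reassoc_of% hn,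
    associator_inv_naturality_left_assoc, ← comp_whiskerRight_assoc, hp, comp_whiskerRight,
    Category.assoc, hp]

theorem act_through {A T Q Z R : C} (m : Q ⊗ Q ⟶ Q) (r : T ⊗ Q ⟶ T)
    (hr : T ◁ m ≫ r = (α_ T Q Q).inv ≫ r ▷ Q ≫ r) (c : A ⟶ T) (u : R ⟶ Q) (k : Z ⟶ R ⊗ Q) :
    A ◁ (k ≫ u ▷ Q ≫ m) ≫ c ▷ Q ≫ r =
      A ◁ k ≫ (α_ A R Q).inv ≫ ((c ⊗ₘ u) ≫ r) ▷ Q ≫ r := by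
  rw [whisker_exchange_assoc, MonoidalCategory.whiskerLeft_comp,
    MonoidalCategory.whiskerLeft_comp, Category.assoc, Category.assoc, hr,
    MonoidalCategory.tensorHom_def, ← whisker_exchange_assoc]
  simp

/-- The right action of `A ⊗ A` on `L ⊗_R L`, by right multiplication in each factor. -/
noncomputable def BialgebroidBase.rho {R : Mon C} (H : BialgebroidBase R) :
    (tens H.L H.L).X ⊗ (H.A.X ⊗ H.A.X) ⟶ (tens H.L H.L).X :=
  tensDescR (H.A.X ⊗ H.A.X) H.L H.L
    (tensorμ H.A.X H.A.X H.A.X H.A.X ≫ (μ[H.A.X] ⊗ₘ μ[H.A.X]) ≫ proj H.L H.L) (by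
      refine factorwise_mul _ _ _ ?_ ?_ (proj_condition H.L H.L)
      · have e : H.L.actRight = (β_ H.A.X R.X).hom ≫ H.t.hom ▷ H.A.X ≫ μ[H.A.X] :=
          BraidedCategory.braiding_naturality_right_assoc _ _ _
        rw [e]
        exact mul_twisted_act H.t.hom SymmetricCategory.symmetry
      · rw [comp_whiskerRight, Category.assoc, MonObj.mul_assoc,
          associator_naturality_left_assoc, whisker_exchange_assoc])

theorem BialgebroidBase.proj_rho {R : Mon C} (H : BialgebroidBase R) :
    proj H.L H.L ▷ (H.A.X ⊗ H.A.X) ≫ H.rho =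
      tensorμ H.A.X H.A.X H.A.X H.A.X ≫ (μ[H.A.X] ⊗ₘ μ[H.A.X]) ≫ proj H.L H.L :=
  proj_tensDescR _ _ _ _ _

theorem BialgebroidBase.rho_assoc {R : Mon C} (H : BialgebroidBase R) :
    (tens H.L H.L).X ◁ (tensorμ H.A.X H.A.X H.A.X H.A.X ≫ (μ[H.A.X] ⊗ₘ μ[H.A.X])) ≫ H.rho =
      (α_ _ _ _).inv ≫ H.rho ▷ (H.A.X ⊗ H.A.X) ≫ H.rho := by
  have h : (H.A.X ⊗ H.A.X) ◁ (tensorμ H.A.X H.A.X H.A.X H.A.X ≫ (μ[H.A.X] ⊗ₘ μ[H.A.X])) ≫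
        (tensorμ H.A.X H.A.X H.A.X H.A.X ≫ (μ[H.A.X] ⊗ₘ μ[H.A.X])) =
      (α_ _ _ _).inv ≫ (tensorμ H.A.X H.A.X H.A.X H.A.X ≫ (μ[H.A.X] ⊗ₘ μ[H.A.X])) ▷
        (H.A.X ⊗ H.A.X) ≫ (tensorμ H.A.X H.A.X H.A.X H.A.X ≫ (μ[H.A.X] ⊗ₘ μ[H.A.X])) := by
    have := MonObj.mul_assoc (H.A.X ⊗ H.A.X)
    rw [← cancel_epi (α_ _ _ _).hom, Iso.hom_inv_id_assoc]
    exact this.symm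
  exact act_descends _ _ _ (proj H.L H.L) (by rw [H.proj_rho, Category.assoc]) h

/-- A comonoid structure on `L` such that `γ(a) (t(r) ⊗ 1) = γ(a) (1 ⊗ s(r))`. -/
structure PreBialgebroid (R : Mon C) extends BialgebroidBase R where
  comul : BimHom toBialgebroidBase.L (tens toBialgebroidBase.L toBialgebroidBase.L)
  counit : BimHom toBialgebroidBase.L (reg R)
  coassoc : comul.hom ≫ (comul.hcomp (Cell.id _)).hom ≫ (assocHom _ _ _).hom =
    comul.hom ≫ ((Cell.id _).hcomp comul).hom
  counit_left : comul.hom ≫ (counit.hcomp (Cell.id _)).hom ≫ (leftUnit _).hom = 𝟙 A.X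
  counit_right : comul.hom ≫ ((Cell.id _).hcomp counit).hom ≫ (rightUnit _).hom = 𝟙 A.X
  takeuchi : (comul.hom ⊗ₘ (t.hom ≫ (ρ_ A.X).inv ≫ A.X ◁ η[A.X])) ≫ toBialgebroidBase.rho =
    (comul.hom ⊗ₘ (s.hom ≫ (λ_ A.X).inv ≫ η[A.X] ▷ A.X)) ≫ toBialgebroidBase.rho

/-- The left action of `A` on `L ⊗_R L`, given by `a (x ⊗ y) = γ(a) (x ⊗ y)`. -/
noncomputable def PreBialgebroid.lam {R : Mon C} (H : PreBialgebroid R) :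
    H.A.X ⊗ (tens H.L H.L).X ⟶ (tens H.L H.L).X :=
  tensDescL H.A.X H.L H.L (H.comul.hom ▷ (H.A.X ⊗ H.A.X) ≫ H.rho) (by
    have h1 := unit_mul_left H.t.hom
    have h2 := unit_mul_right H.s.hom SymmetricCategory.symmetry
    have e1 := act_through _ H.rho H.rho_assoc H.comul.hom
      (H.t.hom ≫ (ρ_ H.A.X).inv ≫ H.A.X ◁ η[H.A.X])
      ((β_ H.A.X R.X).hom ▷ H.A.X ≫ (α_ R.X H.A.X H.A.X).hom)
    have e2 := act_through _ H.rho H.rho_assoc H.comul.hom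
      (H.s.hom ≫ (λ_ H.A.X).inv ≫ η[H.A.X] ▷ H.A.X)
      ((β_ H.A.X R.X).hom ▷ H.A.X ≫ (α_ R.X H.A.X H.A.X).hom)
    rw [H.takeuchi] at e1
    have e3 := e1.trans e2.symm
    simp only [Category.assoc] at e3
    rw [← h1, ← h2, MonoidalCategory.whiskerLeft_comp, Category.assoc] at e3
    exact e3)

/-- A left bialgebroid over the base monoid `R`. -/
structure Bialgebroid (R : Mon C) extends PreBialgebroid R where
  comul_one : η[A.X] ≫ comul.hom =
    (λ_ (𝟙_ C)).inv ≫ (η[A.X] ⊗ₘ η[A.X]) ≫ proj toBialgebroidBase.L toBialgebroidBase.L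
  comul_mul : μ[A.X] ≫ comul.hom = A.X ◁ comul.hom ≫ toPreBialgebroid.lam
  counit_one : η[A.X] ≫ counit.hom = η[R.X]
  counit_mul_s : A.X ◁ (counit.hom ≫ s.hom) ≫ μ[A.X] ≫ counit.hom = μ[A.X] ≫ counit.hom
  counit_mul_t : A.X ◁ (counit.hom ≫ t.hom) ≫ μ[A.X] ≫ counit.hom = μ[A.X] ≫ counit.hom

/-- A morphism of bialgebroids over `R`: a monoid morphism that is a morphism of comonoids in the
category of `R`-`R`-bimodules. -/
structure IsBialgebroidHom {R : Mon C} (X Y : Bialgebroid R) (Φ : X.A ⟶ Y.A) : Prop where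
  comul : ∃ f : BimHom X.L Y.L, f.hom = Φ.hom ∧
    X.comul.hom ≫ (f.hcomp f).hom = Φ.hom ≫ Y.comul.hom
  counit : Φ.hom ≫ Y.counit.hom = X.counit.hom

theorem IsBialgebroidHom.id {R : Mon C} (X : Bialgebroid R) : IsBialgebroidHom X X (𝟙 X.A) where
  comul := by
    refine ⟨Cell.id _, rfl, ?_⟩
    have h : ((Cell.id X.L).hcomp (Cell.id X.L)).hom = 𝟙 _ := by
      rw [← cancel_epi (proj X.L X.L), Cell.proj_hcomp]
      simp
    rw [h]
    exact (Category.comp_id _).trans (Category.id_comp _).symm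
  counit := Category.id_comp _

theorem IsBialgebroidHom.comp {R : Mon C} {X Y Z : Bialgebroid R} {f : X.A ⟶ Y.A}
    {g : Y.A ⟶ Z.A} (hf : IsBialgebroidHom X Y f) (hg : IsBialgebroidHom Y Z g) :
    IsBialgebroidHom X Z (f ≫ g) where
  comul := by
    obtain ⟨f', e, hf'⟩ := hf.comul
    obtain ⟨g', e', hg'⟩ := hg.comul
    refine ⟨(f'.comp g').cast, ?_, ?_⟩
    · simp [e, e']
    · let k : BimHom X.L Z.L := (f'.comp g').cast
      have h : (k.hcomp k).hom = (f'.hcomp f').hom ≫ (g'.hcomp g').hom := by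
        rw [← cancel_epi (proj X.L X.L), Cell.proj_hcomp, Cell.proj_hcomp_assoc, Cell.proj_hcomp]
        simp [k]
      change _ ≫ (k.hcomp k).hom = _
      rw [h, reassoc_of% hf', hg']
      simp
  counit := by
    rw [Mon.comp_hom', Category.assoc, hg.counit, hf.counit]

/-- A morphism in the category of bialgebroids over `R`. -/
@[ext]
structure BialgebroidHom {R : Mon C} (X Y : Bialgebroid R) where
  map : X.A ⟶ Y.A
  isHom : IsBialgebroidHom X Y map

instance (R : Mon C) : Category.{v} (Bialgebroid R) where
  Hom X Y := BialgebroidHom X Y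
  id X := ⟨𝟙 _, IsBialgebroidHom.id X⟩
  comp f g := ⟨f.map ≫ g.map, f.isHom.comp g.isHom⟩
  id_comp f := by ext1; exact Category.id_comp _
  comp_id f := by ext1; exact Category.comp_id _
  assoc f g h := by ext1; exact Category.assoc _ _ _

end Bialgebroids

end IntBgd

/-! A morphism `𝟙_ C ⟶ X` serves as an element of `X`, and everything is controlled by generators.
The canonical multiplication `envM R`, on R ⊗ R ⊗ R, is generated as a right module by 1 ⊗ 1 ⊗ 1,
and the canonical unit `envJ R` is generated as a left module by 1. A cell out of a cyclic module is
determined by its value on the generator (`orbit_cell`). Hence an equation between pasted cells is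
checked by chasing one pure tensor through both sides.

Let (A, M, J, χ, σ, ι) be an object of `DS R`, and let s and t be the restrictions of χ to R and to
its opposite. Tensoring with `companion χ` on the left is restriction along χ. So σ identifies M,
restricted along χ, with m ⊗ (χ ⊠ χ), and this is L ⊗_R L because 1 ⊗ 1 ⊗ 1 satisfies only the
relation that balances t in the first factor against s in the second (`exists_env_desc`). Likewise ι
identifies J with R. The images e and u of the canonical generators yield γ(a) = a e and π(a) = a u.
These identifications are recorded in a `Frame`. The bialgebroid conditions other than
coassociativity and the counit laws then follow from the module axioms of M and J, the balancing of
e and the compatibility of e and u with s and t.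

The monoidal axioms of (χ, σ, ι), evaluated at the generators, force the constraints l, r, a to take
the standard values e ⊗ (u ⊗ 1) ↦ 1, e ⊗ (1 ⊗ u) ↦ 1 and e ⊗ (e ⊗ 1) ↦ e ⊗ (1 ⊗ e). A right linear
map with such values is left linear exactly if the corresponding counit law or coassociativity holds
(`counit_left_of_cell` and `exists_left`, `coassoc_of_cell` and `exists_assoc`).

Conversely, a bialgebroid gives M = L ⊗_R L with the actions λ and ρ, and J = R with a · r = π(a
s(r)). The constraints exist by the counit laws and coassociativity. Pentagon, triangle and the
axioms of the monoidal morphism hold because both sides agree on a generator (`Generators.pentagon`,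
`Generators.triangle`, `Generators.monoidalStr`).

For a monoid morphism Φ, the structure cells required in `IsDSHom` must send generators to
generators, and such cells exist exactly if Φ respects s, t, γ and π. Thus `DS.isDSHom_iff`
identifies the two notions of morphism on the same underlying monoid morphisms. It gives closure
under identities and composition, and makes the functor from `DS R` to bialgebroids full and
faithful. Essential surjectivity is `Bialgebroid.toDSIso`, whose underlying morphism is an identity.
-/

namespace IntBgd

/-! ### Points as elements, and the values of the structure cells on pure tensors. -/

section Points
set_option linter.unusedSectionVars false
variable {C : Type u} [Category.{v} C] [MonoidalCategory C]

/-- The point `x ⊗ y` of a tensor product. -/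
def tensorPoint {X Y : C} (x : 𝟙_ C ⟶ X) (y : 𝟙_ C ⟶ Y) : 𝟙_ C ⟶ X ⊗ Y :=
  (λ_ (𝟙_ C)).inv ≫ (x ⊗ₘ y)

theorem tensorPoint_tensorHom {X Y X' Y' : C} (x : 𝟙_ C ⟶ X) (y : 𝟙_ C ⟶ Y) (f : X ⟶ X')
    (g : Y ⟶ Y') : tensorPoint x y ≫ (f ⊗ₘ g) = tensorPoint (x ≫ f) (y ≫ g) := by
  simp [tensorPoint]

theorem tensorPoint_whiskerRight {X Y X' : C} (x : 𝟙_ C ⟶ X) (y : 𝟙_ C ⟶ Y) (f : X ⟶ X') :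
    tensorPoint x y ≫ f ▷ Y = tensorPoint (x ≫ f) y := by
  rw [← tensorHom_id, tensorPoint_tensorHom, Category.comp_id]

theorem tensorPoint_whiskerLeft {X Y Y' : C} (x : 𝟙_ C ⟶ X) (y : 𝟙_ C ⟶ Y) (g : Y ⟶ Y') :
    tensorPoint x y ≫ X ◁ g = tensorPoint x (y ≫ g) := by
  rw [← id_tensorHom, tensorPoint_tensorHom, Category.comp_id]

theorem tensorPoint_eq_left {X Y : C} (x : 𝟙_ C ⟶ X) (y : 𝟙_ C ⟶ Y) :
    tensorPoint x y = x ≫ (ρ_ X).inv ≫ X ◁ y := by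
  rw [tensorPoint, MonoidalCategory.tensorHom_def, unitors_inv_equal,
    rightUnitor_inv_naturality_assoc]

theorem tensorPoint_eq_right {X Y : C} (x : 𝟙_ C ⟶ X) (y : 𝟙_ C ⟶ Y) :
    tensorPoint x y = y ≫ (λ_ Y).inv ≫ x ▷ Y := by
  rw [tensorPoint, MonoidalCategory.tensorHom_def', leftUnitor_inv_naturality_assoc]

theorem tensorPoint_associator {X Y Z : C} (x : 𝟙_ C ⟶ X) (y : 𝟙_ C ⟶ Y) (z : 𝟙_ C ⟶ Z) :
    tensorPoint (tensorPoint x y) z ≫ (α_ X Y Z).hom = tensorPoint x (tensorPoint y z) := by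
  rw [tensorPoint_eq_left, tensorPoint_eq_left x y, tensorPoint_eq_left x, tensorPoint_eq_left y]
  simp

theorem tensorPoint_associator_inv {X Y Z : C} (x : 𝟙_ C ⟶ X) (y : 𝟙_ C ⟶ Y) (z : 𝟙_ C ⟶ Z) :
    tensorPoint x (tensorPoint y z) ≫ (α_ X Y Z).inv = tensorPoint (tensorPoint x y) z := by
  rw [← tensorPoint_associator]; simp

theorem tensorPoint_leftUnitor {Y : C} (y : 𝟙_ C ⟶ Y) :
    tensorPoint (𝟙 (𝟙_ C)) y ≫ (λ_ Y).hom = y := by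
  rw [tensorPoint_eq_right]; simp

theorem tensorPoint_rightUnitor {Y : C} (y : 𝟙_ C ⟶ Y) :
    tensorPoint y (𝟙 (𝟙_ C)) ≫ (ρ_ Y).hom = y := by
  rw [tensorPoint_eq_left]; simp

theorem tensorPoint_one_mul (A : C) [MonObj A] (x : 𝟙_ C ⟶ A) :
    tensorPoint η[A] x ≫ μ[A] = x := by
  rw [tensorPoint_eq_right]; simp

theorem tensorPoint_braiding [BraidedCategory C] {X Y : C} (x : 𝟙_ C ⟶ X) (y : 𝟙_ C ⟶ Y) :
    tensorPoint x y ≫ (β_ X Y).hom = tensorPoint y x := by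
  rw [tensorPoint, Category.assoc, BraidedCategory.braiding_naturality, tensorPoint]
  simp [← unitors_equal]

theorem tensorPoint_tensorμ [BraidedCategory C] {X Y Z W : C} (x : 𝟙_ C ⟶ X) (y : 𝟙_ C ⟶ Y)
    (z : 𝟙_ C ⟶ Z) (w : 𝟙_ C ⟶ W) :
    tensorPoint (tensorPoint x y) (tensorPoint z w) ≫ tensorμ X Y Z W =
      tensorPoint (tensorPoint x z) (tensorPoint y w) := by
  simp only [tensorμ, ← Category.assoc, tensorPoint_associator, tensorPoint_associator_inv,
    tensorPoint_whiskerLeft, tensorPoint_whiskerRight, tensorPoint_braiding]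

theorem tensorPoint_tensorδ [BraidedCategory C] {X Y Z W : C} (x : 𝟙_ C ⟶ X) (y : 𝟙_ C ⟶ Y)
    (z : 𝟙_ C ⟶ Z) (w : 𝟙_ C ⟶ W) :
    tensorPoint (tensorPoint x y) (tensorPoint z w) ≫ tensorδ X Z Y W =
      tensorPoint (tensorPoint x z) (tensorPoint y w) := by
  rw [← tensorPoint_tensorμ x z y w, Category.assoc, tensorμ_tensorδ, Category.comp_id]

variable {A A' A'' B B' B'' D D' D'' E E' : Mon C}

/-- A point of a restricted bimodule. -/
def resPoint (φ : A ⟶ A') (ψ : B ⟶ B') (P : Bimod A' B') (x : 𝟙_ C ⟶ P.X) :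
    𝟙_ C ⟶ (res φ ψ P).X := x

theorem resPoint_resCell (φ : A ⟶ A') (ψ : B ⟶ B') (P : Bimod A' B') (x : 𝟙_ C ⟶ P.X) :
    resPoint φ ψ P x ≫ (resCell φ ψ P).hom = x := Category.comp_id _

theorem comp_resCellInv (φ : A ⟶ A') (ψ : B ⟶ B') (φ' : A' ⟶ A) (ψ' : B' ⟶ B)
    (P : Bimod A' B') (hφ : φ' ≫ φ = 𝟙 _) (hψ : ψ' ≫ ψ = 𝟙 _) (x : 𝟙_ C ⟶ P.X) :
    x ≫ (resCellInv φ ψ φ' ψ' P hφ hψ).hom = resPoint φ ψ P x := Category.comp_id _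

/-- The unit, as a point of the regular bimodule. -/
def regPoint (A : Mon C) : 𝟙_ C ⟶ (reg A).X := η[A.X]

/-- The unit, as a point of the bimodule induced by a monoid morphism. -/
def companionPoint (f : A ⟶ B) : 𝟙_ C ⟶ (companion f).X := η[B.X]

theorem companionPoint_resCell (f : A ⟶ B) :
    companionPoint f ≫ (resCell f (𝟙 B) (reg B)).hom = regPoint B := Category.comp_id _

section Tens
variable [HasCoequalizers C]
variable [∀ X : C, PreservesColimitsOfShape WalkingParallelPair (tensorLeft X)]
variable [∀ X : C, PreservesColimitsOfShape WalkingParallelPair (tensorRight X)]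

/-- The point `x ⊗ y` of `P ⊗_B N`. -/
noncomputable def tensPoint {P : Bimod A B} {N : Bimod B D} (x : 𝟙_ C ⟶ P.X) (y : 𝟙_ C ⟶ N.X) :
    𝟙_ C ⟶ (tens P N).X := tensorPoint x y ≫ proj P N

/-- Together with the evaluation rules below, this lets `simp` push a pure tensor through any
composite of coherence cells. Later axiom checks consist of such chases. -/
theorem tensPoint_hcomp {φ : A ⟶ A'} {ψ ψ' : B ⟶ B'} {χ : D ⟶ D'}
    {P : Bimod A B} {Q : Bimod A' B'} {N : Bimod B D} {S : Bimod B' D'}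
    (f : Cell φ ψ P Q) (g : Cell ψ' χ N S) (h : ψ = ψ') (x : 𝟙_ C ⟶ P.X) (y : 𝟙_ C ⟶ N.X) :
    tensPoint x y ≫ (Cell.hcomp f g h).hom = tensPoint (x ≫ f.hom) (y ≫ g.hom) := by
  rw [tensPoint, Category.assoc, Cell.proj_hcomp, ← Category.assoc, tensorPoint_tensorHom,
    tensPoint]

theorem tensPoint_assocHom {P : Bimod A B} {N : Bimod B D} {S : Bimod D E} (x : 𝟙_ C ⟶ P.X)
    (y : 𝟙_ C ⟶ N.X) (z : 𝟙_ C ⟶ S.X) :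
    tensPoint (tensPoint x y) z ≫ (assocHom P N S).hom = tensPoint x (tensPoint y z) := by
  have h := proj_assocHomX P N S
  change _ ≫ assocHomX P N S = _
  rw [tensPoint, tensPoint, ← tensorPoint_whiskerRight, Category.assoc, Category.assoc, h,
    ← Category.assoc, tensorPoint_associator, ← Category.assoc, tensorPoint_whiskerLeft]
  rfl

theorem tensPoint_assocInv {P : Bimod A B} {N : Bimod B D} {S : Bimod D E} (x : 𝟙_ C ⟶ P.X)
    (y : 𝟙_ C ⟶ N.X) (z : 𝟙_ C ⟶ S.X) :
    tensPoint x (tensPoint y z) ≫ (assocInv P N S).hom = tensPoint (tensPoint x y) z := by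
  rw [← tensPoint_assocHom, Category.assoc]
  exact (congrArg _ (assoc_hom_inv P N S)).trans (Category.comp_id _)

theorem tensPoint_leftUnit {P : Bimod A B} (x : 𝟙_ C ⟶ P.X) :
    tensPoint (regPoint A) x ≫ (leftUnit P).hom = x := by
  rw [tensPoint, Category.assoc, proj_leftUnit, tensorPoint_eq_right, Category.assoc,
    Category.assoc]
  have e : regPoint A ▷ P.X ≫ P.actLeft = (λ_ P.X).hom := P.one_actLeft
  rw [e]; simp

theorem tensPoint_rightUnit {P : Bimod A B} (x : 𝟙_ C ⟶ P.X) :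
    tensPoint x (regPoint B) ≫ (rightUnit P).hom = x := by
  rw [tensPoint, Category.assoc, proj_rightUnit, tensorPoint_eq_left, Category.assoc,
    Category.assoc]
  have e : P.X ◁ regPoint B ≫ P.actRight = (ρ_ P.X).hom := P.actRight_one
  rw [e]; simp

theorem comp_leftUnitInv {P : Bimod A B} (x : 𝟙_ C ⟶ P.X) :
    x ≫ (leftUnitInv P).hom = tensPoint (regPoint A) x := by
  rw [tensPoint, tensorPoint_eq_right, Category.assoc, Category.assoc]
  rfl

theorem comp_rightUnitInv {P : Bimod A B} (x : 𝟙_ C ⟶ P.X) :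
    x ≫ (rightUnitInv P).hom = tensPoint x (regPoint B) := by
  rw [tensPoint, tensorPoint_eq_left, Category.assoc, Category.assoc]
  rfl

theorem tensPoint_unitSwap {P : Bimod A B} (x : 𝟙_ C ⟶ P.X) :
    tensPoint (regPoint A) x ≫ (unitSwap P).hom = tensPoint x (regPoint B) := by
  rw [unitSwap, Cell.cast_hom, Cell.comp_hom, ← Category.assoc, tensPoint_leftUnit,
    comp_rightUnitInv]

theorem tensPoint_unitSwapInv {P : Bimod A B} (x : 𝟙_ C ⟶ P.X) :
    tensPoint x (regPoint B) ≫ (unitSwapInv P).hom = tensPoint (regPoint A) x := by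
  rw [unitSwapInv, Cell.cast_hom, Cell.comp_hom, ← Category.assoc, tensPoint_rightUnit,
    comp_leftUnitInv]

end Tens

section Box
variable [BraidedCategory C]

/-- The point `x ⊗ y` of `P ⊠ P'`. -/
def boxPoint {P : Bimod A B} {P' : Bimod A' B'} (x : 𝟙_ C ⟶ P.X) (y : 𝟙_ C ⟶ P'.X) :
    𝟙_ C ⟶ (box P P').X := tensorPoint x y

theorem boxPoint_box {φ : A ⟶ B} {ψ : D ⟶ E} {φ' : A' ⟶ B'} {ψ' : D' ⟶ E'}
    {P : Bimod A D} {Q : Bimod B E} {P' : Bimod A' D'} {Q' : Bimod B' E'}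
    (f : Cell φ ψ P Q) (f' : Cell φ' ψ' P' Q') (x : 𝟙_ C ⟶ P.X) (y : 𝟙_ C ⟶ P'.X) :
    boxPoint x y ≫ (Cell.box f f').hom = boxPoint (x ≫ f.hom) (y ≫ f'.hom) :=
  tensorPoint_tensorHom _ _ _ _

theorem boxPoint_boxAssoc {P : Bimod A B} {P' : Bimod A' B'} {P'' : Bimod D E}
    (x : 𝟙_ C ⟶ P.X) (y : 𝟙_ C ⟶ P'.X) (z : 𝟙_ C ⟶ P''.X) :
    boxPoint (boxPoint x y) z ≫ (boxAssoc P P' P'').hom = boxPoint x (boxPoint y z) :=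
  tensorPoint_associator _ _ _

theorem boxPoint_boxAssocInv {P : Bimod A B} {P' : Bimod A' B'} {P'' : Bimod D E}
    (x : 𝟙_ C ⟶ P.X) (y : 𝟙_ C ⟶ P'.X) (z : 𝟙_ C ⟶ P''.X) :
    boxPoint x (boxPoint y z) ≫ (boxAssocInv P P' P'').hom = boxPoint (boxPoint x y) z :=
  tensorPoint_associator_inv _ _ _

theorem boxPoint_boxLeftUnit {P : Bimod A B} (x : 𝟙_ C ⟶ P.X) :
    boxPoint (regPoint (𝟙_ (Mon C))) x ≫ (boxLeftUnit P).hom = x :=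
  tensorPoint_leftUnitor x

theorem boxPoint_boxRightUnit {P : Bimod A B} (x : 𝟙_ C ⟶ P.X) :
    boxPoint x (regPoint (𝟙_ (Mon C))) ≫ (boxRightUnit P).hom = x :=
  tensorPoint_rightUnitor x

theorem boxPoint_boxReg : boxPoint (regPoint A) (regPoint A') ≫ (boxReg A A').hom =
    regPoint (A ⊗ A') := Category.comp_id _

theorem regPoint_boxRegInv : regPoint (A ⊗ A') ≫ (boxRegInv A A').hom =
    boxPoint (regPoint A) (regPoint A') := Category.comp_id _

variable [HasCoequalizers C]
variable [∀ X : C, PreservesColimitsOfShape WalkingParallelPair (tensorLeft X)]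
variable [∀ X : C, PreservesColimitsOfShape WalkingParallelPair (tensorRight X)]

theorem tensPoint_interchange {P : Bimod A B} {P' : Bimod A' B'} {N : Bimod B D}
    {N' : Bimod B' D'} (x : 𝟙_ C ⟶ P.X) (x' : 𝟙_ C ⟶ P'.X) (y : 𝟙_ C ⟶ N.X)
    (y' : 𝟙_ C ⟶ N'.X) :
    tensPoint (boxPoint x x') (boxPoint y y') ≫ (interchange P P' N N').hom =
      boxPoint (tensPoint x y) (tensPoint x' y') := by
  change _ ≫ interchangeX P P' N N' = _
  rw [tensPoint, Category.assoc, proj_interchangeX, ← Category.assoc]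
  exact (congrArg (· ≫ _) (tensorPoint_tensorμ _ _ _ _)).trans (tensorPoint_tensorHom _ _ _ _)

theorem boxPoint_interchangeInv {P : Bimod A B} {P' : Bimod A' B'} {N : Bimod B D}
    {N' : Bimod B' D'} (x : 𝟙_ C ⟶ P.X) (x' : 𝟙_ C ⟶ P'.X) (y : 𝟙_ C ⟶ N.X)
    (y' : 𝟙_ C ⟶ N'.X) :
    boxPoint (tensPoint x y) (tensPoint x' y') ≫ (interchangeInv P P' N N').hom =
      tensPoint (boxPoint x x') (boxPoint y y') := by
  rw [boxPoint, tensPoint, tensPoint, ← tensorPoint_tensorHom, Category.assoc]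
  change _ ≫ _ ≫ interchangeInvX P P' N N' = _
  rw [proj_interchangeInvX, interchangePre, ← Category.assoc]
  exact congrArg (· ≫ _) (tensorPoint_tensorδ _ _ _ _)

theorem tensPoint_collect {m : Bimod A (B ⊗ B')} {N : Bimod B D} {N' : Bimod B' D'}
    {S : Bimod D E} {S' : Bimod D' E'} (x : 𝟙_ C ⟶ m.X) (y : 𝟙_ C ⟶ N.X) (y' : 𝟙_ C ⟶ N'.X)
    (z : 𝟙_ C ⟶ S.X) (z' : 𝟙_ C ⟶ S'.X) :
    tensPoint (tensPoint x (boxPoint y y')) (boxPoint z z') ≫ (collect m N N' S S').hom =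
      tensPoint x (boxPoint (tensPoint y z) (tensPoint y' z')) := by
  rw [collect, Cell.cast_hom, Cell.comp_hom, ← Category.assoc, tensPoint_assocHom,
    tensPoint_hcomp, tensPoint_interchange, Cell.id_hom, Category.comp_id]

theorem tensPoint_distribute {m : Bimod A (B ⊗ B')} {N : Bimod B D} {N' : Bimod B' D'}
    {S : Bimod D E} {S' : Bimod D' E'} (x : 𝟙_ C ⟶ m.X) (y : 𝟙_ C ⟶ N.X) (y' : 𝟙_ C ⟶ N'.X)
    (z : 𝟙_ C ⟶ S.X) (z' : 𝟙_ C ⟶ S'.X) :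
    tensPoint x (boxPoint (tensPoint y z) (tensPoint y' z')) ≫ (distribute m N N' S S').hom =
      tensPoint (tensPoint x (boxPoint y y')) (boxPoint z z') := by
  rw [distribute, Cell.cast_hom, Cell.comp_hom, ← Category.assoc, tensPoint_hcomp,
    boxPoint_interchangeInv, Cell.id_hom, Category.comp_id, tensPoint_assocInv]

theorem tensPoint_tensBoxReg {P : Bimod A (B ⊗ B')} (x : 𝟙_ C ⟶ P.X) :
    tensPoint x (boxPoint (regPoint B) (regPoint B')) ≫ (tensBoxReg P).hom =
      tensPoint x (regPoint (B ⊗ B')) := by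
  rw [tensBoxReg, tensPoint_hcomp, boxPoint_boxReg, Cell.id_hom, Category.comp_id]

theorem tensPoint_tensBoxRegInv {P : Bimod A (B ⊗ B')} (x : 𝟙_ C ⟶ P.X) :
    tensPoint x (regPoint (B ⊗ B')) ≫ (tensBoxRegInv P).hom =
      tensPoint x (boxPoint (regPoint B) (regPoint B')) := by
  rw [tensBoxRegInv, tensPoint_hcomp, regPoint_boxRegInv, Cell.id_hom, Category.comp_id]

theorem tensPoint_unitSwapBox {P : Bimod A (B ⊗ B')} (x : 𝟙_ C ⟶ P.X) :
    tensPoint (regPoint A) x ≫ (unitSwapBox P).hom =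
      tensPoint x (boxPoint (regPoint B) (regPoint B')) := by
  rw [unitSwapBox, Cell.cast_hom, Cell.comp_hom, ← Category.assoc, tensPoint_unitSwap,
    tensPoint_tensBoxRegInv]

theorem tensPoint_unitSwapBoxInv {P : Bimod A (B ⊗ B')} (x : 𝟙_ C ⟶ P.X) :
    tensPoint x (boxPoint (regPoint B) (regPoint B')) ≫ (unitSwapBoxInv P).hom =
      tensPoint (regPoint A) x := by
  rw [unitSwapBoxInv, Cell.cast_hom, Cell.comp_hom, ← Category.assoc, tensPoint_tensBoxReg,
    tensPoint_unitSwapInv]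

/-- The cell is b ⊗ d ↦ g(b)d, and g preserves the unit. -/
theorem tensPoint_companionComp (f : A ⟶ B) (g : B ⟶ D) (h : A ⟶ D) (w : f ≫ g = h) :
    tensPoint (companionPoint f) (companionPoint g) ≫ (companionComp f g h w).hom =
      companionPoint h := by
  have e : proj (companion f) (companion g) ≫ (companionComp f g h w).hom =
      g.hom ▷ D.X ≫ μ[D.X] := by
    unfold companionComp Cell.desc
    dsimp only
    rw [proj_tensDesc]
  rw [tensPoint, Category.assoc, e, ← Category.assoc]
  erw [tensorPoint_whiskerRight]
  have e' : companionPoint f ≫ g.hom = η[D.X] := IsMonHom.one_hom g.hom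
  erw [e']
  exact tensorPoint_one_mul _ _

/-- The hypothesis `hσ` is all that the later checks of the monoidal axioms need to know about `σ`.
-/
theorem tensPoint_extend {A B D D' : Mon C} {M : Bimod A (A ⊗ A)} {m : Bimod B (B ⊗ B)}
    {F : Bimod B A} (σ : BimHom (tens m (box F F)) (tens F M)) {N : Bimod A D}
    {N' : Bimod A D'} {x : 𝟙_ C ⟶ m.X} {f : 𝟙_ C ⟶ F.X} {e : 𝟙_ C ⟶ M.X}
    (hσ : tensPoint x (boxPoint f f) ≫ σ.hom = tensPoint f e)
    (y : 𝟙_ C ⟶ N.X) (y' : 𝟙_ C ⟶ N'.X) :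
    tensPoint x (boxPoint (tensPoint f y) (tensPoint f y')) ≫ (extend σ N N').hom =
      tensPoint f (tensPoint e (boxPoint y y')) := by
  simp only [extend, Cell.cast_hom, Cell.comp_hom, ← Category.assoc]
  rw [tensPoint_distribute, tensPoint_hcomp, hσ, Cell.id_hom, Category.comp_id,
    tensPoint_assocHom]

end Box
end Points

end IntBgd


namespace IntBgd

/-! ### Orbit maps, cyclic modules, and bimodule morphisms determined on a generator. -/

section Orbits
set_option linter.unusedSectionVars false
variable {C : Type u} [Category.{v} C] [MonoidalCategory C]
variable {A A' A'' B B' B'' D D' D'' E E' : Mon C}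

/-- The map `b ↦ e b` given by the right action on a point. -/
def orbit (P : Bimod A B) (e : 𝟙_ C ⟶ P.X) : B.X ⟶ P.X :=
  (λ_ B.X).inv ≫ e ▷ B.X ≫ P.actRight

/-- The map `a ↦ a e` given by the left action on a point. -/
def lorbit (P : Bimod A B) (e : 𝟙_ C ⟶ P.X) : A.X ⟶ P.X :=
  (ρ_ A.X).inv ≫ A.X ◁ e ≫ P.actLeft

/-- In elements, f(eb) = f(e)ψ(b). Once `orbit P e` is epi, an equation between cells splits into an
equation of values at `e` and an equation of base morphisms. -/
theorem orbit_cell {φ : A ⟶ A'} {ψ : B ⟶ B'} {P : Bimod A B} {Q : Bimod A' B'}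
    (f : Cell φ ψ P Q) (e : 𝟙_ C ⟶ P.X) :
    orbit P e ≫ f.hom = ψ.hom ≫ orbit Q (e ≫ f.hom) := by
  simp only [orbit, Category.assoc, f.right, MonoidalCategory.tensorHom_def']
  rw [leftUnitor_inv_naturality_assoc, whisker_exchange_assoc, comp_whiskerRight_assoc,
    ← whisker_exchange_assoc, ← whisker_exchange_assoc]

theorem orbit_cell_assoc {φ : A ⟶ A'} {ψ : B ⟶ B'} {P : Bimod A B} {Q : Bimod A' B'}
    (f : Cell φ ψ P Q) (e : 𝟙_ C ⟶ P.X) {W : C} (k : Q.X ⟶ W) :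
    orbit P e ≫ f.hom ≫ k = ψ.hom ≫ orbit Q (e ≫ f.hom) ≫ k := by
  rw [← Category.assoc, orbit_cell, Category.assoc]

theorem lorbit_cell {φ : A ⟶ A'} {ψ : B ⟶ B'} {P : Bimod A B} {Q : Bimod A' B'}
    (f : Cell φ ψ P Q) (e : 𝟙_ C ⟶ P.X) :
    lorbit P e ≫ f.hom = φ.hom ≫ lorbit Q (e ≫ f.hom) := by
  simp only [lorbit, Category.assoc, f.left, MonoidalCategory.tensorHom_def]
  rw [rightUnitor_inv_naturality_assoc, MonoidalCategory.whiskerLeft_comp_assoc,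
    whisker_exchange_assoc]

theorem lorbit_cell_assoc {φ : A ⟶ A'} {ψ : B ⟶ B'} {P : Bimod A B} {Q : Bimod A' B'}
    (f : Cell φ ψ P Q) (e : 𝟙_ C ⟶ P.X) {W : C} (k : Q.X ⟶ W) :
    lorbit P e ≫ f.hom ≫ k = φ.hom ≫ lorbit Q (e ≫ f.hom) ≫ k := by
  rw [← Category.assoc, lorbit_cell, Category.assoc]

theorem orbit_actRight (P : Bimod A B) (e : 𝟙_ C ⟶ P.X) :
    orbit P e ▷ B.X ≫ P.actRight = μ[B.X] ≫ orbit P e := by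
  have h : P.actRight ▷ B.X ≫ P.actRight = (α_ _ _ _).hom ≫ P.X ◁ μ[B.X] ≫ P.actRight := by
    rw [P.right_assoc, Iso.hom_inv_id_assoc]
  simp only [orbit, comp_whiskerRight, Category.assoc, h]
  rw [leftUnitor_inv_naturality_assoc, whisker_exchange_assoc]
  simp

theorem lorbit_actLeft (P : Bimod A B) (e : 𝟙_ C ⟶ P.X) :
    A.X ◁ lorbit P e ≫ P.actLeft = μ[A.X] ≫ lorbit P e := by
  have h : A.X ◁ P.actLeft ≫ P.actLeft = (α_ _ _ _).inv ≫ μ[A.X] ▷ P.X ≫ P.actLeft := by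
    rw [P.left_assoc, Iso.inv_hom_id_assoc]
  simp only [lorbit, MonoidalCategory.whiskerLeft_comp, Category.assoc, h]
  rw [rightUnitor_inv_naturality_assoc, ← whisker_exchange_assoc]
  simp

/-- In elements, a(eb) = (ae)b. On a module generated by `e`, the left action is therefore known
once the elements ae are known. -/
theorem orbit_actLeft (P : Bimod A B) (e : 𝟙_ C ⟶ P.X) :
    A.X ◁ orbit P e ≫ P.actLeft = lorbit P e ▷ B.X ≫ P.actRight := by
  simp only [orbit, lorbit, comp_whiskerRight, MonoidalCategory.whiskerLeft_comp, Category.assoc,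
    P.middle_assoc]
  simp

theorem one_orbit (P : Bimod A B) (e : 𝟙_ C ⟶ P.X) : η[B.X] ≫ orbit P e = e := by
  have h : P.X ◁ η[B.X] ≫ P.actRight = (ρ_ P.X).hom := P.actRight_one
  rw [orbit, leftUnitor_inv_naturality_assoc, whisker_exchange_assoc, h,
    rightUnitor_naturality, ← unitors_equal]
  simp

theorem one_lorbit (P : Bimod A B) (e : 𝟙_ C ⟶ P.X) : η[A.X] ≫ lorbit P e = e := by
  have h : η[A.X] ▷ P.X ≫ P.actLeft = (λ_ P.X).hom := P.one_actLeft
  rw [lorbit, rightUnitor_inv_naturality_assoc, ← whisker_exchange_assoc, h,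
    leftUnitor_naturality, unitors_equal]
  simp

theorem orbit_reg (A : Mon C) : orbit (reg A) (regPoint A) = 𝟙 _ := by
  have h : regPoint A ▷ A.X ≫ (reg A).actRight = (λ_ A.X).hom := MonObj.one_mul A.X
  rw [orbit, h, Iso.inv_hom_id]

theorem lorbit_reg (A : Mon C) : lorbit (reg A) (regPoint A) = 𝟙 _ := by
  have h : A.X ◁ regPoint A ≫ (reg A).actLeft = (ρ_ A.X).hom := MonObj.mul_one A.X
  rw [lorbit, h, Iso.inv_hom_id]

theorem orbit_res (φ : A ⟶ A') (ψ : B ⟶ B') (P : Bimod A' B') (x : 𝟙_ C ⟶ P.X) :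
    orbit (res φ ψ P) (resPoint φ ψ P x) = ψ.hom ≫ orbit P x := by
  change (λ_ B.X).inv ≫ x ▷ B.X ≫ P.X ◁ ψ.hom ≫ P.actRight = _
  rw [orbit, leftUnitor_inv_naturality_assoc, whisker_exchange_assoc]

theorem lorbit_res (φ : A ⟶ A') (ψ : B ⟶ B') (P : Bimod A' B') (x : 𝟙_ C ⟶ P.X) :
    lorbit (res φ ψ P) (resPoint φ ψ P x) = φ.hom ≫ lorbit P x := by
  change (ρ_ A.X).inv ≫ A.X ◁ x ≫ φ.hom ▷ P.X ≫ P.actLeft = _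
  rw [lorbit, rightUnitor_inv_naturality_assoc, whisker_exchange_assoc]

theorem orbit_companion (f : A ⟶ B) : orbit (companion f) (companionPoint f) = 𝟙 _ := by
  have h := orbit_res f (𝟙 B) (reg B) (regPoint B)
  rw [orbit_reg] at h
  exact h.trans (Category.comp_id _)

theorem lorbit_companion (f : A ⟶ B) : lorbit (companion f) (companionPoint f) = f.hom := by
  have h := lorbit_res f (𝟙 B) (reg B) (regPoint B)
  rw [lorbit_reg] at h
  exact h.trans (Category.comp_id _)

/-- A right module generated by a point. -/
class Cyclic (P : Bimod A B) (e : 𝟙_ C ⟶ P.X) : Prop where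
  stableEpi : StableEpi (orbit P e)

/-- A left module generated by a point. -/
class LeftCyclic (P : Bimod A B) (e : 𝟙_ C ⟶ P.X) : Prop where
  stableEpi : StableEpi (lorbit P e)

theorem stableEpi_of_comp {X Y Z : C} (f : X ⟶ Y) (g : Y ⟶ Z) [h : StableEpi (f ≫ g)] :
    StableEpi g where
  epi W W' := by
    have := h.epi W W'
    rw [MonoidalCategory.whiskerLeft_comp, comp_whiskerRight] at this
    exact epi_of_epi ((W ◁ f) ▷ W') _

instance Cyclic.orbit (P : Bimod A B) (e : 𝟙_ C ⟶ P.X) [h : Cyclic P e] :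
    StableEpi (IntBgd.orbit P e) := h.stableEpi

instance LeftCyclic.lorbit (P : Bimod A B) (e : 𝟙_ C ⟶ P.X) [h : LeftCyclic P e] :
    StableEpi (IntBgd.lorbit P e) := h.stableEpi

instance cyclic_reg (A : Mon C) : Cyclic (reg A) (regPoint A) := ⟨by rw [orbit_reg]; infer_instance⟩

instance cyclic_companion (f : A ⟶ B) : Cyclic (companion f) (companionPoint f) :=
  ⟨by rw [orbit_companion]; infer_instance⟩

/-- The unit of the monoid `𝟙_ (Mon C)` is an identity morphism, so the unit law of the action
already is this formula. -/
theorem actRight_unit [BraidedCategory C] (P : Bimod A (𝟙_ (Mon C))) : P.actRight = (ρ_ P.X).hom := by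
  have h : P.X ◁ 𝟙 (𝟙_ C) ≫ P.actRight = (ρ_ P.X).hom := P.actRight_one
  rw [MonoidalCategory.whiskerLeft_id] at h
  exact (Category.id_comp _).symm.trans h

/-- A bimodule morphism determined by its value on a generator. -/
def Cell.ofOrbit {φ : A ⟶ A'} {ψ : B ⟶ B'} {P : Bimod A B} {Q : Bimod A' B'} (e : 𝟙_ C ⟶ P.X)
    [Cyclic P e] (f : P.X ⟶ Q.X) (e' : 𝟙_ C ⟶ Q.X)
    (hr : IntBgd.orbit P e ≫ f = ψ.hom ≫ IntBgd.orbit Q e')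
    (hl : IntBgd.lorbit P e ≫ f = φ.hom ≫ IntBgd.lorbit Q e') : Cell φ ψ P Q :=
  have hR : P.actRight ≫ f = (f ⊗ₘ ψ.hom) ≫ Q.actRight := by
    rw [← cancel_epi (IntBgd.orbit P e ▷ B.X), reassoc_of% (orbit_actRight P e), hr,
      MonoidalCategory.tensorHom_def, Category.assoc, ← comp_whiskerRight_assoc, hr,
      comp_whiskerRight, Category.assoc, ← whisker_exchange_assoc, orbit_actRight,
      ← MonoidalCategory.tensorHom_def_assoc, IsMonHom.mul_hom_assoc]
  { hom := f
    right := hR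
    -- Since a(eb) = (ae)b, right linearity together with the values at ae settles the whole left
    -- action.
    left := by
      rw [← cancel_epi (A.X ◁ IntBgd.orbit P e), reassoc_of% (orbit_actLeft P e), hR,
        MonoidalCategory.tensorHom_def, MonoidalCategory.tensorHom_def', Category.assoc,
        Category.assoc, ← comp_whiskerRight_assoc, hl, ← MonoidalCategory.whiskerLeft_comp_assoc,
        hr, MonoidalCategory.whiskerLeft_comp_assoc, whisker_exchange_assoc,
        whisker_exchange_assoc, orbit_actLeft, comp_whiskerRight_assoc,
        whisker_exchange_assoc] }

theorem Cell.ofOrbit_hom {φ : A ⟶ A'} {ψ : B ⟶ B'} {P : Bimod A B} {Q : Bimod A' B'}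
    (e : 𝟙_ C ⟶ P.X) [Cyclic P e] (f : P.X ⟶ Q.X) (e' : 𝟙_ C ⟶ Q.X)
    (hr : IntBgd.orbit P e ≫ f = ψ.hom ≫ IntBgd.orbit Q e')
    (hl : IntBgd.lorbit P e ≫ f = φ.hom ≫ IntBgd.lorbit Q e') :
    (Cell.ofOrbit e f e' hr hl).hom = f := rfl

/-- A morphism of left modules determined by its value on a generator. -/
def Cell.ofLorbit [BraidedCategory C] {φ : A ⟶ A'} {P : Bimod A (𝟙_ (Mon C))} {Q : Bimod A' (𝟙_ (Mon C))}
    (e : 𝟙_ C ⟶ P.X) [LeftCyclic P e] (f : P.X ⟶ Q.X) (e' : 𝟙_ C ⟶ Q.X)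
    (hl : IntBgd.lorbit P e ≫ f = φ.hom ≫ IntBgd.lorbit Q e') : Cell φ (𝟙 (𝟙_ (Mon C))) P Q where
  hom := f
  left := by
    rw [← cancel_epi (A.X ◁ IntBgd.lorbit P e), reassoc_of% (lorbit_actLeft P e), hl,
      MonoidalCategory.tensorHom_def', Category.assoc, ← MonoidalCategory.whiskerLeft_comp_assoc,
      hl, MonoidalCategory.whiskerLeft_comp_assoc, whisker_exchange_assoc, lorbit_actLeft,
      ← MonoidalCategory.tensorHom_def'_assoc, IsMonHom.mul_hom_assoc]
  -- Right actions of the unit monoid are unitors, so only naturality is left.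
  right := by
    rw [actRight_unit, actRight_unit]
    change _ = (f ⊗ₘ 𝟙 (𝟙_ C)) ≫ _
    simp

theorem Cell.ofLorbit_hom [BraidedCategory C] {φ : A ⟶ A'} {P : Bimod A (𝟙_ (Mon C))} {Q : Bimod A' (𝟙_ (Mon C))}
    (e : 𝟙_ C ⟶ P.X) [LeftCyclic P e] (f : P.X ⟶ Q.X) (e' : 𝟙_ C ⟶ Q.X)
    (hl : IntBgd.lorbit P e ≫ f = φ.hom ≫ IntBgd.lorbit Q e') :
    (Cell.ofLorbit e f e' hl).hom = f := rfl

section Tens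
variable [HasCoequalizers C]
variable [∀ X : C, PreservesColimitsOfShape WalkingParallelPair (tensorLeft X)]
variable [∀ X : C, PreservesColimitsOfShape WalkingParallelPair (tensorRight X)]

/-- The map `n ↦ x ⊗ n`. -/
noncomputable def insRight {P : Bimod A B} (x : 𝟙_ C ⟶ P.X) (N : Bimod B D) :
    N.X ⟶ (tens P N).X := (λ_ N.X).inv ≫ x ▷ N.X ≫ proj P N

/-- The map `p ↦ p ⊗ y`. -/
noncomputable def insLeft (P : Bimod A B) {N : Bimod B D} (y : 𝟙_ C ⟶ N.X) :
    P.X ⟶ (tens P N).X := (ρ_ P.X).inv ≫ P.X ◁ y ≫ proj P N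

theorem comp_insRight {P : Bimod A B} {N : Bimod B D} (x : 𝟙_ C ⟶ P.X) (y : 𝟙_ C ⟶ N.X) :
    y ≫ insRight x N = tensPoint x y := by
  rw [insRight, tensPoint, tensorPoint_eq_right]; simp

theorem comp_insLeft {P : Bimod A B} {N : Bimod B D} (x : 𝟙_ C ⟶ P.X) (y : 𝟙_ C ⟶ N.X) :
    x ≫ insLeft P y = tensPoint x y := by
  rw [insLeft, tensPoint, tensorPoint_eq_left]; simp

theorem insRight_actRight {P : Bimod A B} (x : 𝟙_ C ⟶ P.X) (N : Bimod B D) :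
    insRight x N ▷ D.X ≫ (tens P N).actRight = N.actRight ≫ insRight x N := by
  have h := proj_actRight P N
  simp only [insRight, comp_whiskerRight, Category.assoc, h]
  rw [leftUnitor_inv_naturality_assoc, whisker_exchange_assoc]
  simp

theorem insLeft_actLeft (P : Bimod A B) {N : Bimod B D} (y : 𝟙_ C ⟶ N.X) :
    A.X ◁ insLeft P y ≫ (tens P N).actLeft = P.actLeft ≫ insLeft P y := by
  have h := proj_actLeft P N
  simp only [insLeft, MonoidalCategory.whiskerLeft_comp, Category.assoc, h]
  rw [rightUnitor_inv_naturality_assoc, ← whisker_exchange_assoc]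
  simp

theorem orbit_tens {P : Bimod A B} {N : Bimod B D} (x : 𝟙_ C ⟶ P.X) (y : 𝟙_ C ⟶ N.X) :
    orbit (tens P N) (tensPoint x y) = orbit N y ≫ insRight x N := by
  rw [orbit, ← comp_insRight, comp_whiskerRight_assoc, insRight_actRight, orbit]
  simp

theorem lorbit_tens {P : Bimod A B} {N : Bimod B D} (x : 𝟙_ C ⟶ P.X) (y : 𝟙_ C ⟶ N.X) :
    lorbit (tens P N) (tensPoint x y) = lorbit P x ≫ insLeft P y := by
  rw [lorbit, ← comp_insLeft, MonoidalCategory.whiskerLeft_comp_assoc, insLeft_actLeft, lorbit]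
  simp

/-- The coequalizer relation xb ⊗ y = x ⊗ by for fixed x and y. It moves a base element from the
first generator across to the second. -/
theorem orbit_insLeft {P : Bimod A B} {N : Bimod B D} (x : 𝟙_ C ⟶ P.X) (y : 𝟙_ C ⟶ N.X) :
    orbit P x ≫ insLeft P y = lorbit N y ≫ insRight x N := by
  have h := proj_condition P N
  have key : (λ_ B.X).inv ≫ x ▷ B.X ≫ (ρ_ _).inv ≫ (P.X ⊗ B.X) ◁ y ≫ (α_ _ _ _).hom =
      (ρ_ _).inv ≫ B.X ◁ y ≫ (λ_ _).inv ≫ x ▷ (B.X ⊗ N.X) := by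
    rw [leftUnitor_inv_naturality_assoc, whisker_exchange]
    monoidal
  rw [orbit, insLeft, lorbit, insRight]
  simp only [Category.assoc]
  rw [rightUnitor_inv_naturality_assoc, leftUnitor_inv_naturality_assoc,
    ← whisker_exchange_assoc, h, reassoc_of% key, whisker_exchange_assoc]

/-- Every p has the form xb, and xb ⊗ n = x ⊗ bn. So the projection, precomposed with the orbit map
of `x`, factors through `insRight x N`. -/
theorem stableEpi_insRight (P : Bimod A B) (x : 𝟙_ C ⟶ P.X) [Cyclic P x] (N : Bimod B D) :
    StableEpi (insRight x N) := by
  have h : orbit P x ▷ N.X ≫ proj P N = N.actLeft ≫ insRight x N := by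
    have h := proj_condition P N
    rw [orbit, insRight]
    simp only [comp_whiskerRight, Category.assoc, h]
    rw [leftUnitor_inv_naturality_assoc, whisker_exchange_assoc]
    simp
  have : StableEpi (orbit P x ▷ N.X ≫ proj P N) := inferInstance
  rw [h] at this
  exact stableEpi_of_comp N.actLeft _

theorem Cyclic.tens {P : Bimod A B} {N : Bimod B D} {x : 𝟙_ C ⟶ P.X} {y : 𝟙_ C ⟶ N.X}
    (_ : Cyclic P x) (_ : Cyclic N y) : Cyclic (IntBgd.tens P N) (tensPoint x y) :=
  ⟨by
    have := stableEpi_insRight P x N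
    rw [orbit_tens]
    infer_instance⟩

/-- The morphism of module tensor products induced by a morphism of right modules and a morphism
of left modules. -/
noncomputable def tensMap {P : Bimod A B} {Q : Bimod A' B'} {N : Bimod B D} {S : Bimod B' D'}
    {b : B.X ⟶ B'.X} (f : P.X ⟶ Q.X) (g : N.X ⟶ S.X)
    (hf : P.actRight ≫ f = (f ⊗ₘ b) ≫ Q.actRight) (hg : N.actLeft ≫ g = (b ⊗ₘ g) ≫ S.actLeft) :
    (tens P N).X ⟶ (tens Q S).X :=
  tensDesc P N ((f ⊗ₘ g) ≫ proj Q S) (by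
    have h1 : P.actRight ▷ N.X ≫ (f ⊗ₘ g) = ((f ⊗ₘ b) ⊗ₘ g) ≫ Q.actRight ▷ S.X := by
      simp only [← tensorHom_id, tensorHom_comp_tensorHom, hf, Category.id_comp,
        Category.comp_id]
    have h2 : P.X ◁ N.actLeft ≫ (f ⊗ₘ g) = (f ⊗ₘ (b ⊗ₘ g)) ≫ Q.X ◁ S.actLeft := by
      simp only [← id_tensorHom, tensorHom_comp_tensorHom, hg, Category.id_comp,
        Category.comp_id]
    rw [reassoc_of% h1, proj_condition, reassoc_of% h2]
    simp)

theorem proj_tensMap {P : Bimod A B} {Q : Bimod A' B'} {N : Bimod B D} {S : Bimod B' D'}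
    {b : B.X ⟶ B'.X} (f : P.X ⟶ Q.X) (g : N.X ⟶ S.X)
    (hf : P.actRight ≫ f = (f ⊗ₘ b) ≫ Q.actRight) (hg : N.actLeft ≫ g = (b ⊗ₘ g) ≫ S.actLeft) :
    proj P N ≫ tensMap f g hf hg = (f ⊗ₘ g) ≫ proj Q S := proj_tensDesc _ _ _ _

theorem isIso_hcomp {φ : A ⟶ A'} {ψ ψ' : B ⟶ B'} {χ : D ⟶ D'}
    {P : Bimod A B} {Q : Bimod A' B'} {N : Bimod B D} {S : Bimod B' D'}
    (f : Cell φ ψ P Q) (g : Cell ψ' χ N S) (h : ψ = ψ') [IsIso f.hom] [IsIso g.hom]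
    [IsIso ψ.hom] : IsIso (Cell.hcomp f g h).hom := by
  subst h
  -- The inverse of `ψ.hom` is taken in `C` only, which is why `tensMap` asks for a bare base
  -- morphism instead of a monoid morphism.
  refine ⟨tensMap (b := inv ψ.hom) (inv f.hom) (inv g.hom) ?_ ?_, ?_, ?_⟩
  · rw [← cancel_epi (f.hom ⊗ₘ ψ.hom), ← f.right_assoc]
    simp
  · rw [← cancel_epi (ψ.hom ⊗ₘ g.hom), ← g.left_assoc]
    simp
  · rw [← cancel_epi (proj P N), Cell.proj_hcomp_assoc, proj_tensMap]
    simp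
  · rw [← cancel_epi (proj Q S), reassoc_of% (proj_tensMap (inv f.hom) (inv g.hom)),
      Cell.proj_hcomp]
    simp

instance (P : Bimod A B) (N : Bimod B D) (S : Bimod D E) : IsIso (assocHom P N S).hom :=
  ⟨assocInvX P N S, assoc_hom_inv P N S, assoc_inv_hom P N S⟩

/-- The map p ↦ 1 ⊗ p is a section of the unit cell, and it is epi because the regular bimodule is
generated by 1. Hence it is a two-sided inverse. -/
instance (P : Bimod A B) : IsIso (leftUnit P).hom := by
  have h : insRight (regPoint A) P ≫ (leftUnit P).hom = 𝟙 _ := by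
    have e : regPoint A ▷ P.X ≫ P.actLeft = (λ_ P.X).hom := P.one_actLeft
    rw [insRight, Category.assoc, Category.assoc, proj_leftUnit, e, Iso.inv_hom_id]
  have := stableEpi_insRight (reg A) (regPoint A) P
  refine ⟨insRight (regPoint A) P, ?_, h⟩
  rw [← cancel_epi (insRight (regPoint A) P), reassoc_of% h, Category.comp_id]

/-- The cell `f_* ⊗ N ⟶ N` along `f`, given by `b ⊗ n ↦ b n`. -/
noncomputable def companionCell (f : A ⟶ B) (N : Bimod B D) :
    Cell f (𝟙 D) (tens (companion f) N) N :=
  (((resCell f (𝟙 B) (reg B)).hcomp (Cell.id N)).comp (leftUnit N)).cast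

theorem tensPoint_companionCell (f : A ⟶ B) (N : Bimod B D) (x : 𝟙_ C ⟶ N.X) :
    tensPoint (companionPoint f) x ≫ (companionCell f N).hom = x := by
  simp only [companionCell, Cell.cast_hom, Cell.comp_hom, ← Category.assoc]
  rw [tensPoint_hcomp, companionPoint_resCell, Cell.id_hom, Category.comp_id,
    tensPoint_leftUnit]

end Tens

end Orbits

end IntBgd


namespace IntBgd

/-! ### Generators of pseudo-monoids, and coherence axioms checked on them. -/

section BoxOrbits
set_option linter.unusedSectionVars false
variable {C : Type u} [Category.{v} C] [MonoidalCategory C] [BraidedCategory C]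
variable {A A' B B' D D' E E' : Mon C}

theorem orbit_box {P : Bimod A B} {P' : Bimod A' B'} (x : 𝟙_ C ⟶ P.X) (y : 𝟙_ C ⟶ P'.X) :
    orbit (box P P') (boxPoint x y) = (orbit P x ⊗ₘ orbit P' y) := by
  have h : (λ_ (B.X ⊗ B'.X)).inv ≫ (λ_ (𝟙_ C)).inv ▷ (B.X ⊗ B'.X) ≫ tensorμ (𝟙_ C) (𝟙_ C) B.X B'.X =
      ((λ_ B.X).inv ⊗ₘ (λ_ B'.X).inv) := by
    rw [← cancel_mono ((λ_ B.X).hom ⊗ₘ (λ_ B'.X).hom), Category.assoc, Category.assoc,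
      ← tensor_left_unitality]
    simp
  change (λ_ (B.X ⊗ B'.X)).inv ≫ ((λ_ (𝟙_ C)).inv ≫ (x ⊗ₘ y)) ▷ (B.X ⊗ B'.X) ≫
    tensorμ _ _ _ _ ≫ (P.actRight ⊗ₘ P'.actRight) = _
  rw [comp_whiskerRight, Category.assoc, tensorμ_natural_left_assoc, reassoc_of% h, orbit, orbit]
  simp

theorem lorbit_box {P : Bimod A B} {P' : Bimod A' B'} (x : 𝟙_ C ⟶ P.X) (y : 𝟙_ C ⟶ P'.X) :
    lorbit (box P P') (boxPoint x y) = (lorbit P x ⊗ₘ lorbit P' y) := by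
  have h : (ρ_ (A.X ⊗ A'.X)).inv ≫ (A.X ⊗ A'.X) ◁ (λ_ (𝟙_ C)).inv ≫ tensorμ A.X A'.X (𝟙_ C) (𝟙_ C) =
      ((ρ_ A.X).inv ⊗ₘ (ρ_ A'.X).inv) := by
    rw [← cancel_mono ((ρ_ A.X).hom ⊗ₘ (ρ_ A'.X).hom), Category.assoc, Category.assoc,
      ← tensor_right_unitality]
    simp
  change (ρ_ (A.X ⊗ A'.X)).inv ≫ (A.X ⊗ A'.X) ◁ ((λ_ (𝟙_ C)).inv ≫ (x ⊗ₘ y)) ≫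
    tensorμ _ _ _ _ ≫ (P.actLeft ⊗ₘ P'.actLeft) = _
  rw [MonoidalCategory.whiskerLeft_comp, Category.assoc, tensorμ_natural_right_assoc,
    reassoc_of% h, lorbit, lorbit]
  simp

theorem Cyclic.box {P : Bimod A B} {P' : Bimod A' B'} {x : 𝟙_ C ⟶ P.X} {y : 𝟙_ C ⟶ P'.X}
    (_ : Cyclic P x) (_ : Cyclic P' y) : Cyclic (IntBgd.box P P') (boxPoint x y) :=
  ⟨by rw [orbit_box]; infer_instance⟩

/-- Cyclicity travels backwards along an invertible cell. This is used where a module is visibly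
cyclic only after regrouping its factors. -/
theorem Cyclic.of_cell_target {φ : A ⟶ A'} {ψ : B ⟶ B'} {P : Bimod A B} {Q : Bimod A' B'}
    (f : Cell φ ψ P Q) (e : 𝟙_ C ⟶ P.X) (e' : 𝟙_ C ⟶ Q.X) (he : e ≫ f.hom = e') [Cyclic Q e']
    [IsIso f.hom] [IsIso ψ.hom] : Cyclic P e := by
  have h : IntBgd.orbit P e = ψ.hom ≫ IntBgd.orbit Q e' ≫ inv f.hom := by
    rw [← he, ← reassoc_of% (orbit_cell f e), IsIso.hom_inv_id, Category.comp_id]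
  exact ⟨by rw [h]; infer_instance⟩

instance (P : Bimod A B) : IsIso (Cell.id P).hom := by
  rw [Cell.id_hom]; infer_instance

variable [HasCoequalizers C]
variable [∀ X : C, PreservesColimitsOfShape WalkingParallelPair (tensorLeft X)]
variable [∀ X : C, PreservesColimitsOfShape WalkingParallelPair (tensorRight X)]

instance (P : Bimod A B) (P' : Bimod A' B') (N : Bimod B D) (N' : Bimod B' D') :
    IsIso (interchange P P' N N').hom := by
  refine ⟨interchangeInvX P P' N N', ?_, ?_⟩
  · have h := proj_interchangeX P P' N N'
    rw [← cancel_epi (proj (box P P') (box N N'))]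
    change _ ≫ interchangeX P P' N N' ≫ _ = _
    rw [reassoc_of% h, proj_interchangeInvX, tensorμ_interchangePre, Category.comp_id]
  · have h := proj_interchangeInvX P P' N N'
    change interchangeInvX P P' N N' ≫ interchangeX P P' N N' = 𝟙 ((tens P N).X ⊗ (tens P' N').X)
    rw [← cancel_epi (proj P N ⊗ₘ proj P' N'), reassoc_of% h, interchangePre, Category.assoc,
      proj_interchangeX, tensorδ_tensorμ_assoc]
    simp

instance (m : Bimod A (B ⊗ B')) (N : Bimod B D) (N' : Bimod B' D')
    (S : Bimod D E) (S' : Bimod D' E') : IsIso (collect m N N' S S').hom := by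
  rw [collect, Cell.cast_hom, Cell.comp_hom]
  have : IsIso ((𝟙 (B ⊗ B') : (B ⊗ B') ⟶ (B ⊗ B')).hom) := by
    rw [Mon.id_hom']; infer_instance
  have := isIso_hcomp (Cell.id m) (interchange N N' S S') rfl
  infer_instance

/-- Generators of the 1-cells of a pseudo-monoid on which the constraints take the standard
values. -/
structure Generators (P : PseudomonoidData C) where
  e : 𝟙_ C ⟶ P.M.X
  u : 𝟙_ C ⟶ P.J.X
  cyclic : Cyclic P.M e
  cyclic_left : Cyclic (tens P.M (box P.J (reg P.A))) (tensPoint e (boxPoint u (regPoint P.A)))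
  cyclic_right : Cyclic (tens P.M (box (reg P.A) P.J)) (tensPoint e (boxPoint (regPoint P.A) u))
  point_l : tensPoint e (boxPoint u (regPoint P.A)) ≫ P.l.hom = regPoint P.A
  point_r : tensPoint e (boxPoint (regPoint P.A) u) ≫ P.r.hom = regPoint P.A
  point_a : tensPoint e (boxPoint e (regPoint P.A)) ≫ P.a.hom =
    tensPoint e (boxPoint (regPoint P.A) e)

attribute [instance] Generators.cyclic Generators.cyclic_left Generators.cyclic_right

theorem comp_cell_comp {φ : A ⟶ B} {ψ : A' ⟶ B'} {φ' : B ⟶ D} {ψ' : B' ⟶ D'}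
    {P : Bimod A A'} {Q : Bimod B B'} {S : Bimod D D'} (f : Cell φ ψ P Q) (g : Cell φ' ψ' Q S)
    {X : C} (x : X ⟶ P.X) : x ≫ (f.comp g).hom = (x ≫ f.hom) ≫ g.hom := by
  rw [Cell.comp_hom, Category.assoc]

theorem comp_cell_id {P : Bimod A B} {X : C} (x : X ⟶ P.X) : x ≫ (Cell.id P).hom = x := by
  rw [Cell.id_hom, Category.comp_id]

namespace Generators

theorem cyclic_assoc {P : PseudomonoidData C} (G : Generators P) :
    Cyclic (tens P.M (box P.M (reg P.A))) (tensPoint G.e (boxPoint G.e (regPoint P.A))) :=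
  G.cyclic.tens (G.cyclic.box (cyclic_reg P.A))

/-- The common source is generated by a pure tensor of three copies of `e` and units. Both sides
send it to the same pure tensor, because `a` sends e ⊗ (e ⊗ 1) to e ⊗ (1 ⊗ e). -/
theorem pentagon {P : PseudomonoidData C} (G : Generators P) : P.Pentagon := by
  have := G.cyclic_assoc.tens ((G.cyclic.box (cyclic_reg P.A)).box (cyclic_reg P.A))
  rw [PseudomonoidData.Pentagon, ← cancel_epi (orbit _ (tensPoint (tensPoint G.e (boxPoint G.e
    (regPoint P.A))) (boxPoint (boxPoint G.e (regPoint P.A)) (regPoint P.A))))]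
  simp only [orbit_cell_assoc, orbit_cell]
  simp only [tensPoint_collect, tensPoint_hcomp, boxPoint_box,
    G.point_a, comp_cell_id, tensPoint_distribute, boxPoint_boxAssoc,
    tensPoint_unitSwapBox, tensPoint_unitSwapBoxInv]
  -- What remains concerns the base morphisms: the pentagon for the associator of `C`.
  simp

/-- `J` need not be cyclic as a right module over the unit monoid, so the source is not a tensor
product of cyclic modules as it stands. The regrouping by `collect` exposes M ⊗ (A ⊠ J), which is
generated by `cyclic_right`. -/
theorem triangle {P : PseudomonoidData C} (G : Generators P) : P.Triangle := by
  have h1 := G.cyclic.tens (G.cyclic_right.box ((cyclic_reg P.A).tens (cyclic_reg P.A)))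
  have : IsIso ((𝟙 ((P.A ⊗ P.A)) : _ ⟶ ((P.A ⊗ P.A))).hom) := by
    rw [Mon.id_hom']; infer_instance
  have := Cyclic.of_cell_target (collect P.M P.M (reg P.A) (box (reg P.A) P.J) (reg P.A)) 
    _ _ (tensPoint_collect G.e G.e (regPoint P.A) (boxPoint (regPoint P.A) G.u) (regPoint P.A)) 
  rw [PseudomonoidData.Triangle, ← cancel_epi (orbit _ (tensPoint (tensPoint G.e (boxPoint G.e
    (regPoint P.A))) (boxPoint (boxPoint (regPoint P.A) G.u) (regPoint P.A))))]
  simp only [orbit_cell_assoc, orbit_cell]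
  simp only [tensPoint_collect, tensPoint_hcomp, boxPoint_box,
    G.point_a, G.point_l, G.point_r, comp_cell_id, boxPoint_boxAssoc,
    tensPoint_leftUnit]
  simp

/-- The structure of a monoidal morphism on a companion, from 2-cells preserving generators. -/
noncomputable def monoidalStr {P Q : PseudomonoidData C} (G : Generators P) (H : Generators Q)
    (f : Q.A ⟶ P.A) (τ : BimHom (tens Q.M (box (companion f) (companion f)))
      (tens (companion f) P.M)) (υ : BimHom Q.J (tens (companion f) P.J))
    (hτ : tensPoint H.e (boxPoint (companionPoint f) (companionPoint f)) ≫ τ.hom =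
      tensPoint (companionPoint f) G.e)
    (hυ : H.u ≫ υ.hom = tensPoint (companionPoint f) G.u) :
    MonoidalStr P Q (companion f) where
  tensorCell := τ
  unitCell := υ
  left_unit := by
    -- Again `J` enters only through the module M ⊗ (J ⊠ A), which is generated even if `J` is not.
    have := H.cyclic_left.tens ((cyclic_reg (𝟙_ (Mon C))).box (cyclic_companion f))
    rw [← cancel_epi (orbit _ (tensPoint (tensPoint H.e (boxPoint H.u
      (regPoint Q.A))) (boxPoint (regPoint (𝟙_ (Mon C))) (companionPoint f))))]
    simp only [orbit_cell_assoc, orbit_cell]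
    simp only [tensPoint_collect, tensPoint_hcomp, boxPoint_box, comp_cell_comp,
      G.point_l, H.point_l, comp_cell_id, tensPoint_extend τ hτ,
      tensPoint_leftUnit, tensPoint_rightUnit, hυ, tensPoint_unitSwap, boxPoint_boxLeftUnit]
    simp
  right_unit := by
    have := H.cyclic_right.tens ((cyclic_companion f).box (cyclic_reg (𝟙_ (Mon C))))
    rw [← cancel_epi (orbit _ (tensPoint (tensPoint H.e (boxPoint (regPoint Q.A) H.u))
      (boxPoint (companionPoint f) (regPoint (𝟙_ (Mon C))))))]
    simp only [orbit_cell_assoc, orbit_cell]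
    simp only [tensPoint_collect, tensPoint_hcomp, boxPoint_box, comp_cell_comp,
      G.point_r, H.point_r, comp_cell_id, tensPoint_extend τ hτ,
      tensPoint_leftUnit, tensPoint_rightUnit, hυ, tensPoint_unitSwap, boxPoint_boxRightUnit]
    simp
  assoc := by
    have := H.cyclic_assoc.tens (((cyclic_companion f).box (cyclic_companion f)).box
      (cyclic_companion f))
    rw [← cancel_epi (orbit _ (tensPoint (tensPoint H.e (boxPoint H.e (regPoint Q.A)))
      (boxPoint (boxPoint (companionPoint f) (companionPoint f)) (companionPoint f))))]
    simp only [orbit_cell_assoc, orbit_cell]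
    simp only [tensPoint_collect, tensPoint_hcomp, boxPoint_box,
      G.point_a, H.point_a, comp_cell_id, tensPoint_extend τ hτ, hτ, boxPoint_boxAssoc,
      tensPoint_unitSwap]
    simp

end Generators

end BoxOrbits
end IntBgd


namespace IntBgd

/-! ### The two inclusions into a tensor product of monoids. -/

section Inclusions
set_option linter.unusedSectionVars false
variable {C : Type u} [Category.{v} C] [MonoidalCategory C]

variable [BraidedCategory C]

/-- The unit of a monoid, as a monoid morphism. -/
def unitHom (A : Mon C) : 𝟙_ (Mon C) ⟶ A where
  hom := η[A.X]
  isMonHom_hom := {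
    one_hom := Category.id_comp _
    mul_hom := by
      change (λ_ (𝟙_ C)).hom ≫ η[A.X] = (η[A.X] ⊗ₘ η[A.X]) ≫ μ[A.X]
      rw [MonoidalCategory.tensorHom_def', Category.assoc, MonObj.one_mul]
      simp }

/-- The monoid morphism `a ↦ a ⊗ 1`. -/
def inl (A B : Mon C) : A ⟶ A ⊗ B := (ρ_ A).inv ≫ A ◁ unitHom B

/-- The monoid morphism `b ↦ 1 ⊗ b`. -/
def inr (A B : Mon C) : B ⟶ A ⊗ B := (λ_ B).inv ≫ unitHom A ▷ B

theorem inl_hom (A B : Mon C) : (inl A B).hom = (ρ_ A.X).inv ≫ A.X ◁ η[B.X] := rfl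
theorem inr_hom (A B : Mon C) : (inr A B).hom = (λ_ B.X).inv ≫ η[A.X] ▷ B.X := rfl

theorem mul_tensor (A B : Mon C) :
    μ[(A ⊗ B).X] = tensorμ A.X B.X A.X B.X ≫ (μ[A.X] ⊗ₘ μ[B.X]) := rfl

/-- In elements, (a ⊗ 1)(1 ⊗ b) = a ⊗ b. Hence a monoid morphism out of `A ⊗ B` is determined by its
restrictions to the factors, which is how `hom_eq` recovers χ from s and t. -/
theorem inl_inr_mul (A B : Mon C) :
    ((inl A B).hom ⊗ₘ (inr A B).hom) ≫ μ[(A ⊗ B).X] = 𝟙 (A.X ⊗ B.X) := by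
  rw [inl_hom, inr_hom, mul_tensor, ← tensorHom_comp_tensorHom, ← id_tensorHom, ← tensorHom_id,
    Category.assoc, tensorμ_natural_assoc, tensorHom_comp_tensorHom, id_tensorHom, tensorHom_id,
    MonObj.mul_one, MonObj.one_mul, tensorμ]
  simp only [braiding_tensorUnit_left]
  monoidal

theorem inr_inl_mul (A B : Mon C) :
    ((inr A B).hom ⊗ₘ (inl A B).hom) ≫ μ[(A ⊗ B).X] = (β_ B.X A.X).hom := by
  rw [inl_hom, inr_hom, mul_tensor, ← tensorHom_comp_tensorHom, ← id_tensorHom, ← tensorHom_id,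
    Category.assoc, tensorμ_natural_assoc, tensorHom_comp_tensorHom, id_tensorHom, tensorHom_id,
    MonObj.mul_one, MonObj.one_mul, tensorμ]
  monoidal

end Inclusions

/-! ### Monoids under R ⊗ Rᵒᵖ versus pairs of source and target maps. -/

section Symm
set_option linter.unusedSectionVars false
variable {C : Type u} [Category.{v} C] [MonoidalCategory C] [SymmetricCategory C]

/-- Reversing the factors produces the braiding twice, so the symmetry is needed here and not just a
braiding. -/
theorem inl_inr_comm (A B : Mon C) :
    ((inl A B).hom ⊗ₘ (inr A B).hom) ≫ μ[(A ⊗ B).X] =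
      ((inl A B).hom ⊗ₘ (inr A B).hom) ≫ (β_ _ _).hom ≫ μ[(A ⊗ B).X] := by
  rw [BraidedCategory.braiding_naturality_assoc, inr_inl_mul, inl_inr_mul,
    SymmetricCategory.symmetry]

/-- The source and target maps of a monoid under `R ⊗ Rᵒᵖ`. -/
abbrev BialgebroidBase.ofEnv {R A : Mon C} (χ : env R ⟶ A) : BialgebroidBase R where
  A := A
  s := inl R (op R) ≫ χ
  t := inr R (op R) ≫ χ
  comm := by
    have h := congrArg (· ≫ χ.hom) (inl_inr_comm R (op R))
    simp only [Category.assoc, IsMonHom.mul_hom,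
      ← BraidedCategory.braiding_naturality_assoc] at h
    rw [Mon.comp_hom', Mon.comp_hom', ← tensorHom_comp_tensorHom, Category.assoc, Category.assoc]
    exact h

/-- Isolates the two middle factors, which are the ones exchanged when `χ` is shown to be
multiplicative. -/
theorem mul_four (A : C) [MonObj A] : (μ[A] ⊗ₘ μ[A]) ≫ μ[A] =
    (α_ _ _ _).hom ≫ A ◁ (α_ _ _ _).inv ≫ A ◁ μ[A] ▷ A ≫ A ◁ μ[A] ≫ μ[A] := by
  rw [MonoidalCategory.tensorHom_def', Category.assoc, MonObj.mul_assoc,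
    associator_naturality_right_assoc, ← MonoidalCategory.whiskerLeft_comp_assoc,
    ← MonoidalCategory.whiskerLeft_comp_assoc, ← MonoidalCategory.whiskerLeft_comp_assoc,
    Category.assoc, MonObj.mul_assoc, Iso.inv_hom_id_assoc]

theorem tensor_four {X Y Z W X' Y' Z' W' V : C} (f : X ⟶ X') (g : Y ⟶ Y') (h : Z ⟶ Z')
    (k : W ⟶ W') (q : Y' ⊗ Z' ⟶ V) :
    ((f ⊗ₘ g) ⊗ₘ (h ⊗ₘ k)) ≫ (α_ _ _ _).hom ≫ X' ◁ (α_ _ _ _).inv ≫ X' ◁ q ▷ W' =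
      (α_ _ _ _).hom ≫ X ◁ (α_ _ _ _).inv ≫ (f ⊗ₘ (((g ⊗ₘ h) ≫ q) ⊗ₘ k)) := by
  rw [associator_naturality_assoc, ← id_tensorHom, ← id_tensorHom, tensorHom_comp_tensorHom_assoc,
    associator_inv_naturality, Category.comp_id, tensorHom_comp_tensorHom, Category.comp_id,
    Category.assoc, ← tensorHom_id, tensorHom_comp_tensorHom, Category.comp_id, ← id_tensorHom,
    tensorHom_comp_tensorHom, Category.id_comp]

/-- The monoid morphism `r ⊗ r' ↦ s(r) t(r')`. -/
def BialgebroidBase.χ {R : Mon C} (H : BialgebroidBase R) : env R ⟶ H.A where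
  hom := (H.s.hom ⊗ₘ H.t.hom) ≫ μ[H.A.X]
  isMonHom_hom := {
    one_hom := by
      have h1 : η[R.X] ≫ H.s.hom = η[H.A.X] := IsMonHom.one_hom H.s.hom
      have h2 : η[R.X] ≫ H.t.hom = η[H.A.X] := IsMonHom.one_hom H.t.hom
      change ((λ_ (𝟙_ C)).inv ≫ (η[R.X] ⊗ₘ η[R.X])) ≫ (H.s.hom ⊗ₘ H.t.hom) ≫ μ[H.A.X] = _
      rw [Category.assoc, tensorHom_comp_tensorHom_assoc, h1, h2, ← Category.assoc]
      exact tensorPoint_one_mul _ _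
    mul_hom := by
      have h1 : μ[R.X] ≫ H.s.hom = (H.s.hom ⊗ₘ H.s.hom) ≫ μ[H.A.X] := IsMonHom.mul_hom H.s.hom
      have h2 : ((β_ R.X R.X).hom ≫ μ[R.X]) ≫ H.t.hom = (H.t.hom ⊗ₘ H.t.hom) ≫ μ[H.A.X] :=
        IsMonHom.mul_hom H.t.hom
      -- That s and t commute, in the form that swaps the middle factors of s(r) t(r') s(x) t(x').
      have h3 : (H.t.hom ⊗ₘ H.s.hom) ≫ μ[H.A.X] =
          (β_ R.X R.X).hom ≫ (H.s.hom ⊗ₘ H.t.hom) ≫ μ[H.A.X] := by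
        rw [H.comm, ← BraidedCategory.braiding_naturality_assoc, SymmetricCategory.symmetry_assoc]
      change (tensorμ R.X R.X R.X R.X ≫ (μ[R.X] ⊗ₘ ((β_ R.X R.X).hom ≫ μ[R.X]))) ≫
        (H.s.hom ⊗ₘ H.t.hom) ≫ μ[H.A.X] =
          (((H.s.hom ⊗ₘ H.t.hom) ≫ μ[H.A.X]) ⊗ₘ ((H.s.hom ⊗ₘ H.t.hom) ≫ μ[H.A.X])) ≫ μ[H.A.X]
      rw [Category.assoc, tensorHom_comp_tensorHom_assoc, h1, h2,
        ← tensorHom_comp_tensorHom, ← tensorHom_comp_tensorHom, Category.assoc, Category.assoc,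
        mul_four]
      have e1 := tensor_four H.s.hom H.s.hom H.t.hom H.t.hom μ[H.A.X]
      have e2 := tensor_four H.s.hom H.t.hom H.s.hom H.t.hom μ[H.A.X]
      have e3 : (H.s.hom ⊗ₘ ((β_ R.X R.X).hom ≫ (H.s.hom ⊗ₘ H.t.hom) ≫ μ[H.A.X]) ⊗ₘ H.t.hom) =
          R.X ◁ (β_ R.X R.X).hom ▷ R.X ≫
            (H.s.hom ⊗ₘ ((H.s.hom ⊗ₘ H.t.hom) ≫ μ[H.A.X]) ⊗ₘ H.t.hom) := by
        rw [← id_tensorHom, ← tensorHom_id, tensorHom_comp_tensorHom, tensorHom_comp_tensorHom,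
          Category.id_comp, Category.id_comp]
      rw [reassoc_of% e1, reassoc_of% e2, h3, e3, tensorμ]
      simp }

end Symm
end IntBgd


namespace IntBgd

/-! ### The canonical pseudo-monoid evaluated at its units. -/

section EnvPoints
set_option linter.unusedSectionVars false
variable {C : Type u} [Category.{v} C] [MonoidalCategory C] [BraidedCategory C] (R : Mon C)

/-- The element `1` of `coev R`. -/
def coevPoint : 𝟙_ C ⟶ (coev R).X := η[R.X]

/-- The element `1` of `envJ R`. -/
def envUnit : 𝟙_ C ⟶ (envJ R).X := η[R.X]

/-- The element `1 ⊗ 1` of `envL R`. -/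
def envLPoint : 𝟙_ C ⟶ (envL R).X :=
  resPoint (ρ_ R).inv (𝟙 _) (box (reg R) (coev R)) (boxPoint (regPoint R) (coevPoint R))

/-- The element `1 ⊗ 1` of `envR R`. -/
def envRPoint : 𝟙_ C ⟶ (envR R).X :=
  resPoint (λ_ (op R)).inv (𝟙 _) (box (coev R) (reg (op R)))
    (boxPoint (coevPoint R) (regPoint (op R)))

/-- The element `1 ⊗ 1 ⊗ 1` of `envM R`. -/
def envOne : 𝟙_ C ⟶ (envM R).X :=
  resPoint (𝟙 _) (envPsi R) (box (envL R) (reg (op R)))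
    (boxPoint (envLPoint R) (regPoint (op R)))

theorem orbit_coev : orbit (coev R) (coevPoint R) = μ[R.X] := by
  change (λ_ (R.X ⊗ R.X)).inv ≫ η[R.X] ▷ (R.X ⊗ R.X) ≫
    (α_ _ _ _).inv ≫ ((β_ R.X R.X).hom ≫ μ[R.X]) ▷ R.X ≫ μ[R.X] = _
  rw [associator_inv_naturality_left_assoc, ← comp_whiskerRight_assoc,
    BraidedCategory.braiding_naturality_left_assoc, MonObj.mul_one, braiding_rightUnitor]
  simp

theorem lorbit_coev : lorbit (coev R) (coevPoint R) = η[R.X] := by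
  change (ρ_ (𝟙_ C)).inv ≫ (𝟙_ C) ◁ η[R.X] ≫ (λ_ R.X).hom = _
  simp [unitors_equal]

theorem orbit_envLPoint : orbit (envL R) (envLPoint R) = R.X ◁ μ[R.X] := by
  rw [envLPoint, orbit_res]
  change 𝟙 _ ≫ orbit (box (reg R) (coev R)) _ = _
  rw [orbit_box, orbit_reg, orbit_coev, Category.id_comp, id_tensorHom]

/-- In elements, a ⊗ a' ⊗ b ⊗ b' ↦ a ⊗ a'b ⊗ b', with the middle product taken in `R` and not in its
opposite. -/
theorem orbit_envOne : orbit (envM R) (envOne R) = (envPsi R).hom ≫ (R.X ◁ μ[R.X]) ▷ R.X := by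
  rw [envOne, orbit_res, orbit_box, orbit_reg, orbit_envLPoint, tensorHom_id]

theorem lorbit_envLPoint : lorbit (envL R) (envLPoint R) = (ρ_ R.X).inv ≫ R.X ◁ η[R.X] := by
  rw [envLPoint, lorbit_res]
  change (ρ_ R.X).inv ≫ lorbit (box (reg R) (coev R)) _ = _
  rw [lorbit_box, lorbit_reg, lorbit_coev, id_tensorHom]

theorem lorbit_envOne :
    lorbit (envM R) (envOne R) = ((ρ_ R.X).inv ≫ R.X ◁ η[R.X]) ▷ R.X := by
  rw [envOne, lorbit_res]
  change 𝟙 _ ≫ lorbit (box (envL R) (reg (op R))) _ = _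
  rw [lorbit_box, lorbit_reg, lorbit_envLPoint, Category.id_comp, tensorHom_id]

theorem lorbit_envUnit : lorbit (envJ R) (envUnit R) = μ[R.X] := by
  change (ρ_ (R.X ⊗ R.X)).inv ≫ (R.X ⊗ R.X) ◁ η[R.X] ≫
    (α_ _ _ _).hom ≫ R.X ◁ ((β_ R.X R.X).hom ≫ μ[R.X]) ≫ μ[R.X] = _
  rw [associator_naturality_right_assoc, ← MonoidalCategory.whiskerLeft_comp_assoc,
    BraidedCategory.braiding_naturality_right_assoc, MonObj.one_mul, braiding_leftUnitor]
  simp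

theorem tensor_envPsi {X Y Z W : C} (f : X ⟶ R.X) (g : Y ⟶ R.X) (h : Z ⟶ R.X) (k : W ⟶ R.X) :
    ((f ⊗ₘ g) ⊗ₘ (h ⊗ₘ k)) ≫ orbit (envM R) (envOne R) =
      (α_ _ _ _).inv ≫ (α_ _ _ _).hom ▷ W ≫ ((f ⊗ₘ ((g ⊗ₘ h) ≫ μ[R.X])) ⊗ₘ k) := by
  rw [orbit_envOne]
  change _ ≫ ((α_ (R.X ⊗ R.X) R.X R.X).inv ≫ (α_ R.X R.X R.X).hom ▷ R.X) ≫ _ = _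
  simp only [← id_tensorHom, ← tensorHom_id, tensorHom_comp_tensorHom, Category.assoc,
    associator_inv_naturality_assoc, Category.comp_id, associator_naturality_assoc,
    Category.id_comp]

/-- The multiplication of `R` has the section 1 ⊗ -, hence is a stable epi, and the orbit map is a
regrouping followed by that multiplication in the middle slot. -/
instance cyclic_envOne : Cyclic (envM R) (envOne R) where
  stableEpi := by
    have h : StableEpi (R.X ◁ μ[R.X]) := by
      have : StableEpi (μ[R.X]) := by
        have : StableEpi (((λ_ R.X).inv ≫ η[R.X] ▷ R.X) ≫ μ[R.X]) := by
          rw [Category.assoc, MonObj.one_mul]; infer_instance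
        exact stableEpi_of_comp ((λ_ R.X).inv ≫ η[R.X] ▷ R.X) _
      infer_instance
    rw [orbit_envOne]
    have : IsIso (envPsi R).hom := by
      change IsIso ((α_ (R.X ⊗ R.X) R.X R.X).inv ≫ (α_ R.X R.X R.X).hom ▷ R.X)
      infer_instance
    infer_instance

/-- Both sides send r to 1 ⊗ r ⊗ 1: the target in the first factor and the source in the second meet
in the middle slot. This relation is what makes m ⊗ (N ⊠ N') a tensor product over `R`. -/
theorem inr_envOne : ((inr R (op R)).hom ≫ (inl (env R) (env R)).hom) ≫
    orbit (envM R) (envOne R) =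
      ((inl R (op R)).hom ≫ (inr (env R) (env R)).hom) ≫ orbit (envM R) (envOne R) := by
  have h1 : (inr R (op R)).hom ≫ (inl (env R) (env R)).hom =
      (λ_ R.X).inv ≫ (ρ_ _).inv ≫ _ ◁ (λ_ _).inv ≫
        ((η[R.X] ⊗ₘ 𝟙 R.X) ⊗ₘ (η[R.X] ⊗ₘ η[R.X])) := by
    change ((λ_ R.X).inv ≫ η[R.X] ▷ R.X) ≫ (ρ_ _).inv ≫ _ ◁ ((λ_ _).inv ≫ (η[R.X] ⊗ₘ η[R.X])) = _
    rw [Category.assoc, rightUnitor_inv_naturality_assoc, MonoidalCategory.whiskerLeft_comp,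
      ← whisker_exchange_assoc, ← MonoidalCategory.tensorHom_def, tensorHom_id]
  have h2 : (inl R (op R)).hom ≫ (inr (env R) (env R)).hom =
      (ρ_ R.X).inv ≫ (λ_ _).inv ≫ (λ_ _).inv ▷ _ ≫
        ((η[R.X] ⊗ₘ η[R.X]) ⊗ₘ (𝟙 R.X ⊗ₘ η[R.X])) := by
    change ((ρ_ R.X).inv ≫ R.X ◁ η[R.X]) ≫ (λ_ _).inv ≫ ((λ_ _).inv ≫ (η[R.X] ⊗ₘ η[R.X])) ▷ _ = _
    rw [Category.assoc, leftUnitor_inv_naturality_assoc, comp_whiskerRight,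
      whisker_exchange_assoc, ← MonoidalCategory.tensorHom_def', id_tensorHom]
  rw [h1, h2]
  simp only [Category.assoc]
  rw [tensor_envPsi, tensor_envPsi, tensorHom_id, id_tensorHom, MonObj.one_mul, MonObj.mul_one]
  simp only [MonoidalCategory.tensorHom_def]
  monoidal

/-- The left action touches only the outer slots. At 1 ⊗ 1 ⊗ 1 these are also reached from the
right, so p ⊗ q acts there as (p ⊗ 1) ⊗ (1 ⊗ q) does on the right. -/
theorem lorbit_envOne_eq : lorbit (envM R) (envOne R) =
    ((inl R (op R)).hom ⊗ₘ (inr R (op R)).hom) ≫ orbit (envM R) (envOne R) := by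
  have h1 : (inl R (op R)).hom = (ρ_ R.X).inv ≫ (𝟙 R.X ⊗ₘ η[R.X]) := by
    rw [id_tensorHom]; rfl
  have h2 : (inr R (op R)).hom = (λ_ R.X).inv ≫ (η[R.X] ⊗ₘ 𝟙 R.X) := by
    rw [tensorHom_id]; rfl
  rw [lorbit_envOne, h1, h2, ← tensorHom_comp_tensorHom, Category.assoc, tensor_envPsi]
  have h : (η[R.X] ⊗ₘ η[R.X]) ≫ μ[R.X] = (λ_ _).hom ≫ η[R.X] := by
    rw [MonoidalCategory.tensorHom_def', Category.assoc, MonObj.one_mul]; simp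
  rw [h]
  simp only [MonoidalCategory.tensorHom_def]
  monoidal

theorem inl_envUnit : (inl R (op R)).hom ≫ lorbit (envJ R) (envUnit R) = 𝟙 R.X := by
  rw [lorbit_envUnit]
  change ((ρ_ R.X).inv ≫ R.X ◁ η[R.X]) ≫ μ[R.X] = _
  simp

theorem inr_envUnit : (inr R (op R)).hom ≫ lorbit (envJ R) (envUnit R) = 𝟙 R.X := by
  rw [lorbit_envUnit]
  change ((λ_ R.X).inv ≫ η[R.X] ▷ R.X) ≫ μ[R.X] = _
  simp

variable [HasCoequalizers C]
variable [∀ X : C, PreservesColimitsOfShape WalkingParallelPair (tensorLeft X)]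
variable [∀ X : C, PreservesColimitsOfShape WalkingParallelPair (tensorRight X)]

theorem snakeOne_point : tensPoint (envLPoint R) (resPoint (α_ R (op R) R).inv (𝟙 _)
    (box (envJ R) (reg R)) (boxPoint (envUnit R) (regPoint R))) ≫ (snakeOne R).hom = regPoint R := by
  have h : proj (envL R) (res (α_ R (op R) R).inv (𝟙 _) (box (envJ R) (reg R))) ≫
    (snakeOne R).hom = tensorμ R.X R.X R.X R.X ≫ (μ[R.X] ⊗ₘ μ[R.X]) ≫ μ[R.X] :=
    proj_tensDesc _ _ _ (snakeOne_w R)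
  rw [tensPoint, Category.assoc, h]
  change tensorPoint (tensorPoint η[R.X] η[R.X]) (tensorPoint η[R.X] η[R.X]) ≫ _ = η[R.X]
  rw [← Category.assoc, tensorPoint_tensorμ, ← Category.assoc, tensorPoint_tensorHom,
    tensorPoint_one_mul, tensorPoint_one_mul]

theorem snakeTwo_point : tensPoint (envRPoint R) (resPoint (α_ (op R) R (op R)).hom (𝟙 _)
    (box (reg (op R)) (envJ R)) (boxPoint (regPoint (op R)) (envUnit R))) ≫ (snakeTwo R).hom =
      regPoint (op R) := by
  have h : proj (envR R) (res (α_ (op R) R (op R)).hom (𝟙 _) (box (reg (op R)) (envJ R))) ≫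
    (snakeTwo R).hom = tensorμ R.X R.X R.X R.X ≫
      (((β_ R.X R.X).hom ≫ μ[R.X]) ⊗ₘ ((β_ R.X R.X).hom ≫ μ[R.X])) ≫ μ[R.X] :=
    proj_tensDesc _ _ _ (snakeTwo_w R)
  rw [tensPoint, Category.assoc, h]
  change tensorPoint (tensorPoint η[R.X] η[R.X]) (tensorPoint η[R.X] η[R.X]) ≫ _ = η[R.X]
  have e : tensorPoint η[R.X] η[R.X] ≫ (β_ R.X R.X).hom ≫ μ[R.X] = η[R.X] := by
    rw [← Category.assoc, tensorPoint_braiding, tensorPoint_one_mul]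
  rw [← Category.assoc, tensorPoint_tensorμ, ← Category.assoc, tensorPoint_tensorHom, e,
    tensorPoint_one_mul]

theorem envMLeft_point : envOne R ≫ (envMLeft R).hom = boxPoint (envLPoint R) (regPoint (op R)) :=
  resPoint_resCell _ _ _ _

theorem envMLeftInv_point :
    boxPoint (envLPoint R) (regPoint (op R)) ≫ (envMLeftInv R).hom = envOne R :=
  comp_resCellInv _ _ _ _ _ _ _ _

theorem envMRight_point : envOne R ≫ (envMRight R).hom = boxPoint (regPoint R) (envRPoint R) := by
  simp only [envMRight, Cell.cast_hom, comp_cell_comp, envMLeft_point, boxPoint_box, envLPoint,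
    resPoint_resCell, comp_cell_id, boxPoint_boxAssoc, comp_resCellInv, envRPoint]

theorem envMRightInv_point :
    boxPoint (regPoint R) (envRPoint R) ≫ (envMRightInv R).hom = envOne R := by
  simp only [envMRightInv, Cell.cast_hom, comp_cell_comp, boxPoint_box, envRPoint,
    resPoint_resCell, comp_cell_id, boxPoint_boxAssocInv, comp_resCellInv, ← envLPoint.eq_1,
    envMLeftInv_point]

theorem envUnitLeft_point :
    tensPoint (envOne R) (boxPoint (envUnit R) (regPoint (env R))) ≫ (envUnitLeft R).hom =
      regPoint (env R) := by
  simp only [envUnitLeft, Cell.cast_hom, comp_cell_comp]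
  erw [tensPoint_hcomp]
  simp only [comp_cell_comp, envMLeft_point,
    boxPoint_box, comp_cell_id, regPoint_boxRegInv, boxPoint_boxAssocInv, comp_resCellInv,
    tensPoint_interchange, snakeOne_point, tensPoint_leftUnit, boxPoint_boxReg]

theorem envUnitRight_point :
    tensPoint (envOne R) (boxPoint (regPoint (env R)) (envUnit R)) ≫ (envUnitRight R).hom =
      regPoint (env R) := by
  simp only [envUnitRight, Cell.cast_hom, comp_cell_comp]
  erw [tensPoint_hcomp]
  simp only [comp_cell_comp, envMRight_point,
    boxPoint_box, comp_cell_id, regPoint_boxRegInv, boxPoint_boxAssoc, comp_resCellInv,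
    tensPoint_interchange, snakeTwo_point, tensPoint_leftUnit, boxPoint_boxReg]

/-- Both flattenings pass through `envL R ⊠ envR R`, and each of the two generators corresponds
there to the pure tensor of units. -/
theorem envAssoc_point :
    tensPoint (envOne R) (boxPoint (envOne R) (regPoint (env R))) ≫ (envAssoc R).hom =
      tensPoint (envOne R) (boxPoint (regPoint (env R)) (envOne R)) := by
  simp only [envAssoc, envFlattenLeft, envFlattenRightInv, Cell.cast_hom, comp_cell_comp,
    tensPoint_hcomp, envMRight_point, envMLeft_point, boxPoint_box, comp_cell_id,
    regPoint_boxRegInv, boxPoint_boxAssoc, boxPoint_boxAssocInv,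
    tensPoint_interchange, boxPoint_boxReg, tensPoint_leftUnit, tensPoint_rightUnit,
    comp_leftUnitInv, comp_rightUnitInv, boxPoint_interchangeInv, envMLeftInv_point,
    envMRightInv_point]

end EnvPoints
end IntBgd


namespace IntBgd

/-! ### Balancing over R, and generators of the modules M ⊗ (J ⊠ A) and M ⊗ (A ⊠ J). -/

section Adapted
set_option linter.unusedSectionVars false
variable {C : Type u} [Category.{v} C] [MonoidalCategory C] [SymmetricCategory C]

namespace BialgebroidBase
variable {R : Mon C} (H : BialgebroidBase R)

/-- The map `r ↦ t(r) ⊗ 1`. -/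
def tE : R.X ⟶ (H.A ⊗ H.A).X := H.t.hom ≫ (inl H.A H.A).hom

/-- The map `r ↦ 1 ⊗ s(r)`. -/
def sE : R.X ⟶ (H.A ⊗ H.A).X := H.s.hom ≫ (inr H.A H.A).hom

theorem inl_act {A B D D' : Mon C} (N : Bimod A D) (N' : Bimod B D') :
    (inl A B).hom ▷ (box N N').X ≫ (box N N').actLeft = (α_ _ _ _).inv ≫ N.actLeft ▷ N'.X := by
  have h := tensorμ_natural_left (𝟙 A.X) η[B.X] N.X N'.X
  have e : η[B.X] ▷ N'.X ≫ N'.actLeft = (λ_ _).hom := N'.one_actLeft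
  rw [id_tensorHom, id_whiskerRight] at h
  change ((ρ_ A.X).inv ≫ A.X ◁ η[B.X]) ▷ (N.X ⊗ N'.X) ≫ tensorμ A.X B.X N.X N'.X ≫
    (N.actLeft ⊗ₘ N'.actLeft) = _
  rw [comp_whiskerRight, Category.assoc, reassoc_of% h, tensorHom_comp_tensorHom, e,
    Category.id_comp, unit_act_left]

theorem inr_act {A B D D' : Mon C} (N : Bimod A D) (N' : Bimod B D') :
    (inr A B).hom ▷ (box N N').X ≫ (box N N').actLeft =
      (α_ _ _ _).inv ≫ (β_ _ _).hom ▷ N'.X ≫ (α_ _ _ _).hom ≫ N.X ◁ N'.actLeft := by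
  have h := tensorμ_natural_left η[A.X] (𝟙 B.X) N.X N'.X
  have e : η[A.X] ▷ N.X ≫ N.actLeft = (λ_ _).hom := N.one_actLeft
  rw [tensorHom_id, id_whiskerRight] at h
  change ((λ_ B.X).inv ≫ η[A.X] ▷ B.X) ▷ (N.X ⊗ N'.X) ≫ tensorμ A.X B.X N.X N'.X ≫
    (N.actLeft ⊗ₘ N'.actLeft) = _
  rw [comp_whiskerRight, Category.assoc, reassoc_of% h, tensorHom_comp_tensorHom, e,
    Category.id_comp, unit_act_right]

/-- An element r standing between `N` and `N'` acts on `N` through t or on `N'` through s. Bringing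
r to the front turns these into the actions of t(r) ⊗ 1, here, and of 1 ⊗ s(r), in `sE_act`. -/
theorem tE_act {D D' : Mon C} (N : Bimod H.A D) (N' : Bimod H.A D') :
    (N.X ◁ H.t.hom ≫ (β_ _ _).hom ≫ N.actLeft) ▷ N'.X =
      (β_ _ _).hom ▷ N'.X ≫ (α_ _ _ _).hom ≫ H.tE ▷ (box N N').X ≫ (box N N').actLeft := by
  rw [tE, comp_whiskerRight H.t.hom, Category.assoc, inl_act,
    BraidedCategory.braiding_naturality_right_assoc]
  simp

theorem sE_act {D D' : Mon C} (N : Bimod H.A D) (N' : Bimod H.A D') :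
    (α_ _ _ _).hom ≫ N.X ◁ (H.s.hom ▷ N'.X ≫ N'.actLeft) =
      (β_ _ _).hom ▷ N'.X ≫ (α_ _ _ _).hom ≫ H.sE ▷ (box N N').X ≫ (box N N').actLeft := by
  -- Here r crosses `N` and comes back, so the symmetry is needed to cancel the two braidings.
  have e : (β_ N.X R.X).hom ≫ H.s.hom ▷ N.X ≫ (β_ H.A.X N.X).hom = N.X ◁ H.s.hom := by
    rw [BraidedCategory.braiding_naturality_left, SymmetricCategory.symmetry_assoc]
  rw [sE, comp_whiskerRight, Category.assoc, inr_act]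
  simp only [associator_inv_naturality_left_assoc, Iso.hom_inv_id_assoc, ← comp_whiskerRight_assoc,
    e]
  simp

/-- A morphism identifies the two actions of `R` on `N ⊠ N'` exactly if it is balanced. -/
theorem balanced_iff {D D' : Mon C} (N : Bimod H.A D) (N' : Bimod H.A D') {W : C}
    (h : (box N N').X ⟶ W) :
    H.tE ▷ (box N N').X ≫ (box N N').actLeft ≫ h = H.sE ▷ (box N N').X ≫ (box N N').actLeft ≫ h ↔
      (N.X ◁ H.t.hom ≫ (β_ _ _).hom ≫ N.actLeft) ▷ N'.X ≫ h =
        (α_ _ _ _).hom ≫ N.X ◁ (H.s.hom ▷ N'.X ≫ N'.actLeft) ≫ h := by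
  have h1 : (N.X ◁ H.t.hom ≫ (β_ _ _).hom ≫ N.actLeft) ▷ N'.X ≫ h =
      (β_ _ _).hom ▷ N'.X ≫ (α_ _ _ _).hom ≫ H.tE ▷ (box N N').X ≫ (box N N').actLeft ≫ h := by
    rw [tE_act, Category.assoc, Category.assoc, Category.assoc]
  have h2 : (α_ _ _ _).hom ≫ N.X ◁ (H.s.hom ▷ N'.X ≫ N'.actLeft) ≫ h =
      (β_ _ _).hom ▷ N'.X ≫ (α_ _ _ _).hom ≫ H.sE ▷ (box N N').X ≫ (box N N').actLeft ≫ h := by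
    rw [← Category.assoc, sE_act, Category.assoc, Category.assoc, Category.assoc]
  rw [h1, h2, cancel_epi ((β_ _ _).hom ▷ N'.X), cancel_epi (α_ _ _ _).hom]

variable [HasCoequalizers C]
variable [∀ X : C, PreservesColimitsOfShape WalkingParallelPair (tensorLeft X)]
variable [∀ X : C, PreservesColimitsOfShape WalkingParallelPair (tensorRight X)]

theorem actLeft_insRight {A B D : Mon C} {P : Bimod A B} (x : 𝟙_ C ⟶ P.X) (N : Bimod B D) :
    N.actLeft ≫ insRight x N = orbit P x ▷ N.X ≫ proj P N := by
  have h := proj_condition P N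
  rw [orbit, insRight]
  simp only [comp_whiskerRight, Category.assoc, h]
  rw [leftUnitor_inv_naturality_assoc, whisker_exchange_assoc]
  simp

/-- A generator `e` of a multiplication 1-cell and a point `u` of a unit 1-cell for which `t(r)` and
`s(r)` agree in the appropriate sense. -/
structure Adapted (M : Bimod H.A (H.A ⊗ H.A)) (J : Bimod H.A (𝟙_ (Mon C))) (e : 𝟙_ C ⟶ M.X)
    (u : 𝟙_ C ⟶ J.X) : Prop where
  cyclic : Cyclic M e
  balanced : H.tE ≫ orbit M e = H.sE ≫ orbit M e
  unit : H.s.hom ≫ lorbit J u = H.t.hom ≫ lorbit J u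
  stableEpi : StableEpi (H.s.hom ≫ lorbit J u)

namespace Adapted
variable {H} {M : Bimod H.A (H.A ⊗ H.A)} {J : Bimod H.A (𝟙_ (Mon C))} {e : 𝟙_ C ⟶ M.X}
  {u : 𝟙_ C ⟶ J.X}

theorem balanced_act (F : H.Adapted M J e u) {D : Mon C} (W : Bimod (H.A ⊗ H.A) D) :
    H.tE ▷ W.X ≫ W.actLeft ≫ insRight e W = H.sE ▷ W.X ≫ W.actLeft ≫ insRight e W := by
  rw [actLeft_insRight, ← comp_whiskerRight_assoc, ← comp_whiskerRight_assoc, F.balanced]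

theorem balanced_box (F : H.Adapted M J e u) {D D' : Mon C} (N : Bimod H.A D) (N' : Bimod H.A D') :
    (N.X ◁ H.t.hom ≫ (β_ _ _).hom ≫ N.actLeft) ▷ N'.X ≫ insRight e (box N N') =
      (α_ _ _ _).hom ≫ N.X ◁ (H.s.hom ▷ N'.X ≫ N'.actLeft) ≫ insRight e (box N N') :=
  (H.balanced_iff N N' _).1 (F.balanced_act _)

/-- In elements, e(t(r)a ⊗ a') = e(a ⊗ s(r)a'). This is the balancing of `e` multiplied on the right
by a ⊗ a'. The orbit map of `e` therefore factors through L ⊗_R L. -/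
theorem balanced_orbit (F : H.Adapted M J e u) :
    H.L.actRight ▷ H.A.X ≫ orbit M e = (α_ _ _ _).hom ≫ H.A.X ◁ H.L.actLeft ≫ orbit M e := by
  refine (H.balanced_iff (reg H.A) (reg H.A) (orbit M e)).1 ?_
  have h : (box (reg H.A) (reg H.A)).actLeft ≫ orbit M e = orbit M e ▷ _ ≫ M.actRight :=
    (orbit_actRight M e).symm
  rw [h]
  change H.tE ▷ (H.A ⊗ H.A).X ≫ _ = H.sE ▷ (H.A ⊗ H.A).X ≫ _
  rw [← comp_whiskerRight_assoc, ← comp_whiskerRight_assoc, F.balanced]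

/-- `balanced_orbit` with 1 in the first slot. In `s_orbit` the 1 is put in the last slot. -/
theorem t_orbit (F : H.Adapted M J e u) : H.t.hom ▷ H.A.X ≫ orbit M e =
    H.L.actLeft ≫ (inr H.A H.A).hom ≫ orbit M e := by
  have h := congrArg (fun k => (((λ_ R.X).inv ≫ η[H.A.X] ▷ R.X) ▷ H.A.X) ≫ k) F.balanced_orbit
  have h1 : ((λ_ R.X).inv ≫ η[H.A.X] ▷ R.X) ≫ H.L.actRight = H.t.hom := by
    simp only [Category.assoc, ← whisker_exchange_assoc,
      BraidedCategory.braiding_naturality_left_assoc, MonObj.mul_one]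
    simp
  simp only [← comp_whiskerRight_assoc] at h
  rw [h1] at h
  rw [h, inr_hom, comp_whiskerRight, Category.assoc, associator_naturality_left_assoc,
    ← whisker_exchange_assoc]
  simp

theorem s_orbit (F : H.Adapted M J e u) : H.A.X ◁ H.s.hom ≫ orbit M e =
    H.L.actRight ≫ (inl H.A H.A).hom ≫ orbit M e := by
  have h := congrArg (fun k => (H.A.X ⊗ R.X) ◁ η[H.A.X] ≫ k) F.balanced_orbit
  have h1 : R.X ◁ η[H.A.X] ≫ H.L.actLeft = (ρ_ R.X).hom ≫ H.s.hom := by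
    rw [whisker_exchange_assoc, MonObj.mul_one, rightUnitor_naturality]
  rw [whisker_exchange_assoc, associator_naturality_right_assoc,
    ← MonoidalCategory.whiskerLeft_comp_assoc, h1] at h
  have aux : ∀ {X Y Z W : C} (f : X ⟶ Y) (g : Y ⊗ 𝟙_ C ⟶ Z) (k : Z ⟶ W),
      f ≫ ((ρ_ Y).inv ≫ g) ≫ k = (ρ_ X).inv ≫ f ▷ 𝟙_ C ≫ g ≫ k := by
    intro X Y Z W f g k
    rw [Category.assoc, rightUnitor_inv_naturality_assoc]
  refine Eq.trans ?_ (aux H.L.actRight (H.A.X ◁ η[H.A.X]) (orbit M e)).symm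
  refine Eq.trans ?_ (congrArg (fun k => (ρ_ _).inv ≫ k) h.symm)
  simp

theorem lorbit_insRight_left (e : 𝟙_ C ⟶ M.X) (u : 𝟙_ C ⟶ J.X) :
    lorbit J u ▷ H.A.X ≫ insRight e (box J (reg H.A)) =
      orbit M e ≫ insLeft M (boxPoint u (regPoint H.A)) := by
  rw [orbit_insLeft, lorbit_box, lorbit_reg, tensorHom_id]

theorem lorbit_insRight_right (e : 𝟙_ C ⟶ M.X) (u : 𝟙_ C ⟶ J.X) :
    H.A.X ◁ lorbit J u ≫ insRight e (box (reg H.A) J) =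
      orbit M e ≫ insLeft M (boxPoint (regPoint H.A) u) := by
  rw [orbit_insLeft, lorbit_box, lorbit_reg, id_tensorHom]

theorem orbit_unit {A : Mon C} (J : Bimod A (𝟙_ (Mon C))) (u : 𝟙_ C ⟶ J.X) : orbit J u = u := by
  have h : J.actRight = (ρ_ J.X).hom := actRight_unit J
  rw [orbit, h]
  change (λ_ (𝟙_ C)).inv ≫ u ▷ (𝟙_ C) ≫ _ = _
  rw [rightUnitor_naturality, ← unitors_equal, Iso.inv_hom_id_assoc]

/-- In elements, e ⊗ (s(r)u ⊗ a) = e ⊗ (t(r)u ⊗ a) = e(t(r) ⊗ a) ⊗ (u ⊗ 1) = e(1 ⊗ s(r)a) ⊗ (u ⊗ 1),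
which is the generator e ⊗ (u ⊗ 1) acted upon by s(r)a. -/
theorem left_act_insRight (F : H.Adapted M J e u) :
    (H.s.hom ≫ lorbit J u) ▷ H.A.X ≫ insRight e (box J (reg H.A)) =
      H.L.actLeft ≫ (λ_ H.A.X).inv ≫
        orbit (tens M (box J (reg H.A))) (tensPoint e (boxPoint u (regPoint H.A))) := by
  rw [F.unit, comp_whiskerRight, Category.assoc, lorbit_insRight_left, reassoc_of% F.t_orbit,
    ← lorbit_insRight_left, inr_hom, orbit_tens, orbit_box, orbit_unit, orbit_reg, tensorHom_id,
    Category.assoc, ← comp_whiskerRight_assoc, one_lorbit]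
  exact (Category.assoc _ _ _).symm

theorem right_act_insRight (F : H.Adapted M J e u) :
    H.A.X ◁ (H.s.hom ≫ lorbit J u) ≫ insRight e (box (reg H.A) J) =
      H.L.actRight ≫ (ρ_ H.A.X).inv ≫
        orbit (tens M (box (reg H.A) J)) (tensPoint e (boxPoint (regPoint H.A) u)) := by
  rw [MonoidalCategory.whiskerLeft_comp, Category.assoc, lorbit_insRight_right,
    reassoc_of% F.s_orbit, ← lorbit_insRight_right, inl_hom, orbit_tens, orbit_box, orbit_unit,
    orbit_reg, id_tensorHom, Category.assoc, ← MonoidalCategory.whiskerLeft_comp_assoc, one_lorbit]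
  simp only [Category.assoc]

/-- The elements s(r)u exhaust `J`, and `left_act_insRight` places every e ⊗ (s(r)u ⊗ a) in the
orbit of the generator. -/
theorem cyclic_left (F : H.Adapted M J e u) :
    Cyclic (tens M (box J (reg H.A))) (tensPoint e (boxPoint u (regPoint H.A))) where
  stableEpi := by
    have := F.cyclic
    have := F.stableEpi
    have := stableEpi_insRight M e (box J (reg H.A))
    have h : StableEpi ((H.s.hom ≫ lorbit J u) ▷ H.A.X ≫ insRight e (box J (reg H.A))) :=
      inferInstance
    rw [F.left_act_insRight, ← Category.assoc] at h
    exact stableEpi_of_comp (h := h) _ _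

theorem cyclic_right (F : H.Adapted M J e u) :
    Cyclic (tens M (box (reg H.A) J)) (tensPoint e (boxPoint (regPoint H.A) u)) where
  stableEpi := by
    have := F.cyclic
    have := F.stableEpi
    have := stableEpi_insRight M e (box (reg H.A) J)
    have h : StableEpi (H.A.X ◁ (H.s.hom ≫ lorbit J u) ≫ insRight e (box (reg H.A) J)) :=
      inferInstance
    rw [F.right_act_insRight, ← Category.assoc] at h
    exact stableEpi_of_comp (h := h) _ _

theorem leftCyclic (F : H.Adapted M J e u) : LeftCyclic J u where
  stableEpi := by
    have := F.stableEpi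
    exact stableEpi_of_comp H.s.hom _

end Adapted

/-- The canonical pseudo-monoid is the case where χ is the identity and the source and target maps
are the two inclusions of R. -/
theorem ofEnv_adapted (R : Mon C) :
    (ofEnv (𝟙 (env R))).Adapted (envM R) (envJ R) (envOne R) (envUnit R) where
  cyclic := cyclic_envOne R
  balanced := by
    have h := inr_envOne R
    simpa [tE, sE, ofEnv] using h
  unit := by
    have h := (inl_envUnit R).trans (inr_envUnit R).symm
    simpa [ofEnv] using h
  stableEpi := by
    have h := inl_envUnit R
    have h' : (ofEnv (𝟙 (env R))).s.hom ≫ lorbit (envJ R) (envUnit R) = 𝟙 R.X := by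
      simpa [ofEnv] using h
    rw [h']
    infer_instance

end BialgebroidBase

variable [HasCoequalizers C]
variable [∀ X : C, PreservesColimitsOfShape WalkingParallelPair (tensorLeft X)]
variable [∀ X : C, PreservesColimitsOfShape WalkingParallelPair (tensorRight X)]

/-- The generators of the canonical pseudo-monoid. -/
def envGenerators (R : Mon C) : Generators (envPseudomonoid R) where
  e := envOne R
  u := envUnit R
  cyclic := cyclic_envOne R
  cyclic_left := (BialgebroidBase.ofEnv_adapted R).cyclic_left
  cyclic_right := (BialgebroidBase.ofEnv_adapted R).cyclic_right
  point_l := envUnitLeft_point R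
  point_r := envUnitRight_point R
  point_a := envAssoc_point R

instance leftCyclic_envUnit (R : Mon C) : LeftCyclic (envJ R) (envUnit R) :=
  (BialgebroidBase.ofEnv_adapted R).leftCyclic
end Adapted
end IntBgd


namespace IntBgd

/-! ### Frames, and the bialgebroid structure read off from a frame. -/

section Frames
set_option linter.unusedSectionVars false
variable {C : Type u} [Category.{v} C] [MonoidalCategory C] [SymmetricCategory C]
variable [HasCoequalizers C]
variable [∀ X : C, PreservesColimitsOfShape WalkingParallelPair (tensorLeft X)]
variable [∀ X : C, PreservesColimitsOfShape WalkingParallelPair (tensorRight X)]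

/-- The bimodule morphism `f ≫ p⁻¹`, for `f` and `p` compatible with actions on their target. -/
noncomputable def Cell.compInv {A B : Mon C} {P Q : Bimod A B} {Y : C} (f : P.X ⟶ Y) (p : Q.X ⟶ Y)
    [IsIso p] (a : A.X ⊗ Y ⟶ Y) (b : Y ⊗ B.X ⟶ Y) (hf : P.actLeft ≫ f = A.X ◁ f ≫ a)
    (hp : Q.actLeft ≫ p = A.X ◁ p ≫ a) (hf' : P.actRight ≫ f = f ▷ B.X ≫ b)
    (hp' : Q.actRight ≫ p = p ▷ B.X ≫ b) : BimHom P Q where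
  hom := f ≫ inv p
  left := by
    rw [← cancel_mono p]
    simp [hp, hf]
  right := by
    rw [← cancel_mono p]
    simp [hp', hf']

/-- The balancing relation `h` applied to 1 ⊗ r ⊗ 1. -/
theorem balanced_point {A R Z : C} [MonObj A] (s t : R ⟶ A) (l : R ⊗ A ⟶ A) (r : A ⊗ R ⟶ A)
    (p : A ⊗ A ⟶ Z) (h : r ▷ A ≫ p = (α_ _ _ _).hom ≫ A ◁ l ≫ p)
    (hl : R ◁ η[A] ≫ l = (ρ_ R).hom ≫ s) (hr : η[A] ▷ R ≫ r = (λ_ R).hom ≫ t) :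
    t ≫ (ρ_ A).inv ≫ A ◁ η[A] ≫ p = s ≫ (λ_ A).inv ≫ η[A] ▷ A ≫ p := by
  have h' := congrArg (fun k => ((λ_ R).inv ≫ η[A] ▷ R ≫ (ρ_ _).inv ≫ (A ⊗ R) ◁ η[A]) ≫ k) h
  simp only [Category.assoc] at h'
  rw [whisker_exchange_assoc, ← rightUnitor_inv_naturality_assoc, reassoc_of% hr,
    Iso.inv_hom_id_assoc, associator_naturality_right_assoc, ← MonoidalCategory.whiskerLeft_comp_assoc,
    hl] at h'
  rw [h', leftUnitor_inv_naturality_assoc, whisker_exchange_assoc]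
  simp

namespace BialgebroidBase

/-- Identifications of a multiplication 1-cell with `L ⊗_R L` and of a unit 1-cell with `R`. -/
structure Frame {R : Mon C} (H : BialgebroidBase R) (M : Bimod H.A (H.A ⊗ H.A))
    (J : Bimod H.A (𝟙_ (Mon C))) where
  e : 𝟙_ C ⟶ M.X
  u : 𝟙_ C ⟶ J.X
  p : (tens H.L H.L).X ⟶ M.X
  isIso_p : IsIso p
  proj_p : proj H.L H.L ≫ p = orbit M e
  s_e : H.s.hom ≫ lorbit M e = H.s.hom ≫ (inl H.A H.A).hom ≫ orbit M e
  t_e : H.t.hom ≫ lorbit M e = H.t.hom ≫ (inr H.A H.A).hom ≫ orbit M e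
  j : R.X ⟶ J.X
  isIso_j : IsIso j
  s_u : H.s.hom ≫ lorbit J u = j
  t_u : H.t.hom ≫ lorbit J u = j

attribute [instance] Frame.isIso_p Frame.isIso_j

namespace Frame
variable {R : Mon C} {H : BialgebroidBase R} {M : Bimod H.A (H.A ⊗ H.A)}
  {J : Bimod H.A (𝟙_ (Mon C))}

theorem adapted (F : H.Frame M J) : H.Adapted M J F.e F.u where
  cyclic := ⟨by rw [← F.proj_p]; infer_instance⟩
  balanced := by
    have h := balanced_point H.s.hom H.t.hom H.L.actLeft H.L.actRight (proj H.L H.L)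
      (proj_condition H.L H.L) (by
        rw [whisker_exchange_assoc, MonObj.mul_one, rightUnitor_naturality]) (by
        rw [← whisker_exchange_assoc, BraidedCategory.braiding_naturality_left_assoc,
          MonObj.mul_one]
        simp)
    rw [F.proj_p.symm, tE, sE]
    have e : H.tE ≫ proj H.L H.L = H.sE ≫ proj H.L H.L :=
      ((Category.assoc _ _ _).trans (congrArg (H.t.hom ≫ ·) (Category.assoc _ _ _))).trans
        (h.trans ((Category.assoc _ _ _).trans (congrArg (H.s.hom ≫ ·) (Category.assoc _ _ _))).symm)
    exact (reassoc_of% e) F.p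
  unit := F.s_u.trans F.t_u.symm
  stableEpi := by
    rw [F.s_u]; infer_instance

/-- Morphisms out of `M ⊗ W` are morphisms out of `W` identifying the two actions of `R`. -/
theorem exists_desc (F : H.Frame M J) {D : Mon C} (W : Bimod (H.A ⊗ H.A) D) {Z : C} (h : W.X ⟶ Z)
    (w : H.tE ▷ W.X ≫ W.actLeft ≫ h = H.sE ▷ W.X ≫ W.actLeft ≫ h) :
    ∃ k : (tens M W).X ⟶ Z, insRight F.e W ≫ k = h := by
  -- The action of A ⊗ A on `W` followed by `h` is balanced over `R`. So it descends to (L ⊗_R L) ⊗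
  -- W, and the inverse of `p` carries it over to M ⊗ W.
  have h1 : H.L.actRight ▷ H.A.X ▷ W.X ≫ W.actLeft ≫ h =
      (α_ _ _ _).hom ▷ W.X ≫ (H.L.X ◁ H.L.actLeft) ▷ W.X ≫ W.actLeft ≫ h := by
    have e1 := H.tE_act (reg H.A) (reg H.A)
    have e2 := H.sE_act (reg H.A) (reg H.A)
    have e3 := W.left_assoc
    have e4 : ∀ k : R.X ⟶ (H.A ⊗ H.A).X, (k ▷ (H.A ⊗ H.A).X ≫
        (box (reg H.A) (reg H.A)).actLeft) ▷ W.X ≫ W.actLeft ≫ h =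
        (α_ _ _ _).hom ≫ R.X ◁ W.actLeft ≫ k ▷ W.X ≫ W.actLeft ≫ h := by
      intro k
      have : (box (reg H.A) (reg H.A)).actLeft ▷ W.X ≫ W.actLeft = _ := e3
      rw [comp_whiskerRight, Category.assoc, reassoc_of% this, associator_naturality_left_assoc,
        whisker_exchange_assoc]
    have e5 : (H.L.actRight ▷ H.A.X) ▷ W.X = ((β_ H.A.X R.X).hom ▷ H.A.X ≫ (α_ _ _ _).hom) ▷ W.X ≫
        (H.tE ▷ (H.A ⊗ H.A).X ≫ (box (reg H.A) (reg H.A)).actLeft) ▷ W.X := by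
      rw [← comp_whiskerRight, Category.assoc]
      exact congrArg (· ▷ W.X) e1
    have e6 : (α_ H.A.X R.X H.A.X).hom ▷ W.X ≫ (H.L.X ◁ H.L.actLeft) ▷ W.X =
        ((β_ H.A.X R.X).hom ▷ H.A.X ≫ (α_ _ _ _).hom) ▷ W.X ≫
        (H.sE ▷ (H.A ⊗ H.A).X ≫ (box (reg H.A) (reg H.A)).actLeft) ▷ W.X := by
      rw [← comp_whiskerRight, ← comp_whiskerRight, Category.assoc]
      exact congrArg (· ▷ W.X) e2
    rw [reassoc_of% e5, reassoc_of% e6, e4, e4, w]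
  have h2 : orbit M F.e ▷ W.X ≫ inv F.p ▷ W.X ≫ tensDescR W.X H.L H.L (W.actLeft ≫ h) h1 =
      W.actLeft ≫ h := by
    rw [← F.proj_p, ← comp_whiskerRight_assoc, Category.assoc, IsIso.hom_inv_id, Category.comp_id,
      proj_tensDescR]
  refine ⟨tensDesc M W (inv F.p ▷ W.X ≫ tensDescR W.X H.L H.L (W.actLeft ≫ h) h1) ?_, ?_⟩
  -- Balancing over A ⊗ A is tested on the orbit of `e`, where it is associativity of the action on
  -- `W`.
  · have := F.adapted.cyclic
    rw [← cancel_epi (orbit M F.e ▷ (H.A ⊗ H.A).X ▷ W.X), ← comp_whiskerRight_assoc,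
      orbit_actRight, comp_whiskerRight, Category.assoc, h2, associator_naturality_left_assoc,
      ← whisker_exchange_assoc, h2, reassoc_of% W.left_assoc]
  · have h3 := congrArg (fun k => (λ_ W.X).inv ≫ η[(H.A ⊗ H.A).X] ▷ W.X ≫ k) h2
    rw [← comp_whiskerRight_assoc, one_orbit, reassoc_of% W.one_actLeft,
      Iso.inv_hom_id_assoc] at h3
    rw [insRight, Category.assoc, Category.assoc, proj_tensDesc, h3]

/-- By `s_e` the element s(r) passes from the left of `e` into the first factor: s(r)(e(a ⊗ a')) =
e(s(r)a ⊗ a'). This matches the left action of `R` on L ⊗_R L. -/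
theorem p_actLeft (F : H.Frame M J) :
    (tens H.L H.L).actLeft ≫ F.p = R.X ◁ F.p ≫ H.s.hom ▷ M.X ≫ M.actLeft := by
  rw [← cancel_epi (R.X ◁ proj H.L H.L), proj_actLeft_assoc, F.proj_p,
    ← MonoidalCategory.whiskerLeft_comp_assoc, F.proj_p, whisker_exchange_assoc, orbit_actLeft]
  change _ = H.s.hom ▷ (H.A ⊗ H.A).X ≫ _
  rw [← comp_whiskerRight_assoc, F.s_e, comp_whiskerRight H.s.hom,
    comp_whiskerRight (inl H.A H.A).hom]
  simp only [Category.assoc]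
  rw [orbit_actRight]
  have h : (inl H.A H.A).hom ▷ (H.A ⊗ H.A).X ≫ μ[(H.A ⊗ H.A).X] =
    (α_ _ _ _).inv ≫ μ[H.A.X] ▷ H.A.X := inl_act (reg H.A) (reg H.A)
  rw [reassoc_of% h, comp_whiskerRight, Category.assoc]
  exact (associator_inv_naturality_left_assoc H.s.hom H.A.X H.A.X _).symm

/-- As for `p_actLeft`, with t(r) entering the second factor by `t_e`. -/
theorem p_actRight (F : H.Frame M J) : (tens H.L H.L).actRight ≫ F.p =
    F.p ▷ R.X ≫ M.X ◁ H.t.hom ≫ (β_ _ _).hom ≫ M.actLeft := by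
  rw [← cancel_epi (proj H.L H.L ▷ R.X), proj_actRight_assoc, F.proj_p,
    ← comp_whiskerRight_assoc, F.proj_p, BraidedCategory.braiding_naturality_right_assoc,
    BraidedCategory.braiding_naturality_left_assoc, whisker_exchange_assoc, orbit_actLeft]
  change _ = (β_ (H.A.X ⊗ H.A.X) R.X).hom ≫ H.t.hom ▷ (H.A ⊗ H.A).X ≫ _
  rw [← comp_whiskerRight_assoc, F.t_e, comp_whiskerRight, comp_whiskerRight]
  simp only [Category.assoc]
  rw [orbit_actRight]
  have h : (inr H.A H.A).hom ▷ (H.A ⊗ H.A).X ≫ μ[(H.A ⊗ H.A).X] =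
    (α_ _ _ _).inv ≫ (β_ _ _).hom ▷ H.A.X ≫ (α_ _ _ _).hom ≫ H.A.X ◁ μ[H.A.X] :=
      inr_act (reg H.A) (reg H.A)
  have e : (β_ (H.A.X ⊗ H.A.X) R.X).hom ≫ H.t.hom ▷ (H.A.X ⊗ H.A.X) ≫
      (α_ _ _ _).inv ≫ (β_ _ _).hom ▷ H.A.X ≫ (α_ _ _ _).hom =
      (α_ _ _ _).hom ≫ H.A.X ◁ (H.A.X ◁ H.t.hom ≫ (β_ _ _).hom) := by
    rw [associator_inv_naturality_left_assoc, ← comp_whiskerRight_assoc,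
      BraidedCategory.braiding_naturality_left, BraidedCategory.braiding_tensor_left_hom,
      BraidedCategory.braiding_naturality_right]
    simp [← comp_whiskerRight_assoc]
  have e' := congrArg (fun k => k ≫ H.A.X ◁ μ[H.A.X] ≫ orbit M F.e) e
  simp only [Category.assoc] at e'
  rw [reassoc_of% h]
  refine Eq.trans ?_ e'.symm
  rw [← MonoidalCategory.whiskerLeft_comp_assoc, Category.assoc]

theorem j_actLeft (F : H.Frame M J) :
    μ[R.X] ≫ F.j = R.X ◁ F.j ≫ H.s.hom ▷ J.X ≫ J.actLeft := by
  rw [← F.s_u, MonoidalCategory.whiskerLeft_comp, Category.assoc, whisker_exchange_assoc,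
    lorbit_actLeft, IsMonHom.mul_hom_assoc, MonoidalCategory.tensorHom_def', Category.assoc]

theorem t_mul (H : BialgebroidBase R) :
    μ[R.X] ≫ H.t.hom = (H.t.hom ⊗ₘ H.t.hom) ≫ (β_ _ _).hom ≫ μ[H.A.X] := by
  have e : ((β_ R.X R.X).hom ≫ μ[R.X]) ≫ H.t.hom = (H.t.hom ⊗ₘ H.t.hom) ≫ μ[H.A.X] :=
    IsMonHom.mul_hom H.t.hom
  rw [← cancel_epi (β_ R.X R.X).hom, ← Category.assoc, e,
    ← BraidedCategory.braiding_naturality_assoc, SymmetricCategory.symmetry_assoc]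

theorem j_actRight (F : H.Frame M J) :
    μ[R.X] ≫ F.j = F.j ▷ R.X ≫ J.X ◁ H.t.hom ≫ (β_ _ _).hom ≫ J.actLeft := by
  rw [← F.t_u, comp_whiskerRight, Category.assoc, ← whisker_exchange_assoc,
    BraidedCategory.braiding_naturality_left_assoc, lorbit_actLeft, reassoc_of% (t_mul H),
    MonoidalCategory.tensorHom_def, Category.assoc]

/-- The comultiplication determined by a frame. -/
noncomputable def comul (F : H.Frame M J) : BimHom H.L (tens H.L H.L) :=
  -- Both a ↦ ae and `p` are linear for left multiplication on `M` by s(r) and by t(r), so p⁻¹(ae)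
  -- is a bimodule morphism in a.
  Cell.compInv (lorbit M F.e) F.p (H.s.hom ▷ M.X ≫ M.actLeft)
    (M.X ◁ H.t.hom ≫ (β_ _ _).hom ≫ M.actLeft)
    (by
      rw [whisker_exchange_assoc, lorbit_actLeft]
      exact Category.assoc _ _ _)
    F.p_actLeft
    (by
      rw [← whisker_exchange_assoc, BraidedCategory.braiding_naturality_left_assoc, lorbit_actLeft]
      exact (Category.assoc _ _ _).trans (congrArg _ (Category.assoc _ _ _)))
    F.p_actRight

theorem comul_p (F : H.Frame M J) : F.comul.hom ≫ F.p = lorbit M F.e := by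
  rw [comul, Cell.compInv, Category.assoc, IsIso.inv_hom_id, Category.comp_id]

/-- The counit determined by a frame. -/
noncomputable def counit (F : H.Frame M J) : BimHom H.L (reg R) :=
  Cell.compInv (lorbit J F.u) F.j (H.s.hom ▷ J.X ≫ J.actLeft)
    (J.X ◁ H.t.hom ≫ (β_ _ _).hom ≫ J.actLeft)
    (by
      rw [whisker_exchange_assoc, lorbit_actLeft]
      exact Category.assoc _ _ _)
    F.j_actLeft
    (by
      rw [← whisker_exchange_assoc, BraidedCategory.braiding_naturality_left_assoc, lorbit_actLeft]
      exact (Category.assoc _ _ _).trans (congrArg _ (Category.assoc _ _ _)))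
    F.j_actRight

theorem counit_j (F : H.Frame M J) : F.counit.hom ≫ F.j = lorbit J F.u := by
  rw [counit, Cell.compInv, Category.assoc, IsIso.inv_hom_id, Category.comp_id]

/-- With this and `comul_p`, the conditions relating γ to the multiplication of `A` become axioms of
the bimodule `M`. -/
theorem rho_p (F : H.Frame M J) : H.rho ≫ F.p = F.p ▷ (H.A ⊗ H.A).X ≫ M.actRight := by
  rw [← cancel_epi (proj H.L H.L ▷ (H.A.X ⊗ H.A.X)), reassoc_of% H.proj_rho, F.proj_p]
  change _ = proj H.L H.L ▷ (H.A ⊗ H.A).X ≫ _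
  rw [← comp_whiskerRight_assoc, F.proj_p, orbit_actRight]
  exact (Category.assoc _ _ _).symm

/-- Under `p` the two sides are a(e(t(r) ⊗ 1)) and a(e(1 ⊗ s(r))), equal by the balancing of `e`. -/
theorem takeuchi (F : H.Frame M J) : (F.comul.hom ⊗ₘ H.tE) ≫ H.rho =
    (F.comul.hom ⊗ₘ H.sE) ≫ H.rho := by
  have h : ∀ k : R.X ⟶ (H.A ⊗ H.A).X, (F.comul.hom ⊗ₘ k) ≫ H.rho ≫ F.p =
      H.A.X ◁ (k ≫ orbit M F.e) ≫ M.actLeft := by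
    intro k
    rw [F.rho_p, MonoidalCategory.tensorHom_def', Category.assoc, ← comp_whiskerRight_assoc,
      F.comul_p, MonoidalCategory.whiskerLeft_comp, Category.assoc, orbit_actLeft]
  rw [← cancel_mono F.p, Category.assoc, Category.assoc, h, h, F.adapted.balanced]

/-- The bialgebroid without the unit and multiplicativity conditions determined by a frame. -/
noncomputable abbrev preBialgebroid (F : H.Frame M J)
    (hc : F.comul.hom ≫ (F.comul.hcomp (Cell.id _)).hom ≫ (assocHom _ _ _).hom =
      F.comul.hom ≫ ((Cell.id _).hcomp F.comul).hom)
    (hl : F.comul.hom ≫ (F.counit.hcomp (Cell.id _)).hom ≫ (leftUnit _).hom = 𝟙 H.A.X)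
    (hr : F.comul.hom ≫ ((Cell.id _).hcomp F.counit).hom ≫ (rightUnit _).hom = 𝟙 H.A.X) :
    PreBialgebroid R where
  toBialgebroidBase := H
  comul := F.comul
  counit := F.counit
  coassoc := hc
  counit_left := hl
  counit_right := hr
  takeuchi := F.takeuchi

/-- The bialgebroid determined by a frame. -/
noncomputable abbrev bialgebroid (F : H.Frame M J)
    (hc : F.comul.hom ≫ (F.comul.hcomp (Cell.id _)).hom ≫ (assocHom _ _ _).hom =
      F.comul.hom ≫ ((Cell.id _).hcomp F.comul).hom)
    (hl : F.comul.hom ≫ (F.counit.hcomp (Cell.id _)).hom ≫ (leftUnit _).hom = 𝟙 H.A.X)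
    (hr : F.comul.hom ≫ ((Cell.id _).hcomp F.counit).hom ≫ (rightUnit _).hom = 𝟙 H.A.X) :
    Bialgebroid R where
  toPreBialgebroid := F.preBialgebroid hc hl hr
  comul_one := by
    change _ ≫ F.comul.hom = _
    rw [← cancel_mono F.p, Category.assoc, F.comul_p, one_lorbit, Category.assoc, Category.assoc,
      F.proj_p]
    exact (one_orbit M F.e).symm.trans (Category.assoc _ _ _)
  comul_mul := by
    -- Under `p` the map λ is the left action on `M`, so multiplicativity of γ is (ab)e = a(be).
    have h : (F.preBialgebroid hc hl hr).lam ≫ F.p = H.A.X ◁ F.p ≫ M.actLeft := by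
      have e : H.A.X ◁ proj H.L H.L ≫ (F.preBialgebroid hc hl hr).lam =
        F.comul.hom ▷ (H.A.X ⊗ H.A.X) ≫ H.rho := proj_tensDescL _ _ _ _ _
      rw [← cancel_epi (H.A.X ◁ proj H.L H.L), reassoc_of% e, F.rho_p,
        ← MonoidalCategory.whiskerLeft_comp_assoc, F.proj_p, orbit_actLeft]
      change F.comul.hom ▷ (H.A ⊗ H.A).X ≫ _ = _
      rw [← comp_whiskerRight_assoc, F.comul_p]
    rw [← cancel_mono F.p, Category.assoc, F.comul_p, Category.assoc, h,
      ← MonoidalCategory.whiskerLeft_comp_assoc, F.comul_p, lorbit_actLeft]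
  counit_one := by
    change _ ≫ F.counit.hom = _
    rw [← cancel_mono F.j, Category.assoc, F.counit_j, one_lorbit, ← F.s_u,
      IsMonHom.one_hom_assoc, one_lorbit]
  counit_mul_s := by
    -- Since s(π(b))u = j(π(b)) = bu, applying `j` to either side gives a(bu).
    change H.A.X ◁ (F.counit.hom ≫ H.s.hom) ≫ μ[H.A.X] ≫ F.counit.hom = μ[H.A.X] ≫ F.counit.hom
    rw [← cancel_mono F.j]
    simp only [Category.assoc]
    rw [F.counit_j, ← lorbit_actLeft, ← MonoidalCategory.whiskerLeft_comp_assoc, Category.assoc,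
      F.s_u, F.counit_j]
  counit_mul_t := by
    change H.A.X ◁ (F.counit.hom ≫ H.t.hom) ≫ μ[H.A.X] ≫ F.counit.hom = μ[H.A.X] ≫ F.counit.hom
    rw [← cancel_mono F.j]
    simp only [Category.assoc]
    rw [F.counit_j, ← lorbit_actLeft, ← MonoidalCategory.whiskerLeft_comp_assoc]
    have e : (F.counit.hom ≫ H.t.hom) ≫ lorbit J F.u = lorbit J F.u := by
      rw [Category.assoc]
      exact (congrArg _ F.t_u).trans F.counit_j
    rw [e]

end Frame
end BialgebroidBase
end Frames
end IntBgd


namespace IntBgd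

theorem isIso_of_epi_comp {C : Type u} [Category.{v} C] {X Y Z : C} (f : X ⟶ Y) (g : Y ⟶ Z) [Epi f]
    [IsIso (f ≫ g)] : IsIso g :=
  ⟨inv (f ≫ g) ≫ f, by rw [← cancel_epi f, ← Category.assoc, IsIso.hom_inv_id_assoc,
    Category.comp_id], by rw [Category.assoc, IsIso.inv_hom_id]⟩

theorem isIso_of_retraction {C : Type u} [Category.{v} C] {X Y : C} (f : X ⟶ Y) (g : Y ⟶ X) [Epi f]
    (h : f ≫ g = 𝟙 X) : IsIso f :=
  ⟨g, h, by rw [← cancel_epi f, reassoc_of% h, Category.comp_id]⟩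

/-! ### Counit laws and coassociativity versus left linearity of the constraints. -/

section Coherence
set_option linter.unusedSectionVars false
variable {C : Type u} [Category.{v} C] [MonoidalCategory C] [SymmetricCategory C]
variable [HasCoequalizers C]
variable [∀ X : C, PreservesColimitsOfShape WalkingParallelPair (tensorLeft X)]
variable [∀ X : C, PreservesColimitsOfShape WalkingParallelPair (tensorRight X)]

namespace BialgebroidBase
namespace Frame
variable {R : Mon C} {H : BialgebroidBase R} {M : Bimod H.A (H.A ⊗ H.A)}
  {J : Bimod H.A (𝟙_ (Mon C))}

theorem balanced_right {A R J : C} (r : A ⊗ R ⟶ A) (m : R ⊗ R ⟶ R) (a : R ⊗ J ⟶ J) (i : J ⟶ R)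
    (e : r ▷ R ≫ r = (α_ _ _ _).hom ≫ A ◁ m ≫ r) (h : a ≫ i = R ◁ i ≫ m) :
    r ▷ J ≫ A ◁ i ≫ r = (α_ _ _ _).hom ≫ A ◁ a ≫ A ◁ i ≫ r := by
  rw [← MonoidalCategory.whiskerLeft_comp_assoc, h, MonoidalCategory.whiskerLeft_comp,
    Category.assoc, ← associator_naturality_right_assoc, ← e, whisker_exchange_assoc]

theorem p_actRight_inv (F : H.Frame M J) : (M.X ◁ H.t.hom ≫ (β_ _ _).hom ≫ M.actLeft) ≫ inv F.p =
    inv F.p ▷ R.X ≫ (tens H.L H.L).actRight := by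
  rw [← cancel_mono F.p]
  simp only [Category.assoc, IsIso.inv_hom_id, Category.comp_id]
  rw [F.p_actRight, ← comp_whiskerRight_assoc, IsIso.inv_hom_id, id_whiskerRight, Category.id_comp]

theorem p_actLeft_inv (F : H.Frame M J) : (H.s.hom ▷ M.X ≫ M.actLeft) ≫ inv F.p =
    R.X ◁ inv F.p ≫ (tens H.L H.L).actLeft := by
  rw [← cancel_mono F.p]
  simp only [Category.assoc, IsIso.inv_hom_id, Category.comp_id]
  rw [F.p_actLeft, ← MonoidalCategory.whiskerLeft_comp_assoc, IsIso.inv_hom_id,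
    MonoidalCategory.whiskerLeft_id, Category.id_comp]

theorem j_actRight_inv (F : H.Frame M J) : (J.X ◁ H.t.hom ≫ (β_ _ _).hom ≫ J.actLeft) ≫ inv F.j =
    inv F.j ▷ R.X ≫ μ[R.X] := by
  rw [← cancel_mono F.j]
  simp only [Category.assoc, IsIso.inv_hom_id, Category.comp_id]
  rw [F.j_actRight, ← comp_whiskerRight_assoc, IsIso.inv_hom_id, id_whiskerRight, Category.id_comp]

theorem j_actLeft_inv (F : H.Frame M J) : (H.s.hom ▷ J.X ≫ J.actLeft) ≫ inv F.j =
    R.X ◁ inv F.j ≫ μ[R.X] := by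
  rw [← cancel_mono F.j]
  simp only [Category.assoc, IsIso.inv_hom_id, Category.comp_id]
  rw [F.j_actLeft, ← MonoidalCategory.whiskerLeft_comp_assoc, IsIso.inv_hom_id,
    MonoidalCategory.whiskerLeft_id, Category.id_comp]

theorem one_j (F : H.Frame M J) : η[R.X] ≫ F.j = F.u := by
  rw [← F.s_u, IsMonHom.one_hom_assoc, one_lorbit]

theorem u_inv_j (F : H.Frame M J) : F.u ≫ inv F.j = η[R.X] := by
  rw [← F.one_j, Category.assoc, IsIso.hom_inv_id, Category.comp_id]

/-- In elements, e(a ⊗ a') ⊗ (u ⊗ 1) = e ⊗ (au ⊗ a'), and au = s(π(a))u. So `left_act_insRight`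
yields the action of s(π(a))a' on the generator. -/
theorem p_insLeft_left (F : H.Frame M J) : F.p ≫ insLeft M (boxPoint F.u (regPoint H.A)) =
    (F.counit.hcomp (Cell.id H.L)).hom ≫ (leftUnit H.L).hom ≫ (λ_ H.A.X).inv ≫
      orbit (tens M (box J (reg H.A))) (tensPoint F.e (boxPoint F.u (regPoint H.A))) := by
  have h1 := F.adapted.left_act_insRight
  have h2 := Adapted.lorbit_insRight_left (H := H) F.e F.u
  rw [F.s_u] at h1
  have h3 {W : C} (k : H.A.X ⟶ W) : proj (reg R) H.L ≫ (leftUnit H.L).hom ≫ k = H.L.actLeft ≫ k := by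
    rw [← Category.assoc, proj_leftUnit]
  have h4 : (F.counit.hom ⊗ₘ (Cell.id H.L).hom) = F.counit.hom ▷ H.A.X := tensorHom_id _ _
  rw [← cancel_epi (proj H.L H.L), Cell.proj_hcomp_assoc, reassoc_of% F.proj_p, ← h2,
    h3, ← h1, h4, ← comp_whiskerRight_assoc, F.counit_j]

theorem p_insLeft_right (F : H.Frame M J) : F.p ≫ insLeft M (boxPoint (regPoint H.A) F.u) =
    ((Cell.id H.L).hcomp F.counit).hom ≫ (rightUnit H.L).hom ≫ (ρ_ H.A.X).inv ≫
      orbit (tens M (box (reg H.A) J)) (tensPoint F.e (boxPoint (regPoint H.A) F.u)) := by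
  have h1 := F.adapted.right_act_insRight
  have h2 := Adapted.lorbit_insRight_right (H := H) F.e F.u
  rw [F.s_u] at h1
  have h3 {W : C} (k : H.A.X ⟶ W) : proj H.L (reg R) ≫ (rightUnit H.L).hom ≫ k = H.L.actRight ≫ k := by
    rw [← Category.assoc, proj_rightUnit]
  have h4 : ((Cell.id H.L).hom ⊗ₘ F.counit.hom) = H.A.X ◁ F.counit.hom := id_tensorHom _ _
  rw [← cancel_epi (proj H.L H.L), Cell.proj_hcomp_assoc, reassoc_of% F.proj_p, ← h2,
    h3, ← h1, h4, ← MonoidalCategory.whiskerLeft_comp_assoc, F.counit_j]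

/-- Left multiplication by a on the generator is right multiplication by the left-counit expression
of a. This equates the left counit law with left linearity of `l`; the two directions are
`counit_left_of_cell` and `exists_left`. -/
theorem lorbit_left (F : H.Frame M J) :
    lorbit (tens M (box J (reg H.A))) (tensPoint F.e (boxPoint F.u (regPoint H.A))) =
    (F.comul.hom ≫ (F.counit.hcomp (Cell.id H.L)).hom ≫ (leftUnit H.L).hom) ≫ (λ_ H.A.X).inv ≫
      orbit (tens M (box J (reg H.A))) (tensPoint F.e (boxPoint F.u (regPoint H.A))) := by
  rw [lorbit_tens, ← F.comul_p, Category.assoc, F.p_insLeft_left, Category.assoc, Category.assoc]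

theorem lorbit_right (F : H.Frame M J) :
    lorbit (tens M (box (reg H.A) J)) (tensPoint F.e (boxPoint (regPoint H.A) F.u)) =
    (F.comul.hom ≫ ((Cell.id H.L).hcomp F.counit).hom ≫ (rightUnit H.L).hom) ≫ (ρ_ H.A.X).inv ≫
      orbit (tens M (box (reg H.A) J)) (tensPoint F.e (boxPoint (regPoint H.A) F.u)) := by
  rw [lorbit_tens, ← F.comul_p, Category.assoc, F.p_insLeft_right, Category.assoc, Category.assoc]

theorem counit_left_of_cell (F : H.Frame M J)
    (l : Cell (𝟙 H.A) (λ_ H.A).hom (tens M (box J (reg H.A))) (reg H.A))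
    (hl : tensPoint F.e (boxPoint F.u (regPoint H.A)) ≫ l.hom = regPoint H.A) :
    F.comul.hom ≫ (F.counit.hcomp (Cell.id H.L)).hom ≫ (leftUnit H.L).hom = 𝟙 H.A.X := by
  have h1 := lorbit_cell l (tensPoint F.e (boxPoint F.u (regPoint H.A)))
  have h2 := orbit_cell l (tensPoint F.e (boxPoint F.u (regPoint H.A)))
  rw [hl, orbit_reg, Category.comp_id] at h2
  rw [hl, lorbit_reg, F.lorbit_left] at h1
  simp only [Category.assoc] at h1
  rw [h2] at h1
  change _ ≫ _ ≫ _ ≫ (λ_ H.A.X).inv ≫ (λ_ H.A.X).hom = 𝟙 H.A.X ≫ 𝟙 H.A.X at h1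
  rw [Iso.inv_hom_id, Category.comp_id, Category.comp_id] at h1
  exact h1

theorem counit_right_of_cell (F : H.Frame M J)
    (r : Cell (𝟙 H.A) (ρ_ H.A).hom (tens M (box (reg H.A) J)) (reg H.A))
    (hr : tensPoint F.e (boxPoint (regPoint H.A) F.u) ≫ r.hom = regPoint H.A) :
    F.comul.hom ≫ ((Cell.id H.L).hcomp F.counit).hom ≫ (rightUnit H.L).hom = 𝟙 H.A.X := by
  have h1 := lorbit_cell r (tensPoint F.e (boxPoint (regPoint H.A) F.u))
  have h2 := orbit_cell r (tensPoint F.e (boxPoint (regPoint H.A) F.u))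
  rw [hr, orbit_reg, Category.comp_id] at h2
  rw [hr, lorbit_reg, F.lorbit_right] at h1
  simp only [Category.assoc] at h1
  rw [h2] at h1
  change _ ≫ _ ≫ _ ≫ (ρ_ H.A.X).inv ≫ (ρ_ H.A.X).hom = 𝟙 H.A.X ≫ 𝟙 H.A.X at h1
  rw [Iso.inv_hom_id, Category.comp_id, Category.comp_id] at h1
  exact h1

theorem exists_left (F : H.Frame M J)
    (hl : F.comul.hom ≫ (F.counit.hcomp (Cell.id H.L)).hom ≫ (leftUnit H.L).hom = 𝟙 H.A.X) :
    ∃ l : Cell (𝟙 H.A) (λ_ H.A).hom (tens M (box J (reg H.A))) (reg H.A),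
      tensPoint F.e (boxPoint F.u (regPoint H.A)) ≫ l.hom = regPoint H.A ∧ IsIso l.hom := by
  have := F.adapted.cyclic_left
  -- The morphism `k` sends e ⊗ (j(r) ⊗ a) to s(r)a.
  obtain ⟨k, hk⟩ := F.exists_desc (box J (reg H.A)) (inv F.j ▷ H.A.X ≫ H.L.actLeft) (by
    refine (H.balanced_iff J (reg H.A) _).2 ?_
    have e : μ[R.X] ▷ H.A.X ≫ H.L.actLeft = (α_ _ _ _).hom ≫ R.X ◁ H.L.actLeft ≫ H.L.actLeft :=
      H.L.left_assoc
    rw [← comp_whiskerRight_assoc, F.j_actRight_inv, comp_whiskerRight, Category.assoc, e,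
      associator_naturality_left_assoc, ← whisker_exchange_assoc])
  have h1 : orbit (tens M (box J (reg H.A))) (tensPoint F.e (boxPoint F.u (regPoint H.A))) ≫ k =
      (λ_ H.A.X).hom := by
    rw [orbit_tens, Category.assoc, hk, orbit_box, orbit_reg, Adapted.orbit_unit]
    change (F.u ⊗ₘ 𝟙 H.A.X) ≫ _ = _
    have e : η[R.X] ▷ H.A.X ≫ H.L.actLeft = (λ_ H.A.X).hom := H.L.one_actLeft
    rw [tensorHom_id, ← comp_whiskerRight_assoc, F.u_inv_j, e]
  -- Left linearity at the generator: this is where the counit law is used.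
  have h2 : lorbit (tens M (box J (reg H.A))) (tensPoint F.e (boxPoint F.u (regPoint H.A))) ≫ k =
      𝟙 H.A.X := by
    rw [F.lorbit_left, hl, Category.assoc, Category.assoc, h1]
    simp
  refine ⟨Cell.ofOrbit (tensPoint F.e (boxPoint F.u (regPoint H.A))) k (regPoint H.A) ?_ ?_, ?_, ?_⟩
  · rw [h1, orbit_reg, Category.comp_id]; rfl
  · rw [h2, lorbit_reg, Category.comp_id]; rfl
  · have h3 := congrArg (η[H.A.X] ≫ ·) h2
    simp only [← Category.assoc] at h3
    rw [one_lorbit] at h3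
    exact h3.trans (Category.comp_id _)
  -- The orbit map is epi and its composite with `k` is a unitor, so `k` is invertible.
  · have : IsIso (orbit (tens M (box J (reg H.A)))
        (tensPoint F.e (boxPoint F.u (regPoint H.A))) ≫ k) := by rw [h1]; infer_instance
    exact isIso_of_epi_comp (orbit (tens M (box J (reg H.A)))
        (tensPoint F.e (boxPoint F.u (regPoint H.A)))) k

theorem exists_right (F : H.Frame M J)
    (hr : F.comul.hom ≫ ((Cell.id H.L).hcomp F.counit).hom ≫ (rightUnit H.L).hom = 𝟙 H.A.X) :
    ∃ r : Cell (𝟙 H.A) (ρ_ H.A).hom (tens M (box (reg H.A) J)) (reg H.A),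
      tensPoint F.e (boxPoint (regPoint H.A) F.u) ≫ r.hom = regPoint H.A ∧ IsIso r.hom := by
  have := F.adapted.cyclic_right
  -- The morphism `k` sends e ⊗ (a ⊗ j(r)) to t(r)a.
  obtain ⟨k, hk⟩ := F.exists_desc (box (reg H.A) J) (H.A.X ◁ inv F.j ≫ H.L.actRight) (by
    refine (H.balanced_iff (reg H.A) J _).2 ?_
    have e : H.L.actRight ▷ R.X ≫ H.L.actRight =
        (α_ _ _ _).hom ≫ H.A.X ◁ μ[R.X] ≫ H.L.actRight := by
      have := H.L.right_assoc
      rw [this, Iso.hom_inv_id_assoc]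
    exact balanced_right _ _ _ _ e F.j_actLeft_inv)
  have h1 : orbit (tens M (box (reg H.A) J)) (tensPoint F.e (boxPoint (regPoint H.A) F.u)) ≫ k =
      (ρ_ H.A.X).hom := by
    rw [orbit_tens, Category.assoc, hk, orbit_box, orbit_reg, Adapted.orbit_unit]
    change (𝟙 H.A.X ⊗ₘ F.u) ≫ _ = _
    have e : H.A.X ◁ η[R.X] ≫ H.L.actRight = (ρ_ H.A.X).hom := H.L.actRight_one
    rw [id_tensorHom, ← MonoidalCategory.whiskerLeft_comp_assoc, F.u_inv_j, e]
  have h2 : lorbit (tens M (box (reg H.A) J)) (tensPoint F.e (boxPoint (regPoint H.A) F.u)) ≫ k =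
      𝟙 H.A.X := by
    rw [F.lorbit_right, hr, Category.assoc, Category.assoc, h1]
    simp
  refine ⟨Cell.ofOrbit (tensPoint F.e (boxPoint (regPoint H.A) F.u)) k (regPoint H.A) ?_ ?_, ?_, ?_⟩
  · rw [h1, orbit_reg, Category.comp_id]; rfl
  · rw [h2, lorbit_reg, Category.comp_id]; rfl
  · have h3 := congrArg (η[H.A.X] ≫ ·) h2
    simp only [← Category.assoc] at h3
    rw [one_lorbit] at h3
    exact h3.trans (Category.comp_id _)
  · have : IsIso (orbit (tens M (box (reg H.A) J))
        (tensPoint F.e (boxPoint (regPoint H.A) F.u)) ≫ k) := by rw [h1]; infer_instance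
    exact isIso_of_epi_comp (orbit (tens M (box (reg H.A) J))
        (tensPoint F.e (boxPoint (regPoint H.A) F.u))) k

/-- The comparison of `(L ⊗_R L) ⊗_R L` with `M ⊗ (M ⊠ A)`. -/
noncomputable def flattenLeft (F : H.Frame M J) :
    (tens (tens H.L H.L) H.L).X ⟶ (tens M (box M (reg H.A))).X :=
  tensDesc (tens H.L H.L) H.L (F.p ▷ H.A.X ≫ insRight F.e (box M (reg H.A))) (by
    have h := F.adapted.balanced_box M (reg H.A)
    rw [← comp_whiskerRight_assoc, F.p_actRight, comp_whiskerRight, Category.assoc, h,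
      associator_naturality_left_assoc, ← whisker_exchange_assoc])

/-- The comparison of `L ⊗_R (L ⊗_R L)` with `M ⊗ (A ⊠ M)`. -/
noncomputable def flattenRight (F : H.Frame M J) :
    (tens H.L (tens H.L H.L)).X ⟶ (tens M (box (reg H.A) M)).X :=
  tensDesc H.L (tens H.L H.L) (H.A.X ◁ F.p ≫ insRight F.e (box (reg H.A) M)) (by
    have h : H.L.actRight ▷ M.X ≫ insRight F.e (box (reg H.A) M) = _ :=
      F.adapted.balanced_box (reg H.A) M
    rw [← MonoidalCategory.whiskerLeft_comp_assoc, F.p_actLeft, MonoidalCategory.whiskerLeft_comp,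
      Category.assoc, ← associator_naturality_right_assoc, ← whisker_exchange_assoc, h])

theorem proj_flattenLeft (F : H.Frame M J) : proj (tens H.L H.L) H.L ≫ F.flattenLeft =
    F.p ▷ H.A.X ≫ insRight F.e (box M (reg H.A)) := proj_tensDesc _ _ _ _

theorem proj_flattenRight (F : H.Frame M J) : proj H.L (tens H.L H.L) ≫ F.flattenRight =
    H.A.X ◁ F.p ≫ insRight F.e (box (reg H.A) M) := proj_tensDesc _ _ _ _

theorem orbit_flattenLeft (F : H.Frame M J) :
    orbit (tens M (box M (reg H.A))) (tensPoint F.e (boxPoint F.e (regPoint H.A))) =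
      proj H.L H.L ▷ H.A.X ≫ proj (tens H.L H.L) H.L ≫ F.flattenLeft := by
  rw [F.proj_flattenLeft, ← comp_whiskerRight_assoc, F.proj_p, orbit_tens, orbit_box, orbit_reg]
  exact congrArg (· ≫ _) (tensorHom_id _ _)

theorem orbit_flattenRight (F : H.Frame M J) :
    orbit (tens M (box (reg H.A) M)) (tensPoint F.e (boxPoint (regPoint H.A) F.e)) =
      H.A.X ◁ proj H.L H.L ≫ proj H.L (tens H.L H.L) ≫ F.flattenRight := by
  rw [F.proj_flattenRight, ← MonoidalCategory.whiskerLeft_comp_assoc, F.proj_p, orbit_tens,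
    orbit_box, orbit_reg]
  exact congrArg (· ≫ _) (id_tensorHom _ _)

/-- In elements, a(e ⊗ (e ⊗ 1)) = p(γ(a)) ⊗ (e ⊗ 1). Moving the two legs of γ(a) across the tensor
sign makes the first one act on the second copy of `e`, which applies γ once more. -/
theorem lorbit_flattenLeft (F : H.Frame M J) :
    lorbit (tens M (box M (reg H.A))) (tensPoint F.e (boxPoint F.e (regPoint H.A))) =
      F.comul.hom ≫ (F.comul.hcomp (Cell.id H.L)).hom ≫ F.flattenLeft := by
  have h : F.p ≫ insLeft M (boxPoint F.e (regPoint H.A)) =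
      (F.comul.hcomp (Cell.id H.L)).hom ≫ F.flattenLeft := by
    have h4 : (F.comul.hom ⊗ₘ (Cell.id H.L).hom) = F.comul.hom ▷ H.A.X := tensorHom_id _ _
    have h5 : (lorbit M F.e ⊗ₘ lorbit (reg H.A) (regPoint H.A)) = lorbit M F.e ▷ H.A.X := by
      rw [lorbit_reg]; exact tensorHom_id _ _
    rw [← cancel_epi (proj H.L H.L), Cell.proj_hcomp_assoc, reassoc_of% F.proj_p, orbit_insLeft,
      lorbit_box, h4, h5, F.proj_flattenLeft, ← comp_whiskerRight_assoc, F.comul_p]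
  rw [lorbit_tens, ← F.comul_p, Category.assoc, h]

theorem lorbit_flattenRight (F : H.Frame M J) :
    lorbit (tens M (box (reg H.A) M)) (tensPoint F.e (boxPoint (regPoint H.A) F.e)) =
      F.comul.hom ≫ ((Cell.id H.L).hcomp F.comul).hom ≫ F.flattenRight := by
  have h : F.p ≫ insLeft M (boxPoint (regPoint H.A) F.e) =
      ((Cell.id H.L).hcomp F.comul).hom ≫ F.flattenRight := by
    have h4 : ((Cell.id H.L).hom ⊗ₘ F.comul.hom) = H.A.X ◁ F.comul.hom := id_tensorHom _ _
    have h5 : (lorbit (reg H.A) (regPoint H.A) ⊗ₘ lorbit M F.e) = H.A.X ◁ lorbit M F.e := by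
      rw [lorbit_reg]; exact id_tensorHom _ _
    rw [← cancel_epi (proj H.L H.L), Cell.proj_hcomp_assoc, reassoc_of% F.proj_p, orbit_insLeft,
      lorbit_box, h4, h5, F.proj_flattenRight, ← MonoidalCategory.whiskerLeft_comp_assoc, F.comul_p]
  rw [lorbit_tens, ← F.comul_p, Category.assoc, h]

theorem cyclic_assocLeft (F : H.Frame M J) :
    Cyclic (tens M (box M (reg H.A))) (tensPoint F.e (boxPoint F.e (regPoint H.A))) :=
  F.adapted.cyclic.tens (F.adapted.cyclic.box (cyclic_reg _))

theorem cyclic_assocRight (F : H.Frame M J) :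
    Cyclic (tens M (box (reg H.A) M)) (tensPoint F.e (boxPoint (regPoint H.A) F.e)) :=
  F.adapted.cyclic.tens ((cyclic_reg _).box F.adapted.cyclic)

/-- It is epi because the orbit map of a cyclic module factors through it. A retraction exists
because maps out of M ⊗ W only have to be balanced over `R`. -/
instance (F : H.Frame M J) : IsIso F.flattenLeft := by
  have h := F.cyclic_assocLeft.stableEpi
  rw [F.orbit_flattenLeft, ← Category.assoc] at h
  have := stableEpi_of_comp (proj H.L H.L ▷ H.A.X ≫ proj (tens H.L H.L) H.L) F.flattenLeft
  obtain ⟨k, hk⟩ := F.exists_desc (box M (reg H.A)) (inv F.p ▷ H.A.X ≫ proj (tens H.L H.L) H.L) (by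
    refine (H.balanced_iff M (reg H.A) _).2 ?_
    have e : (tens H.L H.L).actRight ▷ H.A.X ≫ proj (tens H.L H.L) H.L = _ :=
      proj_condition (tens H.L H.L) H.L
    rw [← comp_whiskerRight_assoc, F.p_actRight_inv, comp_whiskerRight, Category.assoc]
    refine (congrArg (_ ≫ ·) e).trans ?_
    rw [associator_naturality_left_assoc, ← whisker_exchange_assoc])
  refine isIso_of_retraction _ k ?_
  rw [← cancel_epi (proj (tens H.L H.L) H.L), reassoc_of% F.proj_flattenLeft, hk,
    ← comp_whiskerRight_assoc, IsIso.hom_inv_id]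
  exact (congrArg (· ≫ _) (id_whiskerRight _ _)).trans
    ((Category.id_comp _).trans (Category.comp_id _).symm)

instance (F : H.Frame M J) : IsIso F.flattenRight := by
  have h := F.cyclic_assocRight.stableEpi
  rw [F.orbit_flattenRight, ← Category.assoc] at h
  have := stableEpi_of_comp (H.A.X ◁ proj H.L H.L ≫ proj H.L (tens H.L H.L)) F.flattenRight
  obtain ⟨k, hk⟩ := F.exists_desc (box (reg H.A) M) (H.A.X ◁ inv F.p ≫ proj H.L (tens H.L H.L)) (by
    refine (H.balanced_iff (reg H.A) M _).2 ?_
    have e := proj_condition H.L (tens H.L H.L)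
    rw [← MonoidalCategory.whiskerLeft_comp_assoc, F.p_actLeft_inv,
      MonoidalCategory.whiskerLeft_comp, Category.assoc, ← associator_naturality_right_assoc, ← e,
      whisker_exchange_assoc])
  refine isIso_of_retraction _ k ?_
  rw [← cancel_epi (proj H.L (tens H.L H.L)), reassoc_of% F.proj_flattenRight, hk,
    ← MonoidalCategory.whiskerLeft_comp_assoc, IsIso.hom_inv_id]
  exact (congrArg (· ≫ _) (MonoidalCategory.whiskerLeft_id _ _)).trans
    ((Category.id_comp _).trans (Category.comp_id _).symm)

theorem orbit_flatten (F : H.Frame M J) : proj H.L H.L ▷ H.A.X ≫ proj (tens H.L H.L) H.L ≫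
    (assocHom H.L H.L H.L).hom ≫ F.flattenRight =
      (α_ _ _ _).hom ≫ orbit (tens M (box (reg H.A) M))
        (tensPoint F.e (boxPoint (regPoint H.A) F.e)) := by
  have h : proj H.L H.L ▷ H.A.X ≫ proj (tens H.L H.L) H.L ≫ (assocHom H.L H.L H.L).hom =
      (α_ _ _ _).hom ≫ H.A.X ◁ proj H.L H.L ≫ proj H.L (tens H.L H.L) :=
    proj_assocHomX H.L H.L H.L
  rw [F.orbit_flattenRight, reassoc_of% h]

/-- Its value on the generator forces `a` to be the associator of ⊗_R under the flattenings. Left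
linearity at the generator then compares the two iterated comultiplications. -/
theorem coassoc_of_cell (F : H.Frame M J)
    (a : Cell (𝟙 H.A) (α_ H.A H.A H.A).hom (tens M (box M (reg H.A))) (tens M (box (reg H.A) M)))
    (ha : tensPoint F.e (boxPoint F.e (regPoint H.A)) ≫ a.hom =
      tensPoint F.e (boxPoint (regPoint H.A) F.e)) :
    F.comul.hom ≫ (F.comul.hcomp (Cell.id _)).hom ≫ (assocHom _ _ _).hom =
      F.comul.hom ≫ ((Cell.id _).hcomp F.comul).hom := by
  have h1 := orbit_cell a (tensPoint F.e (boxPoint F.e (regPoint H.A)))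
  have h2 := lorbit_cell a (tensPoint F.e (boxPoint F.e (regPoint H.A)))
  rw [ha] at h1 h2
  have h3 : F.flattenLeft ≫ a.hom = (assocHom H.L H.L H.L).hom ≫ F.flattenRight := by
    rw [← cancel_epi (proj H.L H.L ▷ H.A.X ≫ proj (tens H.L H.L) H.L), Category.assoc,
      Category.assoc, F.orbit_flatten]
    rw [F.orbit_flattenLeft, Category.assoc, Category.assoc] at h1
    exact h1
  rw [F.lorbit_flattenLeft, F.lorbit_flattenRight, Category.assoc, Category.assoc, h3] at h2
  rw [← cancel_mono F.flattenRight]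
  simp only [Category.assoc]
  exact h2.trans (Category.id_comp _)

/-- The constraint is the associator of ⊗_R conjugated by the flattenings. It is right linear for
any frame; coassociativity is needed only for left linearity. -/
theorem exists_assoc (F : H.Frame M J)
    (hc : F.comul.hom ≫ (F.comul.hcomp (Cell.id _)).hom ≫ (assocHom _ _ _).hom =
      F.comul.hom ≫ ((Cell.id _).hcomp F.comul).hom) :
    ∃ a : Cell (𝟙 H.A) (α_ H.A H.A H.A).hom (tens M (box M (reg H.A))) (tens M (box (reg H.A) M)),
      tensPoint F.e (boxPoint F.e (regPoint H.A)) ≫ a.hom =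
        tensPoint F.e (boxPoint (regPoint H.A) F.e) ∧ IsIso a.hom := by
  have := F.cyclic_assocLeft
  have h1 : lorbit (tens M (box M (reg H.A))) (tensPoint F.e (boxPoint F.e (regPoint H.A))) ≫
      inv F.flattenLeft ≫ (assocHom H.L H.L H.L).hom ≫ F.flattenRight =
      lorbit (tens M (box (reg H.A) M)) (tensPoint F.e (boxPoint (regPoint H.A) F.e)) := by
    have h := congrArg (· ≫ F.flattenRight) hc
    simp only [Category.assoc] at h
    rw [F.lorbit_flattenLeft, F.lorbit_flattenRight, Category.assoc, Category.assoc,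
      IsIso.hom_inv_id_assoc, h]
  refine ⟨Cell.ofOrbit (tensPoint F.e (boxPoint F.e (regPoint H.A)))
    (inv F.flattenLeft ≫ (assocHom H.L H.L H.L).hom ≫ F.flattenRight)
    (tensPoint F.e (boxPoint (regPoint H.A) F.e)) ?_ ?_, ?_, ?_⟩
  · rw [F.orbit_flattenLeft, Category.assoc, Category.assoc, IsIso.hom_inv_id_assoc,
      F.orbit_flatten]
    rfl
  · rw [h1]
    exact (Category.id_comp _).symm
  · have h2 := congrArg (η[H.A.X] ≫ ·) h1
    simp only [← Category.assoc] at h2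
    rw [one_lorbit, one_lorbit] at h2
    simp only [Category.assoc] at h2
    exact h2
  · rw [Cell.ofOrbit_hom]
    infer_instance

end Frame
end BialgebroidBase
end Coherence
end IntBgd


namespace IntBgd

/-! ### 2-cells into `companion f ⊗ N` as cells along `f`. -/

section Lift
set_option linter.unusedSectionVars false
variable {C : Type u} [Category.{v} C] [MonoidalCategory C]
variable [HasCoequalizers C]
variable [∀ X : C, PreservesColimitsOfShape WalkingParallelPair (tensorLeft X)]
variable [∀ X : C, PreservesColimitsOfShape WalkingParallelPair (tensorRight X)]
variable {A B D : Mon C}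

/-- Tensoring with `companion f` on the left is restriction along `f`: the underlying object does
not change. -/
instance (f : A ⟶ B) (N : Bimod B D) : IsIso (companionCell f N).hom := by
  have h1 : IsIso (resCell f (𝟙 B) (reg B)).hom := inferInstanceAs (IsIso (𝟙 B.X))
  have h2 : IsIso (Cell.id N).hom := inferInstanceAs (IsIso (𝟙 N.X))
  have h3 : IsIso (Mon.Hom.hom (𝟙 B)) := inferInstanceAs (IsIso (𝟙 B.X))
  have := isIso_hcomp (resCell f (𝟙 B) (reg B)) (Cell.id N) rfl
  rw [companionCell, Cell.cast_hom, Cell.comp_hom]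
  exact IsIso.comp_isIso' this inferInstance

/-- The morphism `P ⟶ f_* ⊗ N` corresponding to a cell `P ⟶ N` along `f`. -/
noncomputable def companionLift {f : A ⟶ B} {P : Bimod A D} {N : Bimod B D} (g : Cell f (𝟙 D) P N) :
    BimHom P (tens (companion f) N) where
  hom := g.hom ≫ inv (companionCell f N).hom
  left := by
    rw [← cancel_mono (companionCell f N).hom]
    simp only [Category.assoc, IsIso.inv_hom_id, Category.comp_id, (companionCell f N).left, g.left]
    rw [tensorHom_comp_tensorHom_assoc, Category.assoc, IsIso.inv_hom_id, Category.comp_id,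
      Mon.id_hom', Category.id_comp]
  right := by
    rw [← cancel_mono (companionCell f N).hom]
    simp only [Category.assoc, IsIso.inv_hom_id, Category.comp_id, (companionCell f N).right,
      g.right]
    rw [tensorHom_comp_tensorHom_assoc, Category.assoc, IsIso.inv_hom_id, Category.comp_id,
      Mon.id_hom', Category.id_comp]

theorem companionLift_companionCell {f : A ⟶ B} {P : Bimod A D} {N : Bimod B D}
    (g : Cell f (𝟙 D) P N) : (companionLift g).hom ≫ (companionCell f N).hom = g.hom := by
  rw [companionLift, Category.assoc, IsIso.inv_hom_id, Category.comp_id]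

theorem comp_companionLift {f : A ⟶ B} {P : Bimod A D} {N : Bimod B D}
    (g : Cell f (𝟙 D) P N) {x : 𝟙_ C ⟶ P.X} {y : 𝟙_ C ⟶ N.X} (h : x ≫ g.hom = y) :
    x ≫ (companionLift g).hom = tensPoint (companionPoint f) y := by
  rw [← cancel_mono (companionCell f N).hom, Category.assoc, companionLift_companionCell,
    tensPoint_companionCell, h]

instance {f : A ⟶ B} {P : Bimod A D} {N : Bimod B D} (g : Cell f (𝟙 D) P N) [IsIso g.hom] :
    IsIso (companionLift g).hom := by
  rw [companionLift]; infer_instance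

end Lift

/-! ### Tensor products with the canonical multiplication as tensor products over R. -/

section EnvCells
set_option linter.unusedSectionVars false
variable {C : Type u} [Category.{v} C] [MonoidalCategory C] [SymmetricCategory C]

theorem inl_tensor {A B A' B' : Mon C} (f : A ⟶ A') (g : B ⟶ B') :
    (inl A B).hom ≫ (f.hom ⊗ₘ g.hom) = f.hom ≫ (inl A' B').hom := by
  rw [inl_hom, inl_hom, Category.assoc, MonoidalCategory.tensorHom_def',
    ← MonoidalCategory.whiskerLeft_comp_assoc, IsMonHom.one_hom, whisker_exchange,
    ← rightUnitor_inv_naturality_assoc]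

theorem inr_tensor {A B A' B' : Mon C} (f : A ⟶ A') (g : B ⟶ B') :
    (inr A B).hom ≫ (f.hom ⊗ₘ g.hom) = g.hom ≫ (inr A' B').hom := by
  rw [inr_hom, inr_hom, Category.assoc, MonoidalCategory.tensorHom_def,
    ← comp_whiskerRight_assoc, IsMonHom.one_hom, ← whisker_exchange,
    ← leftUnitor_inv_naturality_assoc]

/-- Writes (a ⊗ a') ⊗ w as the product of (1 ⊗ a') ⊗ 1 and (a ⊗ 1) ⊗ w. This isolates the factor
t(a') that the balancing relation is allowed to move. -/
theorem env_split (R : Mon C) : ((β_ R.X R.X).hom ▷ (env R).X ≫ (α_ R.X R.X (env R).X).hom ≫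
      R.X ◁ (inl R (op R)).hom ▷ (env R).X) ≫
    ((inr R (op R)).hom ≫ (inl (env R) (env R)).hom) ▷ (env R ⊗ env R).X ≫
      μ[(env R ⊗ env R).X] = 𝟙 _ := by
  have h : (inl (env R) (env R)).hom ▷ (env R ⊗ env R).X ≫ μ[(env R ⊗ env R).X] =
    (α_ _ _ _).inv ≫ μ[(env R).X] ▷ (env R).X := BialgebroidBase.inl_act (reg (env R)) (reg (env R))
  have h' : R.X ◁ (inl R (op R)).hom ≫ (inr R (op R)).hom ▷ (env R).X ≫ μ[(env R).X] =
      (β_ R.X R.X).hom := by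
    have := inr_inl_mul R (op R)
    rwa [MonoidalCategory.tensorHom_def', Category.assoc] at this
  rw [comp_whiskerRight (_ : R.X ⟶ (env R).X), Category.assoc (_ ▷ _) (_ ▷ _) μ[_], h]
  change ((β_ R.X R.X).hom ▷ (env R).X ≫ (α_ R.X R.X (env R).X).hom ≫
      R.X ◁ (inl R (op R)).hom ▷ (env R).X) ≫ (inr R (op R)).hom ▷ ((env R).X ⊗ (env R).X) ≫ _ = _
  rw [associator_inv_naturality_left_assoc, Category.assoc, Category.assoc,
    associator_inv_naturality_middle_assoc, Iso.hom_inv_id_assoc, ← comp_whiskerRight,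
    ← comp_whiskerRight, h', ← comp_whiskerRight, SymmetricCategory.symmetry, id_whiskerRight]

/-- The decomposition of `env_split` with 1 ⊗ (a' ⊗ 1) in place of (1 ⊗ a') ⊗ 1. The result (a ⊗ 1)
⊗ (a'b ⊗ b') depends only on the element a ⊗ a'b ⊗ b' of `envM R`. -/
theorem env_collapse (R : Mon C) : ((β_ R.X R.X).hom ▷ (env R).X ≫ (α_ R.X R.X (env R).X).hom ≫
      R.X ◁ (inl R (op R)).hom ▷ (env R).X) ≫
    ((inl R (op R)).hom ≫ (inr (env R) (env R)).hom) ▷ (env R ⊗ env R).X ≫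
      μ[(env R ⊗ env R).X] =
    orbit (envM R) (envOne R) ≫ (α_ R.X R.X R.X).hom ≫ (inl R (op R)).hom ▷ (env R).X := by
  have h : (inr (env R) (env R)).hom ▷ (env R ⊗ env R).X ≫ μ[(env R ⊗ env R).X] =
    (α_ _ _ _).inv ≫ (β_ _ _).hom ▷ (env R).X ≫ (α_ _ _ _).hom ≫ (env R).X ◁ μ[(env R).X] :=
    BialgebroidBase.inr_act (reg (env R)) (reg (env R))
  have h' : (inl R (op R)).hom ▷ (env R).X ≫ μ[(env R).X] =
    (α_ R.X R.X R.X).inv ≫ μ[R.X] ▷ R.X := BialgebroidBase.inl_act (reg R) (reg (op R))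
  have hb : (((β_ R.X R.X).hom ≫ R.X ◁ (inl R (op R)).hom) ≫ (inl R (op R)).hom ▷ (env R).X) ≫
      (β_ (env R).X (env R).X).hom = ((inl R (op R)).hom ⊗ₘ (inl R (op R)).hom) := by
    rw [Category.assoc, Category.assoc,
      BraidedCategory.braiding_naturality_left, BraidedCategory.braiding_naturality_right_assoc,
      SymmetricCategory.symmetry_assoc, MonoidalCategory.tensorHom_def]
  rw [comp_whiskerRight (_ : R.X ⟶ (env R).X), Category.assoc (_ ▷ _) (_ ▷ _) μ[_], h]
  change ((β_ R.X R.X).hom ▷ (env R).X ≫ (α_ R.X R.X (env R).X).hom ≫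
      R.X ◁ (inl R (op R)).hom ▷ (env R).X) ≫ (inl R (op R)).hom ▷ ((env R).X ⊗ (env R).X) ≫ _ = _
  rw [associator_inv_naturality_left_assoc, Category.assoc, Category.assoc,
    associator_inv_naturality_middle_assoc, Iso.hom_inv_id_assoc, ← comp_whiskerRight_assoc,
    ← comp_whiskerRight_assoc, ← comp_whiskerRight_assoc, hb, MonoidalCategory.tensorHom_def',
    comp_whiskerRight, Category.assoc,
    associator_naturality_left_assoc, ← whisker_exchange, associator_naturality_middle_assoc,
    ← MonoidalCategory.whiskerLeft_comp_assoc, h', orbit_envOne]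
  change _ = (((α_ (R.X ⊗ R.X) R.X R.X).inv ≫ (α_ R.X R.X R.X).hom ▷ R.X) ≫
    (R.X ◁ μ[R.X]) ▷ R.X) ≫ (α_ R.X R.X R.X).hom ≫ (inl R (op R)).hom ▷ (R.X ⊗ R.X)
  change (α_ R.X R.X (R.X ⊗ R.X)).hom ≫ R.X ◁ ((α_ R.X R.X R.X).inv ≫ μ[R.X] ▷ R.X) ≫
    (inl R (op R)).hom ▷ (R.X ⊗ R.X) = _
  monoidal

namespace BialgebroidBase
variable {R : Mon C}

theorem companion_actRight (H : BialgebroidBase R) (χ : env R ⟶ H.A)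
    (ht : (inr R (op R)).hom ≫ χ.hom = H.t.hom) :
    (companion χ).X ◁ (ofEnv (𝟙 (env R))).t.hom ≫ (β_ _ _).hom ≫ (companion χ).actLeft =
      H.L.actRight := by
  change H.A.X ◁ ((inr R (op R)).hom ≫ 𝟙 _) ≫ (β_ _ _).hom ≫ χ.hom ▷ H.A.X ≫ μ[H.A.X] =
    H.A.X ◁ H.t.hom ≫ (β_ _ _).hom ≫ μ[H.A.X]
  rw [← BraidedCategory.braiding_naturality_right_assoc, Category.comp_id,
    ← MonoidalCategory.whiskerLeft_comp_assoc, ht]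

theorem companion_actLeft (H : BialgebroidBase R) (χ : env R ⟶ H.A)
    (hs : (inl R (op R)).hom ≫ χ.hom = H.s.hom) :
    (ofEnv (𝟙 (env R))).s.hom ▷ (companion χ).X ≫ (companion χ).actLeft = H.L.actLeft := by
  change ((inl R (op R)).hom ≫ 𝟙 _) ▷ H.A.X ≫ χ.hom ▷ H.A.X ≫ μ[H.A.X] =
    H.s.hom ▷ H.A.X ≫ μ[H.A.X]
  rw [Category.comp_id, ← comp_whiskerRight_assoc, hs]

variable [HasCoequalizers C]
variable [∀ X : C, PreservesColimitsOfShape WalkingParallelPair (tensorLeft X)]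
variable [∀ X : C, PreservesColimitsOfShape WalkingParallelPair (tensorRight X)]

/-- The products in `env_split` and `env_collapse` differ only in the factor that `w` identifies.
After acting on `W` and applying `h` they agree, so the action factors through the orbit map of
`envM R`. -/
theorem exists_env_desc {D : Mon C} (W : Bimod (env R ⊗ env R) D) {Z : C} (h : W.X ⟶ Z)
    (w : (ofEnv (𝟙 (env R))).tE ▷ W.X ≫ W.actLeft ≫ h =
      (ofEnv (𝟙 (env R))).sE ▷ W.X ≫ W.actLeft ≫ h) :
    ∃ k : (tens (envM R) W).X ⟶ Z, insRight (envOne R) W ≫ k = h := by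
  have ht : (ofEnv (𝟙 (env R))).tE = (inr R (op R)).hom ≫ (inl (env R) (env R)).hom := by
    simp [tE]
  have hs : (ofEnv (𝟙 (env R))).sE = (inl R (op R)).hom ≫ (inr (env R) (env R)).hom := by
    simp [sE]
  rw [ht, hs] at w
  have e4 : ∀ (b : (env R ⊗ env R).X ⟶ R.X ⊗ (env R ⊗ env R).X) (k : R.X ⟶ (env R ⊗ env R).X),
      (b ≫ k ▷ (env R ⊗ env R).X ≫ μ[(env R ⊗ env R).X]) ▷ W.X ≫ W.actLeft ≫ h =
        b ▷ W.X ≫ (α_ _ _ _).hom ≫ R.X ◁ W.actLeft ≫ k ▷ W.X ≫ W.actLeft ≫ h := by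
    intro b k
    rw [comp_whiskerRight, comp_whiskerRight, Category.assoc, Category.assoc,
      reassoc_of% W.left_assoc, associator_naturality_left_assoc, whisker_exchange_assoc]
  have e5 := e4 _ ((inr R (op R)).hom ≫ (inl (env R) (env R)).hom) |>.symm.trans (congrArg
    (fun k => k ▷ W.X ≫ W.actLeft ≫ h) (env_split R))
  have e6 := e4 _ ((inl R (op R)).hom ≫ (inr (env R) (env R)).hom) |>.symm.trans (congrArg
    (fun k => k ▷ W.X ≫ W.actLeft ≫ h) (env_collapse R))
  rw [w] at e5
  have e9 : 𝟙 (env R ⊗ env R).X ▷ W.X ≫ W.actLeft ≫ h = W.actLeft ≫ h := by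
    rw [id_whiskerRight, Category.id_comp]
  have e7 := e9.symm.trans (e5.symm.trans e6)
  -- Acts through x ⊗ y ⊗ z ↦ (x ⊗ 1) ⊗ (y ⊗ z), a section of the orbit map.
  let k' : (envM R).X ⊗ W.X ⟶ Z :=
    ((α_ R.X R.X R.X).hom ≫ (inl R (op R)).hom ▷ (env R).X) ▷ W.X ≫ W.actLeft ≫ h
  have e8 : orbit (envM R) (envOne R) ▷ W.X ≫ k' = W.actLeft ≫ h := by
    rw [e7, comp_whiskerRight, Category.assoc]
  refine ⟨tensDesc (envM R) W k' ?_, ?_⟩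
  · rw [← cancel_epi (orbit (envM R) (envOne R) ▷ (env R ⊗ env R).X ▷ W.X),
      ← comp_whiskerRight_assoc, orbit_actRight, comp_whiskerRight, Category.assoc, e8,
      associator_naturality_left_assoc, ← whisker_exchange_assoc, e8, reassoc_of% W.left_assoc]
  · have h3 := congrArg (fun k => (λ_ W.X).inv ≫ η[(env R ⊗ env R).X] ▷ W.X ≫ k) e8
    rw [← comp_whiskerRight_assoc, one_orbit, reassoc_of% W.one_actLeft,
      Iso.inv_hom_id_assoc] at h3
    rw [insRight, Category.assoc, Category.assoc, proj_tensDesc, h3]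

/-- The comparison of `L ⊗_R L` with `m ⊗ (χ_* ⊠ χ_*)`. -/
theorem exists_envFlatten (H : BialgebroidBase R) (χ : env R ⟶ H.A)
    (hs : (inl R (op R)).hom ≫ χ.hom = H.s.hom) (ht : (inr R (op R)).hom ≫ χ.hom = H.t.hom) :
    ∃ q : (tens H.L H.L).X ⟶ (tens (envM R) (box (companion χ) (companion χ))).X,
      proj H.L H.L ≫ q = insRight (envOne R) (box (companion χ) (companion χ)) ∧ IsIso q := by
  have h := (ofEnv_adapted R).balanced_box (companion χ) (companion χ)
  rw [H.companion_actRight χ ht, H.companion_actLeft χ hs] at h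
  refine ⟨tensDesc H.L H.L (insRight (envOne R) (box (companion χ) (companion χ))) h,
    proj_tensDesc _ _ _ _, ?_⟩
  obtain ⟨k, hk⟩ := exists_env_desc (box (companion χ) (companion χ)) (proj H.L H.L) (by
    refine ((ofEnv (𝟙 (env R))).balanced_iff (companion χ) (companion χ) _).2 ?_
    rw [H.companion_actRight χ ht, H.companion_actLeft χ hs]
    exact proj_condition H.L H.L)
  have h1 := stableEpi_insRight (envM R) (envOne R) (box (companion χ) (companion χ))
  have h2 : proj H.L H.L ≫ tensDesc H.L H.L _ h = _ := proj_tensDesc _ _ _ _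
  rw [← h2] at h1
  have := stableEpi_of_comp (proj H.L H.L) (tensDesc H.L H.L _ h)
  refine isIso_of_retraction _ k ?_
  rw [← cancel_epi (proj H.L H.L), reassoc_of% h2, hk, Category.comp_id]

/-- Left multiplication by p ⊗ q moves into the two companions as s(p) and t(q). The fields `s_e`
and `t_e` of a frame come from this formula. -/
theorem lorbit_env (H : BialgebroidBase R) (χ : env R ⟶ H.A)
    (hs : (inl R (op R)).hom ≫ χ.hom = H.s.hom) (ht : (inr R (op R)).hom ≫ χ.hom = H.t.hom) :
    lorbit (tens (envM R) (box (companion χ) (companion χ)))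
      (tensPoint (envOne R) (boxPoint (companionPoint χ) (companionPoint χ))) =
    (H.s.hom ⊗ₘ H.t.hom) ≫ insRight (envOne R) (box (companion χ) (companion χ)) := by
  rw [lorbit_tens, lorbit_envOne_eq, Category.assoc, orbit_insLeft, lorbit_box, lorbit_companion,
    tensorHom_comp_tensorHom_assoc, hs, ht]

theorem orbit_env {A : Mon C} (χ : env R ⟶ A) :
    orbit (tens (envM R) (box (companion χ) (companion χ)))
      (tensPoint (envOne R) (boxPoint (companionPoint χ) (companionPoint χ))) =
    insRight (envOne R) (box (companion χ) (companion χ)) := by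
  rw [orbit_tens, orbit_box, orbit_companion]
  exact (congrArg (· ≫ _) (id_tensorHom_id _ _)).trans (Category.id_comp _)

/-- The frame of a multiplication and a unit obtained from the canonical ones along `χ`. -/
theorem exists_frame (H : BialgebroidBase R) (χ : env R ⟶ H.A)
    (hs : (inl R (op R)).hom ≫ χ.hom = H.s.hom) (ht : (inr R (op R)).hom ≫ χ.hom = H.t.hom)
    {M : Bimod H.A (H.A ⊗ H.A)} {J : Bimod H.A (𝟙_ (Mon C))}
    (σ : Cell χ (𝟙 (H.A ⊗ H.A)) (tens (envM R) (box (companion χ) (companion χ))) M)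
    (υ : Cell χ (𝟙 (𝟙_ (Mon C))) (envJ R) J) [IsIso σ.hom] [IsIso υ.hom] :
    ∃ F : H.Frame M J, tensPoint (envOne R) (boxPoint (companionPoint χ) (companionPoint χ)) ≫
      σ.hom = F.e ∧ envUnit R ≫ υ.hom = F.u := by
  obtain ⟨q, hq, hq'⟩ := H.exists_envFlatten χ hs ht
  have h1 := orbit_cell σ (tensPoint (envOne R) (boxPoint (companionPoint χ) (companionPoint χ)))
  have h2 := lorbit_cell σ (tensPoint (envOne R) (boxPoint (companionPoint χ) (companionPoint χ)))
  have h3 := lorbit_cell υ (envUnit R)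
  rw [orbit_env, Mon.id_hom', Category.id_comp] at h1
  rw [H.lorbit_env χ hs ht, Category.assoc, h1] at h2
  refine ⟨{
    e := tensPoint (envOne R) (boxPoint (companionPoint χ) (companionPoint χ)) ≫ σ.hom
    u := envUnit R ≫ υ.hom
    p := q ≫ σ.hom
    isIso_p := inferInstance
    proj_p := by rw [reassoc_of% hq, h1]
    s_e := by
      rw [← reassoc_of% inl_tensor H.s H.t, h2, ← hs, Category.assoc]
    t_e := by
      rw [← reassoc_of% inr_tensor H.s H.t, h2, ← ht, Category.assoc]
    j := υ.hom
    isIso_j := inferInstance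
    s_u := by
      rw [← hs, Category.assoc, ← h3, reassoc_of% inl_envUnit]
    t_u := by
      rw [← ht, Category.assoc, ← h3, reassoc_of% inr_envUnit] }, rfl, rfl⟩

end BialgebroidBase
end EnvCells
end IntBgd


namespace IntBgd

/-! ### From an object of `DS R` to its bialgebroid. -/

section Criterion
set_option linter.unusedSectionVars false
variable {C : Type u} [Category.{v} C] [MonoidalCategory C] [SymmetricCategory C]
variable [HasCoequalizers C]
variable [∀ X : C, PreservesColimitsOfShape WalkingParallelPair (tensorLeft X)]
variable [∀ X : C, PreservesColimitsOfShape WalkingParallelPair (tensorRight X)]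

/-- Through `companionCell`, points of `companion f ⊗ N` are the same as points of `N`. So
generators can be transported along structure cells without ambiguity. -/
theorem tensPoint_companion_injective {A B D : Mon C} {f : A ⟶ B} {N : Bimod B D}
    {x y : 𝟙_ C ⟶ N.X} (h : tensPoint (companionPoint f) x = tensPoint (companionPoint f) y) :
    x = y := by
  rw [← tensPoint_companionCell f N x, h, tensPoint_companionCell]

theorem tensPoint_companion_surjective {A B D : Mon C} (f : A ⟶ B) (N : Bimod B D)
    (y : 𝟙_ C ⟶ (tens (companion f) N).X) :
    tensPoint (companionPoint f) (y ≫ (companionCell f N).hom) = y := by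
  rw [← cancel_mono (companionCell f N).hom, tensPoint_companionCell]

theorem tensPoint_companion_rightUnit {A B : Mon C} (f : A ⟶ B) (x : 𝟙_ C ⟶ (reg B).X) :
    tensPoint (companionPoint f) x ≫ (rightUnit (companion f)).hom = x := by
  rw [tensPoint, Category.assoc, proj_rightUnit]
  change tensorPoint η[B.X] x ≫ B.X ◁ 𝟙 _ ≫ μ[B.X] = x
  rw [MonoidalCategory.whiskerLeft_id, Category.id_comp, tensorPoint_one_mul]

namespace MonoidalStr
variable {P Q : PseudomonoidData C} {f : Q.A ⟶ P.A} {e : 𝟙_ C ⟶ P.M.X} {u : 𝟙_ C ⟶ P.J.X}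

/-- Evaluate the left unit axiom at the generator: one side is 1 since `Q.l` takes its standard
value, the other is the value sought. Thus the constraints of `P` are dictated by those of `Q`;
`point_r` and `point_a` follow the same pattern. -/
theorem point_l (H : Generators Q) (S : MonoidalStr P Q (companion f))
    (hτ : tensPoint H.e (boxPoint (companionPoint f) (companionPoint f)) ≫ S.tensorCell.hom =
      tensPoint (companionPoint f) e)
    (hυ : H.u ≫ S.unitCell.hom = tensPoint (companionPoint f) u) :
    tensPoint e (boxPoint u (regPoint P.A)) ≫ P.l.hom = regPoint P.A := by
  have h := congrArg (fun k => tensPoint (tensPoint H.e (boxPoint H.u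
      (regPoint Q.A))) (boxPoint (regPoint (𝟙_ (Mon C))) (companionPoint f)) ≫ k) S.left_unit
  simp only [← Category.assoc] at h
  simp only [tensPoint_collect, tensPoint_hcomp, boxPoint_box, comp_cell_comp,
      H.point_l, comp_cell_id, tensPoint_extend S.tensorCell hτ,
      tensPoint_leftUnit, tensPoint_rightUnit, hυ, tensPoint_unitSwap, boxPoint_boxLeftUnit] at h
  rw [tensPoint_companion_rightUnit] at h
  exact h

theorem point_r (H : Generators Q) (S : MonoidalStr P Q (companion f))
    (hτ : tensPoint H.e (boxPoint (companionPoint f) (companionPoint f)) ≫ S.tensorCell.hom =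
      tensPoint (companionPoint f) e)
    (hυ : H.u ≫ S.unitCell.hom = tensPoint (companionPoint f) u) :
    tensPoint e (boxPoint (regPoint P.A) u) ≫ P.r.hom = regPoint P.A := by
  have h := congrArg (fun k => tensPoint (tensPoint H.e (boxPoint (regPoint Q.A) H.u))
      (boxPoint (companionPoint f) (regPoint (𝟙_ (Mon C)))) ≫ k) S.right_unit
  simp only [← Category.assoc] at h
  simp only [tensPoint_collect, tensPoint_hcomp, boxPoint_box, comp_cell_comp,
      H.point_r, comp_cell_id, tensPoint_extend S.tensorCell hτ,
      tensPoint_leftUnit, tensPoint_rightUnit, hυ, tensPoint_unitSwap, boxPoint_boxRightUnit] at h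
  rw [tensPoint_companion_rightUnit] at h
  exact h

theorem point_a (H : Generators Q) (S : MonoidalStr P Q (companion f))
    (hτ : tensPoint H.e (boxPoint (companionPoint f) (companionPoint f)) ≫ S.tensorCell.hom =
      tensPoint (companionPoint f) e) :
    tensPoint e (boxPoint e (regPoint P.A)) ≫ P.a.hom = tensPoint e (boxPoint (regPoint P.A) e) := by
  have h := congrArg (fun k => tensPoint (tensPoint H.e (boxPoint H.e (regPoint Q.A)))
      (boxPoint (boxPoint (companionPoint f) (companionPoint f)) (companionPoint f)) ≫ k) S.assoc
  simp only [← Category.assoc] at h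
  simp only [tensPoint_collect, tensPoint_hcomp, boxPoint_box,
      H.point_a, comp_cell_id, tensPoint_extend S.tensorCell hτ, hτ, boxPoint_boxAssoc,
      tensPoint_unitSwap] at h
  exact tensPoint_companion_injective h

end MonoidalStr

namespace BialgebroidBase
variable {R : Mon C}

theorem hom_eq (H : BialgebroidBase R) (χ : env R ⟶ H.A)
    (hs : (inl R (op R)).hom ≫ χ.hom = H.s.hom) (ht : (inr R (op R)).hom ≫ χ.hom = H.t.hom) :
    χ.hom = (H.s.hom ⊗ₘ H.t.hom) ≫ μ[H.A.X] := by
  have h := congrArg (· ≫ χ.hom) (inl_inr_mul R (op R))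
  rw [Category.assoc, IsMonHom.mul_hom, tensorHom_comp_tensorHom_assoc, hs, ht] at h
  exact (Category.id_comp _).symm.trans h.symm

namespace Frame
variable {H : BialgebroidBase R} {M : Bimod H.A (H.A ⊗ H.A)}
  {J : Bimod H.A (𝟙_ (Mon C))}

theorem cyclic_env {A : Mon C} (χ : env R ⟶ A) :
    Cyclic (tens (envM R) (box (companion χ) (companion χ)))
      (tensPoint (envOne R) (boxPoint (companionPoint χ) (companionPoint χ))) :=
  (cyclic_envOne R).tens ((cyclic_companion χ).box (cyclic_companion χ))

/-- By `t_e` and then `s_e`, s(r)t(r')e = s(r)(e(1 ⊗ t(r'))) = e(s(r) ⊗ t(r')). The two conditions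
combine into compatibility along χ. -/
theorem mul_lorbit (F : H.Frame M J) :
    (H.s.hom ⊗ₘ H.t.hom) ≫ μ[H.A.X] ≫ lorbit M F.e = (H.s.hom ⊗ₘ H.t.hom) ≫ orbit M F.e := by
  have e1 : (H.s.hom ⊗ₘ H.t.hom) ≫ H.A.X ◁ lorbit M F.e =
      (H.s.hom ⊗ₘ (H.t.hom ≫ (inr H.A H.A).hom)) ≫ H.A.X ◁ orbit M F.e := by
    rw [← id_tensorHom, tensorHom_comp_tensorHom, ← id_tensorHom, tensorHom_comp_tensorHom, F.t_e,
      Category.assoc]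
  have e2 : (H.s.hom ⊗ₘ (H.t.hom ≫ (inr H.A H.A).hom)) ≫ lorbit M F.e ▷ (H.A ⊗ H.A).X =
      ((H.s.hom ⊗ₘ H.t.hom) ≫ ((inl H.A H.A).hom ⊗ₘ (inr H.A H.A).hom)) ≫
        orbit M F.e ▷ (H.A ⊗ H.A).X := by
    rw [← tensorHom_id, tensorHom_comp_tensorHom, ← tensorHom_id, tensorHom_comp_tensorHom,
      tensorHom_comp_tensorHom, F.s_e]
    simp only [Category.assoc]
  rw [← lorbit_actLeft, reassoc_of% e1, orbit_actLeft, reassoc_of% e2, orbit_actRight]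
  have e3 := inl_inr_mul H.A H.A
  rw [reassoc_of% e3]

/-- L ⊗_R L is a common model of m ⊗ (χ ⊠ χ), by `exists_envFlatten`, and of `M`, by the frame.
Composing the two identifications gives the cell. -/
theorem exists_tensorCell (F : H.Frame M J) (χ : env R ⟶ H.A)
    (hs : (inl R (op R)).hom ≫ χ.hom = H.s.hom) (ht : (inr R (op R)).hom ≫ χ.hom = H.t.hom) :
    ∃ τ : BimHom (tens (envM R) (box (companion χ) (companion χ))) (tens (companion χ) M),
      tensPoint (envOne R) (boxPoint (companionPoint χ) (companionPoint χ)) ≫ τ.hom =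
        tensPoint (companionPoint χ) F.e ∧ IsIso τ.hom := by
  obtain ⟨q, hq, hq'⟩ := H.exists_envFlatten χ hs ht
  have := cyclic_env χ
  have h1 : insRight (envOne R) (box (companion χ) (companion χ)) ≫ inv q ≫ F.p = orbit M F.e := by
    rw [← hq, Category.assoc, IsIso.hom_inv_id_assoc, F.proj_p]
  have h2 : lorbit (tens (envM R) (box (companion χ) (companion χ)))
      (tensPoint (envOne R) (boxPoint (companionPoint χ) (companionPoint χ))) ≫ inv q ≫ F.p =
      χ.hom ≫ lorbit M F.e := by
    rw [H.lorbit_env χ hs ht, Category.assoc, h1, H.hom_eq χ hs ht, Category.assoc,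
      F.mul_lorbit]
  refine ⟨companionLift (Cell.ofOrbit
    (tensPoint (envOne R) (boxPoint (companionPoint χ) (companionPoint χ))) (inv q ≫ F.p) F.e
      ?_ h2), comp_companionLift _ ?_, ?_⟩
  · rw [orbit_env, h1]
    exact (Category.id_comp _).symm
  · rw [Cell.ofOrbit_hom]
    have h3 := congrArg (η[(env R).X] ≫ ·) h2
    simp only [← Category.assoc] at h3
    rw [one_lorbit, IsMonHom.one_hom, one_lorbit] at h3
    simp only [Category.assoc] at h3
    exact h3
  · have : IsIso (Cell.ofOrbit (φ := χ) (ψ := 𝟙 _)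
      (tensPoint (envOne R) (boxPoint (companionPoint χ) (companionPoint χ))) (inv q ≫ F.p) F.e
      (by rw [orbit_env, h1]; exact (Category.id_comp _).symm) h2).hom := by
      rw [Cell.ofOrbit_hom]; infer_instance
    infer_instance

theorem exists_unitCell (F : H.Frame M J) (χ : env R ⟶ H.A)
    (hs : (inl R (op R)).hom ≫ χ.hom = H.s.hom) (ht : (inr R (op R)).hom ≫ χ.hom = H.t.hom) :
    ∃ υ : BimHom (envJ R) (tens (companion χ) J),
      envUnit R ≫ υ.hom = tensPoint (companionPoint χ) F.u ∧ IsIso υ.hom := by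
  -- In elements, j(rr') = s(r)j(r') = s(r)t(r')u.
  have h : lorbit (envJ R) (envUnit R) ≫ F.j = χ.hom ≫ lorbit J F.u := by
    rw [lorbit_envUnit, F.j_actLeft, H.hom_eq χ hs ht, Category.assoc, ← lorbit_actLeft,
      MonoidalCategory.tensorHom_def', Category.assoc, whisker_exchange_assoc,
      ← F.t_u, MonoidalCategory.whiskerLeft_comp_assoc, whisker_exchange_assoc]
  let υ' : Cell χ (𝟙 (𝟙_ (Mon C))) (envJ R) J := Cell.ofLorbit (envUnit R) F.j F.u h
  have : IsIso υ'.hom := F.isIso_j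
  exact ⟨companionLift υ', comp_companionLift υ' F.one_j, inferInstance⟩

end Frame
end BialgebroidBase

namespace DS
variable {R : Mon C}

/-- Strength of the monoidal morphism is used here, to make the identifications `p` and `j`
invertible. -/
theorem exists_frame (X : DS R) : ∃ F : (BialgebroidBase.ofEnv X.χ).Frame X.P.M X.P.J,
    tensPoint (envOne R) (boxPoint (companionPoint X.χ) (companionPoint X.χ)) ≫
      X.str.tensorCell.hom = tensPoint (companionPoint X.χ) F.e ∧
    envUnit R ≫ X.str.unitCell.hom = tensPoint (companionPoint X.χ) F.u := by
  have := X.isStrong.isIso_tensorCell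
  have := X.isStrong.isIso_unitCell
  let σ : Cell X.χ (𝟙 (X.P.A ⊗ X.P.A)) (tens (envM R) (box (companion X.χ) (companion X.χ))) X.P.M :=
    (X.str.tensorCell.comp (companionCell X.χ X.P.M)).cast
  let υ : Cell X.χ (𝟙 (𝟙_ (Mon C))) (envJ R) X.P.J :=
    (X.str.unitCell.comp (companionCell X.χ X.P.J)).cast
  have h1 : IsIso σ.hom :=
    inferInstanceAs (IsIso (X.str.tensorCell.hom ≫ (companionCell X.χ X.P.M).hom))
  have h2 : IsIso υ.hom :=
    inferInstanceAs (IsIso (X.str.unitCell.hom ≫ (companionCell X.χ X.P.J).hom))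
  obtain ⟨F, hF, hF'⟩ := (BialgebroidBase.ofEnv X.χ).exists_frame X.χ rfl rfl σ υ
  refine ⟨F, ?_, ?_⟩
  · rw [← hF]
    exact ((congrArg _ (Category.assoc _ _ _).symm).trans
      (tensPoint_companion_surjective X.χ X.P.M _)).symm
  · rw [← hF']
    exact ((congrArg _ (Category.assoc _ _ _).symm).trans
      (tensPoint_companion_surjective X.χ X.P.J _)).symm

/-- The frame of an object of `DS_R`. -/
noncomputable def frame (X : DS R) : (BialgebroidBase.ofEnv X.χ).Frame X.P.M X.P.J :=
  X.exists_frame.choose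

theorem tensorCell_point (X : DS R) :
    tensPoint (envOne R) (boxPoint (companionPoint X.χ) (companionPoint X.χ)) ≫
      X.str.tensorCell.hom = tensPoint (companionPoint X.χ) X.frame.e :=
  X.exists_frame.choose_spec.1

theorem unitCell_point (X : DS R) :
    envUnit R ≫ X.str.unitCell.hom = tensPoint (companionPoint X.χ) X.frame.u :=
  X.exists_frame.choose_spec.2

/-- The generators of the pseudo-monoid of an object of `DS_R`. -/
noncomputable def generators (X : DS R) : Generators X.P.toPseudomonoidData where
  e := X.frame.e
  u := X.frame.u
  cyclic := X.frame.adapted.cyclic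
  cyclic_left := X.frame.adapted.cyclic_left
  cyclic_right := X.frame.adapted.cyclic_right
  point_l := X.str.point_l (envGenerators R) X.tensorCell_point X.unitCell_point
  point_r := X.str.point_r (envGenerators R) X.tensorCell_point X.unitCell_point
  point_a := X.str.point_a (envGenerators R) X.tensorCell_point

/-- The bialgebroid of an object of `DS_R`. -/
noncomputable def bialgebroid (X : DS R) : Bialgebroid R :=
  X.frame.bialgebroid (X.frame.coassoc_of_cell X.P.a X.generators.point_a)
    (X.frame.counit_left_of_cell X.P.l X.generators.point_l)
    (X.frame.counit_right_of_cell X.P.r X.generators.point_r)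

end DS
end Criterion
end IntBgd


namespace IntBgd

/-! ### Morphisms of `DS R` are the morphisms of bialgebroids. -/

section Homs
set_option linter.unusedSectionVars false
variable {C : Type u} [Category.{v} C] [MonoidalCategory C] [SymmetricCategory C]
variable [HasCoequalizers C]
variable [∀ X : C, PreservesColimitsOfShape WalkingParallelPair (tensorLeft X)]
variable [∀ X : C, PreservesColimitsOfShape WalkingParallelPair (tensorRight X)]

namespace BialgebroidBase
variable {R : Mon C} {H H' : BialgebroidBase R} {Φ : H.A ⟶ H'.A} {M : Bimod H.A (H.A ⊗ H.A)}
  {J : Bimod H.A (𝟙_ (Mon C))} {M' : Bimod H'.A (H'.A ⊗ H'.A)} {J' : Bimod H'.A (𝟙_ (Mon C))}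

/-- A monoid morphism compatible with sources and targets is a morphism of `R`-`R`-bimodules. -/
def bimHom (Φ : H.A ⟶ H'.A) (hs : H.s.hom ≫ Φ.hom = H'.s.hom) (ht : H.t.hom ≫ Φ.hom = H'.t.hom) :
    BimHom H.L H'.L where
  hom := Φ.hom
  left := by
    have e : (H.s.hom ▷ H.A.X ≫ μ[H.A.X]) ≫ Φ.hom = (𝟙 R.X ⊗ₘ Φ.hom) ≫ H'.s.hom ▷ H'.A.X ≫ μ[H'.A.X] := by
      rw [Category.assoc, IsMonHom.mul_hom, ← hs, id_tensorHom, MonoidalCategory.tensorHom_def',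
        Category.assoc, comp_whiskerRight, Category.assoc, whisker_exchange_assoc,
        whisker_exchange_assoc, whisker_exchange_assoc]
    exact e
  right := by
    have e : (H.A.X ◁ H.t.hom ≫ (β_ _ _).hom ≫ μ[H.A.X]) ≫ Φ.hom =
        (Φ.hom ⊗ₘ 𝟙 R.X) ≫ H'.A.X ◁ H'.t.hom ≫ (β_ _ _).hom ≫ μ[H'.A.X] := by
      rw [Category.assoc, Category.assoc, IsMonHom.mul_hom, ← ht,
        ← BraidedCategory.braiding_naturality_assoc, tensorHom_id,
        MonoidalCategory.whiskerLeft_comp, Category.assoc, MonoidalCategory.tensorHom_def,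
        Category.assoc, whisker_exchange_assoc]
    exact e

/-- A bialgebroid morphism is not required to respect the source maps. It does so by left linearity
over `R`, evaluated at 1. -/
theorem s_comp_of_bimHom (f : BimHom H.L H'.L) (h : f.hom = Φ.hom) :
    H.s.hom ≫ Φ.hom = H'.s.hom := by
  have e1 := f.left
  rw [h] at e1
  have e2 := congrArg (fun k => (ρ_ R.X).inv ≫ R.X ◁ η[H.A.X] ≫ k) e1
  change (ρ_ R.X).inv ≫ R.X ◁ η[H.A.X] ≫ (H.s.hom ▷ H.A.X ≫ μ[H.A.X]) ≫ Φ.hom =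
    (ρ_ R.X).inv ≫ R.X ◁ η[H.A.X] ≫ (𝟙 R.X ⊗ₘ Φ.hom) ≫ H'.s.hom ▷ H'.A.X ≫ μ[H'.A.X] at e2
  rw [id_tensorHom, ← MonoidalCategory.whiskerLeft_comp_assoc, IsMonHom.one_hom,
    whisker_exchange_assoc, MonObj.mul_one, Category.assoc, whisker_exchange_assoc,
    MonObj.mul_one_assoc] at e2
  simpa using e2

theorem t_comp_of_bimHom (f : BimHom H.L H'.L) (h : f.hom = Φ.hom) :
    H.t.hom ≫ Φ.hom = H'.t.hom := by
  have e1 := f.right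
  rw [h] at e1
  have e2 := congrArg (fun k => (λ_ R.X).inv ≫ η[H.A.X] ▷ R.X ≫ k) e1
  change (λ_ R.X).inv ≫ η[H.A.X] ▷ R.X ≫ (H.A.X ◁ H.t.hom ≫ (β_ _ _).hom ≫ μ[H.A.X]) ≫ Φ.hom =
    (λ_ R.X).inv ≫ η[H.A.X] ▷ R.X ≫ (Φ.hom ⊗ₘ 𝟙 R.X) ≫
      H'.A.X ◁ H'.t.hom ≫ (β_ _ _).hom ≫ μ[H'.A.X] at e2
  rw [tensorHom_id, ← comp_whiskerRight_assoc, IsMonHom.one_hom,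
    ← whisker_exchange_assoc, BraidedCategory.braiding_naturality_left_assoc, MonObj.mul_one,
    Category.assoc, ← whisker_exchange_assoc, Category.assoc,
    BraidedCategory.braiding_naturality_left_assoc, MonObj.mul_one_assoc] at e2
  simpa using e2

namespace Frame

theorem cyclic_companion_box (F : H.Frame M J) (Φ : H.A ⟶ H'.A) :
    Cyclic (tens M (box (companion Φ) (companion Φ)))
      (tensPoint F.e (boxPoint (companionPoint Φ) (companionPoint Φ))) :=
  F.adapted.cyclic.tens ((cyclic_companion Φ).box (cyclic_companion Φ))

theorem orbit_companion_box (F : H.Frame M J) (Φ : H.A ⟶ H'.A) :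
    orbit (tens M (box (companion Φ) (companion Φ)))
      (tensPoint F.e (boxPoint (companionPoint Φ) (companionPoint Φ))) =
    insRight F.e (box (companion Φ) (companion Φ)) := by
  rw [orbit_tens, orbit_box, orbit_companion]
  exact (congrArg (· ≫ _) (id_tensorHom_id _ _)).trans (Category.id_comp _)

/-- Multiplying the generator by a gives p(γ(a)) ⊗ (1 ⊗ 1). Moving the two legs into the companions
applies Φ to each of them. -/
theorem lorbit_companion_box (F : H.Frame M J) (F' : H'.Frame M' J') (f : BimHom H.L H'.L)
    (hf : f.hom = Φ.hom) (k : (tens M (box (companion Φ) (companion Φ))).X ⟶ M'.X)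
    (hk : insRight F.e (box (companion Φ) (companion Φ)) ≫ k = orbit M' F'.e) :
    lorbit (tens M (box (companion Φ) (companion Φ)))
      (tensPoint F.e (boxPoint (companionPoint Φ) (companionPoint Φ))) ≫ k =
    F.comul.hom ≫ (f.hcomp f).hom ≫ F'.p := by
  have h : F.p ≫ insLeft M (boxPoint (companionPoint Φ) (companionPoint Φ)) ≫ k =
      (f.hcomp f).hom ≫ F'.p := by
    rw [← cancel_epi (proj H.L H.L), reassoc_of% F.proj_p, ← Category.assoc, orbit_insLeft,
      lorbit_box, lorbit_companion, Category.assoc, hk, Cell.proj_hcomp_assoc, F'.proj_p, hf]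
  rw [lorbit_tens, ← F.comul_p, Category.assoc, Category.assoc, h]

/-- Cells between the multiplications that preserve the generators are comultiplicative. -/
theorem comul_of_cell (F : H.Frame M J) (F' : H'.Frame M' J') (f : BimHom H.L H'.L)
    (hf : f.hom = Φ.hom)
    (τ : Cell Φ (𝟙 (H'.A ⊗ H'.A)) (tens M (box (companion Φ) (companion Φ))) M')
    (hτ : tensPoint F.e (boxPoint (companionPoint Φ) (companionPoint Φ)) ≫ τ.hom = F'.e) :
    F.comul.hom ≫ (f.hcomp f).hom = Φ.hom ≫ F'.comul.hom := by
  have h1 := orbit_cell τ (tensPoint F.e (boxPoint (companionPoint Φ) (companionPoint Φ)))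
  have h2 := lorbit_cell τ (tensPoint F.e (boxPoint (companionPoint Φ) (companionPoint Φ)))
  rw [hτ, orbit_companion_box, Mon.id_hom', Category.id_comp] at h1
  rw [hτ, F.lorbit_companion_box F' f hf τ.hom h1] at h2
  rw [← cancel_mono F'.p, Category.assoc, Category.assoc, F'.comul_p, h2]

/-- The cell carries s(r)u to s'(r)u', hence `j` to `j'`. So υ(au) = Φ(a)u' compares the counits. -/
theorem counit_of_cell (F : H.Frame M J) (F' : H'.Frame M' J')
    (hs : H.s.hom ≫ Φ.hom = H'.s.hom) (υ : Cell Φ (𝟙 (𝟙_ (Mon C))) J J')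
    (hυ : F.u ≫ υ.hom = F'.u) : Φ.hom ≫ F'.counit.hom = F.counit.hom := by
  have h1 := lorbit_cell υ F.u
  rw [hυ] at h1
  have h2 : F.j ≫ υ.hom = F'.j := by
    rw [← F.s_u, ← F'.s_u, Category.assoc, h1, reassoc_of% hs]
  rw [← cancel_mono F'.j, Category.assoc, F'.counit_j, ← h1, ← F.counit_j, Category.assoc, h2]

theorem exists_tensorCell_of_comul (F : H.Frame M J) (F' : H'.Frame M' J') (f : BimHom H.L H'.L)
    (hf : f.hom = Φ.hom) (h : F.comul.hom ≫ (f.hcomp f).hom = Φ.hom ≫ F'.comul.hom) :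
    ∃ τ : Cell Φ (𝟙 (H'.A ⊗ H'.A)) (tens M (box (companion Φ) (companion Φ))) M',
      tensPoint F.e (boxPoint (companionPoint Φ) (companionPoint Φ)) ≫ τ.hom = F'.e := by
  have hs := s_comp_of_bimHom f hf
  have ht := t_comp_of_bimHom f hf
  have hl : H.s.hom ▷ (companion Φ).X ≫ (companion Φ).actLeft = H'.L.actLeft := by
    change H.s.hom ▷ H'.A.X ≫ Φ.hom ▷ H'.A.X ≫ μ[H'.A.X] = H'.s.hom ▷ H'.A.X ≫ μ[H'.A.X]
    rw [← comp_whiskerRight_assoc, hs]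
  have hr : (companion Φ).X ◁ H.t.hom ≫ (β_ _ _).hom ≫ (companion Φ).actLeft = H'.L.actRight := by
    change H'.A.X ◁ H.t.hom ≫ (β_ _ _).hom ≫ Φ.hom ▷ H'.A.X ≫ μ[H'.A.X] =
      H'.A.X ◁ H'.t.hom ≫ (β_ _ _).hom ≫ μ[H'.A.X]
    rw [← BraidedCategory.braiding_naturality_right_assoc,
      ← MonoidalCategory.whiskerLeft_comp_assoc, ht]
  -- Restricted along s and t, the companion is the bimodule L of `H'`. So the orbit map of the
  -- second generator is balanced and descends.
  obtain ⟨k, hk⟩ := F.exists_desc (box (companion Φ) (companion Φ)) (orbit M' F'.e) (by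
    refine (H.balanced_iff (companion Φ) (companion Φ) _).2 ?_
    rw [hl, hr]
    exact F'.adapted.balanced_orbit)
  have := F.cyclic_companion_box Φ
  -- Left linearity at the generator is the comultiplicativity of Φ.
  have h2 : lorbit (tens M (box (companion Φ) (companion Φ)))
      (tensPoint F.e (boxPoint (companionPoint Φ) (companionPoint Φ))) ≫ k =
      Φ.hom ≫ lorbit M' F'.e := by
    rw [F.lorbit_companion_box F' f hf k hk, reassoc_of% h, F'.comul_p]
  refine ⟨Cell.ofOrbit (tensPoint F.e (boxPoint (companionPoint Φ) (companionPoint Φ))) k F'.e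
    ?_ h2, ?_⟩
  · rw [orbit_companion_box, hk]
    exact (Category.id_comp _).symm
  · rw [Cell.ofOrbit_hom]
    have h3 := congrArg (η[H.A.X] ≫ ·) h2
    simp only [← Category.assoc] at h3
    rwa [one_lorbit, IsMonHom.one_hom, one_lorbit] at h3

theorem exists_unitCell_of_counit (F : H.Frame M J) (F' : H'.Frame M' J')
    (h : Φ.hom ≫ F'.counit.hom = F.counit.hom) :
    ∃ υ : Cell Φ (𝟙 (𝟙_ (Mon C))) J J', F.u ≫ υ.hom = F'.u := by
  have := F.adapted.leftCyclic
  refine ⟨Cell.ofLorbit F.u (inv F.j ≫ F'.j) F'.u ?_, ?_⟩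
  · rw [← F.counit_j, Category.assoc, IsIso.hom_inv_id_assoc, ← h, Category.assoc, F'.counit_j]
  · rw [Cell.ofLorbit_hom, ← Category.assoc, F.u_inv_j, F'.one_j]

end Frame
end BialgebroidBase

namespace DS
variable {R : Mon C}

/-- Evaluated at the canonical generators, the two compatibility equations say that the structure
cells of Φ send the generators of `X` to those of `Y`. -/
theorem isBialgebroidHom_of_isDSHom {X Y : DS R} {Φ : X.P.A ⟶ Y.P.A} (h : IsDSHom X Y Φ) :
    IsBialgebroidHom X.bialgebroid Y.bialgebroid Φ := by
  obtain ⟨w, T, h1, h2⟩ := h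
  let τ : Cell Φ (𝟙 (Y.P.A ⊗ Y.P.A)) (tens X.P.M (box (companion Φ) (companion Φ))) Y.P.M :=
    (T.tensorCell.comp (companionCell Φ Y.P.M)).cast
  let υ : Cell Φ (𝟙 (𝟙_ (Mon C))) X.P.J Y.P.J :=
    (T.unitCell.comp (companionCell Φ Y.P.J)).cast
  have hτ' : tensPoint X.frame.e (boxPoint (companionPoint Φ) (companionPoint Φ)) ≫
      T.tensorCell.hom = tensPoint (companionPoint Φ)
        (tensPoint X.frame.e (boxPoint (companionPoint Φ) (companionPoint Φ)) ≫ τ.hom) :=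
    ((congrArg _ (Category.assoc _ _ _).symm).trans
      (tensPoint_companion_surjective Φ Y.P.M _)).symm
  have hυ' : X.frame.u ≫ T.unitCell.hom = tensPoint (companionPoint Φ) (X.frame.u ≫ υ.hom) :=
    ((congrArg _ (Category.assoc _ _ _).symm).trans
      (tensPoint_companion_surjective Φ Y.P.J _)).symm
  have hτ : tensPoint X.frame.e (boxPoint (companionPoint Φ) (companionPoint Φ)) ≫ τ.hom =
      Y.frame.e := by
    have e := congrArg (fun k => tensPoint (envOne R)
      (boxPoint (tensPoint (companionPoint X.χ) (companionPoint Φ))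
        (tensPoint (companionPoint X.χ) (companionPoint Φ))) ≫ k) h1
    simp only [MonoidalStr.compTensor, Cell.cast_hom, ← Category.assoc] at e
    simp only [comp_cell_comp, tensPoint_hcomp, boxPoint_box, comp_cell_id,
      tensPoint_extend X.str.tensorCell X.tensorCell_point, tensPoint_companionComp,
      Y.tensorCell_point, hτ', tensPoint_assocInv] at e
    exact tensPoint_companion_injective e
  have hυ : X.frame.u ≫ υ.hom = Y.frame.u := by
    have e := congrArg (fun k => envUnit R ≫ k) h2
    simp only [MonoidalStr.compUnit, Cell.cast_hom, ← Category.assoc] at e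
    simp only [comp_cell_comp, tensPoint_hcomp, comp_cell_id, tensPoint_companionComp,
      X.unitCell_point, Y.unitCell_point, hυ', tensPoint_assocInv] at e
    exact tensPoint_companion_injective e
  have hs : (BialgebroidBase.ofEnv X.χ).s.hom ≫ Φ.hom = (BialgebroidBase.ofEnv Y.χ).s.hom := by
    rw [← w]; exact Category.assoc _ _ _
  have ht : (BialgebroidBase.ofEnv X.χ).t.hom ≫ Φ.hom = (BialgebroidBase.ofEnv Y.χ).t.hom := by
    rw [← w]; exact Category.assoc _ _ _
  exact ⟨⟨BialgebroidBase.bimHom Φ hs ht, rfl, X.frame.comul_of_cell Y.frame _ rfl τ hτ⟩,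
    X.frame.counit_of_cell Y.frame hs υ hυ⟩

/-- Comultiplicativity and counitality provide generator-preserving cells. Their monoidal axioms and
the compatibility with the structures over R ⊗ Rᵒᵖ then hold because they hold on generators. -/
theorem isDSHom_of_isBialgebroidHom {X Y : DS R} {Φ : X.P.A ⟶ Y.P.A}
    (h : IsBialgebroidHom X.bialgebroid Y.bialgebroid Φ) : IsDSHom X Y Φ := by
  obtain ⟨⟨f, hf, h1⟩, h2⟩ := h
  obtain ⟨τ, hτ⟩ := X.frame.exists_tensorCell_of_comul Y.frame f hf h1
  obtain ⟨υ, hυ⟩ := X.frame.exists_unitCell_of_counit Y.frame h2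
  have hs : (BialgebroidBase.ofEnv X.χ).s.hom ≫ Φ.hom = (BialgebroidBase.ofEnv Y.χ).s.hom :=
    BialgebroidBase.s_comp_of_bimHom f hf
  have ht : (BialgebroidBase.ofEnv X.χ).t.hom ≫ Φ.hom = (BialgebroidBase.ofEnv Y.χ).t.hom :=
    BialgebroidBase.t_comp_of_bimHom f hf
  have w : X.χ ≫ Φ = Y.χ := by
    ext1
    have e1 := (BialgebroidBase.ofEnv X.χ).hom_eq X.χ rfl rfl
    have e2 := (BialgebroidBase.ofEnv Y.χ).hom_eq Y.χ rfl rfl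
    rw [Mon.comp_hom', e1, e2, ← hs, ← ht, ← tensorHom_comp_tensorHom, Category.assoc,
      Category.assoc]
    exact congrArg _ (IsMonHom.mul_hom Φ.hom)
  -- From here on only the values of the structure cells on generators matter, so the construction
  -- of `T` is hidden.
  obtain ⟨T, hτ', hυ'⟩ : ∃ T : MonoidalStr Y.P.toPseudomonoidData X.P.toPseudomonoidData
      (companion Φ),
      tensPoint X.frame.e (boxPoint (companionPoint Φ) (companionPoint Φ)) ≫ T.tensorCell.hom =
        tensPoint (companionPoint Φ) Y.frame.e ∧
      X.frame.u ≫ T.unitCell.hom = tensPoint (companionPoint Φ) Y.frame.u :=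
    ⟨Y.generators.monoidalStr X.generators Φ (companionLift τ) (companionLift υ)
      (comp_companionLift τ hτ) (comp_companionLift υ hυ), comp_companionLift τ hτ,
      comp_companionLift υ hυ⟩
  refine ⟨w, T, ?_, ?_⟩
  · have c := (cyclic_envOne R).tens
      (((cyclic_companion X.χ).tens (cyclic_companion Φ)).box
        ((cyclic_companion X.χ).tens (cyclic_companion Φ)))
    rw [← cancel_epi (orbit _ (tensPoint (envOne R)
      (boxPoint (tensPoint (companionPoint X.χ) (companionPoint Φ))
        (tensPoint (companionPoint X.χ) (companionPoint Φ)))))]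
    simp only [MonoidalStr.compTensor, Cell.cast_hom]
    simp only [orbit_cell_assoc, orbit_cell]
    simp only [comp_cell_comp, tensPoint_hcomp, boxPoint_box, comp_cell_id,
      tensPoint_extend X.str.tensorCell X.tensorCell_point, tensPoint_companionComp,
      Y.tensorCell_point, tensPoint_assocInv, hτ']
    simp
  -- The canonical unit is generated from the left; over the unit monoid it need not be generated
  -- from the right.
  · rw [← cancel_epi (lorbit _ (envUnit R))]
    simp only [MonoidalStr.compUnit, Cell.cast_hom]
    simp only [lorbit_cell_assoc, lorbit_cell]
    simp only [comp_cell_comp, tensPoint_hcomp, comp_cell_id,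
      tensPoint_companionComp, X.unitCell_point, Y.unitCell_point, tensPoint_assocInv, hυ']
    simp

/-- Carries both the closure statements and the full faithfulness. With it, the monoidal structures
of two composable morphisms of `DS R` never have to be composed. -/
theorem isDSHom_iff {X Y : DS R} {Φ : X.P.A ⟶ Y.P.A} :
    IsDSHom X Y Φ ↔ IsBialgebroidHom X.bialgebroid Y.bialgebroid Φ :=
  ⟨isBialgebroidHom_of_isDSHom, isDSHom_of_isBialgebroidHom⟩

end DS
end Homs
end IntBgd


namespace IntBgd

/-! ### Bimodules built from quotients of regular modules and from characters. -/

section Quotients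
set_option linter.unusedSectionVars false
variable {C : Type u} [Category.{v} C] [MonoidalCategory C] [SymmetricCategory C]
variable [HasCoequalizers C]
variable [∀ X : C, PreservesColimitsOfShape WalkingParallelPair (tensorLeft X)]
variable [∀ X : C, PreservesColimitsOfShape WalkingParallelPair (tensorRight X)]

/-- A quotient `π` of the regular right module of `Q`, with a left action of `A` that is determined
by the image of the generator of the quotient. -/
def quotientBimod {A Q : Mon C} {T : C} (π : Q.X ⟶ T) [StableEpi π] (r : T ⊗ Q.X ⟶ T)
    (c : A.X ⟶ T) (l : A.X ⊗ T ⟶ T) (hr : π ▷ Q.X ≫ r = μ[Q.X] ≫ π)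
    (hl : A.X ◁ π ≫ l = c ▷ Q.X ≫ r) (h1 : η[A.X] ≫ c = η[Q.X] ≫ π)
    (h2 : μ[A.X] ≫ c = A.X ◁ c ≫ l) : Bimod A Q :=
  have right_assoc : T ◁ μ[Q.X] ≫ r = (α_ T Q.X Q.X).inv ≫ r ▷ Q.X ≫ r :=
    act_descends μ[Q.X] μ[Q.X] r π hr (by rw [MonObj.mul_assoc, Iso.inv_hom_id_assoc])
  -- On the quotient, a acts on π(x) as c(a)x. This commutes with right multiplication by
  -- associativity of `r`.
  have middle_assoc : l ▷ Q.X ≫ r = (α_ _ _ _).hom ≫ A.X ◁ r ≫ l := by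
    rw [← cancel_epi ((A.X ◁ π) ▷ Q.X), ← comp_whiskerRight_assoc, hl,
      associator_naturality_middle_assoc, ← MonoidalCategory.whiskerLeft_comp_assoc, hr,
      MonoidalCategory.whiskerLeft_comp, Category.assoc, hl, comp_whiskerRight, Category.assoc,
      whisker_exchange_assoc, right_assoc]
    simp
  { X := T
    actLeft := l
    actRight := r
    one_actLeft := by
      rw [← cancel_epi (𝟙_ C ◁ π), whisker_exchange_assoc, hl, ← comp_whiskerRight_assoc, h1,
        comp_whiskerRight, Category.assoc, hr, MonObj.one_mul_assoc]
      simp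
    -- By the commutation just shown, this reduces to the image of 1, where it is `h2`.
    left_assoc := by
      rw [← cancel_epi ((A.X ⊗ A.X) ◁ π), whisker_exchange_assoc, hl, ← comp_whiskerRight_assoc,
        h2, comp_whiskerRight, Category.assoc, middle_assoc, associator_naturality_right_assoc,
        ← MonoidalCategory.whiskerLeft_comp_assoc, hl]
      simp
    actRight_one := by
      rw [← cancel_epi (π ▷ 𝟙_ C), ← whisker_exchange_assoc, hr, MonObj.mul_one_assoc]
      simp
    right_assoc := right_assoc
    middle_assoc := middle_assoc }

theorem orbit_quotientBimod {A Q : Mon C} {T : C} (π : Q.X ⟶ T) [StableEpi π] (r : T ⊗ Q.X ⟶ T)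
    (c : A.X ⟶ T) (l : A.X ⊗ T ⟶ T) (hr : π ▷ Q.X ≫ r = μ[Q.X] ≫ π)
    (hl : A.X ◁ π ≫ l = c ▷ Q.X ≫ r) (h1 : η[A.X] ≫ c = η[Q.X] ≫ π)
    (h2 : μ[A.X] ≫ c = A.X ◁ c ≫ l) :
    orbit (quotientBimod π r c l hr hl h1 h2) (η[Q.X] ≫ π) = π := by
  change (λ_ _).inv ≫ (η[Q.X] ≫ π) ▷ Q.X ≫ r = π
  rw [comp_whiskerRight, Category.assoc, hr, MonObj.one_mul_assoc, Iso.inv_hom_id_assoc]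

theorem lorbit_quotientBimod {A Q : Mon C} {T : C} (π : Q.X ⟶ T) [StableEpi π] (r : T ⊗ Q.X ⟶ T)
    (c : A.X ⟶ T) (l : A.X ⊗ T ⟶ T) (hr : π ▷ Q.X ≫ r = μ[Q.X] ≫ π)
    (hl : A.X ◁ π ≫ l = c ▷ Q.X ≫ r) (h1 : η[A.X] ≫ c = η[Q.X] ≫ π)
    (h2 : μ[A.X] ≫ c = A.X ◁ c ≫ l) :
    lorbit (quotientBimod π r c l hr hl h1 h2) (η[Q.X] ≫ π) = c := by
  change (ρ_ _).inv ≫ A.X ◁ (η[Q.X] ≫ π) ≫ l = c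
  rw [← h1, MonoidalCategory.whiskerLeft_comp, Category.assoc, ← h2, MonObj.mul_one_assoc,
    Iso.inv_hom_id_assoc]

/-- The left `A`-module on a retract `R` of `A` along a character. -/
def characterModule {A : Mon C} {R : C} (s : R ⟶ A.X) (π : A.X ⟶ R)
    (h1 : s ≫ π = 𝟙 R) (h2 : A.X ◁ (π ≫ s) ≫ μ[A.X] ≫ π = μ[A.X] ≫ π) :
    Bimod A (𝟙_ (Mon C)) where
  X := R
  actLeft := A.X ◁ s ≫ μ[A.X] ≫ π
  actRight := (ρ_ R).hom
  one_actLeft := by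
    rw [← whisker_exchange_assoc, MonObj.one_mul_assoc, leftUnitor_naturality_assoc, h1,
      Category.comp_id]
  -- In elements, π(a s(π(b s(r)))) = π(ab s(r)), an instance of `h2`.
  left_assoc := by
    rw [MonoidalCategory.whiskerLeft_comp, MonoidalCategory.whiskerLeft_comp, Category.assoc,
      Category.assoc, ← MonoidalCategory.whiskerLeft_comp_assoc _ π s, h2, ← whisker_exchange_assoc,
      MonObj.mul_assoc_assoc]
    simp
  actRight_one := by
    change R ◁ 𝟙 _ ≫ _ = _
    simp
  right_assoc := by
    change R ◁ (λ_ (𝟙_ C)).hom ≫ _ = _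
    monoidal
  middle_assoc := by
    change (A.X ◁ s ≫ μ[A.X] ≫ π) ▷ 𝟙_ C ≫ _ = _
    simp

theorem lorbit_characterModule {A R : Mon C} (s : R ⟶ A) (π : A.X ⟶ R.X)
    (h1 : s.hom ≫ π = 𝟙 R.X) (h2 : A.X ◁ (π ≫ s.hom) ≫ μ[A.X] ≫ π = μ[A.X] ≫ π) :
    lorbit (characterModule s.hom π h1 h2) η[R.X] = π := by
  change (ρ_ _).inv ≫ A.X ◁ η[R.X] ≫ A.X ◁ s.hom ≫ μ[A.X] ≫ π = π
  rw [← MonoidalCategory.whiskerLeft_comp_assoc, IsMonHom.one_hom, MonObj.mul_one_assoc,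
    Iso.inv_hom_id_assoc]

end Quotients

/-! ### Every bialgebroid comes from an object of `DS R`, and the equivalence. -/

section Surjectivity
set_option linter.unusedSectionVars false
variable {C : Type u} [Category.{v} C] [MonoidalCategory C] [SymmetricCategory C]
variable [HasCoequalizers C]
variable [∀ X : C, PreservesColimitsOfShape WalkingParallelPair (tensorLeft X)]
variable [∀ X : C, PreservesColimitsOfShape WalkingParallelPair (tensorRight X)]
variable {R : Mon C}

theorem BialgebroidBase.one_L_left (H : BialgebroidBase R) :
    (ρ_ R.X).inv ≫ R.X ◁ η[H.A.X] ≫ H.L.actLeft = H.s.hom := by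
  change (ρ_ R.X).inv ≫ R.X ◁ η[H.A.X] ≫ H.s.hom ▷ H.A.X ≫ μ[H.A.X] = _
  rw [whisker_exchange_assoc, MonObj.mul_one]
  simp

theorem BialgebroidBase.one_L_right (H : BialgebroidBase R) :
    (λ_ R.X).inv ≫ η[H.A.X] ▷ R.X ≫ H.L.actRight = H.t.hom := by
  change (λ_ R.X).inv ≫ η[H.A.X] ▷ R.X ≫ H.A.X ◁ H.t.hom ≫ (β_ _ _).hom ≫ μ[H.A.X] = _
  rw [← whisker_exchange_assoc, BraidedCategory.braiding_naturality_left_assoc, MonObj.mul_one]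
  simp

/-- The value of a bimodule morphism out of `L` on the source is determined on the unit. -/
theorem BialgebroidBase.s_bimHom (H : BialgebroidBase R) {P : Bimod R R} (f : BimHom H.L P) :
    H.s.hom ≫ f.hom = lorbit P (η[H.A.X] ≫ f.hom) := by
  have e := lorbit_cell f (P := H.L) η[H.A.X]
  rw [Mon.id_hom', Category.id_comp] at e
  rw [← e]
  exact congrArg (· ≫ f.hom) H.one_L_left.symm

theorem BialgebroidBase.t_bimHom (H : BialgebroidBase R) {P : Bimod R R} (f : BimHom H.L P) :
    H.t.hom ≫ f.hom = orbit P (η[H.A.X] ≫ f.hom) := by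
  have e := orbit_cell f (P := H.L) η[H.A.X]
  rw [Mon.id_hom', Category.id_comp] at e
  rw [← e]
  exact congrArg (· ≫ f.hom) H.one_L_right.symm

theorem BialgebroidBase.inl_χ (H : BialgebroidBase R) :
    (inl R (op R)).hom ≫ H.χ.hom = H.s.hom := by
  have h : η[R.X] ≫ H.t.hom = η[H.A.X] := IsMonHom.one_hom H.t.hom
  change ((ρ_ R.X).inv ≫ R.X ◁ η[R.X]) ≫ (H.s.hom ⊗ₘ H.t.hom) ≫ μ[H.A.X] = H.s.hom
  rw [MonoidalCategory.tensorHom_def', Category.assoc, Category.assoc,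
    ← MonoidalCategory.whiskerLeft_comp_assoc, h, whisker_exchange_assoc, MonObj.mul_one]
  simp

theorem BialgebroidBase.inr_χ (H : BialgebroidBase R) :
    (inr R (op R)).hom ≫ H.χ.hom = H.t.hom := by
  have h : η[R.X] ≫ H.s.hom = η[H.A.X] := IsMonHom.one_hom H.s.hom
  change ((λ_ R.X).inv ≫ η[R.X] ▷ R.X) ≫ (H.s.hom ⊗ₘ H.t.hom) ≫ μ[H.A.X] = H.t.hom
  rw [MonoidalCategory.tensorHom_def, Category.assoc, Category.assoc,
    ← comp_whiskerRight_assoc, h, ← whisker_exchange_assoc, MonObj.one_mul]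
  simp

namespace BialgebroidBase.Frame
variable {H H' : BialgebroidBase R} {Φ : H.A ⟶ H'.A} {M : Bimod H.A (H.A ⊗ H.A)}
  {J : Bimod H.A (𝟙_ (Mon C))} {M' : Bimod H'.A (H'.A ⊗ H'.A)} {J' : Bimod H'.A (𝟙_ (Mon C))}

/-- Equivariant maps that preserve the generators are comultiplicative. -/
theorem comul_of_equivariant (F : H.Frame M J) (F' : H'.Frame M' J') (f : BimHom H.L H'.L)
    (hf : f.hom = Φ.hom) (g : Cell Φ (Φ ⊗ₘ Φ) M M') (hg : F.e ≫ g.hom = F'.e) :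
    F.comul.hom ≫ (f.hcomp f).hom = Φ.hom ≫ F'.comul.hom := by
  have h1 := orbit_cell g F.e
  have h2 := lorbit_cell g F.e
  rw [hg] at h1 h2
  have h : F.p ≫ g.hom = (f.hcomp f).hom ≫ F'.p := by
    rw [← cancel_epi (proj H.L H.L), reassoc_of% F.proj_p, h1, Cell.proj_hcomp_assoc, F'.proj_p, hf]
    rfl
  rw [← cancel_mono F'.p, Category.assoc, Category.assoc, F'.comul_p, ← h2, ← F.comul_p,
    Category.assoc, h]

end BialgebroidBase.Frame

namespace Bialgebroid
variable (B : Bialgebroid R)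

theorem s_counit : B.s.hom ≫ B.counit.hom = 𝟙 R.X := by
  rw [B.s_bimHom B.counit, B.counit_one]
  exact lorbit_reg R

theorem t_counit : B.t.hom ≫ B.counit.hom = 𝟙 R.X := by
  rw [B.t_bimHom B.counit, B.counit_one]
  exact orbit_reg R

/-- Left linearity and γ(1) = 1 ⊗ 1 give γ(s(r)) = s(r) ⊗ 1, which becomes the field `s_e` of the
frame. Symmetrically, `t_comul` becomes `t_e`. -/
theorem s_comul : B.s.hom ≫ B.comul.hom = B.s.hom ≫ (inl B.A B.A).hom ≫ proj B.L B.L := by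
  rw [B.s_bimHom B.comul, B.comul_one]
  have e : (λ_ (𝟙_ C)).inv ≫ (η[B.A.X] ⊗ₘ η[B.A.X]) ≫ proj B.L B.L =
      tensPoint (P := B.L) (N := B.L) η[B.A.X] η[B.A.X] := (Category.assoc _ _ _).symm
  rw [e, lorbit_tens]
  have h : lorbit B.L η[B.A.X] = B.s.hom := B.one_L_left
  rw [h, insLeft, inl_hom, Category.assoc]

theorem t_comul : B.t.hom ≫ B.comul.hom = B.t.hom ≫ (inr B.A B.A).hom ≫ proj B.L B.L := by
  rw [B.t_bimHom B.comul, B.comul_one]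
  have e : (λ_ (𝟙_ C)).inv ≫ (η[B.A.X] ⊗ₘ η[B.A.X]) ≫ proj B.L B.L =
      tensPoint (P := B.L) (N := B.L) η[B.A.X] η[B.A.X] := (Category.assoc _ _ _).symm
  rw [e, orbit_tens]
  have h : orbit B.L η[B.A.X] = B.t.hom := B.one_L_right
  rw [h, insRight, inr_hom, Category.assoc]

theorem proj_lam : B.A.X ◁ proj B.L B.L ≫ B.lam = B.comul.hom ▷ (B.A.X ⊗ B.A.X) ≫ B.rho :=
  proj_tensDescL _ _ _ _ _

/-- The multiplication of the pseudo-monoid of a bialgebroid. -/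
noncomputable def mulBimod : Bimod B.A (B.A ⊗ B.A) :=
  quotientBimod (A := B.A) (Q := B.A ⊗ B.A) (proj B.L B.L) B.rho B.comul.hom B.lam
    (B.proj_rho.trans (Category.assoc _ _ _).symm) B.proj_lam
    (B.comul_one.trans (Category.assoc _ _ _).symm) B.comul_mul

/-- The unit of the pseudo-monoid of a bialgebroid. -/
noncomputable def unitBimod : Bimod B.A (𝟙_ (Mon C)) :=
  characterModule B.s.hom B.counit.hom B.s_counit B.counit_mul_s

/-- The generator of the multiplication. -/
noncomputable def mulPoint : 𝟙_ C ⟶ B.mulBimod.X := η[(B.A ⊗ B.A).X] ≫ proj B.L B.L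

/-- The generator of the unit. -/
noncomputable def unitPoint : 𝟙_ C ⟶ B.unitBimod.X := η[R.X]

theorem orbit_mulPoint : orbit B.mulBimod B.mulPoint = proj B.L B.L :=
  orbit_quotientBimod _ _ _ _ _ _ _ _

theorem lorbit_mulPoint : lorbit B.mulBimod B.mulPoint = B.comul.hom :=
  lorbit_quotientBimod _ _ _ _ _ _ _ _

theorem lorbit_unitPoint : lorbit B.unitBimod B.unitPoint = B.counit.hom :=
  lorbit_characterModule _ _ _ _

/-- The identifications of the underlying bimodules of the pseudo-monoid of a bialgebroid. -/
noncomputable def frame : B.Frame B.mulBimod B.unitBimod where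
  e := B.mulPoint
  u := B.unitPoint
  -- The two bimodules live on L ⊗_R L and `R` themselves, so both identifications are identities.
  p := 𝟙 _
  isIso_p := IsIso.id _
  proj_p := (Category.comp_id _).trans B.orbit_mulPoint.symm
  s_e := by rw [B.lorbit_mulPoint, B.orbit_mulPoint]; exact B.s_comul
  t_e := by rw [B.lorbit_mulPoint, B.orbit_mulPoint]; exact B.t_comul
  j := 𝟙 _
  isIso_j := IsIso.id _
  s_u := by rw [B.lorbit_unitPoint]; exact B.s_counit
  t_u := by rw [B.lorbit_unitPoint]; exact B.t_counit

/-- Reading γ off this frame returns the given one. The existence results for frames therefore apply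
to the bialgebroid's own coassociativity and counit laws. -/
theorem frame_comul : B.frame.comul = B.comul := by
  ext1
  exact (Category.comp_id _).symm.trans (B.frame.comul_p.trans B.lorbit_mulPoint)

theorem frame_counit : B.frame.counit = B.counit := by
  ext1
  exact (Category.comp_id _).symm.trans (B.frame.counit_j.trans B.lorbit_unitPoint)

theorem exists_left : ∃ l : Cell (𝟙 B.A) (λ_ B.A).hom (tens B.mulBimod (box B.unitBimod (reg B.A)))
      (reg B.A), tensPoint B.mulPoint (boxPoint B.unitPoint (regPoint B.A)) ≫ l.hom =
        regPoint B.A ∧ IsIso l.hom :=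
  B.frame.exists_left (by rw [frame_comul, frame_counit]; exact B.counit_left)

theorem exists_right : ∃ r : Cell (𝟙 B.A) (ρ_ B.A).hom
      (tens B.mulBimod (box (reg B.A) B.unitBimod)) (reg B.A),
      tensPoint B.mulPoint (boxPoint (regPoint B.A) B.unitPoint) ≫ r.hom =
        regPoint B.A ∧ IsIso r.hom :=
  B.frame.exists_right (by rw [frame_comul, frame_counit]; exact B.counit_right)

theorem exists_assoc : ∃ a : Cell (𝟙 B.A) (α_ B.A B.A B.A).hom
      (tens B.mulBimod (box B.mulBimod (reg B.A))) (tens B.mulBimod (box (reg B.A) B.mulBimod)),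
      tensPoint B.mulPoint (boxPoint B.mulPoint (regPoint B.A)) ≫ a.hom =
        tensPoint B.mulPoint (boxPoint (regPoint B.A) B.mulPoint) ∧ IsIso a.hom :=
  B.frame.exists_assoc (by rw [frame_comul]; exact B.coassoc)

/-- The underlying data of the pseudo-monoid of a bialgebroid. -/
noncomputable abbrev pseudomonoidData : PseudomonoidData C where
  A := B.A
  M := B.mulBimod
  J := B.unitBimod
  l := B.exists_left.choose
  r := B.exists_right.choose
  a := B.exists_assoc.choose

/-- The generators of the pseudo-monoid of a bialgebroid. -/
noncomputable def generators : Generators B.pseudomonoidData where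
  e := B.mulPoint
  u := B.unitPoint
  cyclic := B.frame.adapted.cyclic
  cyclic_left := B.frame.adapted.cyclic_left
  cyclic_right := B.frame.adapted.cyclic_right
  point_l := B.exists_left.choose_spec.1
  point_r := B.exists_right.choose_spec.1
  point_a := B.exists_assoc.choose_spec.1

/-- The pseudo-monoid of a bialgebroid. -/
noncomputable abbrev pseudomonoid : Pseudomonoid C where
  toPseudomonoidData := B.pseudomonoidData
  isIso_l := B.exists_left.choose_spec.2
  isIso_r := B.exists_right.choose_spec.2
  isIso_a := B.exists_assoc.choose_spec.2
  pentagon := B.generators.pentagon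
  triangle := B.generators.triangle

theorem exists_tensorCell : ∃ τ : BimHom (tens (envM R) (box (companion B.χ) (companion B.χ)))
      (tens (companion B.χ) B.mulBimod),
      tensPoint (envOne R) (boxPoint (companionPoint B.χ) (companionPoint B.χ)) ≫ τ.hom =
        tensPoint (companionPoint B.χ) B.mulPoint ∧ IsIso τ.hom :=
  B.frame.exists_tensorCell B.χ B.inl_χ B.inr_χ

theorem exists_unitCell : ∃ υ : BimHom (envJ R) (tens (companion B.χ) B.unitBimod),
      envUnit R ≫ υ.hom = tensPoint (companionPoint B.χ) B.unitPoint ∧ IsIso υ.hom :=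
  B.frame.exists_unitCell B.χ B.inl_χ B.inr_χ

/-- The object of `DS_R` of a bialgebroid. -/
noncomputable def toDS : DS R where
  P := B.pseudomonoid
  χ := B.χ
  str := B.generators.monoidalStr (envGenerators R) B.χ B.exists_tensorCell.choose
    B.exists_unitCell.choose B.exists_tensorCell.choose_spec.1 B.exists_unitCell.choose_spec.1
  isStrong := ⟨B.exists_tensorCell.choose_spec.2, B.exists_unitCell.choose_spec.2⟩

/-- The frame of an object of `DS R` is a choice, but its generator is pinned down by the tensor
cell. -/
theorem toDS_frame_e : B.toDS.frame.e = B.mulPoint :=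
  tensPoint_companion_injective
    (B.toDS.tensorCell_point.symm.trans B.exists_tensorCell.choose_spec.1)

theorem toDS_frame_u : B.toDS.frame.u = B.unitPoint :=
  tensPoint_companion_injective
    (B.toDS.unitCell_point.symm.trans B.exists_unitCell.choose_spec.1)

theorem toDS_s : (BialgebroidBase.ofEnv B.toDS.χ).s.hom = B.s.hom := B.inl_χ

theorem toDS_t : (BialgebroidBase.ofEnv B.toDS.χ).t.hom = B.t.hom := B.inr_χ

/-- Both bialgebroids are read off from frames on the same bimodules with the same generators. The
base data differ only in that s and t are recovered from χ. -/
theorem isBialgebroidHom_ofDS : IsBialgebroidHom B.toDS.bialgebroid B (𝟙 B.A) where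
  comul := by
    let f := BialgebroidBase.bimHom (H := BialgebroidBase.ofEnv B.toDS.χ) (H' := B.toBialgebroidBase) (𝟙 B.A)
      ((Category.comp_id _).trans B.toDS_s) ((Category.comp_id _).trans B.toDS_t)
    have h := BialgebroidBase.Frame.comul_of_equivariant
      (H := BialgebroidBase.ofEnv B.toDS.χ) (H' := B.toBialgebroidBase)
      B.toDS.frame B.frame f rfl (Φ := 𝟙 B.A)
      ((Cell.id B.mulBimod).cast rfl (id_tensorHom_id _ _).symm)
      ((Category.comp_id _).trans B.toDS_frame_e)
    rw [B.frame_comul] at h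
    exact ⟨f, rfl, h⟩
  counit := by
    have h := BialgebroidBase.Frame.counit_of_cell
      (H := BialgebroidBase.ofEnv B.toDS.χ) (H' := B.toBialgebroidBase)
      B.toDS.frame B.frame (Φ := 𝟙 B.A)
      ((Category.comp_id _).trans B.toDS_s) (Cell.id B.unitBimod)
      ((Category.comp_id _).trans B.toDS_frame_u)
    rw [B.frame_counit] at h
    exact h

theorem isBialgebroidHom_toDS : IsBialgebroidHom B B.toDS.bialgebroid (𝟙 B.A) where
  comul := by
    let f := BialgebroidBase.bimHom (H := B.toBialgebroidBase) (H' := BialgebroidBase.ofEnv B.toDS.χ) (𝟙 B.A)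
      ((Category.comp_id _).trans B.toDS_s.symm) ((Category.comp_id _).trans B.toDS_t.symm)
    have h := BialgebroidBase.Frame.comul_of_equivariant
      (H := B.toBialgebroidBase) (H' := BialgebroidBase.ofEnv B.toDS.χ)
      B.frame B.toDS.frame f rfl (Φ := 𝟙 B.A)
      ((Cell.id B.mulBimod).cast rfl (id_tensorHom_id _ _).symm)
      ((Category.comp_id _).trans B.toDS_frame_e.symm)
    rw [B.frame_comul] at h
    exact ⟨f, rfl, h⟩
  counit := by
    have h := BialgebroidBase.Frame.counit_of_cell
      (H := B.toBialgebroidBase) (H' := BialgebroidBase.ofEnv B.toDS.χ)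
      B.frame B.toDS.frame (Φ := 𝟙 B.A)
      ((Category.comp_id _).trans B.toDS_s.symm) (Cell.id B.unitBimod)
      ((Category.comp_id _).trans B.toDS_frame_u.symm)
    rw [B.frame_counit] at h
    exact h

/-- The bialgebroid of the object of `DS_R` of a bialgebroid. -/
noncomputable def toDSIso : B.toDS.bialgebroid ≅ B where
  hom := ⟨𝟙 B.A, B.isBialgebroidHom_ofDS⟩
  inv := ⟨𝟙 B.A, B.isBialgebroidHom_toDS⟩
  hom_inv_id := BialgebroidHom.ext (Category.comp_id _)
  inv_hom_id := BialgebroidHom.ext (Category.comp_id _)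

end Bialgebroid

namespace DS

theorem isDSHom_id (X : DS R) : IsDSHom X X (𝟙 X.P.A) :=
  isDSHom_iff.2 (IsBialgebroidHom.id X.bialgebroid)

theorem isDSHom_comp (X Y Z : DS R) (f : X.P.A ⟶ Y.P.A) (g : Y.P.A ⟶ Z.P.A)
    (hf : IsDSHom X Y f) (hg : IsDSHom Y Z g) : IsDSHom X Z (f ≫ g) :=
  isDSHom_iff.2 ((isDSHom_iff.1 hf).comp (isDSHom_iff.1 hg))

noncomputable instance (R : Mon C) : Category.{v} (DS R) := DS.category R isDSHom_id isDSHom_comp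

/-- The functor that sends an object of `DS_R` to its bialgebroid. -/
noncomputable def toBialgebroid (R : Mon C) : DS R ⥤ Bialgebroid R where
  obj X := X.bialgebroid
  map f := ⟨DSHom.map f, isDSHom_iff.1 (DSHom.isHom f)⟩
  map_id _ := rfl
  map_comp _ _ := rfl

instance (R : Mon C) : (toBialgebroid R).Faithful where
  map_injective h := DSHom.ext (congrArg BialgebroidHom.map h)

instance (R : Mon C) : (toBialgebroid R).Full where
  map_surjective f := ⟨⟨BialgebroidHom.map f, isDSHom_iff.2 (BialgebroidHom.isHom f)⟩, rfl⟩

instance (R : Mon C) : (toBialgebroid R).EssSurj where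
  mem_essImage B := ⟨B.toDS, ⟨B.toDSIso⟩⟩

instance (R : Mon C) : (toBialgebroid R).IsEquivalence where

end DS
end Surjectivity
end IntBgd
theorem mainTheorem2 {C : Type u} [Category.{v} C] [MonoidalCategory C] [SymmetricCategory C]
    [HasCoequalizers C]
    [∀ X : C, PreservesColimitsOfShape WalkingParallelPair (tensorLeft X)]
    [∀ X : C, PreservesColimitsOfShape WalkingParallelPair (tensorRight X)] (R : Mon C) :
    ∃ (hid : ∀ X : IntBgd.DS R, IntBgd.IsDSHom X X (𝟙 X.P.A))
      (hcomp : ∀ (X Y Z : IntBgd.DS R) (f : X.P.A ⟶ Y.P.A) (g : Y.P.A ⟶ Z.P.A),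
        IntBgd.IsDSHom X Y f → IntBgd.IsDSHom Y Z g → IntBgd.IsDSHom X Z (f ≫ g)),
      Nonempty (@CategoryTheory.Equivalence (IntBgd.Bialgebroid R) (IntBgd.DS R) _
        (IntBgd.DS.category R hid hcomp)) :=
  ⟨IntBgd.DS.isDSHom_id, IntBgd.DS.isDSHom_comp,
    -- The category structure behind `toBialgebroid` is formed from the same two closure proofs, so
    -- it is the one required.
    ⟨(IntBgd.DS.toBialgebroid R).asEquivalence.symm⟩⟩
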